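/- Let $n\ge 1$ and $\Lambda(n)=\mathbb{Q}[d_1^{\pm1},\dots,d_n^{\pm1}]$. A *univalent graph* is a finite graph (loops and multiple edges allowed) whose vertices have valency one or three, with a cyclic orientation at each trivalent vertex, such that every connected component contains a univalent vertex. A *trivalent diagram* $D$ on $\Gamma_n=I_1\sqcup\dots\sqcup I_n$ ($n$ oriented intervals) is a univalent graph whose univalent vertices ("feet") are glued injectively to interior points of $\Gamma_n$; only the interval containing each foot and the order of the feet along each interval matter, and homeomorphic diagrams are identified. A *leg* is an edge ending in a foot; a leg on an edge is said to be to the left of a direction of travel if the counterclockwise order at its trivalent vertex is (back, forward, leg). Let $\mathcal C(n)$ be the $\Lambda(n)$-module generated by the trivalent diagrams on $\Gamma_n$ modulo the following local relations. * (STU) Let $y,z$ be adjacent feet on an interval, $y$ immediately before $z$. Then $S=T-U$, where $T$ is the given diagram, $U$ is obtained by exchanging $y$ and $z$, and $S$ is obtained by joining $y$ and $z$ to one trivalent vertex that is connected to the same place of the interval by a new edge $x$, with counterclockwise order $(x,z,y)$. * (CL1) Let $Y$ be a diagram with a trivalent vertex one of whose edges is a leg with foot on $I_i$. Replace this vertex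 by a row of three trivalent vertices with three legs, all to the left (as the original leg was) when travelling along the row. Let $D_{123}$ and $D_{321}$ be the two diagrams in which the three feet are placed consecutively on $I_i$ in place of the original foot, in the order of the row and in the opposite order respectively. Then $D_{123}+D_{321}=2d_i^2\,Y$. * (CL2) If $D'$ is obtained from $D$ by attaching, to an edge that joins two distinct trivalent vertices, two neighbouring legs on the same side of the edge, with feet anywhere on $I_i$ and $I_j$ ($i=j$ allowed), then $D'=d_id_j\,D$. Stacking diagrams (the diagram on the left above, the intervals being oriented downwards) makes $\mathcal C(n)$ a $\Lambda(n)$-algebra. For a univalent graph $D$ with univalent vertices labelled by elements of $\{1,\dots,n\}$, let $W$ be the set of tuples $w=(w_1,\dots,w_n)$ where $w_i$ is a linear order on the univalent vertices labelled $i$ such that every vertex lying, in this order, between two vertices of the same connected component belongs to this component too. Let $D_w$ be the trivalent diagram obtained by gluing the vertices labelled $i$ to $I_i$ in the order $w_i$, and put $\chi(D)=\frac1{\#W}\sum_{w\in W}D_w\in\mathcal C(n)$. Let $G(n)$ be the finite set consisting of the following labelled univalent graphs: * a single edge with end labels $a,b$, for $1\le a\le b\le n$; * a single trivalent vertex joined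 to univalent vertices labelled $1,c,d$ in counterclockwise order, for $2\le c<d\le n$; * the letter H with a horizontal bar, with top labels $1$ (left) and $1$ (right) and bottom labels $e$ (left) and $f$ (right), for $2\le e\le f\le n$; * a circle with two outward legs, both labelled $1$. Then the $\Lambda(n)$-module $\mathcal C(n)$ is free. Moreover, for every total order on $G(n)$, the ordered monomials $\prod_{g\in G(n)}\chi(g)^{m(g)}$ (factors written in increasing order of $g$), for $m:G(n)\to\mathbb{Z}_{\ge0}$, form a basis of the $\Lambda(n)$-module $\mathcal C(n)$. -/

import Mathlib

noncomputable section

namespace TriDiag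

/-! ### Univalent graphs

A graph whose vertices have valency one or three and whose trivalent vertices are cyclically
oriented is encoded by its half-edges ("flags").  The edges are the orbits of the fixed point free
involution `inv`, the vertices are the orbits of `rot` (where `rot ^ 3 = 1`): a fixed point of `rot`
is (the half-edge at) a univalent vertex, and an orbit of length three is a trivalent vertex with
its half-edges in counterclockwise order.  Loops and multiple edges are allowed. -/

/-- Two flags are connected when one reaches the other through `inv` and `rot` (a symmetric
relation, because both maps have finite order): they lie in the same connected component. -/
def FlagConn {F : Type} (inv rot : F → F) : F → F → Prop :=
  Relation.ReflTransGen fun a b => b = inv a ∨ b = rot a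

/-- Finite univalent graphs with cyclically oriented trivalent vertices and at least one univalent
vertex on each connected component, with set of half-edges `F`. -/
structure UGraph (F : Type) where
  finite : Finite F
  inv : F → F
  rot : F → F
  inv_inv : ∀ a, inv (inv a) = a
  inv_ne : ∀ a, inv a ≠ a
  rot_rot_rot : ∀ a, rot (rot (rot a)) = a
  exists_leg : ∀ a, ∃ b, FlagConn inv rot a b ∧ rot b = b

/-- A univalent diagram on `{1, …, n}`: each univalent vertex has a label. -/
structure UDiag (n : ℕ) (F : Type) extends UGraph F where
  lab : {a : F // rot a = a} → Fin n

/-- A trivalent diagram on the skeleton of `n` oriented intervals: `feet i` lists the univalent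
vertices glued to the `i`-th interval, in the order in which they occur along this interval. -/
structure TDiag (n : ℕ) (F : Type) extends UGraph F where
  feet : Fin n → List F
  nodup_feet : ∀ i, (feet i).Nodup
  eq_of_mem_feet : ∀ i j a, a ∈ feet i → a ∈ feet j → i = j
  mem_feet : ∀ a, (∃ i, a ∈ feet i) ↔ rot a = a

variable {n : ℕ} {F F' G G' H : Type}

namespace TDiag

/-- Homeomorphisms of trivalent diagrams: they respect the orientations of the vertices and are
homotopic to the identity on the skeleton. -/
@[ext] structure Iso (D : TDiag n F) (E : TDiag n G) where
  e : F ≃ G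
  inv : ∀ a, e (D.inv a) = E.inv (e a)
  rot : ∀ a, e (D.rot a) = E.rot (e a)
  feet : ∀ i, (D.feet i).map e = E.feet i

def Iso.refl (D : TDiag n F) : Iso D D := ⟨Equiv.refl _, by simp, by simp, by simp⟩

def Iso.symm {D : TDiag n F} {E : TDiag n G} (f : Iso D E) : Iso E D where
  e := f.e.symm
  inv a := by rw [Equiv.symm_apply_eq, f.inv, Equiv.apply_symm_apply]
  rot a := by rw [Equiv.symm_apply_eq, f.rot, Equiv.apply_symm_apply]
  feet i := by rw [← f.feet, List.map_map]; simp

def Iso.trans {D : TDiag n F} {E : TDiag n G} {K : TDiag n H} (f : Iso D E) (g : Iso E K) :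
    Iso D K where
  e := f.e.trans g.e
  inv a := by simp [f.inv, g.inv]
  rot a := by simp [f.rot, g.rot]
  feet i := by rw [← g.feet, ← f.feet, List.map_map]; rfl

end TDiag

/-! ### Stacking -/

theorem FlagConn.map {inv rot : F → F} {inv' rot' : G → G} (f : F → G)
    (h₁ : ∀ a, FlagConn inv' rot' (f a) (f (inv a)))
    (h₂ : ∀ a, FlagConn inv' rot' (f a) (f (rot a))) {a b : F} (h : FlagConn inv rot a b) :
    FlagConn inv' rot' (f a) (f b) :=
  Relation.ReflTransGen.lift' f (by rintro x y (rfl | rfl); exacts [h₁ x, h₂ x]) _ _ h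

theorem FlagConn.inv_step {inv rot : F → F} (a : F) : FlagConn inv rot a (inv a) :=
  Relation.ReflTransGen.single (Or.inl rfl)

theorem FlagConn.rot_step {inv rot : F → F} (a : F) : FlagConn inv rot a (rot a) :=
  Relation.ReflTransGen.single (Or.inr rfl)

/-- Disjoint union. -/
def UGraph.sum (D : UGraph F) (E : UGraph G) : UGraph (F ⊕ G) where
  finite := by have := D.finite; have := E.finite; infer_instance
  inv := Sum.map D.inv E.inv
  rot := Sum.map D.rot E.rot
  inv_inv := by rintro (a | a) <;> simp [D.inv_inv, E.inv_inv]
  inv_ne := by rintro (a | a) <;> simp [D.inv_ne, E.inv_ne]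
  rot_rot_rot := by rintro (a | a) <;> simp [D.rot_rot_rot, E.rot_rot_rot]
  exists_leg := by
    rintro (a | a)
    · obtain ⟨b, h, hb⟩ := D.exists_leg a
      exact ⟨.inl b, h.map Sum.inl (fun c => .inv_step (Sum.inl c)) fun c => .rot_step (Sum.inl c),
        by simp [hb]⟩
    · obtain ⟨b, h, hb⟩ := E.exists_leg a
      exact ⟨.inr b, h.map Sum.inr (fun c => .inv_step (Sum.inr c)) fun c => .rot_step (Sum.inr c),
        by simp [hb]⟩

namespace TDiag

/-- The product: `D` is put above `E`.  The intervals are oriented downwards, so on each of them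
the feet of `D` come first. -/
def mul (D : TDiag n F) (E : TDiag n G) : TDiag n (F ⊕ G) where
  toUGraph := D.toUGraph.sum E.toUGraph
  feet i := (D.feet i).map Sum.inl ++ (E.feet i).map Sum.inr
  nodup_feet i := by
    rw [List.nodup_append]
    refine ⟨(D.nodup_feet i).map Sum.inl_injective, (E.nodup_feet i).map Sum.inr_injective, ?_⟩
    simp
  eq_of_mem_feet := by
    rintro i j (a | a) h h'
    · exact D.eq_of_mem_feet i j a (by simpa using h) (by simpa using h')
    · exact E.eq_of_mem_feet i j a (by simpa using h) (by simpa using h')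
  mem_feet := by
    rintro (a | a)
    · simpa [UGraph.sum] using D.mem_feet a
    · simpa [UGraph.sum] using E.mem_feet a

/-- The diagram without any vertices (the skeleton alone). -/
def one : TDiag n Empty where
  finite := inferInstance
  inv := id
  rot := id
  inv_inv a := a.elim
  inv_ne a := a.elim
  rot_rot_rot a := a.elim
  exists_leg a := a.elim
  feet _ := []
  nodup_feet := by simp
  eq_of_mem_feet := by simp
  mem_feet a := a.elim

def Iso.mul {D : TDiag n F} {D' : TDiag n F'} {E : TDiag n G} {E' : TDiag n G'}
    (f : Iso D D') (g : Iso E E') :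
    Iso (D.mul E) (D'.mul E') where
  e := Equiv.sumCongr f.e g.e
  inv := by rintro (a | a) <;> simp [TDiag.mul, UGraph.sum, f.inv, g.inv]
  rot := by rintro (a | a) <;> simp [TDiag.mul, UGraph.sum, f.rot, g.rot]
  feet i := by simp [TDiag.mul, ← f.feet, ← g.feet, Function.comp_def]

def Iso.mulAssoc (D : TDiag n F) (E : TDiag n G) (K : TDiag n H) :
    Iso ((D.mul E).mul K) (D.mul (E.mul K)) where
  e := Equiv.sumAssoc _ _ _
  inv := by rintro ((a | a) | a) <;> rfl
  rot := by rintro ((a | a) | a) <;> rfl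
  feet i := by simp [TDiag.mul, Function.comp_def]

def Iso.oneMul (D : TDiag n F) : Iso (one.mul D) D where
  e := Equiv.emptySum Empty _
  inv := by rintro (a | a); exacts [a.elim, rfl]
  rot := by rintro (a | a); exacts [a.elim, rfl]
  feet i := by simp [TDiag.mul, one, Function.comp_def]

def Iso.mulOne (D : TDiag n F) : Iso (D.mul one) D where
  e := Equiv.sumEmpty _ Empty
  inv := by rintro (a | a); exacts [rfl, a.elim]
  rot := by rintro (a | a); exacts [rfl, a.elim]
  feet i := by simp [TDiag.mul, one, Function.comp_def]

/-- Two trivalent diagrams are equivalent when they are homeomorphic. -/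
instance setoid (n : ℕ) : Setoid (Σ F : Type, TDiag n F) where
  r D E := Nonempty (Iso D.2 E.2)
  iseqv := ⟨fun D => ⟨Iso.refl D.2⟩, fun ⟨f⟩ => ⟨f.symm⟩, fun ⟨f⟩ ⟨g⟩ => ⟨f.trans g⟩⟩

end TDiag

/-- Homeomorphism classes of trivalent diagrams on `n` intervals. -/
def Diag (n : ℕ) : Type 1 := Quotient (TDiag.setoid n)

/-- The homeomorphism class of a trivalent diagram. -/
def TDiag.cls (D : TDiag n F) : Diag n := Quotient.mk _ ⟨F, D⟩

theorem TDiag.Iso.cls_eq {D : TDiag n F} {E : TDiag n G} (f : TDiag.Iso D E) : D.cls = E.cls :=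
  Quotient.sound ⟨f⟩

/-- The monoid of diagrams under stacking. -/
instance : Monoid (Diag n) where
  one := TDiag.one.cls
  mul := Quotient.map₂ (fun D E => ⟨_, D.2.mul E.2⟩) fun _ _ ⟨f⟩ _ _ ⟨g⟩ => ⟨f.mul g⟩
  mul_assoc := by
    rintro ⟨_, D⟩ ⟨_, E⟩ ⟨_, K⟩; exact (TDiag.Iso.mulAssoc D E K).cls_eq
  one_mul := by rintro ⟨_, D⟩; exact (TDiag.Iso.oneMul D).cls_eq
  mul_one := by rintro ⟨_, D⟩; exact (TDiag.Iso.mulOne D).cls_eq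

theorem TDiag.cls_mul (D : TDiag n F) (E : TDiag n G) : D.cls * E.cls = (D.mul E).cls := rfl

/-! ### Local modifications of diagrams -/

namespace UGraph

open scoped Classical in
/-- The involution of `UGraph.insertLeg`. -/
def insertInv (D : UGraph F) (a : F) : F ⊕ Fin 4 → F ⊕ Fin 4 :=
  Sum.elim
    (fun c => if c = a then .inr 0 else if c = D.inv a then .inr 1 else .inl (D.inv c))
    ![.inl a, .inl (D.inv a), .inr 3, .inr 2]

/-- The rotation of `UGraph.insertLeg`. -/
def insertRot (D : UGraph F) : F ⊕ Fin 4 → F ⊕ Fin 4 :=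
  Sum.map D.rot ![1, 2, 0, 3]

theorem insert_conn (D : UGraph F) (a : F) :
    (∀ c, FlagConn (D.insertInv a) D.insertRot (.inl c) (.inl (D.inv c))) ∧
    ∀ c, FlagConn (D.insertInv a) D.insertRot (.inr c) (.inr 3) := by
  have i0 : FlagConn (D.insertInv a) D.insertRot (.inr 0) (.inl a) := .inv_step _
  have i1 : FlagConn (D.insertInv a) D.insertRot (.inr 1) (.inl (D.inv a)) := .inv_step _
  have i2 : FlagConn (D.insertInv a) D.insertRot (.inr 2) (.inr 3) := .inv_step _
  have r0 : FlagConn (D.insertInv a) D.insertRot (.inr 0) (.inr 1) := .rot_step _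
  have r1 : FlagConn (D.insertInv a) D.insertRot (.inr 1) (.inr 2) := .rot_step _
  have r2 : FlagConn (D.insertInv a) D.insertRot (.inr 2) (.inr 0) := .rot_step _
  constructor
  · intro c
    have h := FlagConn.inv_step (inv := D.insertInv a) (rot := D.insertRot) (.inl c)
    by_cases h0 : c = a
    · subst h0
      have h' : D.insertInv c (.inl c) = .inr 0 := by simp [insertInv]
      rw [h'] at h
      exact (h.trans r0).trans i1
    · by_cases h1 : c = D.inv a
      · subst h1
        have h' : D.insertInv a (.inl (D.inv a)) = .inr 1 := by simp [insertInv, D.inv_ne]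
        rw [h'] at h
        rw [D.inv_inv]
        exact ((h.trans r1).trans r2).trans i0
      · have h' : D.insertInv a (.inl c) = .inl (D.inv c) := by simp [insertInv, h0, h1]
        rwa [h'] at h
  · intro c
    fin_cases c
    exacts [(r0.trans r1).trans i2, r1.trans i2, i2, .refl]

/-- Insert a trivalent vertex in the middle of the edge `{a, inv a}`, together with a new edge that
leaves this vertex to the left when we travel from `a` to `inv a`.  The half-edges at the new vertex
are `inr 0` (backwards), `inr 1` (forwards), `inr 2` (to the left), in counterclockwise order, and
`inr 3` is the new univalent vertex. -/
def insertLeg (D : UGraph F) (a : F) : UGraph (F ⊕ Fin 4) where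
  finite := by have := D.finite; infer_instance
  inv := D.insertInv a
  rot := D.insertRot
  inv_inv := by
    rintro (c | c)
    · by_cases h : c = a
      · simp [insertInv, h]
      · by_cases h' : c = D.inv a
        · simp [insertInv, h', D.inv_ne]
        · have h1 : D.inv c ≠ a := fun e => h' (by rw [← e, D.inv_inv])
          have h2 : D.inv c ≠ D.inv a := fun e => h (by rw [← D.inv_inv c, e, D.inv_inv])
          simp [insertInv, h, h', h1, h2, D.inv_inv]
    · fin_cases c <;> simp [insertInv, D.inv_ne]
  inv_ne := by
    rintro (c | c)
    · by_cases h : c = a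
      · simp [insertInv, h]
      · by_cases h' : c = D.inv a
        · simp [insertInv, h', D.inv_ne]
        · simp [insertInv, h, h', D.inv_ne]
    · fin_cases c <;> simp [insertInv]
  rot_rot_rot := by
    rintro (c | c)
    · simp [insertRot, D.rot_rot_rot]
    · fin_cases c <;> simp [insertRot]
  exists_leg := by
    rintro (c | c)
    · obtain ⟨b, h, hb⟩ := D.exists_leg c
      exact ⟨.inl b, h.map Sum.inl (D.insert_conn a).1 fun c => .rot_step (Sum.inl c),
        by simp [insertRot, hb]⟩
    · exact ⟨.inr 3, (D.insert_conn a).2 c, by simp [insertRot]⟩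

open scoped Classical in
/-- The rotation of `UGraph.mergeLegs`. -/
def mergeRot (D : UGraph F) (y z : F) : F ⊕ Fin 2 → F ⊕ Fin 2 :=
  Sum.elim (fun c => if c = y then .inr 0 else if c = z then .inl y else .inl (D.rot c))
    ![.inl z, .inr 1]

/-- Join two univalent vertices `y`, `z` to a trivalent vertex, with a new edge from this vertex to
a new univalent vertex `inr 1`.  The counterclockwise order at the new vertex is: new edge
`inr 0`, then `z`, then `y`. -/
def mergeLegs (D : UGraph F) (y z : F) (hy : D.rot y = y) (hz : D.rot z = z) (hyz : y ≠ z) :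
    UGraph (F ⊕ Fin 2) where
  finite := by have := D.finite; infer_instance
  inv := Sum.map D.inv ![1, 0]
  rot := D.mergeRot y z
  inv_inv := by
    rintro (c | c)
    · simp [D.inv_inv]
    · fin_cases c <;> simp
  inv_ne := by
    rintro (c | c)
    · simp [D.inv_ne]
    · fin_cases c <;> simp
  rot_rot_rot := by
    have inj : Function.Injective D.rot := fun u v e => by
      rw [← D.rot_rot_rot u, e, D.rot_rot_rot]
    rintro (c | c)
    · by_cases h : c = y
      · subst h; simp [mergeRot, hyz.symm]
      · by_cases h' : c = z
        · subst h'; simp [mergeRot, hyz.symm]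
        · have h1 : D.rot c ≠ y := fun e => h (inj (e.trans hy.symm))
          have h2 : D.rot c ≠ z := fun e => h' (inj (e.trans hz.symm))
          have h3 : D.rot (D.rot c) ≠ y := fun e => h1 (inj (e.trans hy.symm))
          have h4 : D.rot (D.rot c) ≠ z := fun e => h2 (inj (e.trans hz.symm))
          simp [mergeRot, h, h', h1, h2, h3, h4, D.rot_rot_rot]
    · fin_cases c <;> simp [mergeRot, hyz.symm]
  exists_leg := by
    have s0 : FlagConn (Sum.map D.inv ![1, 0]) (D.mergeRot y z) (.inr 0) (.inr 1) := .inv_step _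
    have sy : FlagConn (Sum.map D.inv ![1, 0]) (D.mergeRot y z) (.inl y) (.inr 0) := by
      have := FlagConn.rot_step (inv := Sum.map D.inv ![1, 0]) (rot := D.mergeRot y z) (.inl y)
      simpa [mergeRot] using this
    have sz : FlagConn (Sum.map D.inv ![1, 0]) (D.mergeRot y z) (.inl z) (.inl y) := by
      have := FlagConn.rot_step (inv := Sum.map D.inv ![1, 0]) (rot := D.mergeRot y z) (.inl z)
      simpa [mergeRot, hyz.symm] using this
    rintro (c | c)
    · obtain ⟨b, h, hb⟩ := D.exists_leg c
      have h' : FlagConn (Sum.map D.inv ![1, 0]) (D.mergeRot y z) (.inl c) (.inl b) := by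
        refine h.map Sum.inl (fun c => .inv_step (Sum.inl c)) fun c => ?_
        by_cases h : c = y
        · subst h; rw [hy]; exact .refl
        · by_cases h' : c = z
          · subst h'; rw [hz]; exact .refl
          · have := FlagConn.rot_step (inv := Sum.map D.inv ![1, 0]) (rot := D.mergeRot y z)
              (.inl c)
            simpa [mergeRot, h, h'] using this
      by_cases h : b = y
      · subst h; exact ⟨.inr 1, (h'.trans sy).trans s0, by simp [mergeRot]⟩
      · by_cases h1 : b = z
        · subst h1; exact ⟨.inr 1, ((h'.trans sz).trans sy).trans s0, by simp [mergeRot]⟩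
        · exact ⟨.inl b, h', by simp [mergeRot, h, h1, hb]⟩
    · refine ⟨.inr 1, ?_, by simp [mergeRot]⟩
      fin_cases c
      exacts [s0, .refl]

end UGraph

/-- Insert `x` into the list `l` after its first `k` entries. -/
def insertAt {α : Type} (l : List α) (k : ℕ) (x : α) : List α := l.take k ++ x :: l.drop k

theorem insertAt_perm {α : Type} (l : List α) (k : ℕ) (x : α) : (insertAt l k x).Perm (x :: l) := by
  have := List.perm_middle (a := x) (l₁ := l.take k) (l₂ := l.drop k)
  rwa [List.take_append_drop] at this

namespace TDiag

/-- Insert a vertex with a leg to the left in the edge `{a, inv a}`, travelling from `a` to `inv a`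
(see `UGraph.insertLeg`), and glue the new univalent vertex to the `i`-th interval, immediately
after the first `k` feet of this interval. -/
def insertLeg (D : TDiag n F) (a : F) (i : Fin n) (k : ℕ) : TDiag n (F ⊕ Fin 4) where
  toUGraph := D.toUGraph.insertLeg a
  feet j := if j = i then insertAt ((D.feet j).map .inl) k (.inr 3) else (D.feet j).map .inl
  nodup_feet j := by
    have := (D.nodup_feet j).map (Sum.inl_injective (β := Fin 4))
    split_ifs
    · rw [(insertAt_perm _ _ _).nodup_iff]
      exact List.nodup_cons.2 ⟨by simp, this⟩
    · exact this
  eq_of_mem_feet j j' := by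
    rintro (c | c) h h'
    · refine D.eq_of_mem_feet j j' c ?_ ?_
      · split_ifs at h <;> simpa [(insertAt_perm _ _ _).mem_iff] using h
      · split_ifs at h' <;> simpa [(insertAt_perm _ _ _).mem_iff] using h'
    · have key : ∀ j, (Sum.inr c ∈ if j = i then insertAt ((D.feet j).map Sum.inl) k (.inr 3)
          else (D.feet j).map (Sum.inl (β := Fin 4))) → j = i := by
        intro j h
        by_contra hj
        simp [hj] at h
      rw [key j h, key j' h']
  mem_feet := by
    rintro (c | c)
    · refine Iff.trans (exists_congr fun j => ?_) ((D.mem_feet c).trans ?_)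
      · split_ifs <;> simp [(insertAt_perm _ _ _).mem_iff]
      · simp [UGraph.insertLeg, UGraph.insertRot]
    · constructor
      · rintro ⟨j, h⟩
        have hc : c = 3 := by
          split_ifs at h <;> simp [(insertAt_perm _ _ _).mem_iff] at h
          exact h
        subst hc
        simp [UGraph.insertLeg, UGraph.insertRot]
      · intro h
        have hc : c = 3 := by
          fin_cases c <;> simp [UGraph.insertLeg, UGraph.insertRot] at h ⊢
        subst hc
        exact ⟨i, by simp [(insertAt_perm _ _ _).mem_iff]⟩

theorem rot_eq_of_feet (D : TDiag n F) {i : Fin n} {l : List F} (h : D.feet i = l) {a : F}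
    (ha : a ∈ l) : D.rot a = a := (D.mem_feet a).1 ⟨i, h ▸ ha⟩

/-- Exchange two adjacent feet `y`, `z` on the `i`-th interval. -/
def exchange (D : TDiag n F) (i : Fin n) (L R : List F) (y z : F)
    (h : D.feet i = L ++ y :: z :: R) : TDiag n F where
  toUGraph := D.toUGraph
  feet j := if j = i then L ++ z :: y :: R else D.feet j
  nodup_feet j := by
    have hp : (L ++ z :: y :: R).Perm (D.feet i) :=
      h ▸ (List.Perm.swap y z R).append_left L
    split_ifs
    · exact hp.nodup_iff.2 (D.nodup_feet i)
    · exact D.nodup_feet j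
  eq_of_mem_feet j j' a ha ha' := by
    have hp : (L ++ z :: y :: R).Perm (D.feet i) :=
      h ▸ (List.Perm.swap y z R).append_left L
    refine D.eq_of_mem_feet j j' a ?_ ?_
    · split_ifs at ha with e
      · rw [e]; exact hp.mem_iff.1 ha
      · exact ha
    · split_ifs at ha' with e
      · rw [e]; exact hp.mem_iff.1 ha'
      · exact ha'
  mem_feet a := by
    have hp : (L ++ z :: y :: R).Perm (D.feet i) :=
      h ▸ (List.Perm.swap y z R).append_left L
    refine Iff.trans (exists_congr fun j => ?_) (D.mem_feet a)
    split_ifs with e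
    · rw [e]; exact hp.mem_iff
    · rfl

/-- Join two adjacent feet `y`, `z` (in this order) on the `i`-th interval to a trivalent vertex that
is connected by a new edge to the same place of this interval. -/
def merge (D : TDiag n F) (i : Fin n) (L R : List F) (y z : F)
    (h : D.feet i = L ++ y :: z :: R) : TDiag n (F ⊕ Fin 2) where
  toUGraph := D.toUGraph.mergeLegs y z (D.rot_eq_of_feet h (by simp))
    (D.rot_eq_of_feet h (by simp))
    (by have := D.nodup_feet i; rw [h] at this; rintro rfl; simp [List.nodup_append] at this)
  feet j := if j = i then L.map .inl ++ .inr 1 :: R.map .inl else (D.feet j).map .inl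
  nodup_feet j := by
    split_ifs
    · have := D.nodup_feet i
      rw [h] at this
      have h2 : (L ++ R).Nodup :=
        this.sublist ((((List.Sublist.refl R).cons z).cons y).append_left L)
      have h3 := h2.map (Sum.inl_injective (β := Fin 2))
      rw [List.perm_middle.nodup_iff, ← List.map_append]
      exact List.nodup_cons.2 ⟨by simp, h3⟩
    · exact (D.nodup_feet j).map Sum.inl_injective
  eq_of_mem_feet j j' := by
    rintro (c | c) hc hc'
    · have key : ∀ j, (Sum.inl c ∈ if j = i then L.map Sum.inl ++ Sum.inr 1 :: R.map Sum.inl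
          else (D.feet j).map (Sum.inl (β := Fin 2))) → c ∈ D.feet j := by
        intro j hj
        split_ifs at hj with e
        · rw [e, h]; simp at hj; simp; tauto
        · simpa using hj
      exact D.eq_of_mem_feet j j' c (key j hc) (key j' hc')
    · have key : ∀ j, (Sum.inr c ∈ if j = i then L.map Sum.inl ++ Sum.inr 1 :: R.map Sum.inl
          else (D.feet j).map (Sum.inl (β := Fin 2))) → j = i := by
        intro j h
        by_contra hj
        simp [hj] at h
      rw [key j hc, key j' hc']
  mem_feet := by
    have hn := D.nodup_feet i
    rw [h] at hn
    have hyz : y ≠ z := by rintro rfl; simp [List.nodup_append] at hn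
    have hyL : y ∉ L ∧ y ∉ R := by
      simp [List.nodup_append] at hn; exact ⟨fun hh => (hn.2.2 y hh).1 rfl, hn.2.1.1.2⟩
    have hzL : z ∉ L ∧ z ∉ R := by
      simp [List.nodup_append] at hn; exact ⟨fun hh => (hn.2.2 z hh).2.1 rfl, hn.2.1.2.1⟩
    have hy : y ∈ D.feet i := by simp [h]
    have hz : z ∈ D.feet i := by simp [h]
    rintro (c | c)
    · by_cases h1 : c = y
      · subst h1
        simp only [UGraph.mergeLegs, UGraph.mergeRot, Sum.elim_inl, if_true, reduceCtorEq,
          iff_false, not_exists]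
        intro j hj
        split_ifs at hj with e
        · simp [hyL] at hj
        · exact e (D.eq_of_mem_feet j i c (by simpa using hj) hy)
      · by_cases h2 : c = z
        · subst h2
          simp only [UGraph.mergeLegs, UGraph.mergeRot, Sum.elim_inl, if_true, if_neg h1,
            Sum.inl.injEq, hyz, iff_false, not_exists]
          intro j hj
          split_ifs at hj with e
          · simp [hzL] at hj
          · exact e (D.eq_of_mem_feet j i c (by simpa using hj) hz)
        · refine Iff.trans (exists_congr fun j => ?_) ((D.mem_feet c).trans ?_)
          · split_ifs with e
            · rw [e, h]; simp [h1, h2]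
            · simp
          · simp [UGraph.mergeLegs, UGraph.mergeRot, h1, h2]
    · constructor
      · rintro ⟨j, hj⟩
        have hc : c = 1 := by
          split_ifs at hj <;> simp at hj
          exact hj
        subst hc
        simp [UGraph.mergeLegs, UGraph.mergeRot]
      · intro hc
        have hc : c = 1 := by
          fin_cases c <;> simp [UGraph.mergeLegs, UGraph.mergeRot] at hc ⊢
        subst hc
        exact ⟨i, by simp⟩

/-- In `D`, the foot `f` on the `i`-th interval belongs to a leg that ends in a trivalent vertex with
half-edges `z`, `y`, `x` (in counterclockwise order), where `x = inv f`.  A vertex with a leg is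
inserted behind `z` and another one behind `y`, which turns the vertex into a row of three vertices
with parallel legs.  The feet of these legs, in the order from the `z`-end of the row to its `y`-end,
are consecutive on the interval, in this order. -/
def comb (D : TDiag n F) (i : Fin n) (L : List F) (f : F) :
    TDiag n ((F ⊕ Fin 4) ⊕ Fin 4) :=
  let z := D.rot (D.inv f)
  let y := D.rot z
  (D.insertLeg (D.inv z) i L.length).insertLeg (.inl y) i (L.length + 2)

/-- As `TDiag.comb`, but with the three feet in the opposite order on the interval. -/
def combRev (D : TDiag n F) (i : Fin n) (L : List F) (f : F) :
    TDiag n ((F ⊕ Fin 4) ⊕ Fin 4) :=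
  let z := D.rot (D.inv f)
  let y := D.rot z
  (D.insertLeg (D.inv z) i (L.length + 1)).insertLeg (.inl y) i L.length

/-! Compatibility of the modifications with homeomorphisms and with stacking -/

theorem ext_feet {D E : TDiag n F} (h : D.toUGraph = E.toUGraph) (h' : D.feet = E.feet) :
    D = E := by
  cases D; cases E; cases h; cases h'; rfl

theorem map_insertAt {α β : Type} (f : α → β) (l : List α) (k : ℕ) (x : α) :
    (insertAt l k x).map f = insertAt (l.map f) k (f x) := by
  simp [insertAt, List.map_take, List.map_drop]

theorem insertAt_append_right {α : Type} (l l' : List α) (k : ℕ) (x : α) :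
    insertAt (l ++ l') (l.length + k) x = l ++ insertAt l' k x := by
  have h1 : l.take (l.length + k) = l := List.take_of_length_le (by omega)
  have h2 : l.drop (l.length + k) = [] := List.drop_of_length_le (by omega)
  simp [insertAt, List.take_append, List.drop_append, h1, h2]

theorem insertAt_append_left {α : Type} (l l' : List α) (k : ℕ) (x : α) (hk : k ≤ l.length) :
    insertAt (l ++ l') k x = insertAt l k x ++ l' := by
  simp [insertAt, List.take_append, List.drop_append, Nat.sub_eq_zero_of_le hk]

def Iso.insertLeg {D : TDiag n F} {E : TDiag n G} (φ : Iso D E) (a : F) (i : Fin n) (k : ℕ) :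
    Iso (D.insertLeg a i k) (E.insertLeg (φ.e a) i k) where
  e := Equiv.sumCongr φ.e (Equiv.refl _)
  inv := by
    rintro (c | c)
    · by_cases h0 : c = a
      · subst h0; simp [TDiag.insertLeg, UGraph.insertLeg, UGraph.insertInv]
      · by_cases h1 : c = D.inv a
        · subst h1
          simp [TDiag.insertLeg, UGraph.insertLeg, UGraph.insertInv, ← φ.inv, D.inv_ne]
        · simp [TDiag.insertLeg, UGraph.insertLeg, UGraph.insertInv, ← φ.inv, h0, h1]
    · fin_cases c <;> simp [TDiag.insertLeg, UGraph.insertLeg, UGraph.insertInv, φ.inv]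
  rot := by
    rintro (c | c)
    · simp [TDiag.insertLeg, UGraph.insertLeg, UGraph.insertRot, φ.rot]
    · simp [TDiag.insertLeg, UGraph.insertLeg, UGraph.insertRot]
  feet j := by
    simp only [TDiag.insertLeg, ← φ.feet]
    split_ifs <;> simp [map_insertAt, Function.comp_def]

/-- `(F ⊕ A) ⊕ G ≃ (F ⊕ G) ⊕ A`. -/
def sumRight (F A G : Type) : (F ⊕ A) ⊕ G ≃ (F ⊕ G) ⊕ A where
  toFun := Sum.elim (Sum.elim (fun c => .inl (.inl c)) .inr) fun c => .inl (.inr c)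
  invFun := Sum.elim (Sum.elim (fun c => .inl (.inl c)) .inr) fun c => .inl (.inr c)
  left_inv := by rintro ((c | c) | c) <;> rfl
  right_inv := by rintro ((c | c) | c) <;> rfl

def Iso.insertLegMul (D : TDiag n F) (E : TDiag n G) (a : F) (i : Fin n) (k : ℕ)
    (hk : k ≤ (D.feet i).length) :
    Iso ((D.insertLeg a i k).mul E) ((D.mul E).insertLeg (.inl a) i k) where
  e := sumRight F (Fin 4) G
  inv := by
    rintro ((c | c) | c)
    · by_cases h0 : c = a
      · subst h0
        simp [TDiag.mul, UGraph.sum, TDiag.insertLeg, UGraph.insertLeg, UGraph.insertInv, sumRight]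
      · by_cases h1 : c = D.inv a
        · subst h1
          simp [TDiag.mul, UGraph.sum, TDiag.insertLeg, UGraph.insertLeg, UGraph.insertInv,
            sumRight, D.inv_ne]
        · simp [TDiag.mul, UGraph.sum, TDiag.insertLeg, UGraph.insertLeg, UGraph.insertInv,
            sumRight, h0, h1]
    · fin_cases c <;> simp [TDiag.mul, UGraph.sum, TDiag.insertLeg, UGraph.insertLeg,
        UGraph.insertInv, sumRight]
    · simp [TDiag.mul, UGraph.sum, TDiag.insertLeg, UGraph.insertLeg, UGraph.insertInv, sumRight]
  rot := by
    rintro ((c | c) | c) <;>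
      simp [TDiag.mul, UGraph.sum, TDiag.insertLeg, UGraph.insertLeg, UGraph.insertRot, sumRight]
  feet j := by
    simp only [TDiag.mul, TDiag.insertLeg]
    split_ifs with h
    · subst h
      simp only [List.map_append, map_insertAt, List.map_map]
      rw [insertAt_append_left _ _ _ _ (by simpa using hk)]
      rfl
    · simp [sumRight, Function.comp_def]

def Iso.mulInsertLeg (E : TDiag n G) (D : TDiag n F) (a : F) (i : Fin n) (k : ℕ) :
    Iso (E.mul (D.insertLeg a i k)) ((E.mul D).insertLeg (.inr a) i ((E.feet i).length + k)) where
  e := (Equiv.sumAssoc _ _ _).symm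
  inv := by
    rintro (c | (c | c))
    · simp [TDiag.mul, UGraph.sum, TDiag.insertLeg, UGraph.insertLeg, UGraph.insertInv]
    · by_cases h0 : c = a
      · subst h0
        simp [TDiag.mul, UGraph.sum, TDiag.insertLeg, UGraph.insertLeg, UGraph.insertInv]
      · by_cases h1 : c = D.inv a
        · subst h1
          simp [TDiag.mul, UGraph.sum, TDiag.insertLeg, UGraph.insertLeg, UGraph.insertInv,
            D.inv_ne]
        · simp [TDiag.mul, UGraph.sum, TDiag.insertLeg, UGraph.insertLeg, UGraph.insertInv,
            h0, h1]
    · fin_cases c <;> simp [TDiag.mul, UGraph.sum, TDiag.insertLeg, UGraph.insertLeg,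
        UGraph.insertInv]
  rot := by
    rintro (c | (c | c)) <;>
      simp [TDiag.mul, UGraph.sum, TDiag.insertLeg, UGraph.insertLeg, UGraph.insertRot]
  feet j := by
    simp only [TDiag.mul, TDiag.insertLeg]
    split_ifs with h
    · subst h
      simp only [List.map_append, map_insertAt, List.map_map]
      have := insertAt_append_right ((E.feet j).map (fun c => (Sum.inl (Sum.inl c) : (G ⊕ F) ⊕ Fin 4)))
        ((D.feet j).map (fun c => (Sum.inl (Sum.inr c) : (G ⊕ F) ⊕ Fin 4))) k (.inr 3)
      rw [List.length_map] at this
      exact this.symm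
    · simp [Function.comp_def]

theorem exchange_mul (D : TDiag n F) (E : TDiag n G) (i : Fin n) (L R : List F) (y z : F)
    (h : D.feet i = L ++ y :: z :: R)
    (h' : (D.mul E).feet i = L.map .inl ++ .inl y :: .inl z :: (R.map .inl ++ (E.feet i).map .inr)) :
    (D.exchange i L R y z h).mul E = (D.mul E).exchange i _ _ _ _ h' := by
  refine ext_feet rfl (funext fun j => ?_)
  by_cases hj : j = i
  · subst hj; simp [TDiag.mul, exchange]
  · simp [TDiag.mul, exchange, hj]

theorem mul_exchange (E : TDiag n G) (D : TDiag n F) (i : Fin n) (L R : List F) (y z : F)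
    (h : D.feet i = L ++ y :: z :: R)
    (h' : (E.mul D).feet i = ((E.feet i).map .inl ++ L.map .inr) ++ .inr y :: .inr z :: R.map .inr) :
    E.mul (D.exchange i L R y z h) = (E.mul D).exchange i _ _ _ _ h' := by
  refine ext_feet rfl (funext fun j => ?_)
  by_cases hj : j = i
  · subst hj; simp [TDiag.mul, exchange]
  · simp [TDiag.mul, exchange, hj]

def Iso.mergeMul (D : TDiag n F) (E : TDiag n G) (i : Fin n) (L R : List F) (y z : F)
    (h : D.feet i = L ++ y :: z :: R)
    (h' : (D.mul E).feet i = L.map .inl ++ .inl y :: .inl z :: (R.map .inl ++ (E.feet i).map .inr)) :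
    Iso ((D.merge i L R y z h).mul E) ((D.mul E).merge i _ _ _ _ h') where
  e := sumRight F (Fin 2) G
  inv := by
    rintro ((c | c) | c) <;> simp [TDiag.mul, UGraph.sum, merge, UGraph.mergeLegs, sumRight]
  rot := by
    rintro ((c | c) | c)
    · by_cases h0 : c = y
      · subst h0; simp [TDiag.mul, UGraph.sum, merge, UGraph.mergeLegs, UGraph.mergeRot, sumRight]
      · by_cases h1 : c = z
        · subst h1
          simp [TDiag.mul, UGraph.sum, merge, UGraph.mergeLegs, UGraph.mergeRot, sumRight, h0]
        · simp [TDiag.mul, UGraph.sum, merge, UGraph.mergeLegs, UGraph.mergeRot, sumRight, h0, h1]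
    · fin_cases c <;> simp [TDiag.mul, UGraph.sum, merge, UGraph.mergeLegs, UGraph.mergeRot,
        sumRight]
    · simp [TDiag.mul, UGraph.sum, merge, UGraph.mergeLegs, UGraph.mergeRot, sumRight]
  feet j := by
    by_cases hj : j = i
    · subst hj; simp [TDiag.mul, merge, sumRight, Function.comp_def]
    · simp [TDiag.mul, merge, hj, sumRight, Function.comp_def]

def Iso.mulMerge (E : TDiag n G) (D : TDiag n F) (i : Fin n) (L R : List F) (y z : F)
    (h : D.feet i = L ++ y :: z :: R)
    (h' : (E.mul D).feet i = ((E.feet i).map .inl ++ L.map .inr) ++ .inr y :: .inr z :: R.map .inr) :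
    Iso (E.mul (D.merge i L R y z h)) ((E.mul D).merge i _ _ _ _ h') where
  e := (Equiv.sumAssoc _ _ _).symm
  inv := by
    rintro (c | (c | c)) <;> simp [TDiag.mul, UGraph.sum, merge, UGraph.mergeLegs]
  rot := by
    rintro (c | (c | c))
    · simp [TDiag.mul, UGraph.sum, merge, UGraph.mergeLegs, UGraph.mergeRot]
    · by_cases h0 : c = y
      · subst h0; simp [TDiag.mul, UGraph.sum, merge, UGraph.mergeLegs, UGraph.mergeRot]
      · by_cases h1 : c = z
        · subst h1
          simp [TDiag.mul, UGraph.sum, merge, UGraph.mergeLegs, UGraph.mergeRot, h0]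
        · simp [TDiag.mul, UGraph.sum, merge, UGraph.mergeLegs, UGraph.mergeRot, h0, h1]
    · fin_cases c <;> simp [TDiag.mul, UGraph.sum, merge, UGraph.mergeLegs, UGraph.mergeRot]
  feet j := by
    by_cases hj : j = i
    · subst hj; simp [TDiag.mul, merge, Function.comp_def]
    · simp [TDiag.mul, merge, hj, Function.comp_def]

end TDiag

/-! ### The algebra `C(n)` -/

/-- `Λ(n) = ℚ[d₁^{±1}, …, dₙ^{±1}]`. -/
abbrev Lam (n : ℕ) : Type := AddMonoidAlgebra ℚ (Fin n → ℤ)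

/-- The indeterminate `dᵢ`. -/
def d (i : Fin n) : Lam n := AddMonoidAlgebra.single (Pi.single i 1) 1

/-- The free `Λ(n)`-module on the trivalent diagrams, with the product given by stacking. -/
abbrev Free (n : ℕ) : Type 1 := MonoidAlgebra (Lam n) (Diag n)

/-- A trivalent diagram as an element of the free module. -/
def TDiag.elt (D : TDiag n F) : Free n := MonoidAlgebra.of (Lam n) (Diag n) D.cls

/-- The defining relations of `C(n)`.
* `stu`: a leg that ends in a trivalent vertex is the difference of the two ways to glue the two
  other half-edges of this vertex directly to the interval.
* `cl1`: the sum over the two orders of the feet of a row of three parallel legs on the interval `i`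
  equals `2 dᵢ²` times the diagram with one leg in place of three.
* `cl2`: two neighbouring legs that are attached from the same side to an edge between two distinct
  trivalent vertices, and are glued to the intervals `i` and `j`, are replaced by `dᵢ dⱼ`. -/
inductive Rel : Free n → Prop
  | stu {F : Type} (D : TDiag n F) (i : Fin n) (L R : List F) (y z : F)
      (h : D.feet i = L ++ y :: z :: R) :
      Rel ((D.merge i L R y z h).elt - (D.elt - (D.exchange i L R y z h).elt))
  | cl1 {F : Type} (D : TDiag n F) (i : Fin n) (L R : List F) (f : F)
      (h : D.feet i = L ++ f :: R) (hf : D.rot (D.inv f) ≠ D.inv f) :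
      Rel ((D.comb i L f).elt + (D.combRev i L f).elt - (2 * d i ^ 2) • D.elt)
  | cl2 {F : Type} (D : TDiag n F) (a : F) (ha : D.rot a ≠ a)
      (hb : D.rot (D.inv a) ≠ D.inv a)
      (h₁ : D.inv a ≠ D.rot a) (h₂ : D.inv a ≠ D.rot (D.rot a))
      (i j : Fin n) (k l : ℕ) (hk : k ≤ (D.feet i).length)
      (hl : l ≤ ((D.insertLeg a i k).feet j).length) :
      Rel (((D.insertLeg a i k).insertLeg (.inr 1) j l).elt - (d i * d j) • D.elt)

theorem TDiag.Iso.elt_eq {D : TDiag n F} {E : TDiag n G} (f : TDiag.Iso D E) : D.elt = E.elt := by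
  rw [TDiag.elt, TDiag.elt, f.cls_eq]

theorem TDiag.elt_mul (D : TDiag n F) (E : TDiag n G) : D.elt * E.elt = (D.mul E).elt := by
  rw [TDiag.elt, TDiag.elt, TDiag.elt, ← map_mul, TDiag.cls_mul]

theorem TDiag.insertLeg_length (D : TDiag n F) (a : F) (i : Fin n) (k : ℕ) (j : Fin n) :
    ((D.insertLeg a i k).feet j).length = (D.feet j).length + if j = i then 1 else 0 := by
  simp only [TDiag.insertLeg]
  split_ifs <;> simp [(insertAt_perm _ _ _).length_eq]

theorem TDiag.insertLeg₂_mul (D : TDiag n F) (E : TDiag n G) (a : F) (i : Fin n) (k : ℕ)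
    (b : F ⊕ Fin 4) (j : Fin n) (l : ℕ) (hk : k ≤ (D.feet i).length)
    (hl : l ≤ ((D.insertLeg a i k).feet j).length) :
    (((D.insertLeg a i k).insertLeg b j l).mul E).elt =
      (((D.mul E).insertLeg (.inl a) i k).insertLeg (sumRight F (Fin 4) G (.inl b)) j l).elt :=
  ((TDiag.Iso.insertLegMul (D.insertLeg a i k) E b j l hl).trans
    ((TDiag.Iso.insertLegMul D E a i k hk).insertLeg (.inl b) j l)).elt_eq

theorem TDiag.mul_insertLeg₂ (E : TDiag n G) (D : TDiag n F) (a : F) (i : Fin n) (k : ℕ)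
    (b : F ⊕ Fin 4) (j : Fin n) (l : ℕ) :
    (E.mul ((D.insertLeg a i k).insertLeg b j l)).elt =
      (((E.mul D).insertLeg (.inr a) i ((E.feet i).length + k)).insertLeg
        ((Equiv.sumAssoc G F (Fin 4)).symm (.inr b)) j ((E.feet j).length + l)).elt :=
  ((TDiag.Iso.mulInsertLeg E (D.insertLeg a i k) b j l).trans
    ((TDiag.Iso.mulInsertLeg E D a i k).insertLeg (.inr b) j ((E.feet j).length + l))).elt_eq

/-- The set of relations is closed under stacking from below. -/
theorem Rel.mul_elt {x : Free n} (hx : Rel x) (E : TDiag n G) : Rel (x * E.elt) := by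
  cases hx with
  | stu D i L R y z h =>
    have h' : (D.mul E).feet i =
        L.map .inl ++ .inl y :: .inl z :: (R.map .inl ++ (E.feet i).map .inr) := by
      simp [TDiag.mul, h]
    have := Rel.stu (D.mul E) i _ _ _ _ h'
    rw [← TDiag.exchange_mul D E i L R y z h,
      ← (TDiag.Iso.mergeMul D E i L R y z h h').elt_eq] at this
    simpa only [sub_mul, TDiag.elt_mul] using this
  | cl1 D i L R f h hf =>
    have h' : (D.mul E).feet i = L.map .inl ++ .inl f :: (R.map .inl ++ (E.feet i).map .inr) := by
      simp [TDiag.mul, h]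
    have := Rel.cl1 (D.mul E) i _ _ _ h' (by simpa [TDiag.mul, UGraph.sum] using hf)
    have e1 : ((D.comb i L f).mul E).elt = ((D.mul E).comb i (L.map .inl) (.inl f)).elt := by
      simp only [TDiag.comb, List.length_map]
      exact TDiag.insertLeg₂_mul D E _ _ _ _ _ _ (by simp [h])
        (by simp [TDiag.insertLeg_length, h])
    have e2 : ((D.combRev i L f).mul E).elt = ((D.mul E).combRev i (L.map .inl) (.inl f)).elt := by
      simp only [TDiag.combRev, List.length_map]
      exact TDiag.insertLeg₂_mul D E _ _ _ _ _ _ (by simp [h])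
        (by simp [TDiag.insertLeg_length, h]; omega)
    rw [← e1, ← e2] at this
    simpa only [sub_mul, add_mul, TDiag.elt_mul, smul_mul_assoc] using this
  | @cl2 F D a ha hb h₁ h₂ i j k l hk hl =>
    have := Rel.cl2 (D.mul E) (.inl a) (by simpa [TDiag.mul, UGraph.sum] using ha)
      (by simpa [TDiag.mul, UGraph.sum] using hb) (by simpa [TDiag.mul, UGraph.sum] using h₁)
      (by simpa [TDiag.mul, UGraph.sum] using h₂) i j k l
      (hk.trans (by simp [TDiag.mul]))
      (hl.trans (by simp only [TDiag.insertLeg_length]; simp [TDiag.mul]))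
    have e := TDiag.insertLeg₂_mul D E a i k (.inr 1) j l hk hl
    rw [show TDiag.sumRight F (Fin 4) G (.inl (.inr 1)) = .inr 1 from rfl] at e
    rw [← e] at this
    simpa only [sub_mul, TDiag.elt_mul, smul_mul_assoc] using this

/-- The set of relations is closed under stacking from above. -/
theorem Rel.elt_mul {x : Free n} (hx : Rel x) (E : TDiag n G) : Rel (E.elt * x) := by
  cases hx with
  | stu D i L R y z h =>
    have h' : (E.mul D).feet i =
        ((E.feet i).map .inl ++ L.map .inr) ++ .inr y :: .inr z :: R.map .inr := by
      simp [TDiag.mul, h]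
    have := Rel.stu (E.mul D) i _ _ _ _ h'
    rw [← TDiag.mul_exchange E D i L R y z h,
      ← (TDiag.Iso.mulMerge E D i L R y z h h').elt_eq] at this
    simpa only [mul_sub, TDiag.elt_mul] using this
  | cl1 D i L R f h hf =>
    have h' : (E.mul D).feet i =
        ((E.feet i).map .inl ++ L.map .inr) ++ .inr f :: R.map .inr := by
      simp [TDiag.mul, h]
    have := Rel.cl1 (E.mul D) i _ _ _ h' (by simpa [TDiag.mul, UGraph.sum] using hf)
    have e1 : (E.mul (D.comb i L f)).elt =
        ((E.mul D).comb i ((E.feet i).map .inl ++ L.map .inr) (.inr f)).elt := by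
      simp only [TDiag.comb, List.length_append, List.length_map]
      exact TDiag.mul_insertLeg₂ E D _ _ _ _ _ _
    have e2 : (E.mul (D.combRev i L f)).elt =
        ((E.mul D).combRev i ((E.feet i).map .inl ++ L.map .inr) (.inr f)).elt := by
      simp only [TDiag.combRev, List.length_append, List.length_map]
      exact TDiag.mul_insertLeg₂ E D _ _ _ _ _ _
    rw [← e1, ← e2] at this
    simpa only [mul_sub, mul_add, TDiag.elt_mul, mul_smul_comm] using this
  | @cl2 F D a ha hb h₁ h₂ i j k l hk hl =>
    have := Rel.cl2 (E.mul D) (.inr a) (by simpa [TDiag.mul, UGraph.sum] using ha)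
      (by simpa [TDiag.mul, UGraph.sum] using hb) (by simpa [TDiag.mul, UGraph.sum] using h₁)
      (by simpa [TDiag.mul, UGraph.sum] using h₂) i j ((E.feet i).length + k)
      ((E.feet j).length + l)
      (by simpa [TDiag.mul] using hk)
      (by
        simp only [TDiag.insertLeg_length] at hl ⊢
        simp only [TDiag.mul, List.length_append, List.length_map]
        omega)
    have e := TDiag.mul_insertLeg₂ E D a i k (.inr 1) j l
    rw [show (Equiv.sumAssoc G F (Fin 4)).symm (.inr (.inr 1)) = .inr 1 from rfl] at e
    rw [← e] at this
    simpa only [mul_sub, TDiag.elt_mul, mul_smul_comm] using this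

/-- The `Λ(n)`-linear span of the relations. -/
def relSpan (n : ℕ) : Submodule (Lam n) (Free n) := Submodule.span (Lam n) {x | Rel x}

theorem mul_mem_relSpan (x : Free n) {r : Free n} (hr : r ∈ relSpan n) :
    x * r ∈ relSpan n ∧ r * x ∈ relSpan n := by
  induction x using MonoidAlgebra.induction_on with
  | of D =>
    obtain ⟨⟨G, E⟩, rfl⟩ := Quotient.exists_rep D
    change E.elt * r ∈ _ ∧ r * E.elt ∈ _
    induction hr using Submodule.span_induction with
    | mem r hr => exact ⟨Submodule.subset_span (hr.elt_mul E), Submodule.subset_span (hr.mul_elt E)⟩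
    | zero => simp
    | add u v _ _ hu hv =>
      rw [mul_add, add_mul]
      exact ⟨add_mem hu.1 hv.1, add_mem hu.2 hv.2⟩
    | smul c u _ hu =>
      rw [mul_smul_comm, smul_mul_assoc]
      exact ⟨Submodule.smul_mem _ _ hu.1, Submodule.smul_mem _ _ hu.2⟩
  | add u v hu hv =>
    rw [mul_add, add_mul]
    exact ⟨add_mem hu.1 hv.1, add_mem hu.2 hv.2⟩
  | smul c u hu =>
    rw [mul_smul_comm, smul_mul_assoc]
    exact ⟨Submodule.smul_mem _ _ hu.1, Submodule.smul_mem _ _ hu.2⟩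

/-- The span of the relations is a two-sided ideal. -/
def relIdeal (n : ℕ) : Ideal (Free n) where
  carrier := relSpan n
  add_mem' := add_mem
  zero_mem' := zero_mem _
  smul_mem' x _ hr := (mul_mem_relSpan x hr).1

instance : (relIdeal n).IsTwoSided := ⟨fun x hr => (mul_mem_relSpan x hr).2⟩

/-- The `Λ(n)`-algebra `C(n)`: the free `Λ(n)`-module on the trivalent diagrams modulo the span of
the relations, with the product given by stacking. -/
abbrev C (n : ℕ) : Type 1 := Free n ⧸ relIdeal n

/-- The class of a trivalent diagram in `C(n)`. -/
def TDiag.toC (D : TDiag n F) : C n := Ideal.Quotient.mk (relIdeal n) D.elt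

/-! ### The map `χ` -/

/-- The elements of `W(D)`: for each `i`, a linear order (given as a list) on the univalent vertices
labelled `i`, such that a vertex that lies between two vertices of the same component belongs to
this component, too. -/
structure UDiag.IsOrdering (D : UDiag n F) (w : Fin n → List F) : Prop where
  nodup : ∀ i, (w i).Nodup
  mem_iff : ∀ i a, a ∈ w i ↔ ∃ h : D.rot a = a, D.lab ⟨a, h⟩ = i
  between : ∀ i a b c, [a, b, c].Sublist (w i) → FlagConn D.inv D.rot a c →
    FlagConn D.inv D.rot a b

/-- The diagram `D_w`, obtained by gluing the univalent vertices labelled `i` to the `i`-th interval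
in the order `w i`. -/
def UDiag.glue (D : UDiag n F) (w : Fin n → List F) (hw : D.IsOrdering w) : TDiag n F where
  toUGraph := D.toUGraph
  feet := w
  nodup_feet := hw.nodup
  eq_of_mem_feet i j a hi hj := by
    obtain ⟨h, rfl⟩ := (hw.mem_iff i a).1 hi
    obtain ⟨_, rfl⟩ := (hw.mem_iff j a).1 hj
    rfl
  mem_feet a := by
    refine ⟨fun ⟨i, hi⟩ => ((hw.mem_iff i a).1 hi).1, fun h => ⟨_, (hw.mem_iff _ a).2 ⟨h, rfl⟩⟩⟩

instance UDiag.finite_ordering (D : UDiag n F) : Finite {w // D.IsOrdering w} := by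
  classical
  have := D.finite
  have := Fintype.ofFinite F
  refine Finite.of_injective
    (fun w i => (⟨w.1 i, w.2.nodup i⟩ : {l : List F // l.Nodup})) fun w w' h => ?_
  ext1; funext i
  exact congrArg Subtype.val (congrFun h i)

instance UDiag.fintype_ordering (D : UDiag n F) : Fintype {w // D.IsOrdering w} :=
  Fintype.ofFinite _

/-- `χ(D)` is the average of the diagrams `D_w` over all `w` in `W(D)`. -/
def UDiag.chi (D : UDiag n F) : C n :=
  ((Fintype.card {w // D.IsOrdering w} : ℚ)⁻¹) • ∑ w : {w // D.IsOrdering w}, (D.glue w.1 w.2).toC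

/-! ### The generators -/

theorem exists_leg_of_near {inv rot : F → F}
    (h : ∀ a, rot a = a ∨ rot (inv a) = inv a ∨ rot (inv (rot a)) = inv (rot a) ∨
      rot (inv (rot (rot a))) = inv (rot (rot a))) (a : F) :
    ∃ b, FlagConn inv rot a b ∧ rot b = b := by
  rcases h a with h | h | h | h
  · exact ⟨_, .refl, h⟩
  · exact ⟨_, FlagConn.inv_step _, h⟩
  · exact ⟨_, (FlagConn.rot_step _).trans (FlagConn.inv_step _), h⟩
  · exact ⟨_, ((FlagConn.rot_step _).trans (FlagConn.rot_step _)).trans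
      (FlagConn.inv_step _), h⟩

/-- A single edge with univalent vertices labelled `a`, `b`. -/
def strutDiag (a b : Fin n) : UDiag n (Fin 2) where
  finite := inferInstance
  inv := ![1, 0]
  rot := ![0, 1]
  inv_inv := by decide
  inv_ne := by decide
  rot_rot_rot := by decide
  exists_leg := exists_leg_of_near (by decide)
  lab v := ![a, b] v.1

/-- One trivalent vertex (flags `3, 4, 5` in this order) that is joined to univalent vertices
(flags `0, 1, 2`) labelled `a`, `b`, `c`. -/
def tripodDiag (a b c : Fin n) : UDiag n (Fin 6) where
  finite := inferInstance
  inv := ![3, 4, 5, 0, 1, 2]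
  rot := ![0, 1, 2, 4, 5, 3]
  inv_inv := by decide
  inv_ne := by decide
  rot_rot_rot := by decide
  exists_leg := exists_leg_of_near (by decide)
  lab v := ![a, b, c, a, b, c] v.1

/-- The letter H with a horizontal bar (the edge `{8, 9}`): the left vertex (flags `8, 4, 5`) is
joined to the top left and bottom left univalent vertices labelled `a`, `b`, and the right vertex
(flags `9, 7, 6`) to the top right and bottom right univalent vertices labelled `c`, `e`. -/
def hDiag (a b c e : Fin n) : UDiag n (Fin 10) where
  finite := inferInstance
  inv := ![4, 5, 6, 7, 0, 1, 2, 3, 9, 8]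
  rot := ![0, 1, 2, 3, 5, 8, 9, 6, 4, 7]
  inv_inv := by decide
  inv_ne := by decide
  rot_rot_rot := by decide
  exists_leg := exists_leg_of_near (by decide)
  lab v := ![a, b, c, e, a, b, c, e, a, a] v.1

/-- A circle with two outward legs labelled `a` (left) and `b` (right): the left vertex has the
flags `2` (leg), `6` (lower arc), `4` (upper arc), and the right vertex the flags `3` (leg),
`5` (upper arc), `7` (lower arc). -/
def wheelDiag (a b : Fin n) : UDiag n (Fin 8) where
  finite := inferInstance
  inv := ![2, 3, 0, 1, 5, 4, 7, 6]
  rot := ![0, 1, 6, 5, 2, 7, 4, 3]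
  inv_inv := by decide
  inv_ne := by decide
  rot_rot_rot := by decide
  exists_leg := exists_leg_of_near (by decide)
  lab v := ![a, b, a, b, a, a, a, a] v.1

/-- The set `G(n)` of generators.  The labels `1, …, n` are the elements of `Fin n`, so that the
label `1` is `(0 : Fin n)`. -/
inductive Gen (n : ℕ) [NeZero n] : Type
  | strut (a b : Fin n) (hab : a ≤ b)
  | tripod (c d : Fin n) (hc : 0 < c) (hcd : c < d)
  | h (e f : Fin n) (he : 0 < e) (hef : e ≤ f)
  | wheel

/-- The image under `χ` of a generator. -/
def Gen.chi [NeZero n] : Gen n → C n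
  | strut a b _ => (strutDiag a b).chi
  | tripod c d _ _ => (tripodDiag 0 c d).chi
  | h e f _ _ => (hDiag 0 e 0 f).chi
  | wheel => (wheelDiag 0 0).chi

/-- The ordered monomial `∏ χ(g) ^ m(g)` in `C(n)`, the factors being written in increasing order
of `g`. -/
def orderedMonomial [NeZero n] [LinearOrder (Gen n)] (m : Gen n →₀ ℕ) : C n :=
  ((m.support.sort (· ≤ ·)).map fun g => g.chi ^ m g).prod

end TriDiag

end

noncomputable section

set_option linter.unusedSimpArgs false
set_option linter.unusedSectionVars false

namespace TriDiag
variable {n : ℕ} {F F' G H : Type}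

/-! ### Diagrams given by a graph, a labelling and a list of feet -/

/-! The argument has the shape of the Poincaré–Birkhoff–Witt theorem. Filter C(n) by the number of
feet (`Fil`). By (STU), exchanging two adjacent feet changes a diagram by one with fewer feet. Up to
lower terms the feet may thus be permuted, stacking is disjoint union, factors commute, and `χ(g)`
may be replaced by any single gluing of g. It remains to show that connected graphs reduce to G(n)
up to lower terms, and that no further relation exists.

Spanning. (STU) implies antisymmetry at each vertex (`val_flip`) and the vanishing of the sum of the
three ways to attach a leg next to a vertex (`val_slide`). Both follow by induction on the number of
half-edges, because each component with a trivalent vertex has one next to a foot, which can be cut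
off (`exists_unmerge`). Since the dᵢ are units, (CL2) shows that a leg on an edge between two
distinct trivalent vertices depends, up to dᵢ, neither on its label nor on the place of its foot
(`val_insert_free`), and that a diagram vanishes if some vertex has three such edges
(`val_eq_zero_of_internal`). The remaining connected graphs are caterpillars and circles with legs.
Two neighbouring legs in the middle can be removed, so only the edge, the tripod, the H, the comb
with five legs, the circle with two legs and the triangle survive (`classified`). The triangle
vanishes by a reflection (`null_triangle`). (CL1) makes combs and tripods equivalent modulo diagrams
with two feet (`comb_iff_tripod`), and three-term relations between labels then reduce everything to
the labels in G(n) (`comb_and_tripod_mem`, `h_mem`, `wheel_mem`). Sorting the factors of a product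
gives `span_orderedMonomial`.

Independence. A metrized Lie algebra acting on each interval gives a state sum that respects
stacking and (STU). For the oscillator algebra, with number operator, central element and bosons,
where the central element acts on the interval i by dᵢ, the state sum also respects (CL1) and (CL2)
(`WeightSystem.exists_hom`, `oscillator`). Realised by operators on polynomials, each generator has
a leading symbol that does not depend on the order of its feet (`hasSymbol_chi`). A suitable
specialisation of the variables turns the symbols of the edges, tripods and letters H into
independent variables, while the circle becomes the scalar 2Nd₁², where N is the number of bosons
(`Gen.exists_symbol`). A linear relation between ordered monomials yields, in top degree and for
every large N, a relation between these symbols. So a polynomial in one variable over the domain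
Λ(n) has infinitely many roots, and all its coefficients vanish
(`linearIndependent_orderedMonomial`). -/

/-- The list `w` enumerates the univalent vertices of `g`. -/
def UGraph.IsLay (g : UGraph F) (w : List F) : Prop := w.Nodup ∧ ∀ a, a ∈ w ↔ g.rot a = a

/-- Glue the univalent vertices to the intervals prescribed by `lab`, in the order of `w`. -/
def UGraph.lay (g : UGraph F) (lab : F → Fin n) (w : List F) (hw : g.IsLay w) : TDiag n F where
  toUGraph := g
  feet i := w.filter (fun a => lab a = i)
  nodup_feet i := hw.1.filter _
  eq_of_mem_feet i j a hi hj := by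
    simp only [List.mem_filter, decide_eq_true_eq] at hi hj
    rw [← hi.2, hj.2]
  mem_feet a := by
    simp only [List.mem_filter, decide_eq_true_eq]
    exact ⟨fun ⟨_, h, _⟩ => (hw.2 a).1 h, fun h => ⟨_, (hw.2 a).2 h, rfl⟩⟩

open scoped Classical in
/-- The class of `UGraph.lay` in `C(n)`. -/
def UGraph.val (g : UGraph F) (lab : F → Fin n) (w : List F) : C n :=
  -- The word `w` lists the feet of all intervals at once; only the order among equal labels
  -- matters. The value 0 off the layouts keeps `val` total, so that words can be rewritten without
  -- transporting proofs.
  if h : g.IsLay w then (g.lay lab w h).toC else 0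

theorem UGraph.val_eq {g : UGraph F} {lab : F → Fin n} {w : List F} (h : g.IsLay w) :
    g.val lab w = (g.lay lab w h).toC := dif_pos h

theorem filter_flatMap_eq {ι : Type} [DecidableEq ι] (f : ι → List F) (lab : F → ι)
    (h : ∀ i, ∀ a ∈ f i, lab a = i) (l : List ι) (hl : l.Nodup) (i : ι) :
    (l.flatMap f).filter (fun a => lab a = i) = if i ∈ l then f i else [] := by
  induction l with
  | nil => simp
  | cons j l ih =>
    rw [List.flatMap_cons, List.filter_append, ih (List.nodup_cons.1 hl).2]
    by_cases hij : i = j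
    · subst hij
      have h1 : (f i).filter (fun a => lab a = i) = f i :=
        List.filter_eq_self.2 fun a ha => by simp [h i a ha]
      simp [h1, (List.nodup_cons.1 hl).1]
    · have h1 : (f j).filter (fun a => lab a = i) = [] :=
        List.filter_eq_nil_iff.2 fun a ha => by simp [h j a ha, Ne.symm hij]
      simp [h1, hij]

theorem TDiag.exists_lab [NeZero n] (D : TDiag n F) :
    ∃ lab : F → Fin n, ∀ i, ∀ a ∈ D.feet i, lab a = i := by
  classical
  -- Half-edges that are not feet receive the irrelevant label 0.
  refine ⟨fun a => if h : ∃ i, a ∈ D.feet i then h.choose else 0, fun i a ha => ?_⟩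
  have h : ∃ i, a ∈ D.feet i := ⟨i, ha⟩
  beta_reduce
  rw [dif_pos h]
  exact D.eq_of_mem_feet _ _ a h.choose_spec ha

theorem TDiag.isLay_flatMap (D : TDiag n F) :
    D.toUGraph.IsLay ((List.finRange n).flatMap D.feet) := by
  refine ⟨?_, fun a => ?_⟩
  · rw [List.nodup_flatMap]
    refine ⟨fun i _ => D.nodup_feet i, (List.nodup_finRange n).imp fun {i j} hij => ?_⟩
    exact fun a hi hj => hij (D.eq_of_mem_feet _ _ a hi hj)
  · simp [List.mem_flatMap, D.mem_feet]

/-- Concatenating the intervals loses nothing, because filtering by the label recovers each list of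
feet. Hence statements about `val` cover all of C(n). -/
theorem TDiag.toC_eq_val (D : TDiag n F) (lab : F → Fin n) (h : ∀ i, ∀ a ∈ D.feet i, lab a = i) :
    D.toC = D.toUGraph.val lab ((List.finRange n).flatMap D.feet) := by
  rw [UGraph.val_eq D.isLay_flatMap]
  congr 1
  refine TDiag.ext_feet rfl (funext fun i => ?_)
  simp only [UGraph.lay]
  rw [filter_flatMap_eq _ _ h _ (List.nodup_finRange n)]
  simp

theorem TDiag.Iso.toC_eq {D : TDiag n F} {E : TDiag n G} (f : TDiag.Iso D E) : D.toC = E.toC := by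
  rw [TDiag.toC, TDiag.toC, f.elt_eq]

/-- Isomorphisms of graphs. -/
structure UGraph.Equiv (g : UGraph F) (g' : UGraph G) where
  e : F ≃ G
  inv : ∀ a, e (g.inv a) = g'.inv (e a)
  rot : ∀ a, e (g.rot a) = g'.rot (e a)

namespace UGraph.Equiv

def refl (g : UGraph F) : g.Equiv g := ⟨_root_.Equiv.refl F, fun _ => rfl, fun _ => rfl⟩

def symm {g : UGraph F} {g' : UGraph G} (φ : g.Equiv g') : g'.Equiv g where
  e := φ.e.symm
  inv a := by rw [_root_.Equiv.symm_apply_eq, φ.inv, _root_.Equiv.apply_symm_apply]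
  rot a := by rw [_root_.Equiv.symm_apply_eq, φ.rot, _root_.Equiv.apply_symm_apply]

theorem rot_eq_iff {g : UGraph F} {g' : UGraph G} (φ : g.Equiv g') (a : F) :
    g'.rot (φ.e a) = φ.e a ↔ g.rot a = a := by
  rw [← φ.rot, φ.e.apply_eq_iff_eq]

theorem isLay {g : UGraph F} {g' : UGraph G} (φ : g.Equiv g') {w : List F} (h : g.IsLay w) :
    g'.IsLay (w.map φ.e) := by
  refine ⟨h.1.map φ.e.injective, fun b => ?_⟩
  obtain ⟨a, rfl⟩ := φ.e.surjective b
  rw [φ.rot_eq_iff, ← h.2, List.mem_map_of_injective φ.e.injective]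

end UGraph.Equiv

namespace UGraph

theorem val_congr {g : UGraph F} {lab lab' : F → Fin n} {w w' : List F} (h : g.IsLay w)
    (h' : g.IsLay w')
    (e : ∀ i, w.filter (fun a => lab a = i) = w'.filter (fun a => lab' a = i)) :
    g.val lab w = g.val lab' w' := by
  rw [val_eq h, val_eq h']
  congr 1
  exact TDiag.ext_feet rfl (funext e)

theorem val_congr_lab {g : UGraph F} {lab lab' : F → Fin n} {w : List F}
    (e : ∀ a ∈ w, lab a = lab' a) : g.val lab w = g.val lab' w := by
  by_cases h : g.IsLay w
  · refine val_congr h h fun i => List.filter_congr fun a ha => by rw [e a ha]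
  · rw [val, val, dif_neg h, dif_neg h]

theorem val_iso {g : UGraph F} {g' : UGraph G} (φ : g.Equiv g') {lab : F → Fin n} {w : List F}
    (h : g.IsLay w) (lab' : G → Fin n) (hl : ∀ a ∈ w, lab' (φ.e a) = lab a) :
    g.val lab w = g'.val lab' (w.map φ.e) := by
  rw [val_eq h, val_eq (φ.isLay h)]
  refine TDiag.Iso.toC_eq ⟨φ.e, φ.inv, φ.rot, fun i => ?_⟩
  simp only [lay, List.filter_map]
  congr 1
  refine List.filter_congr fun a ha => ?_
  simp [hl a ha]

theorem val_iso' {g : UGraph F} {g' : UGraph G} (φ : g.Equiv g') {lab : F → Fin n} {w : List F}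
    (h : g.IsLay w) : g.val lab w = g'.val (lab ∘ φ.e.symm) (w.map φ.e) :=
  val_iso φ h _ (by simp)

/-! ### The relations -/

theorem toC_eq_zero {x : Free n} (h : Rel x) : Ideal.Quotient.mk (relIdeal n) x = 0 :=
  Ideal.Quotient.eq_zero_iff_mem.2 (Submodule.subset_span h)

theorem mk_smul (c : Lam n) (x : Free n) :
    Ideal.Quotient.mk (relIdeal n) (c • x) = c • Ideal.Quotient.mk (relIdeal n) x := rfl

theorem IsLay.perm {g : UGraph F} {w w' : List F} (h : g.IsLay w) (p : w.Perm w') : g.IsLay w' :=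
  ⟨p.nodup_iff.1 h.1, fun a => by rw [← p.mem_iff, h.2]⟩

/-- Feet with different labels lie on different intervals; their relative order is an artefact of
the single word. -/
theorem val_exchange_of_ne {g : UGraph F} {lab : F → Fin n} {L R : List F} {y z : F}
    (h : g.IsLay (L ++ y :: z :: R)) (hyz : lab y ≠ lab z) :
    g.val lab (L ++ y :: z :: R) = g.val lab (L ++ z :: y :: R) := by
  refine val_congr h (h.perm ((List.Perm.swap z y R).append_left L)) fun i => ?_
  simp only [List.filter_append, List.filter_cons]
  by_cases h1 : lab y = i
  · have h2 : lab z ≠ i := fun e => hyz (h1.trans e.symm)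
    simp [h1, h2]
  · simp [h1]

theorem IsLay.rot_eq {g : UGraph F} {w : List F} (h : g.IsLay w) {a : F} (ha : a ∈ w) :
    g.rot a = a := (h.2 a).1 ha

theorem isLay_merge {g : UGraph F} {L R : List F} {y z : F} (h : g.IsLay (L ++ y :: z :: R))
    (hy : g.rot y = y) (hz : g.rot z = z) (hyz : y ≠ z) :
    (g.mergeLegs y z hy hz hyz).IsLay (L.map .inl ++ .inr 1 :: R.map .inl) := by
  have hn := h.1
  simp only [List.nodup_append, List.nodup_cons, List.mem_cons, not_or] at hn
  refine ⟨?_, ?_⟩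
  · rw [List.perm_middle.nodup_iff, ← List.map_append, List.nodup_cons]
    refine ⟨by simp, List.Nodup.map Sum.inl_injective ?_⟩
    exact h.1.sublist ((((List.Sublist.refl R).cons z).cons y).append_left L)
  · rintro (c | c)
    · have hc := h.2 c
      simp only [List.mem_append, List.mem_cons] at hc
      by_cases h1 : c = y
      · subst h1
        simp only [mergeLegs, mergeRot, Sum.elim_inl, if_true]
        simp
        refine ⟨fun hh => ?_, hn.2.1.1.2⟩
        exact hn.2.2 c hh c (Or.inl rfl) rfl
      · by_cases h2 : c = z
        · subst h2
          simp only [mergeLegs, mergeRot, Sum.elim_inl, if_true, if_neg h1, Sum.inl.injEq]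
          simp [hyz]
          exact ⟨fun hh => hn.2.2 c hh c (Or.inr (Or.inl rfl)) rfl, hn.2.1.2.1⟩
        · simp [mergeLegs, mergeRot, h1, h2] at hc ⊢
          exact hc
    · fin_cases c <;> simp [mergeLegs, mergeRot]

/-- (STU) for words: `y` and `z` have the same label and are neighbours in the word, so they stay
neighbours when the word is filtered to their interval. -/
theorem val_merge_append {g : UGraph F} {lab : F → Fin n} {lab' : F ⊕ Fin 2 → Fin n} {L R : List F}
    {y z : F} (h : g.IsLay (L ++ y :: z :: R)) (hy : g.rot y = y) (hz : g.rot z = z) (hyz : y ≠ z)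
    (hly : lab y = lab' (.inr 1)) (hlz : lab z = lab' (.inr 1))
    (hlab : ∀ a ∈ L ++ R, lab a = lab' (.inl a)) :
    (g.mergeLegs y z hy hz hyz).val lab' (L.map .inl ++ .inr 1 :: R.map .inl) =
      g.val lab (L ++ y :: z :: R) - g.val lab (L ++ z :: y :: R) := by
  have h2 := h.perm ((List.Perm.swap z y R).append_left L)
  rw [val_eq h, val_eq h2, val_eq (isLay_merge h hy hz hyz)]
  set i := lab' (.inr 1) with hi
  have hf : (g.lay lab _ h).feet i =
      L.filter (fun a => lab a = i) ++ y :: z :: R.filter (fun a => lab a = i) := by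
    simp [lay, List.filter_append, List.filter_cons, hly, hlz]
  have key := toC_eq_zero (Rel.stu (g.lay lab _ h) i _ _ y z hf)
  rw [map_sub, map_sub, sub_eq_zero] at key
  have e1 : (g.lay lab _ h).exchange i _ _ y z hf = g.lay lab _ h2 := by
    refine TDiag.ext_feet rfl (funext fun j => ?_)
    by_cases hj : j = i
    · subst hj; simp [lay, TDiag.exchange, List.filter_append, List.filter_cons, hly, hlz]
    · simp [lay, TDiag.exchange, hj, List.filter_append, List.filter_cons, hly, hlz, Ne.symm hj]
  have hL : ∀ j, L.filter (fun a => lab a = j) = L.filter (fun a => lab' (.inl a) = j) := fun j =>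
    List.filter_congr fun a ha => by rw [hlab a (by simp [ha])]
  have hR : ∀ j, R.filter (fun a => lab a = j) = R.filter (fun a => lab' (.inl a) = j) := fun j =>
    List.filter_congr fun a ha => by rw [hlab a (by simp [ha])]
  have e2 : (g.lay lab _ h).merge i _ _ y z hf = (g.mergeLegs y z hy hz hyz).lay lab' _
      (isLay_merge h hy hz hyz) := by
    refine TDiag.ext_feet rfl (funext fun j => ?_)
    by_cases hj : j = i
    · subst hj
      simp [lay, TDiag.merge, List.filter_append, List.filter_cons, List.filter_map,
        Function.comp_def, hL, hR, ← hi]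
    · simp [lay, TDiag.merge, hj, List.filter_append, List.filter_cons, hly, hlz, Ne.symm hj,
        List.filter_map, Function.comp_def, hL, hR, ← hi]
  rw [e1, e2] at key
  exact key

/-! ### Substitution in lists -/

/-- A word in the letters of `F` and `A` in which the letters of `A` have been replaced. -/
def subst {A : Type} (s : A → List F) : List (F ⊕ A) → List F :=
  List.flatMap (Sum.elim (fun a => [a]) s)

variable {A : Type} (s : A → List F)

@[simp] theorem subst_nil : subst s [] = [] := rfl
@[simp] theorem subst_inl (a : F) (l) : subst s (.inl a :: l) = a :: subst s l := rfl
@[simp] theorem subst_inr (a : A) (l) : subst s (.inr a :: l) = s a ++ subst s l := rfl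
@[simp] theorem subst_append (l l') : subst s (l ++ l') = subst s l ++ subst s l' := by
  simp [subst]
@[simp] theorem subst_map_inl (l : List F) : subst s (l.map .inl) = l := by
  induction l with
  | nil => rfl
  | cons a l ih => simp [ih]

theorem exists_map_inl {l : List (F ⊕ A)} (h : ∀ a, .inr a ∉ l) : ∃ l' : List F, l = l'.map .inl := by
  induction l with
  | nil => exact ⟨[], rfl⟩
  | cons a l ih =>
    obtain ⟨l', rfl⟩ := ih fun a ha => h a (by simp [ha])
    rcases a with a | a
    · exact ⟨a :: l', rfl⟩
    · exact absurd (by simp) (h a)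

/-- A word in which exactly one letter of `A` occurs, and only once. -/
theorem exists_split {w : List (F ⊕ A)} (hw : w.Nodup) {a : A} (ha : ∀ b, .inr b ∈ w ↔ b = a) :
    ∃ L R : List F, w = L.map .inl ++ .inr a :: R.map .inl := by
  obtain ⟨L, R, rfl⟩ := List.append_of_mem ((ha a).2 rfl)
  have h1 : ∀ b, Sum.inr b ∉ L := by
    intro b hb
    obtain rfl := (ha b).1 (by simp [hb])
    rw [List.nodup_append] at hw
    exact hw.2.2 _ hb _ (by simp) rfl
  have h2 : ∀ b, Sum.inr b ∉ R := by
    intro b hb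
    obtain rfl := (ha b).1 (by simp [hb])
    rw [List.nodup_append, List.nodup_cons] at hw
    exact hw.2.1.1 hb
  obtain ⟨L', rfl⟩ := exists_map_inl h1
  obtain ⟨R', rfl⟩ := exists_map_inl h2
  exact ⟨L', R', rfl⟩

/-- The only new foot of a merged graph is `inr 1`; writing `y`, `z` in its place gives back a
layout of the graph before the merge. -/
theorem IsLay.exists_split_merge {g : UGraph F} {y z : F} {hy : g.rot y = y} {hz : g.rot z = z}
    {hyz : y ≠ z} {w : List (F ⊕ Fin 2)} (h : (g.mergeLegs y z hy hz hyz).IsLay w) :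
    ∃ L R : List F, w = L.map .inl ++ .inr 1 :: R.map .inl ∧ g.IsLay (L ++ y :: z :: R) := by
  obtain ⟨L, R, rfl⟩ := exists_split h.1 (a := 1) fun b => by
    rw [h.2]; fin_cases b <;> simp [mergeLegs, mergeRot]
  refine ⟨L, R, rfl, ?_⟩
  have hm : ∀ c, c ∈ L ++ R ↔ g.rot c = c ∧ c ≠ y ∧ c ≠ z := by
    intro c
    have := h.2 (.inl c)
    simp only [List.mem_append, List.mem_map, Sum.inl.injEq, exists_eq_right, List.mem_cons,
      reduceCtorEq, false_or] at this ⊢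
    rw [this]
    by_cases h1 : c = y
    · subst h1; simp [mergeLegs, mergeRot]
    · by_cases h2 : c = z
      · subst h2; simp [mergeLegs, mergeRot, h1, hyz]
      · simp [mergeLegs, mergeRot, h1, h2]
  have p : (L ++ y :: z :: R).Perm (y :: z :: (L ++ R)) :=
    List.perm_middle.trans (List.Perm.cons _ List.perm_middle)
  have hLR : (L ++ R).Nodup := by
    have := h.1
    rw [List.perm_middle.nodup_iff, ← List.map_append, List.nodup_cons] at this
    exact List.Nodup.of_map _ this.2
  refine IsLay.perm ⟨?_, fun c => ?_⟩ p.symm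
  · rw [List.nodup_cons, List.nodup_cons, List.mem_cons, hm, hm]
    exact ⟨by simp [hyz], by simp, hLR⟩
  · rw [List.mem_cons, List.mem_cons, hm]
    by_cases h1 : c = y
    · simp [h1, hy]
    · by_cases h2 : c = z
      · simp [h2, hz]
      · simp [h1, h2]

open scoped Classical in
/-- The relation (STU). -/
theorem val_merge {g : UGraph F} {lab : F ⊕ Fin 2 → Fin n} {y z : F}
    {hy : g.rot y = y} {hz : g.rot z = z} {hyz : y ≠ z} {w : List (F ⊕ Fin 2)}
    (h : (g.mergeLegs y z hy hz hyz).IsLay w) :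
    (g.mergeLegs y z hy hz hyz).val lab w =
      g.val (fun a => if a = y ∨ a = z then lab (.inr 1) else lab (.inl a))
        (subst (fun _ => [y, z]) w) -
      g.val (fun a => if a = y ∨ a = z then lab (.inr 1) else lab (.inl a))
        (subst (fun _ => [z, y]) w) := by
  obtain ⟨L, R, rfl, h'⟩ := h.exists_split_merge
  rw [val_merge_append h' hy hz hyz (lab := fun a => if a = y ∨ a = z then lab (.inr 1) else
    lab (.inl a)) (by simp) (by simp)]
  · simp
  · intro a ha
    have hn := (List.perm_middle.trans (List.Perm.cons _ List.perm_middle)).nodup_iff.1 h'.1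
    rw [List.nodup_cons, List.nodup_cons, List.mem_cons] at hn
    have h1 : a ≠ y := by rintro rfl; exact hn.1 (Or.inr ha)
    have h2 : a ≠ z := by rintro rfl; exact hn.2.1 ha
    simp [h1, h2]

theorem isLay_subst_merge {g : UGraph F} {y z : F} {hy : g.rot y = y} {hz : g.rot z = z}
    {hyz : y ≠ z} {w : List (F ⊕ Fin 2)} (h : (g.mergeLegs y z hy hz hyz).IsLay w) :
    g.IsLay (subst (fun _ => [y, z]) w) ∧ g.IsLay (subst (fun _ => [z, y]) w) := by
  obtain ⟨L, R, rfl, h'⟩ := h.exists_split_merge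
  simpa using ⟨h', h'.perm ((List.Perm.swap z y R).append_left L)⟩

end UGraph
end TriDiag

/-! ### Inserted legs and the relations (CL1), (CL2) in terms of words -/

namespace TriDiag
variable {n : ℕ} {F F' G H : Type}
namespace UGraph

theorem IsLay.exists_split_insert {g : UGraph F} {a : F} {w : List (F ⊕ Fin 4)}
    (h : (g.insertLeg a).IsLay w) :
    ∃ L R : List F, w = L.map .inl ++ .inr 3 :: R.map .inl ∧ g.IsLay (L ++ R) := by
  obtain ⟨L, R, rfl⟩ := exists_split h.1 (a := 3) fun b => by
    rw [h.2]; fin_cases b <;> simp [insertLeg, insertRot]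
  refine ⟨L, R, rfl, ?_, fun c => ?_⟩
  · have := h.1
    rw [List.perm_middle.nodup_iff, ← List.map_append, List.nodup_cons] at this
    exact List.Nodup.of_map _ this.2
  · simpa [insertLeg, insertRot] using h.2 (.inl c)

theorem isLay_insert {g : UGraph F} (a : F) {L R : List F} (h : g.IsLay (L ++ R)) :
    (g.insertLeg a).IsLay (L.map .inl ++ .inr 3 :: R.map .inl) := by
  refine ⟨?_, ?_⟩
  · rw [List.perm_middle.nodup_iff, ← List.map_append, List.nodup_cons]
    exact ⟨by simp, h.1.map Sum.inl_injective⟩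
  · rintro (c | c)
    · simpa [insertLeg, insertRot] using h.2 c
    · fin_cases c <;> simp [insertLeg, insertRot]

theorem isLay_subst_insert {g : UGraph F} {a : F} {w : List (F ⊕ Fin 4)}
    (h : (g.insertLeg a).IsLay w) : g.IsLay (subst (fun _ => []) w) := by
  obtain ⟨L, R, rfl, h'⟩ := h.exists_split_insert
  simpa using h'

theorem isLay_insert_cons {g : UGraph F} (a : F) {w : List F} (h : g.IsLay w) :
    (g.insertLeg a).IsLay (.inr 3 :: w.map .inl) :=
  isLay_insert a (L := []) h

/-- The rotation after an insertion does not involve the chosen edge, so the feet are literally the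
same. Layouts can be reused when a leg moves to another edge. -/
theorem isLay_insert_iff {g : UGraph F} (a b : F) {w : List (F ⊕ Fin 4)} :
    (g.insertLeg a).IsLay w ↔ (g.insertLeg b).IsLay w := Iff.rfl

/-- The position of the new foot on its interval is the number of earlier letters of the word with
the same label. -/
theorem lay_insertLeg {g : UGraph F} (a : F) (lab : F ⊕ Fin 4 → Fin n) {L R : List F}
    (h : g.IsLay (L ++ R)) (h' : (g.insertLeg a).IsLay (L.map .inl ++ .inr 3 :: R.map .inl)) :
    (g.lay (lab ∘ .inl) (L ++ R) h).insertLeg a (lab (.inr 3))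
      (L.filter (fun c => lab (.inl c) = lab (.inr 3))).length =
    (g.insertLeg a).lay lab _ h' := by
  refine TDiag.ext_feet rfl (funext fun j => ?_)
  by_cases hj : j = lab (.inr 3)
  · subst hj
    simp only [lay, TDiag.insertLeg, if_true, List.filter_append, List.map_append,
      List.filter_cons, List.filter_map, Function.comp_def, insertAt]
    rw [List.take_left' (by simp), List.drop_left' (by simp)]
    simp
  · simp [lay, TDiag.insertLeg, hj, Ne.symm hj, List.filter_append, List.filter_map,
      Function.comp_def]

/-- The edge `{a, inv a}` joins two distinct trivalent vertices. -/
structure Internal (g : UGraph F) (a : F) : Prop where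
  rot_ne : g.rot a ≠ a
  rot_inv_ne : g.rot (g.inv a) ≠ g.inv a
  inv_ne_rot : g.inv a ≠ g.rot a
  inv_ne_rot_rot : g.inv a ≠ g.rot (g.rot a)

/-- The relation (CL2). -/
theorem val_cl2 {g : UGraph F} {a : F} (ha : g.Internal a) {lab : (F ⊕ Fin 4) ⊕ Fin 4 → Fin n}
    {w : List ((F ⊕ Fin 4) ⊕ Fin 4)} (h : ((g.insertLeg a).insertLeg (.inr 1)).IsLay w) :
    ((g.insertLeg a).insertLeg (.inr 1)).val lab w =
      (d (lab (.inl (.inr 3))) * d (lab (.inr 3))) •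
        g.val (fun c => lab (.inl (.inl c))) (subst (fun _ => []) (subst (fun _ => []) w)) := by
  obtain ⟨L, R, rfl, h1⟩ := h.exists_split_insert
  obtain ⟨L', R', e, h2⟩ := h1.exists_split_insert
  have h3 : g.IsLay (subst (fun _ => []) (subst (fun _ => [])
    (L.map .inl ++ .inr 3 :: R.map .inl : List ((F ⊕ Fin 4) ⊕ Fin 4)))) := by
    simpa [e] using isLay_subst_insert h1
  have e3 : subst (fun _ => []) (subst (fun _ => [])
    (L.map .inl ++ .inr 3 :: R.map .inl : List ((F ⊕ Fin 4) ⊕ Fin 4))) = L' ++ R' := by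
    simp only [subst_append, subst_map_inl, subst_inr, List.nil_append]
    rw [← subst_append, e]; simp
  have hh : (g.insertLeg a).IsLay (L'.map .inl ++ .inr 3 :: R'.map .inl) := e ▸ h1
  have hlay : (g.insertLeg a).lay (lab ∘ .inl) _ h1 = (g.insertLeg a).lay (lab ∘ .inl) _ hh := by
    congr 1
  have l1 := lay_insertLeg (Sum.inr 1) lab h1 h
  have l2 := lay_insertLeg a (lab ∘ .inl) h2 hh
  rw [hlay, ← l2] at l1
  -- Positions are lengths of filtered prefixes: `L'` for the first foot, and `L`, taken in the word
  -- that already contains the first foot, for the second.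
  have key := toC_eq_zero (Rel.cl2 (g.lay ((lab ∘ .inl) ∘ .inl) (L' ++ R') h2) a ha.rot_ne
    ha.rot_inv_ne ha.inv_ne_rot ha.inv_ne_rot_rot (lab (.inl (.inr 3))) (lab (.inr 3))
    (L'.filter (fun c => lab (.inl (.inl c)) = lab (.inl (.inr 3)))).length
    (L.filter (fun c => lab (.inl c) = lab (.inr 3))).length
    (by simp [lay, List.filter_append]) (by
      have := congrArg (fun D : TDiag n (F ⊕ Fin 4) => (D.feet (lab (.inr 3))).length) l2
      have hL : ((L'.map .inl ++ .inr 3 :: R'.map .inl : List (F ⊕ Fin 4)).filter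
        (fun c => lab (.inl c) = lab (.inr 3))).length =
        ((L ++ R).filter (fun c => lab (.inl c) = lab (.inr 3))).length := by rw [e]
      simp only [Function.comp_apply] at this
      rw [this]
      simp only [lay, Function.comp_apply, hL]
      simp [List.filter_append]))
  rw [map_sub, mk_smul, sub_eq_zero] at key
  rw [val_eq h, val_eq h3]
  refine Eq.trans (congrArg TDiag.toC l1.symm) (key.trans ?_)
  congr 1
  have : (g.lay (fun c => lab (.inl (.inl c))) _ h3) =
      g.lay ((lab ∘ .inl) ∘ .inl) (L' ++ R') h2 := by
    refine TDiag.ext_feet rfl (funext fun i => ?_)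
    simp only [lay, e3]; rfl
  rw [this]; rfl

/-- The index `A.length + 2` skips `A`, the foot inserted first, and `f`. In the reversed version
below, `A.length + 1` puts the first new foot behind `f` and `A.length` the second one in front of
it. -/
theorem insertAt_comb (A B : List F) (f : F) :
    insertAt ((insertAt ((A ++ f :: B).map .inl) A.length (.inr 3 : F ⊕ Fin 4)).map .inl)
      (A.length + 2) (.inr 3 : (F ⊕ Fin 4) ⊕ Fin 4) =
    (A.map .inl).map .inl ++ .inl (.inr 3) :: .inl (.inl f) :: .inr 3 :: (B.map .inl).map .inl := by
  induction A with
  | nil => simp [insertAt]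
  | cons a A ih => simp [insertAt] at ih ⊢; exact ih

theorem insertAt_combRev (A B : List F) (f : F) :
    insertAt ((insertAt ((A ++ f :: B).map .inl) (A.length + 1) (.inr 3 : F ⊕ Fin 4)).map .inl)
      A.length (.inr 3 : (F ⊕ Fin 4) ⊕ Fin 4) =
    (A.map .inl).map .inl ++ .inr 3 :: .inl (.inl f) :: .inl (.inr 3) :: (B.map .inl).map .inl := by
  induction A with
  | nil => simp [insertAt]
  | cons a A ih => simp [insertAt] at ih ⊢; exact ih

/-- The relation (CL1). -/
theorem val_cl1 {g : UGraph F} {lab : (F ⊕ Fin 4) ⊕ Fin 4 → Fin n} {L R : List F} {f : F}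
    (h : g.IsLay (L ++ f :: R)) (hf : g.rot (g.inv f) ≠ g.inv f)
    (h1 : lab (.inl (.inr 3)) = lab (.inl (.inl f))) (h2 : lab (.inr 3) = lab (.inl (.inl f))) :
    ((g.insertLeg (g.inv (g.rot (g.inv f)))).insertLeg (.inl (g.rot (g.rot (g.inv f))))).val lab
        ((L.map .inl).map .inl ++ .inl (.inr 3) :: .inl (.inl f) :: .inr 3 ::
          (R.map .inl).map .inl) +
      ((g.insertLeg (g.inv (g.rot (g.inv f)))).insertLeg (.inl (g.rot (g.rot (g.inv f))))).val lab
        ((L.map .inl).map .inl ++ .inr 3 :: .inl (.inl f) :: .inl (.inr 3) ::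
          (R.map .inl).map .inl) =
      (2 * d (lab (.inl (.inl f))) ^ 2) •
        g.val (fun c => lab (.inl (.inl c))) (L ++ f :: R) := by
  set i := lab (.inl (.inl f)) with hi
  set z := g.rot (g.inv f)
  set y := g.rot z
  have hfeet : (g.lay (fun c => lab (.inl (.inl c))) _ h).feet i =
      L.filter (fun c => lab (.inl (.inl c)) = i) ++ f ::
        R.filter (fun c => lab (.inl (.inl c)) = i) := by
    simp [lay, List.filter_append, List.filter_cons, ← hi]
  have key := toC_eq_zero (Rel.cl1 (g.lay (fun c => lab (.inl (.inl c))) _ h) i _ _ f hfeet hf)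
  rw [map_sub, map_add, mk_smul, sub_eq_zero] at key
  have a1 : (g.insertLeg (g.inv z)).IsLay (L.map .inl ++ .inr 3 :: (f :: R).map .inl) :=
    isLay_insert _ h
  have b1 : ((g.insertLeg (g.inv z)).insertLeg (.inl y)).IsLay
      ((L.map .inl).map .inl ++ .inl (.inr 3) :: .inl (.inl f) :: .inr 3 ::
          (R.map .inl).map .inl) := by
    have := isLay_insert (g := g.insertLeg (g.inv z)) (.inl y)
      (L := L.map .inl ++ [.inr 3, .inl f]) (R := R.map .inl) (by simpa using a1)
    simpa using this
  have a2 : (g.insertLeg (g.inv z)).IsLay ((L ++ [f]).map .inl ++ .inr 3 :: R.map .inl) :=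
    isLay_insert _ (by simpa using h)
  have b2 : ((g.insertLeg (g.inv z)).insertLeg (.inl y)).IsLay
      ((L.map .inl).map .inl ++ .inr 3 :: .inl (.inl f) :: .inl (.inr 3) ::
          (R.map .inl).map .inl) := by
    have := isLay_insert (g := g.insertLeg (g.inv z)) (.inl y)
      (L := L.map .inl) (R := .inl f :: .inr 3 :: R.map .inl) (by simpa using a2)
    simpa using this
  rw [val_eq h, val_eq b1, val_eq b2]
  refine Eq.trans (congrArg₂ _ (congrArg TDiag.toC ?_) (congrArg TDiag.toC ?_)) key
  · refine TDiag.ext_feet rfl (funext fun j => ?_)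
    by_cases hj : j = i
    · simp only [TDiag.comb, TDiag.insertLeg, hj, if_true, hfeet]
      rw [insertAt_comb]
      simp [lay, List.filter_append, List.filter_map, Function.comp_def, List.filter_cons, h1, h2,
        ← hi]
    · simp [lay, TDiag.comb, TDiag.insertLeg, hj, Ne.symm hj, List.filter_append, List.filter_map,
        Function.comp_def, List.filter_cons, h1, h2, ← hi]
  · refine TDiag.ext_feet rfl (funext fun j => ?_)
    by_cases hj : j = i
    · simp only [TDiag.combRev, TDiag.insertLeg, hj, if_true, hfeet]
      rw [insertAt_combRev]
      simp [lay, List.filter_append, List.filter_map, Function.comp_def, List.filter_cons, h1, h2,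
        ← hi]
    · simp [lay, TDiag.combRev, TDiag.insertLeg, hj, Ne.symm hj, List.filter_append,
        List.filter_map, Function.comp_def, List.filter_cons, h1, h2, ← hi]

/-! ### Products -/

theorem isLay_sum {g : UGraph F} {g' : UGraph G} {w : List F} {w' : List G} (h : g.IsLay w)
    (h' : g'.IsLay w') : (g.sum g').IsLay (w.map .inl ++ w'.map .inr) := by
  refine ⟨?_, ?_⟩
  · rw [List.nodup_append]
    exact ⟨h.1.map Sum.inl_injective, h'.1.map Sum.inr_injective, by simp⟩
  · rintro (a | a)
    · simpa [UGraph.sum] using h.2 a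
    · simpa [UGraph.sum] using h'.2 a

theorem toC_mul (D : TDiag n F) (E : TDiag n G) : D.toC * E.toC = (D.mul E).toC := by
  rw [TDiag.toC, TDiag.toC, TDiag.toC, ← map_mul, TDiag.elt_mul]

theorem val_mul {g : UGraph F} {g' : UGraph G} {w : List F} {w' : List G} (h : g.IsLay w)
    (h' : g'.IsLay w') (lab : F → Fin n) (lab' : G → Fin n) :
    g.val lab w * g'.val lab' w' =
      (g.sum g').val (Sum.elim lab lab') (w.map .inl ++ w'.map .inr) := by
  rw [val_eq h, val_eq h', val_eq (isLay_sum h h'), toC_mul]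
  congr 1
  refine TDiag.ext_feet rfl (funext fun i => ?_)
  simp only [lay, TDiag.mul, List.filter_append, List.filter_map, Function.comp_def, Sum.elim_inl,
    Sum.elim_inr]
  congr!

end UGraph
end TriDiag

/-! ### Reversing the orientation of a vertex -/

namespace TriDiag
variable {n : ℕ} {F F' G H : Type}
namespace UGraph

theorem rot_injective (g : UGraph F) : Function.Injective g.rot := fun u v e => by
  rw [← g.rot_rot_rot u, e, g.rot_rot_rot]

theorem inv_injective (g : UGraph F) : Function.Injective g.inv := fun u v e => by
  rw [← g.inv_inv u, e, g.inv_inv]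

theorem inv_eq_iff (g : UGraph F) {a b : F} : g.inv a = b ↔ a = g.inv b :=
  ⟨fun h => by rw [← h, g.inv_inv], fun h => by rw [h, g.inv_inv]⟩

theorem rot_rot_ne (g : UGraph F) {a : F} (h : g.rot a ≠ a) : g.rot (g.rot a) ≠ a := fun e =>
  h (by conv_rhs => rw [← g.rot_rot_rot a, e])

theorem rot_rot_ne_rot (g : UGraph F) {a : F} (h : g.rot a ≠ a) : g.rot (g.rot a) ≠ g.rot a :=
  fun e => h (g.rot_injective e)

/-- `a` is one of the half-edges at the vertex of `v`. -/
def Orb (g : UGraph F) (v a : F) : Prop := a = v ∨ a = g.rot v ∨ a = g.rot (g.rot v)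

theorem orb_rot (g : UGraph F) {v a : F} : g.Orb v (g.rot a) ↔ g.Orb v a := by
  constructor
  · rintro (h | h | h)
    · exact Or.inr (Or.inr (by rw [← h, g.rot_rot_rot]))
    · exact Or.inl (g.rot_injective h)
    · exact Or.inr (Or.inl (g.rot_injective h))
  · rintro (rfl | rfl | rfl)
    · exact Or.inr (Or.inl rfl)
    · exact Or.inr (Or.inr rfl)
    · exact Or.inl (g.rot_rot_rot _)

theorem orb_self (g : UGraph F) (v : F) : g.Orb v v := Or.inl rfl

theorem orb_iff_rot (g : UGraph F) {v a : F} : g.Orb (g.rot v) a ↔ g.Orb v a := by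
  unfold Orb
  rw [g.rot_rot_rot]
  tauto

/-- The rotation of `UGraph.flip`. -/
def flipRot (g : UGraph F) (v : F) : F → F := by
  classical exact fun a => if g.Orb v a then g.rot (g.rot a) else g.rot a

theorem flipRot_orb (g : UGraph F) {v a : F} (h : g.Orb v a) :
    g.flipRot v a = g.rot (g.rot a) := if_pos h

theorem flipRot_not (g : UGraph F) {v a : F} (h : ¬ g.Orb v a) : g.flipRot v a = g.rot a := if_neg h

/-- At the reversed vertex the old rotation is the square of the new one, so an old step is replaced
by two new ones. -/
theorem flip_conn (g : UGraph F) (v : F) {a b : F} (h : FlagConn g.inv g.rot a b) :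
    FlagConn g.inv (g.flipRot v) a b := by
  refine h.map id (fun a => .inv_step a) fun a => ?_
  by_cases h : g.Orb v a
  · have h1 := FlagConn.rot_step (inv := g.inv) (rot := g.flipRot v) a
    have h2 := FlagConn.rot_step (inv := g.inv) (rot := g.flipRot v) (g.flipRot v a)
    rw [g.flipRot_orb h] at h1 h2
    rw [g.flipRot_orb (g.orb_rot.2 (g.orb_rot.2 h)), g.rot_rot_rot] at h2
    exact h1.trans h2
  · have h1 := FlagConn.rot_step (inv := g.inv) (rot := g.flipRot v) a
    rwa [g.flipRot_not h] at h1

/-- Reverse the cyclic order at the vertex of `v`. -/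
def flip (g : UGraph F) (v : F) : UGraph F where
  finite := g.finite
  inv := g.inv
  rot := g.flipRot v
  inv_inv := g.inv_inv
  inv_ne := g.inv_ne
  rot_rot_rot a := by
    by_cases h : g.Orb v a
    · rw [g.flipRot_orb h, g.flipRot_orb (g.orb_rot.2 (g.orb_rot.2 h)),
        g.flipRot_orb (g.orb_rot.2 (g.orb_rot.2 (g.orb_rot.2 (g.orb_rot.2 h))))]
      rw [g.rot_rot_rot, g.rot_rot_rot]
    · rw [g.flipRot_not h, g.flipRot_not (fun h' => h (g.orb_rot.1 h')),
        g.flipRot_not (fun h' => h (g.orb_rot.1 (g.orb_rot.1 h'))), g.rot_rot_rot]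
  exists_leg a := by
    obtain ⟨b, h, hb⟩ := g.exists_leg a
    refine ⟨b, g.flip_conn v h, ?_⟩
    by_cases h : g.Orb v b
    · rw [g.flipRot_orb h, hb, hb]
    · rw [g.flipRot_not h, hb]

theorem flip_rot_orb (g : UGraph F) {v a : F} (h : g.Orb v a) :
    (g.flip v).rot a = g.rot (g.rot a) := if_pos h

theorem flip_rot_not (g : UGraph F) {v a : F} (h : ¬ g.Orb v a) : (g.flip v).rot a = g.rot a :=
  if_neg h

@[simp] theorem flip_inv (g : UGraph F) (v a : F) : (g.flip v).inv a = g.inv a := rfl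

theorem flip_rot_eq_iff (g : UGraph F) {v a : F} : (g.flip v).rot a = a ↔ g.rot a = a := by
  by_cases h : g.Orb v a
  · rw [g.flip_rot_orb h]
    exact ⟨fun e => by conv_lhs => rw [← e, g.rot_rot_rot], fun e => by rw [e, e]⟩
  · rw [g.flip_rot_not h]

theorem isLay_flip {g : UGraph F} {v : F} {w : List F} : (g.flip v).IsLay w ↔ g.IsLay w := by
  unfold IsLay
  simp only [flip_rot_eq_iff]

/-- Isomorphisms are compatible with reversing the order at a vertex. -/
def Equiv.flip {g : UGraph F} {g' : UGraph G} (φ : g.Equiv g') (v : F) :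
    (g.flip v).Equiv (g'.flip (φ.e v)) where
  e := φ.e
  inv := φ.inv
  rot a := by
    have ho : g'.Orb (φ.e v) (φ.e a) ↔ g.Orb v a := by
      unfold Orb
      rw [← φ.rot, ← φ.rot, φ.e.apply_eq_iff_eq, φ.e.apply_eq_iff_eq, φ.e.apply_eq_iff_eq]
    by_cases h : g.Orb v a
    · rw [g.flip_rot_orb h, g'.flip_rot_orb (ho.2 h), φ.rot, φ.rot]
    · rw [g.flip_rot_not h, g'.flip_rot_not (fun h' => h (ho.1 h')), φ.rot]

theorem flip_eq_of_orb (g : UGraph F) {v v' : F} (h : ∀ a, g.Orb v a ↔ g.Orb v' a) :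
    g.flip v = g.flip v' := by
  have : g.flipRot v = g.flipRot v' := by
    funext a
    by_cases ha : g.Orb v a
    · rw [g.flipRot_orb ha, g.flipRot_orb ((h a).1 ha)]
    · rw [g.flipRot_not ha, g.flipRot_not fun h' => ha ((h a).2 h')]
  unfold flip
  simp only [this]

theorem flip_rot_eq (g : UGraph F) (v : F) : g.flip (g.rot v) = g.flip v :=
  g.flip_eq_of_orb fun _ => g.orb_iff_rot

/-! ### Cutting a vertex next to a foot -/

/-- Inverse of `mergeLegs`: deleting a foot and the other half of its leg turns the two remaining
half-edges of the trivalent vertex into feet. Two half-edges disappear, which drives the inductions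
below. -/
theorem exists_unmerge (g : UGraph F) {f : F} (hf : g.rot f = f) (hx : g.rot (g.inv f) ≠ g.inv f) :
    ∃ (F₀ : Type) (g₀ : UGraph F₀) (y z : F₀) (hy : g₀.rot y = y) (hz : g₀.rot z = z) (hyz : y ≠ z)
      (φ : (g₀.mergeLegs y z hy hz hyz).Equiv g), φ.e (.inr 0) = g.inv f ∧ φ.e (.inr 1) = f ∧
      φ.e (.inl z) = g.rot (g.inv f) ∧ φ.e (.inl y) = g.rot (g.rot (g.inv f)) := by
  classical
  set x := g.inv f with hxdef
  set z := g.rot x with hzdef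
  set y := g.rot z with hydef
  have hfx : g.inv x = f := g.inv_inv f
  have hxf : x ≠ f := g.inv_ne f
  have hzx : z ≠ x := hx
  have hyx : y ≠ x := g.rot_rot_ne hx
  have hyz : y ≠ z := g.rot_rot_ne_rot hx
  have hyrot : g.rot y = x := g.rot_rot_rot x
  have hzf : z ≠ f := fun e => hx (g.rot_injective (by rw [← hzdef, e, hf]))
  have hyf : y ≠ f := fun e => hyx (by rw [e, ← hyrot, e, hf])
  have hyx' : ∀ a, g.rot a = x ↔ a = y := fun a =>
    ⟨fun e => g.rot_injective (e.trans hyrot.symm), fun e => e ▸ hyrot⟩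
  have hrf : ∀ a, g.rot a = f ↔ a = f := fun a =>
    ⟨fun e => g.rot_injective (e.trans hf.symm), fun e => e ▸ hf⟩
  have hif : ∀ a, g.inv a = f ↔ a = x := fun a => g.inv_eq_iff
  have hix : ∀ a, g.inv a = x ↔ a = f := fun a => by rw [g.inv_eq_iff, hfx]
  let F₀ := {a : F // a ≠ f ∧ a ≠ x}
  let inv₀ : F₀ → F₀ := fun a => ⟨g.inv a, fun e => a.2.2 ((hif _).1 e), fun e => a.2.1 ((hix _).1 e)⟩
  -- The half-edges `y` and `z` become univalent; every other rotation stays inside `F₀`, since only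
  -- `y` rotates to `x` and only `f` to `f`.
  let rot₀ : F₀ → F₀ := fun a => if h : a.1 = y ∨ a.1 = z then a else
    ⟨g.rot a, fun e => a.2.1 ((hrf _).1 e), fun e => h (Or.inl ((hyx' _).1 e))⟩
  let y₀ : F₀ := ⟨y, hyf, hyx⟩
  let z₀ : F₀ := ⟨z, hzf, hzx⟩
  have r1 : ∀ a : F₀, a.1 = y ∨ a.1 = z → rot₀ a = a := fun a h => dif_pos h
  have r2 : ∀ a : F₀, ¬ (a.1 = y ∨ a.1 = z) → (rot₀ a).1 = g.rot a := fun a h => by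
    change (dite _ _ _ : F₀).1 = _
    rw [dif_neg h]
  -- A path of `g` that starts in `F₀` stays there until it has to rotate at the cut vertex; at that
  -- moment it is at `y` or `z`, which is a foot now.
  have hleg : ∀ a b, FlagConn g.inv g.rot a b → ∀ ha : a ≠ f ∧ a ≠ x,
      (∃ c : F₀, FlagConn inv₀ rot₀ ⟨a, ha⟩ c ∧ rot₀ c = c) ∨
        ∃ hb : b ≠ f ∧ b ≠ x, FlagConn inv₀ rot₀ ⟨a, ha⟩ ⟨b, hb⟩ := by
    intro a b h ha
    induction h with
    | refl => exact Or.inr ⟨ha, .refl⟩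
    | @tail b c h1 h2 ih =>
      rcases ih with ih | ⟨hb, ih⟩
      · exact Or.inl ih
      · rcases h2 with rfl | rfl
        · exact Or.inr ⟨(inv₀ ⟨b, hb⟩).2, ih.trans (FlagConn.inv_step (inv := inv₀) (rot := rot₀) ⟨b, hb⟩)⟩
        · by_cases hyz' : b = y ∨ b = z
          · exact Or.inl ⟨⟨b, hb⟩, ih, r1 _ hyz'⟩
          · refine Or.inr ⟨?_, ?_⟩
            · rw [← r2 ⟨b, hb⟩ hyz']; exact (rot₀ ⟨b, hb⟩).2
            · have := ih.trans (FlagConn.rot_step (inv := inv₀) (rot := rot₀) _)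
              have e : (⟨g.rot b, by rw [← r2 ⟨b, hb⟩ hyz']; exact (rot₀ ⟨b, hb⟩).2⟩ : F₀) =
                rot₀ ⟨b, hb⟩ := Subtype.ext (r2 ⟨b, hb⟩ hyz').symm
              rw [e]; exact this
  let g₀ : UGraph F₀ :=
    { finite := by have := g.finite; exact Subtype.finite
      inv := inv₀
      rot := rot₀
      inv_inv := fun a => Subtype.ext (g.inv_inv _)
      inv_ne := fun a e => g.inv_ne a (congrArg Subtype.val e)
      rot_rot_rot := by
        intro a
        by_cases h : a.1 = y ∨ a.1 = z
        · rw [r1 a h, r1 a h, r1 a h]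
        · have h2 : ¬ ((rot₀ a).1 = y ∨ (rot₀ a).1 = z) := by
            rw [r2 a h]
            rintro (e | e)
            · exact h (Or.inr (g.rot_injective e))
            · exact a.2.2 (g.rot_injective e)
          have h3 : ¬ ((rot₀ (rot₀ a)).1 = y ∨ (rot₀ (rot₀ a)).1 = z) := by
            rw [r2 _ h2]
            rintro (e | e)
            · exact h2 (Or.inr (g.rot_injective e))
            · exact (rot₀ a).2.2 (g.rot_injective e)
          exact Subtype.ext (by rw [r2 _ h3, r2 _ h2, r2 _ h, g.rot_rot_rot])
      exists_leg := by
        intro a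
        obtain ⟨b, hab, hb⟩ := g.exists_leg a
        rcases hleg a b hab a.2 with h | ⟨hb', h⟩
        · exact h
        · refine ⟨⟨b, hb'⟩, h, ?_⟩
          by_cases hyz' : b = y ∨ b = z
          · exact r1 _ hyz'
          · exact Subtype.ext ((r2 _ hyz').trans hb) }
  have hxr : g.rot x ≠ f := hzf
  let e : F₀ ⊕ Fin 2 ≃ F := _root_.Equiv.ofBijective (Sum.elim Subtype.val ![x, f]) (by
    constructor
    · rintro (a | a) (b | b) h
      · exact congrArg Sum.inl (Subtype.ext h)
      · fin_cases b
        · exact absurd h a.2.2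
        · exact absurd h a.2.1
      · fin_cases a
        · exact absurd h.symm b.2.2
        · exact absurd h.symm b.2.1
      · fin_cases a <;> fin_cases b <;> simp_all
    · intro a
      by_cases h1 : a = f
      · exact ⟨.inr 1, h1.symm⟩
      · by_cases h2 : a = x
        · exact ⟨.inr 0, h2.symm⟩
        · exact ⟨.inl ⟨a, h1, h2⟩, rfl⟩)
  refine ⟨F₀, g₀, y₀, z₀, r1 _ (Or.inl rfl), r1 _ (Or.inr rfl), fun h => hyz (congrArg Subtype.val h),
    ⟨e, ?_, ?_⟩, rfl, rfl, rfl, rfl⟩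
  · rintro (a | a)
    · rfl
    · fin_cases a
      · exact hfx.symm
      · rfl
  · rintro (a | a)
    · by_cases h1 : a = y₀
      · subst h1
        simp only [mergeLegs, mergeRot, Sum.elim_inl, if_true]
        exact hyrot.symm
      · by_cases h2 : a = z₀
        · subst h2
          simp only [mergeLegs, mergeRot, Sum.elim_inl, if_neg h1, if_true]
          rfl
        · simp only [mergeLegs, mergeRot, Sum.elim_inl, if_neg h1, if_neg h2]
          refine r2 a ?_
          rintro (h | h)
          · exact h1 (Subtype.ext h)
          · exact h2 (Subtype.ext h)
    · fin_cases a
      · rfl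
      · exact hf.symm

end UGraph
end TriDiag

/-! ### Antisymmetry -/

namespace TriDiag
variable {n : ℕ} {F F' G H : Type}
namespace UGraph

/-- A path from a trivalent vertex to a foot leaves the trivalent vertices by an application of
`inv`, since rotation does not change the valency. -/
theorem exists_tri_near_leg (g : UGraph F) {v : F} (hv : g.rot v ≠ v) :
    ∃ c, g.rot c ≠ c ∧ g.rot (g.inv c) = g.inv c := by
  obtain ⟨b, hb, hb'⟩ := g.exists_leg v
  have : ∀ b, FlagConn g.inv g.rot v b →
      g.rot b ≠ b ∨ ∃ c, g.rot c ≠ c ∧ g.rot (g.inv c) = g.inv c := by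
    intro b hb
    induction hb with
    | refl => exact Or.inl hv
    | @tail b c _ h ih =>
      rcases ih with ih | ih
      · rcases h with rfl | rfl
        · by_cases hi : g.rot (g.inv b) = g.inv b
          · exact Or.inr ⟨b, ih, hi⟩
          · exact Or.inl hi
        · exact Or.inl (g.rot_rot_ne_rot ih)
      · exact Or.inr ih
  exact (this b hb).resolve_left (fun h => h hb')

theorem val_iso_symm {g : UGraph F} {g' : UGraph G} (φ : g.Equiv g') {lab : G → Fin n}
    {w : List G} (h : g'.IsLay w) : g'.val lab w = g.val (lab ∘ φ.e) (w.map φ.e.symm) := by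
  have := val_iso' φ.symm (lab := lab) h
  exact this

theorem isLay_map_symm {g : UGraph F} {g' : UGraph G} (φ : g.Equiv g')
    {w : List G} (h : g'.IsLay w) : g.IsLay (w.map φ.e.symm) := φ.symm.isLay h

theorem val_merge' {g : UGraph F} {lab : F ⊕ Fin 2 → Fin n} (lab' : F → Fin n) {y z : F}
    {hy : g.rot y = y} {hz : g.rot z = z} {hyz : y ≠ z} {w : List (F ⊕ Fin 2)}
    (h : (g.mergeLegs y z hy hz hyz).IsLay w) (ly : lab' y = lab (.inr 1))
    (lz : lab' z = lab (.inr 1)) (l : ∀ a, a ≠ y → a ≠ z → lab' a = lab (.inl a)) :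
    (g.mergeLegs y z hy hz hyz).val lab w =
      g.val lab' (subst (fun _ => [y, z]) w) - g.val lab' (subst (fun _ => [z, y]) w) := by
  classical
  rw [val_merge h]
  have : (fun a => if a = y ∨ a = z then lab (.inr 1) else lab (.inl a)) = lab' := by
    funext a
    by_cases h1 : a = y
    · simp [h1, ly]
    · by_cases h2 : a = z
      · simp [h2, lz]
      · simp [h1, h2, l a h1 h2]
  rw [this]

theorem ext_fun {g g' : UGraph F} (h : ∀ a, g.inv a = g'.inv a) (h' : ∀ a, g.rot a = g'.rot a) :
    g = g' := by
  cases g; cases g'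
  obtain rfl := funext h
  obtain rfl := funext h'
  rfl

/-- Reversing the new vertex amounts to exchanging the two joined feet, hence the two terms of
(STU). -/
theorem mergeLegs_flip_new (g : UGraph F) {y z : F} (hy : g.rot y = y) (hz : g.rot z = z) (hyz : y ≠ z) :
    ((g.mergeLegs y z hy hz hyz).flip (.inr 0)) = (g.mergeLegs z y hz hy hyz.symm) := by
  refine ext_fun (fun _ => rfl) ?_
  have r0 : (g.mergeLegs y z hy hz hyz).rot (.inr 0) = .inl z := rfl
  have r1 : (g.mergeLegs y z hy hz hyz).rot (.inl z) = .inl y := by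
    simp [mergeLegs, mergeRot, hyz.symm]
  have r2 : (g.mergeLegs y z hy hz hyz).rot (.inl y) = .inr 0 := by
    simp [mergeLegs, mergeRot]
  have ho : ∀ a, (g.mergeLegs y z hy hz hyz).Orb (.inr 0) a ↔
    a = .inr 0 ∨ a = .inl z ∨ a = .inl y := fun a => by rw [Orb, r0, r1]
  intro a
  by_cases h : (g.mergeLegs y z hy hz hyz).Orb (.inr 0) a
  · rw [flip_rot_orb _ h]
    rcases (ho a).1 h with rfl | rfl | rfl
    · rw [r0, r1]; rfl
    · rw [r1, r2]; simp [mergeLegs, mergeRot]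
    · rw [r2, r0]; simp [mergeLegs, mergeRot, hyz]
  · rw [flip_rot_not _ h]
    rw [ho] at h
    rcases a with a | a
    · simp only [reduceCtorEq, Sum.inl.injEq, false_or, not_or] at h
      simp [mergeLegs, mergeRot, h.1, h.2]
    · fin_cases a
      · simp at h
      · rfl

theorem mergeLegs_flip_old (g : UGraph F) {y z : F} (hy : g.rot y = y) (hz : g.rot z = z) (hyz : y ≠ z)
    {v : F} (hv : g.rot v ≠ v) :
    ((g.mergeLegs y z hy hz hyz).flip (.inl v)) = ((g.flip v).mergeLegs y z
      (g.flip_rot_eq_iff.2 hy) (g.flip_rot_eq_iff.2 hz) hyz) := by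
  refine ext_fun (fun _ => rfl) ?_
  have hvy : ∀ a, g.Orb v a → a ≠ y ∧ a ≠ z := by
    have h1 : ∀ c, g.rot c = c → ∀ a, g.Orb v a → a ≠ c := by
      rintro c hc _ (rfl | rfl | rfl) rfl
      · exact hv hc
      · exact hv (g.rot_injective hc)
      · exact hv (g.rot_injective (g.rot_injective hc))
    exact fun a ha => ⟨h1 y hy a ha, h1 z hz a ha⟩
  have hr : ∀ a, g.Orb v a → (g.mergeLegs y z hy hz hyz).rot (.inl a) = .inl (g.rot a) :=
    fun a ha => by simp [mergeLegs, mergeRot, hvy a ha]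
  have ho : ∀ a, (g.mergeLegs y z hy hz hyz).Orb (.inl v) (.inl a) ↔ g.Orb v a := fun a => by
    rw [Orb, hr v (g.orb_self v), hr _ (g.orb_rot.2 (g.orb_self v))]
    simp [Orb]
  have ho' : ∀ a, ¬ (g.mergeLegs y z hy hz hyz).Orb (.inl v) (.inr a) := fun a => by
    rw [Orb, hr v (g.orb_self v), hr _ (g.orb_rot.2 (g.orb_self v))]
    simp
  rintro (a | a)
  · by_cases h : g.Orb v a
    · rw [flip_rot_orb _ ((ho a).2 h), hr a h, hr _ (g.orb_rot.2 h)]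
      simp [mergeLegs, mergeRot, hvy a h, flip_rot_orb _ h]
    · rw [flip_rot_not _ fun h' => h ((ho a).1 h')]
      simp only [mergeLegs, mergeRot, Sum.elim_inl, flip_rot_not _ h]
  · rw [flip_rot_not _ (ho' a)]
    fin_cases a <;> rfl

theorem orb_congr (g : UGraph F) {v x : F} (h : g.Orb v x) : g.flip v = g.flip x := by
  rcases h with rfl | rfl | rfl
  · rfl
  · rw [flip_rot_eq]
  · rw [flip_rot_eq, flip_rot_eq]

theorem card_lt_of_merge {F₀ : Type} {g₀ : UGraph F₀} {g : UGraph F} (e : F₀ ⊕ Fin 2 ≃ F) :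
    Nat.card F₀ < Nat.card F := by
  have := g₀.finite
  have := g.finite
  rw [← Nat.card_congr e, Nat.card_sum]
  simp

/-- Antisymmetry. -/
theorem val_flip (g : UGraph F) {v : F} (hv : g.rot v ≠ v) (lab : F → Fin n) {w : List F}
    (h : g.IsLay w) : (g.flip v).val lab w = - g.val lab w := by
  induction hk : Nat.card F using Nat.strong_induction_on generalizing F with
  | _ k ih =>
  -- If the vertex of `v` has a leg, cut it there: (STU) gives T − U, and U − T after the reversal.
  by_cases hc : ∃ x, g.Orb v x ∧ g.rot (g.inv x) = g.inv x
  · obtain ⟨x, hx, hf⟩ := hc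
    have hxt : g.rot x ≠ x := by
      rcases hx with rfl | rfl | rfl
      · exact hv
      · exact g.rot_rot_ne_rot hv
      · exact fun e => hv (g.rot_injective (g.rot_injective e))
    rw [g.orb_congr hx]
    obtain ⟨F₀, g₀, y, z, hy, hz, hyz, φ, e0, -⟩ :=
      g.exists_unmerge hf (by rwa [g.inv_inv])
    rw [g.inv_inv] at e0
    have h1 := isLay_map_symm φ h
    rw [val_iso_symm φ h, ← e0, val_iso_symm (φ.flip (.inr 0)) (isLay_flip.2 h)]
    change ((g₀.mergeLegs y z hy hz hyz).flip (.inr 0)).val (lab ∘ φ.e) (w.map φ.e.symm) = _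
    have h2 := isLay_flip (v := .inr 0).2 h1
    rw [g₀.mergeLegs_flip_new] at h2 ⊢
    classical
    rw [val_merge h1, neg_sub]
    exact val_merge' _ h2 (by simp) (by simp) (fun a ha ha' => by simp [ha, ha'])
  -- Otherwise cut another vertex next to a foot. The vertex of `v` survives in both terms of (STU),
  -- which have fewer half-edges.
  · obtain ⟨c, hct, hf⟩ := g.exists_tri_near_leg hv
    obtain ⟨F₀, g₀, y, z, hy, hz, hyz, φ, e0, e1, e2, e3⟩ :=
      g.exists_unmerge hf (by rwa [g.inv_inv])
    rw [g.inv_inv] at e0 e2 e3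
    obtain ⟨t, rfl⟩ := φ.e.surjective v
    have hco : ¬ g.Orb c (φ.e t) := by
      intro h
      refine hc ⟨c, ?_, hf⟩
      rcases h with h | h | h
      · rw [h]; exact g.orb_self _
      · rw [h]; exact Or.inr (Or.inr (g.rot_rot_rot c).symm)
      · rw [h]; exact Or.inr (Or.inl (g.rot_rot_rot c).symm)
    rcases t with t | t
    swap
    · exfalso
      fin_cases t
      · exact hco (Or.inl e0)
      · exact hv ((φ.rot_eq_iff (.inr 1)).2 rfl)
    have hty : t ≠ y := fun e => hco (Or.inr (Or.inr (by rw [e, e3])))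
    have htz : t ≠ z := fun e => hco (Or.inr (Or.inl (by rw [e, e2])))
    have ht : g₀.rot t ≠ t := by
      intro e
      rw [ne_eq, φ.rot_eq_iff] at hv
      exact hv (by simp [mergeLegs, mergeRot, hty, htz, e])
    have h1 := isLay_map_symm φ h
    rw [val_iso_symm φ h, val_iso_symm (φ.flip (.inl t)) (isLay_flip.2 h)]
    change ((g₀.mergeLegs y z hy hz hyz).flip (.inl t)).val (lab ∘ φ.e) (w.map φ.e.symm) = _
    have h2 := isLay_flip (v := .inl t).2 h1
    rw [g₀.mergeLegs_flip_old hy hz hyz ht] at h2 ⊢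
    obtain ⟨h3, h4⟩ := isLay_subst_merge h1
    have hlt : Nat.card F₀ < k := hk ▸ card_lt_of_merge (g₀ := g₀) (g := g) φ.e
    rw [val_merge h1, val_merge h2, ih _ hlt g₀ ht _ h3 rfl, ih _ hlt g₀ ht _ h4 rfl]
    rw [neg_sub, neg_sub_neg]

end UGraph
end TriDiag

/-! ### A leg next to a foot, as the join of this foot with an end of a free chord -/

namespace TriDiag
variable {n : ℕ} {F F' G H : Type}
namespace UGraph

theorem insertInv_self (g : UGraph F) (a : F) : g.insertInv a (.inl a) = .inr 0 := by
  simp [insertInv]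

theorem insertInv_inv (g : UGraph F) (a : F) : g.insertInv a (.inl (g.inv a)) = .inr 1 := by
  simp [insertInv, g.inv_ne]

theorem insertInv_of_ne (g : UGraph F) {a c : F} (h : c ≠ a) (h' : c ≠ g.inv a) :
    g.insertInv a (.inl c) = .inl (g.inv c) := by
  simp [insertInv, h, h']

/-- A single edge without trivalent vertices. -/
def chord : UGraph (Fin 2) where
  finite := inferInstance
  inv := ![1, 0]
  rot := id
  inv_inv := by decide
  inv_ne := by decide
  rot_rot_rot _ := rfl
  exists_leg a := ⟨a, .refl, rfl⟩

open scoped Classical in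
/-- Insertion of a leg next to a foot, as the result of a merge. -/
def insertFoot (g : UGraph F) {f : F} (hf : g.rot f = f) :
    (g.insertLeg f).Equiv ((g.sum chord).mergeLegs (.inr 0) (.inl f) rfl
      (by simp [UGraph.sum, hf]) (by simp)) where
  e :=
    { toFun := Sum.elim (fun a => if a = f then .inr 1 else .inl (.inl a))
        ![.inr 0, .inl (.inl f), .inl (.inr 0), .inl (.inr 1)]
      invFun := Sum.elim (Sum.elim (fun a => if a = f then .inr 1 else .inl a) ![.inr 2, .inr 3])
        ![.inr 0, .inl f]
      left_inv := by
        rintro (a | a)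
        · by_cases h : a = f <;> simp [h]
        · fin_cases a <;> simp
      right_inv := by
        rintro ((a | a) | a)
        · by_cases h : a = f <;> simp [h]
        · fin_cases a <;> simp
        · fin_cases a <;> simp }
  inv := by
    rintro (a | a)
    · by_cases h : a = f
      · subst h; simp [insertLeg, insertInv, mergeLegs]
      · by_cases h' : a = g.inv f
        · subst h'; simp [insertLeg, insertInv, mergeLegs, g.inv_ne, UGraph.sum, g.inv_inv]
        · have : g.inv a ≠ f := fun e => h' (by rw [← e, g.inv_inv])
          simp [insertLeg, insertInv, mergeLegs, h, h', UGraph.sum, this]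
    · fin_cases a <;> simp [insertLeg, insertInv, mergeLegs, g.inv_ne, UGraph.sum, chord]
  rot := by
    rintro (a | a)
    · by_cases h : a = f
      · subst h; simp [insertLeg, insertRot, mergeLegs, mergeRot, hf]
      · have : g.rot a ≠ f := fun e => h (g.rot_injective (e.trans hf.symm))
        simp [insertLeg, insertRot, mergeLegs, mergeRot, h, UGraph.sum, this]
    · fin_cases a <;> simp [insertLeg, insertRot, mergeLegs, mergeRot, UGraph.sum, chord]

open scoped Classical in
/-- As `insertFoot`, travelling in the opposite direction. -/
def insertFootInv (g : UGraph F) {f : F} (hf : g.rot f = f) :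
    (g.insertLeg (g.inv f)).Equiv ((g.sum chord).mergeLegs (.inl f) (.inr 0)
      (by simp [UGraph.sum, hf]) rfl (by simp)) where
  e :=
    { toFun := Sum.elim (fun a => if a = f then .inr 1 else .inl (.inl a))
        ![.inl (.inl f), .inr 0, .inl (.inr 0), .inl (.inr 1)]
      invFun := Sum.elim (Sum.elim (fun a => if a = f then .inr 0 else .inl a) ![.inr 2, .inr 3])
        ![.inr 1, .inl f]
      left_inv := by
        rintro (a | a)
        · by_cases h : a = f <;> simp [h]
        · fin_cases a <;> simp
      right_inv := by
        rintro ((a | a) | a)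
        · by_cases h : a = f <;> simp [h]
        · fin_cases a <;> simp
        · fin_cases a <;> simp }
  inv := by
    rintro (a | a)
    · by_cases h : a = f
      · subst h; simp [insertLeg, insertInv, mergeLegs, g.inv_inv, (g.inv_ne a).symm]
      · by_cases h' : a = g.inv f
        · subst h'; simp [insertLeg, insertInv, mergeLegs, g.inv_ne, UGraph.sum, g.inv_inv]
        · have : g.inv a ≠ f := fun e => h' (by rw [← e, g.inv_inv])
          simp [insertLeg, insertInv, mergeLegs, h, h', UGraph.sum, this, g.inv_inv]
    · fin_cases a <;> simp [insertLeg, insertInv, mergeLegs, g.inv_ne, UGraph.sum, chord, g.inv_inv]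
  rot := by
    rintro (a | a)
    · by_cases h : a = f
      · subst h; simp [insertLeg, insertRot, mergeLegs, mergeRot, hf]
      · have : g.rot a ≠ f := fun e => h (g.rot_injective (e.trans hf.symm))
        simp [insertLeg, insertRot, mergeLegs, mergeRot, h, UGraph.sum, this]
    · fin_cases a <;> simp [insertLeg, insertRot, mergeLegs, mergeRot, UGraph.sum, chord]

/-- Insertion of a leg commutes with merging. -/
def mergeInsert (g : UGraph F) {y z : F} (hy : g.rot y = y) (hz : g.rot z = z) (hyz : y ≠ z)
    (c : F) :
    ((g.mergeLegs y z hy hz hyz).insertLeg (.inl c)).Equiv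
      ((g.insertLeg c).mergeLegs (.inl y) (.inl z) (by simp [insertLeg, insertRot, hy])
        (by simp [insertLeg, insertRot, hz]) (by simpa using hyz)) where
  e := TDiag.sumRight F (Fin 2) (Fin 4)
  inv := by
    rintro ((a | a) | a)
    · by_cases h : a = c
      · subst h; simp [insertLeg, insertInv, mergeLegs, TDiag.sumRight]
      · by_cases h' : a = g.inv c
        · subst h'; simp [insertLeg, insertInv, mergeLegs, TDiag.sumRight, g.inv_ne]
        · simp [insertLeg, insertInv, mergeLegs, TDiag.sumRight, h, h']
    · fin_cases a <;> simp [insertLeg, insertInv, mergeLegs, TDiag.sumRight]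
    · fin_cases a <;> simp [insertLeg, insertInv, mergeLegs, TDiag.sumRight]
  rot := by
    rintro ((a | a) | a)
    · by_cases h : a = y
      · subst h; simp [insertLeg, insertRot, mergeLegs, mergeRot, TDiag.sumRight]
      · by_cases h' : a = z
        · subst h'; simp [insertLeg, insertRot, mergeLegs, mergeRot, TDiag.sumRight, h]
        · simp [insertLeg, insertRot, mergeLegs, mergeRot, TDiag.sumRight, h, h']
    · fin_cases a <;> simp [insertLeg, insertRot, mergeLegs, mergeRot, TDiag.sumRight]
    · fin_cases a <;> simp [insertLeg, insertRot, mergeLegs, mergeRot, TDiag.sumRight]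

/-- Merging commutes with disjoint unions. -/
def mergeSum (g : UGraph F) {y z : F} (hy : g.rot y = y) (hz : g.rot z = z) (hyz : y ≠ z)
    (g' : UGraph G) :
    ((g.mergeLegs y z hy hz hyz).sum g').Equiv
      ((g.sum g').mergeLegs (.inl y) (.inl z) (by simp [UGraph.sum, hy])
        (by simp [UGraph.sum, hz]) (by simpa using hyz)) where
  e := TDiag.sumRight F (Fin 2) G
  inv := by rintro ((a | a) | a) <;> simp [UGraph.sum, mergeLegs, TDiag.sumRight]
  rot := by
    rintro ((a | a) | a)
    · by_cases h : a = y
      · subst h; simp [UGraph.sum, mergeLegs, mergeRot, TDiag.sumRight]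
      · by_cases h' : a = z
        · subst h'; simp [UGraph.sum, mergeLegs, mergeRot, TDiag.sumRight, h]
        · simp [UGraph.sum, mergeLegs, mergeRot, TDiag.sumRight, h, h']
    · fin_cases a <;> simp [UGraph.sum, mergeLegs, mergeRot, TDiag.sumRight]
    · simp [UGraph.sum, mergeLegs, mergeRot, TDiag.sumRight]

end UGraph
end TriDiag

/-! ### The three ways to attach a leg next to a vertex -/

namespace TriDiag
variable {n : ℕ} {F F' G H : Type}
namespace UGraph

theorem flatMap_congr_mem {α β : Type} {w : List α} {s t : α → List β} (h : ∀ a ∈ w, s a = t a) :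
    w.flatMap s = w.flatMap t := by
  induction w with
  | nil => rfl
  | cons a w ih =>
    rw [List.flatMap_cons, List.flatMap_cons, h a (by simp), ih fun b hb => h b (by simp [hb])]

theorem subst_map_eq {A : Type} {α : Type} (s : A → List F) (e : α → F ⊕ A) (w : List α) :
    subst s (w.map e) = w.flatMap fun a => Sum.elim (fun a => [a]) s (e a) := by
  rw [subst, List.flatMap_map]

theorem subst_map_flatMap {A : Type} {α β : Type} (s : A → List F) (e : α → F ⊕ A) (w : List α)
    (t : F → List β) :
    (subst s (w.map e)).flatMap t =
      w.flatMap fun a => (Sum.elim (fun a => [a]) s (e a)).flatMap t := by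
  rw [subst_map_eq, List.flatMap_assoc]

theorem inr_mem_insert {g : UGraph F} {a : F} {w : List (F ⊕ Fin 4)} (h : (g.insertLeg a).IsLay w)
    {k : Fin 4} (hk : .inr k ∈ w) : k = 3 := by
  have := (h.2 _).1 hk
  revert this
  fin_cases k <;> simp [insertLeg, insertRot]

open scoped Classical in
/-- The substitution that describes the insertion of a leg next to the foot `f`. -/
def footSub (f : F) (u : List (F ⊕ Fin 2)) : F ⊕ Fin 4 → List (F ⊕ Fin 2) :=
  Sum.elim (fun a => if a = f then u else [.inl a]) fun _ => [.inr 1]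

/-- (STU) at the inserted vertex: the other end of the inserted leg becomes an end of a free chord,
placed on either side of `f`. -/
theorem val_insertFoot {g : UGraph F} {f : F} (hf : g.rot f = f) {lab : F ⊕ Fin 4 → Fin n}
    {w : List (F ⊕ Fin 4)} (h : (g.insertLeg f).IsLay w) (lab' : F ⊕ Fin 2 → Fin n)
    (l0 : lab' (.inr 0) = lab (.inl f)) (l1 : lab' (.inr 1) = lab (.inr 3))
    (l : ∀ a, lab' (.inl a) = lab (.inl a)) :
    (g.insertLeg f).val lab w =
      (g.sum chord).val lab' (w.flatMap (footSub f [.inr 0, .inl f])) -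
      (g.sum chord).val lab' (w.flatMap (footSub f [.inl f, .inr 0])) := by
  rw [val_iso' (g.insertFoot hf) h, val_merge' lab' ((g.insertFoot hf).isLay h)]
  · rw [subst_map_eq, subst_map_eq]
    congr 2 <;>
    · refine flatMap_congr_mem ?_
      rintro (a | a) ha
      · by_cases haf : a = f <;> simp [insertFoot, footSub, haf]
      · obtain rfl := inr_mem_insert h ha
        simp [insertFoot, footSub]
  · simpa [insertFoot] using l0
  · simpa [insertFoot] using l f
  · rintro (a | a) h1 h2
    · have : a ≠ f := by rintro rfl; exact h2 rfl
      simpa [insertFoot, this] using l a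
    · fin_cases a
      · exact absurd rfl h1
      · simpa [insertFoot] using l1

theorem val_insertFootInv {g : UGraph F} {f : F} (hf : g.rot f = f) {lab : F ⊕ Fin 4 → Fin n}
    {w : List (F ⊕ Fin 4)} (h : (g.insertLeg (g.inv f)).IsLay w) (lab' : F ⊕ Fin 2 → Fin n)
    (l0 : lab' (.inr 0) = lab (.inl f)) (l1 : lab' (.inr 1) = lab (.inr 3))
    (l : ∀ a, lab' (.inl a) = lab (.inl a)) :
    (g.insertLeg (g.inv f)).val lab w =
      (g.sum chord).val lab' (w.flatMap (footSub f [.inl f, .inr 0])) -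
      (g.sum chord).val lab' (w.flatMap (footSub f [.inr 0, .inl f])) := by
  rw [val_iso' (g.insertFootInv hf) h, val_merge' lab' ((g.insertFootInv hf).isLay h)]
  · rw [subst_map_eq, subst_map_eq]
    congr 2 <;>
    · refine flatMap_congr_mem ?_
      rintro (a | a) ha
      · by_cases haf : a = f <;> simp [insertFootInv, footSub, haf]
      · obtain rfl := inr_mem_insert h ha
        simp [insertFootInv, footSub]
  · simpa [insertFootInv] using l f
  · simpa [insertFootInv] using l0
  · rintro (a | a) h1 h2
    · have : a ≠ f := by rintro rfl; exact h1 rfl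
      simpa [insertFootInv, this] using l a
    · fin_cases a
      · exact absurd rfl h2
      · simpa [insertFootInv] using l1

open scoped Classical in
theorem val_merge_insert {g : UGraph F} {y z : F} {hy : g.rot y = y} {hz : g.rot z = z}
    {hyz : y ≠ z} {c : F} {lab : (F ⊕ Fin 2) ⊕ Fin 4 → Fin n} {w : List ((F ⊕ Fin 2) ⊕ Fin 4)}
    (h : ((g.mergeLegs y z hy hz hyz).insertLeg (.inl c)).IsLay w) :
    ((g.mergeLegs y z hy hz hyz).insertLeg (.inl c)).val lab w =
      (g.insertLeg c).val (Sum.elim (fun a => if a = y ∨ a = z then lab (.inl (.inr 1)) else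
          lab (.inl (.inl a))) fun k => lab (.inr k))
        (subst (fun _ => [.inl y, .inl z]) (w.map (TDiag.sumRight F (Fin 2) (Fin 4)))) -
      (g.insertLeg c).val (Sum.elim (fun a => if a = y ∨ a = z then lab (.inl (.inr 1)) else
          lab (.inl (.inl a))) fun k => lab (.inr k))
        (subst (fun _ => [.inl z, .inl y]) (w.map (TDiag.sumRight F (Fin 2) (Fin 4)))) := by
  rw [val_iso' (g.mergeInsert hy hz hyz c) h, val_merge'
    (lab' := Sum.elim (fun a => if a = y ∨ a = z then lab (.inl (.inr 1)) else
          lab (.inl (.inl a))) fun k => lab (.inr k)) ((g.mergeInsert hy hz hyz c).isLay h)]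
  · rfl
  · simp [mergeInsert, TDiag.sumRight]
  · simp [mergeInsert, TDiag.sumRight]
  · rintro (a | a) h1 h2
    · have h1' : a ≠ y := by rintro rfl; exact h1 rfl
      have h2' : a ≠ z := by rintro rfl; exact h2 rfl
      simp [mergeInsert, TDiag.sumRight, h1', h2']
    · simp [mergeInsert, TDiag.sumRight]

theorem isLay_merge_insert {g : UGraph F} {y z : F} {hy : g.rot y = y} {hz : g.rot z = z}
    {hyz : y ≠ z} {c : F} {w : List ((F ⊕ Fin 2) ⊕ Fin 4)}
    (h : ((g.mergeLegs y z hy hz hyz).insertLeg (.inl c)).IsLay w) :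
    (g.insertLeg c).IsLay
        (subst (fun _ => [.inl y, .inl z]) (w.map (TDiag.sumRight F (Fin 2) (Fin 4)))) ∧
      (g.insertLeg c).IsLay
        (subst (fun _ => [.inl z, .inl y]) (w.map (TDiag.sumRight F (Fin 2) (Fin 4)))) :=
  isLay_subst_merge ((g.mergeInsert hy hz hyz c).isLay h)

/-- The feet of a diagram with a vertex next to the foot `inl (inr 1)`, which is replaced by a word
in the feet of the diagram without this vertex and with an additional chord. -/
def wordSub (u : List (F ⊕ Fin 2)) : (F ⊕ Fin 2) ⊕ Fin 4 → List (F ⊕ Fin 2) :=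
  Sum.elim (Sum.elim (fun a => [.inl a]) fun _ => u) fun _ => [.inr 1]

/-- The sum over the three ways to attach a leg to an edge at a vertex vanishes; the case of a
vertex next to a foot. -/
theorem val_slide_new {g : UGraph F} {y z : F} {hy : g.rot y = y} {hz : g.rot z = z} {hyz : y ≠ z}
    {lab : (F ⊕ Fin 2) ⊕ Fin 4 → Fin n} {w : List ((F ⊕ Fin 2) ⊕ Fin 4)}
    (h : ((g.mergeLegs y z hy hz hyz).insertLeg (.inr 0)).IsLay w) :
    ((g.mergeLegs y z hy hz hyz).insertLeg (.inr 0)).val lab w +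
      ((g.mergeLegs y z hy hz hyz).insertLeg (.inl z)).val lab w +
      ((g.mergeLegs y z hy hz hyz).insertLeg (.inl y)).val lab w = 0 := by
  classical
  set lab' : F ⊕ Fin 2 → Fin n := Sum.elim (fun a => if a = y ∨ a = z then lab (.inl (.inr 1)) else
    lab (.inl (.inl a))) ![lab (.inl (.inr 1)), lab (.inr 3)] with hlab'
  -- `B u` is the value after both vertices have been cut, with the word `u` in the ends `y`, `z`
  -- and the chord end `inr 0` in place of the foot of the vertex. Each of the three insertions is a
  -- signed sum of four such terms, and the twelve terms cancel, as in the derivation property of a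
  -- commutator.
  set B : List (F ⊕ Fin 2) → C n := fun u => (g.sum chord).val lab' (w.flatMap (wordSub u)) with hB
  have hwin : ∀ a, .inl (.inl a) ∈ w → a ≠ y ∧ a ≠ z := by
    intro a ha
    have := (h.2 _).1 ha
    constructor
    · rintro rfl; simp [insertLeg, insertRot, mergeLegs, mergeRot] at this
    · rintro rfl; simp [insertLeg, insertRot, mergeLegs, mergeRot, hyz.symm] at this; exact hyz this
  have hwin' : ∀ k, .inl (.inr k) ∈ w → k = 1 := by
    intro k ha
    have := (h.2 _).1 ha
    revert this
    fin_cases k <;> simp [insertLeg, insertRot, mergeLegs, mergeRot]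
  have key : ∀ c : F, c = y ∨ c = z → ∀ u v : List (F ⊕ Fin 4),
      ∀ u' v' : List (F ⊕ Fin 2), u' = u.flatMap (footSub c v') →
      ((subst (fun _ : Fin 2 => u) (w.map (TDiag.sumRight F (Fin 2) (Fin 4)))).flatMap
        (footSub c v')) = w.flatMap (wordSub u') := by
    intro c hc u v u' v' huv
    rw [subst_map_flatMap]
    refine flatMap_congr_mem ?_
    rintro ((a | a) | a) ha
    · have hac : a ≠ c := by
        rcases hc with rfl | rfl
        exacts [(hwin a ha).1, (hwin a ha).2]
      simp [TDiag.sumRight, footSub, wordSub, hac]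
    · simp [TDiag.sumRight, wordSub, huv]
    · simp [TDiag.sumRight, footSub, wordSub]
  have hz' : ((g.mergeLegs y z hy hz hyz).insertLeg (.inl z)).val lab w =
      (B [.inl y, .inr 0, .inl z] - B [.inl y, .inl z, .inr 0]) -
      (B [.inr 0, .inl z, .inl y] - B [.inl z, .inr 0, .inl y]) := by
    obtain ⟨h1, h2⟩ := isLay_merge_insert (c := z) ((isLay_insert_iff _ _).1 h)
    rw [val_merge_insert ((isLay_insert_iff _ _).1 h),
      val_insertFoot hz h1 lab' (by simp [hlab']) (by simp [hlab']) (by simp [hlab']),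
      val_insertFoot hz h2 lab' (by simp [hlab']) (by simp [hlab']) (by simp [hlab'])]
    simp only [hB]
    rw [key z (Or.inr rfl) _ [] _ _ rfl, key z (Or.inr rfl) _ [] _ _ rfl,
      key z (Or.inr rfl) _ [] _ _ rfl, key z (Or.inr rfl) _ [] _ _ rfl]
    simp [footSub, hyz]
  have hy' : ((g.mergeLegs y z hy hz hyz).insertLeg (.inl y)).val lab w =
      (B [.inr 0, .inl y, .inl z] - B [.inl y, .inr 0, .inl z]) -
      (B [.inl z, .inr 0, .inl y] - B [.inl z, .inl y, .inr 0]) := by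
    obtain ⟨h1, h2⟩ := isLay_merge_insert (c := y) ((isLay_insert_iff _ _).1 h)
    rw [val_merge_insert ((isLay_insert_iff _ _).1 h),
      val_insertFoot hy h1 lab' (by simp [hlab']) (by simp [hlab']) (by simp [hlab']),
      val_insertFoot hy h2 lab' (by simp [hlab']) (by simp [hlab']) (by simp [hlab'])]
    simp only [hB]
    rw [key y (Or.inl rfl) _ [] _ _ rfl, key y (Or.inl rfl) _ [] _ _ rfl,
      key y (Or.inl rfl) _ [] _ _ rfl, key y (Or.inl rfl) _ [] _ _ rfl]
    simp [footSub, hyz.symm]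
  have hx' : ((g.mergeLegs y z hy hz hyz).insertLeg (.inr 0)).val lab w =
      (B [.inl y, .inl z, .inr 0] - B [.inl z, .inl y, .inr 0]) -
      (B [.inr 0, .inl y, .inl z] - B [.inr 0, .inl z, .inl y]) := by
    -- The edge of `inr 0` is the leg with foot `inr 1`. So the inserted vertex is cut first, next
    -- to this foot, and the old vertex second.
    have hr : (g.mergeLegs y z hy hz hyz).rot (.inr 1) = .inr 1 := by simp [mergeLegs, mergeRot]
    set lab₁ : (F ⊕ Fin 2) ⊕ Fin 2 → Fin n :=
      Sum.elim (fun a => lab (.inl a)) ![lab (.inl (.inr 1)), lab (.inr 3)] with hlab₁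
    have e1 := val_insertFootInv hr (lab := lab) (w := w) h lab₁ (by simp [hlab₁]) (by simp [hlab₁])
      (by simp [hlab₁])
    have hl := isLay_subst_merge (((g.mergeLegs y z hy hz hyz).insertFootInv hr).isLay h)
    have e2 : ∀ u v, (u = [.inl (.inr 1), .inr 0] ∨ u = [.inr 0, .inl (.inr 1)]) → 
        (v = fun x : List (F ⊕ Fin 2) => u.flatMap (Sum.elim (Sum.elim (fun a => [.inl a]) fun _ => x)
          fun k => [.inr k])) →
        ((g.mergeLegs y z hy hz hyz).sum chord).val lab₁ (w.flatMap (footSub (.inr 1) u)) =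
        B (v [.inl y, .inl z]) - B (v [.inl z, .inl y]) := by
      rintro u v hu rfl
      have hlay : ((g.mergeLegs y z hy hz hyz).sum chord).IsLay
          (w.flatMap (footSub (.inr 1) u)) := by
        rw [subst_map_eq, subst_map_eq] at hl
        rcases hu with rfl | rfl
        · convert hl.1 using 1
          refine flatMap_congr_mem ?_
          rintro (a | a) ha
          · by_cases haf : a = .inr 1 <;> simp [insertFootInv, footSub, haf]
          · obtain rfl := inr_mem_insert h ha
            simp [insertFootInv, footSub]
        · convert hl.2 using 1
          refine flatMap_congr_mem ?_
          rintro (a | a) ha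
          · by_cases haf : a = .inr 1 <;> simp [insertFootInv, footSub, haf]
          · obtain rfl := inr_mem_insert h ha
            simp [insertFootInv, footSub]
      rw [val_iso' (g.mergeSum hy hz hyz chord) hlay,
        val_merge' lab' ((g.mergeSum hy hz hyz chord).isLay hlay)]
      · simp only [hB]
        rw [subst_map_eq, subst_map_eq, List.flatMap_assoc, List.flatMap_assoc]
        congr 2 <;>
        · refine flatMap_congr_mem ?_
          rintro ((a | a) | a) ha
          · simp [footSub, wordSub, mergeSum, TDiag.sumRight]
          · obtain rfl := hwin' a ha
            rcases hu with rfl | rfl <;> simp [footSub, wordSub, mergeSum, TDiag.sumRight]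
          · simp [footSub, wordSub, mergeSum, TDiag.sumRight]
      · simp [hlab', hlab₁, mergeSum, TDiag.sumRight]
      · simp [hlab', hlab₁, mergeSum, TDiag.sumRight]
      · rintro (a | a) h1 h2
        · have h1' : a ≠ y := by rintro rfl; exact h1 rfl
          have h2' : a ≠ z := by rintro rfl; exact h2 rfl
          simp [hlab', hlab₁, mergeSum, TDiag.sumRight, h1', h2']
        · simp [hlab', hlab₁, mergeSum, TDiag.sumRight]
    refine e1.trans ?_
    rw [e2 _ _ (Or.inl rfl) rfl, e2 _ _ (Or.inr rfl) rfl]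
    simp
  rw [hx', hy', hz']
  abel

/-- Insertion of a leg is compatible with isomorphisms. -/
def Equiv.insertLeg {g : UGraph F} {g' : UGraph G} (φ : g.Equiv g') (a : F) :
    (g.insertLeg a).Equiv (g'.insertLeg (φ.e a)) where
  e := _root_.Equiv.sumCongr φ.e (_root_.Equiv.refl _)
  inv := by
    rintro (c | c)
    · by_cases h0 : c = a
      · subst h0; simp [UGraph.insertLeg, UGraph.insertInv]
      · by_cases h1 : c = g.inv a
        · subst h1
          simp [UGraph.insertLeg, UGraph.insertInv, ← φ.inv, g.inv_ne]
        · simp [UGraph.insertLeg, UGraph.insertInv, ← φ.inv, h0, h1]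
    · fin_cases c <;> simp [UGraph.insertLeg, UGraph.insertInv, φ.inv]
  rot := by
    rintro (c | c)
    · simp [UGraph.insertLeg, UGraph.insertRot, φ.rot]
    · simp [UGraph.insertLeg, UGraph.insertRot]

/-- The sum over the three ways to attach a leg to an edge at a vertex vanishes. -/
theorem val_slide (g : UGraph F) {v : F} (hv : g.rot v ≠ v) (lab : F ⊕ Fin 4 → Fin n)
    {w : List (F ⊕ Fin 4)} (h : (g.insertLeg v).IsLay w) :
    (g.insertLeg v).val lab w + (g.insertLeg (g.rot v)).val lab w +
      (g.insertLeg (g.rot (g.rot v))).val lab w = 0 := by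
  induction hk : Nat.card F using Nat.strong_induction_on generalizing F with
  | _ k ih =>
  -- The induction of `val_flip`: either the vertex of `v` itself has a leg, or another vertex is
  -- cut, which commutes with the three insertions.
  by_cases hc : ∃ x, g.Orb v x ∧ g.rot (g.inv x) = g.inv x
  · obtain ⟨x, hx, hf⟩ := hc
    have hxt : g.rot x ≠ x := by
      rcases hx with rfl | rfl | rfl
      · exact hv
      · exact g.rot_rot_ne_rot hv
      · exact fun e => hv (g.rot_injective (g.rot_injective e))
    obtain ⟨F₀, g₀, y, z, hy, hz, hyz, φ, e0, e1, e2, e3⟩ :=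
      g.exists_unmerge hf (by rwa [g.inv_inv])
    rw [g.inv_inv] at e0 e2 e3
    have key := val_slide_new (lab := lab ∘ (φ.insertLeg (.inr 0)).e)
      (isLay_map_symm (φ.insertLeg (.inr 0)) ((isLay_insert_iff _ _).1 h))
    rw [← val_iso_symm (φ.insertLeg (.inr 0)) ((isLay_insert_iff _ _).1 h)] at key
    have k1 := val_iso_symm (φ.insertLeg (.inl z)) (lab := lab) ((isLay_insert_iff _ _).1 h)
    have k2 := val_iso_symm (φ.insertLeg (.inl y)) (lab := lab) ((isLay_insert_iff _ _).1 h)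
    change _ + UGraph.val _ (lab ∘ (φ.insertLeg (.inl z)).e) (w.map (φ.insertLeg (.inl z)).e.symm) +
      UGraph.val _ (lab ∘ (φ.insertLeg (.inl y)).e) (w.map (φ.insertLeg (.inl y)).e.symm) = 0 at key
    rw [← k1, ← k2, e0, e2, e3] at key
    rcases hx with rfl | rfl | rfl
    · exact key
    · rw [g.rot_rot_rot] at key
      rw [← key]; abel
    · rw [g.rot_rot_rot] at key
      rw [← key]; abel
  · obtain ⟨c, hct, hf⟩ := g.exists_tri_near_leg hv
    obtain ⟨F₀, g₀, y, z, hy, hz, hyz, φ, e0, e1, e2, e3⟩ :=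
      g.exists_unmerge hf (by rwa [g.inv_inv])
    rw [g.inv_inv] at e0 e2 e3
    obtain ⟨t, rfl⟩ := φ.e.surjective v
    have hco : ¬ g.Orb c (φ.e t) := by
      intro h
      refine hc ⟨c, ?_, hf⟩
      rcases h with h | h | h
      · rw [h]; exact g.orb_self _
      · rw [h]; exact Or.inr (Or.inr (g.rot_rot_rot c).symm)
      · rw [h]; exact Or.inr (Or.inl (g.rot_rot_rot c).symm)
    rcases t with t | t
    swap
    · exfalso
      fin_cases t
      · exact hco (Or.inl e0)
      · exact hv ((φ.rot_eq_iff (.inr 1)).2 rfl)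
    have hty : t ≠ y := fun e => hco (Or.inr (Or.inr (by rw [e, e3])))
    have htz : t ≠ z := fun e => hco (Or.inr (Or.inl (by rw [e, e2])))
    have ht : g₀.rot t ≠ t := by
      intro e
      rw [ne_eq, φ.rot_eq_iff] at hv
      exact hv (by simp [mergeLegs, mergeRot, hty, htz, e])
    have hty' : g₀.rot t ≠ y := fun e => hty (g₀.rot_injective (e.trans hy.symm))
    have htz' : g₀.rot t ≠ z := fun e => htz (g₀.rot_injective (e.trans hz.symm))
    have r1 : g.rot (φ.e (.inl t)) = φ.e (.inl (g₀.rot t)) := by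
      rw [← φ.rot]; simp [mergeLegs, mergeRot, hty, htz]
    have r2 : g.rot (φ.e (.inl (g₀.rot t))) = φ.e (.inl (g₀.rot (g₀.rot t))) := by
      rw [← φ.rot]; simp [mergeLegs, mergeRot, hty', htz']
    rw [r1, r2]
    have hlt : Nat.card F₀ < k := hk ▸ card_lt_of_merge (g₀ := g₀) (g := g) φ.e
    rw [val_iso_symm (φ.insertLeg (.inl t)) h,
      val_iso_symm (φ.insertLeg (.inl (g₀.rot t))) ((isLay_insert_iff _ _).1 h),
      val_iso_symm (φ.insertLeg (.inl (g₀.rot (g₀.rot t)))) ((isLay_insert_iff _ _).1 h)]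
    have h1 := isLay_map_symm (φ.insertLeg (.inl t)) h
    change _ + UGraph.val _ (lab ∘ (φ.insertLeg (.inl t)).e) (w.map (φ.insertLeg (.inl t)).e.symm) +
      UGraph.val _ (lab ∘ (φ.insertLeg (.inl t)).e) (w.map (φ.insertLeg (.inl t)).e.symm) = 0
    rw [val_merge_insert h1, val_merge_insert ((isLay_insert_iff _ _).1 h1),
      val_merge_insert ((isLay_insert_iff _ _).1 h1)]
    obtain ⟨h2, h3⟩ := isLay_merge_insert h1
    have i1 := fun L => ih _ hlt g₀ ht L h2 rfl
    have i2 := fun L => ih _ hlt g₀ ht L h3 rfl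
    rw [sub_add_sub_comm, sub_add_sub_comm, i1, i2, sub_zero]

end UGraph
end TriDiag

/-! ### Consequences of (CL2): freedom of inserted legs and vanishing of internal vertices -/

namespace TriDiag
variable {n : ℕ} {F F' G H : Type}

theorem isUnit_d (i : Fin n) : IsUnit (d i) := by
  refine IsUnit.of_mul_eq_one (AddMonoidAlgebra.single (-Pi.single i 1) 1) ?_
  rw [d, AddMonoidAlgebra.single_mul_single, add_neg_cancel, one_mul]
  rfl

/-- The `dᵢ` are units of Λ(n), so relations obtained after attaching legs can be divided by the
resulting factors. -/
theorem d_smul_cancel {M : Type*} [AddCommGroup M] [Module (Lam n) M] (i : Fin n) {x y : M}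
    (h : d i • x = d i • y) : x = y := (isUnit_d i).smul_left_cancel.1 h

namespace UGraph

/-- Insertions on different edges commute. -/
def insertComm (g : UGraph F) {a b : F} (h : b ≠ a) (h' : b ≠ g.inv a) :
    ((g.insertLeg a).insertLeg (.inl b)).Equiv ((g.insertLeg b).insertLeg (.inl a)) where
  e := TDiag.sumRight F (Fin 4) (Fin 4)
  inv := by
    have h1 : a ≠ g.inv b := fun e => h' (by rw [e, g.inv_inv])
    have h2 : g.inv a ≠ g.inv b := fun e => h (g.inv_injective e).symm
    rintro ((c | c) | c)
    · by_cases c1 : c = a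
      · subst c1; simp [insertLeg, insertInv, TDiag.sumRight, h.symm, h1, h, h']
      · by_cases c2 : c = g.inv a
        · subst c2
          simp [insertLeg, insertInv, TDiag.sumRight, h.symm, h1, h'.symm, h2, h, g.inv_ne, h']
        · by_cases c3 : c = b
          · subst c3
            simp [insertLeg, insertInv, TDiag.sumRight, c1, c2, h.symm, h1]
          · by_cases c4 : c = g.inv b
            · subst c4
              simp [insertLeg, insertInv, TDiag.sumRight, c1, c2, g.inv_ne, h, h', h.symm, h1]
            · simp [insertLeg, insertInv, TDiag.sumRight, c1, c2, c3, c4, h, h', h.symm, h1]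
    · fin_cases c <;>
        simp [insertLeg, insertInv, TDiag.sumRight, h, h', h.symm, h'.symm, h1, h2]
    · fin_cases c <;>
        simp [insertLeg, insertInv, TDiag.sumRight, h, h', h.symm, h'.symm, h1, h2]
  rot := by
    rintro ((c | c) | c) <;> simp [insertLeg, insertRot, TDiag.sumRight]

/-- Two insertions on the same edge. -/
def insertTwice (g : UGraph F) (a : F) :
    ((g.insertLeg a).insertLeg (.inl a)).Equiv ((g.insertLeg a).insertLeg (.inr 1)) where
  e := TDiag.sumRight F (Fin 4) (Fin 4)
  inv := by
    rintro ((c | c) | c)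
    · by_cases c1 : c = a
      · subst c1; simp [insertLeg, insertInv, TDiag.sumRight, (g.inv_ne _).symm]
      · by_cases c2 : c = g.inv a
        · subst c2; simp [insertLeg, insertInv, TDiag.sumRight, g.inv_ne]
        · simp [insertLeg, insertInv, TDiag.sumRight, c1, c2]
    · fin_cases c <;> simp [insertLeg, insertInv, TDiag.sumRight, g.inv_ne]
    · fin_cases c <;> simp [insertLeg, insertInv, TDiag.sumRight, g.inv_ne]
  rot := by
    rintro ((c | c) | c) <;> simp [insertLeg, insertRot, TDiag.sumRight]

/-- Three insertions on the same edge. -/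
def insertThrice (g : UGraph F) (a : F) :
    (((g.insertLeg a).insertLeg (.inr 1)).insertLeg (.inr 1)).Equiv
      (((g.insertLeg a).insertLeg (.inl a)).insertLeg (.inr 1)) where
  e :=
    { toFun := Sum.elim (Sum.elim (Sum.elim (fun c => .inl (.inl (.inl c))) fun k => .inl (.inr k))
        fun k => .inr k) fun k => .inl (.inl (.inr k))
      invFun := Sum.elim (Sum.elim (Sum.elim (fun c => .inl (.inl (.inl c))) fun k => .inr k)
        fun k => .inl (.inl (.inr k))) fun k => .inl (.inr k)
      left_inv := by rintro (((c | c) | c) | c) <;> rfl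
      right_inv := by rintro (((c | c) | c) | c) <;> rfl }
  inv := by
    rintro (((c | c) | c) | c)
    · by_cases c1 : c = a
      · subst c1; simp [insertLeg, insertInv, (g.inv_ne _).symm]
      · by_cases c2 : c = g.inv a
        · subst c2; simp [insertLeg, insertInv, g.inv_ne]
        · simp [insertLeg, insertInv, c1, c2]
    · fin_cases c <;> simp [insertLeg, insertInv, g.inv_ne]
    · fin_cases c <;> simp [insertLeg, insertInv, g.inv_ne]
    · fin_cases c <;> simp [insertLeg, insertInv, g.inv_ne]
  rot := by
    rintro (((c | c) | c) | c) <;> simp [insertLeg, insertRot]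

theorem Internal.insert_inl {g : UGraph F} {a : F} (h : g.Internal a) (b : F) :
    (g.insertLeg b).Internal (.inl a) := by
  have h1 := h.1
  have h2 := h.2
  have h3 := h.3
  have h4 := h.4
  by_cases c1 : a = b
  · subst c1
    constructor <;> simp [insertLeg, insertInv, insertRot, h1]
  · by_cases c2 : a = g.inv b
    · subst c2
      constructor <;> simp [insertLeg, insertInv, insertRot, h1, g.inv_ne]
    · constructor <;> simp [insertLeg, insertInv, insertRot, c1, c2, h1, h2, h3, h4]

theorem Internal.insert_inr {g : UGraph F} {a : F} (h : g.Internal a) :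
    (g.insertLeg a).Internal (.inr 1) := by
  constructor <;> simp [insertLeg, insertInv, insertRot, h.rot_inv_ne]

theorem val_cl2_inl {g : UGraph F} {a : F} (ha : g.Internal a) {lab : (F ⊕ Fin 4) ⊕ Fin 4 → Fin n}
    {w : List ((F ⊕ Fin 4) ⊕ Fin 4)} (h : ((g.insertLeg a).insertLeg (.inl a)).IsLay w) :
    ((g.insertLeg a).insertLeg (.inl a)).val lab w =
      (d (lab (.inl (.inr 3))) * d (lab (.inr 3))) •
        g.val (fun c => lab (.inl (.inl c))) (subst (fun _ => []) (subst (fun _ => []) w)) := by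
  rw [val_iso' (g.insertTwice a) h, val_cl2 ha ((g.insertTwice a).isLay h), mul_comm]
  congr 2
  simp only [subst, List.flatMap_map, List.flatMap_assoc]
  refine flatMap_congr_mem ?_
  rintro ((c | c) | c) _ <;> rfl

/-- The value of a diagram with a leg on an internal edge does not depend on the place of the foot
of this leg, and is proportional to the indeterminate of its label. -/
theorem val_insert_head {g : UGraph F} {a : F} (ha : g.Internal a) {lab : F ⊕ Fin 4 → Fin n}
    {w : List (F ⊕ Fin 4)} (h : (g.insertLeg a).IsLay w) (i : Fin n) :
    d i • (g.insertLeg a).val lab w = d (lab (.inr 3)) • (g.insertLeg a).val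
      (Sum.elim (fun c => lab (.inl c)) fun _ => i) (.inr 3 :: (subst (fun _ => []) w).map .inl) := by
  -- Put two more legs with label `i` on the same edge. Of the three legs in a row, (CL2) removes
  -- either the two new ones, or the given one and its neighbour; comparing the results replaces the
  -- given leg by one with label `i` and its foot in front.
  have hW := isLay_insert_cons (g := (g.insertLeg a).insertLeg (.inr 1)) (.inr 1)
    (isLay_insert_cons (.inr 1) h)
  have e1 := val_cl2 (lab := Sum.elim (Sum.elim lab fun _ => i) fun _ => i) ha.insert_inr hW
  rw [val_iso' (g.insertThrice a) hW,
    val_cl2 (ha.insert_inl a) ((g.insertThrice a).isLay hW)] at e1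
  refine d_smul_cancel i ?_
  rw [smul_smul, smul_smul]
  have el : ∀ x : F ⊕ Fin 4, ((Sum.elim (Sum.elim lab fun _ => i) fun _ => i) ∘
      (g.insertThrice a).e.symm) (.inl (.inl x)) =
        Sum.elim (fun c => lab (.inl c)) (fun _ => i) x := by
    rintro (x | x) <;> simp [insertThrice]
  have ew : subst (fun _ : Fin 4 => ([] : List (F ⊕ Fin 4))) (subst (fun _ => []) (List.map
      (g.insertThrice a).e (.inr 3 :: List.map .inl (.inr 3 :: List.map .inl w)))) =
      .inr 3 :: (subst (fun _ => []) w).map .inl := by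
    simp only [subst, List.flatMap_map, List.map_flatMap, List.flatMap_assoc, List.map_cons,
      List.flatMap_cons, List.map_map]
    simp only [insertThrice, Equiv.coe_fn_mk, Sum.elim_inr, Sum.elim_inl, List.flatMap_cons,
      List.flatMap_nil, List.nil_append, List.append_nil, List.singleton_append,
      List.cons.injEq, true_and]
    rw [List.flatMap_assoc]
    refine flatMap_congr_mem ?_
    rintro (x | x) _ <;> simp
  have el' : (fun c => ((Sum.elim (Sum.elim lab fun _ => i) fun _ => i) ∘
      (g.insertThrice a).e.symm) (.inl (.inl c))) = Sum.elim (fun c => lab (.inl c)) fun _ => i :=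
    funext el
  have e2 : ((Sum.elim (Sum.elim lab fun _ => i) fun _ => i) ∘
      (g.insertThrice a).e.symm) (.inl (.inr 3)) = lab (.inr 3) := by simp [insertThrice]
  have e3 : ((Sum.elim (Sum.elim lab fun _ => i) fun _ => i) ∘
      (g.insertThrice a).e.symm) (.inr 3) = i := by simp [insertThrice]
  rw [ew, el', e2, e3, mul_comm] at e1
  simpa only [Sum.elim_inl, Sum.elim_inr, subst_inr, subst_inl, subst_map_inl, List.nil_append]
    using e1.symm

/-- Both sides are compared with the leg whose foot is in front of all others (`val_insert_head`).
Feet of legs on internal edges thus move freely, and their labels matter only through the units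
`dᵢ`. -/
theorem val_insert_free {g : UGraph F} {a : F} (ha : g.Internal a) {lab lab' : F ⊕ Fin 4 → Fin n}
    {w w' : List (F ⊕ Fin 4)} (h : (g.insertLeg a).IsLay w) (h' : (g.insertLeg a).IsLay w')
    (hl : ∀ c, lab (.inl c) = lab' (.inl c)) (hw : subst (fun _ => []) w = subst (fun _ => []) w') :
    d (lab' (.inr 3)) • (g.insertLeg a).val lab w = d (lab (.inr 3)) • (g.insertLeg a).val lab' w' := by
  refine d_smul_cancel (lab (.inr 3)) ?_
  have e1 := val_insert_head ha h (lab := lab) (lab (.inr 3))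
  have e2 := val_insert_head ha h' (lab := lab') (lab (.inr 3))
  rw [smul_comm, e1, e2, hw]
  simp only [hl]
  rw [smul_comm]

/-- A leg with label `1` on the edge of `a`, with its foot in front of all other feet. -/
def ins [NeZero n] (g : UGraph F) (a : F) (lab : F → Fin n) (w : List F) : C n :=
  (g.insertLeg a).val (Sum.elim lab fun _ => 0) (.inr 3 :: w.map .inl)

/-- Triple insertions at a vertex. -/
def ins₃ [NeZero n] (g : UGraph F) (a b c : F) (lab : F → Fin n) (w : List F) : C n :=
  (((g.insertLeg a).insertLeg (.inl b)).insertLeg (.inl (.inl c))).val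
    (Sum.elim (Sum.elim (Sum.elim lab fun _ => 0) fun _ => 0) fun _ => 0)
    (.inr 3 :: (.inr 3 :: (.inr 3 :: w.map .inl).map .inl).map .inl)

theorem ins_slide [NeZero n] {g : UGraph F} {v : F} (hv : g.rot v ≠ v) (lab : F → Fin n)
    {w : List F} (h : g.IsLay w) :
    g.ins v lab w + g.ins (g.rot v) lab w + g.ins (g.rot (g.rot v)) lab w = 0 :=
  g.val_slide hv _ (isLay_insert_cons v h)

theorem ins₃_slide [NeZero n] {g : UGraph F} {v : F} (hv : g.rot v ≠ v) (a b : F) (lab : F → Fin n)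
    {w : List F} (h : g.IsLay w) :
    g.ins₃ a b v lab w + g.ins₃ a b (g.rot v) lab w + g.ins₃ a b (g.rot (g.rot v)) lab w = 0 :=
  ((g.insertLeg a).insertLeg (.inl b)).val_slide (v := .inl (.inl v))
    (by simpa [insertLeg, insertRot] using hv) _
    (isLay_insert_cons _ (isLay_insert_cons _ (isLay_insert_cons _ h)))

theorem ins₃_same [NeZero n] {g : UGraph F} {b : F} (hb : g.Internal b) (a : F) (lab : F → Fin n)
    {w : List F} (h : g.IsLay w) :
    g.ins₃ a b b lab w = (d (0 : Fin n) * d 0) • g.ins a lab w := by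
  refine (val_cl2_inl (hb.insert_inl a)
    (isLay_insert_cons _ (isLay_insert_cons _ (isLay_insert_cons _ h)))).trans ?_
  simp only [Sum.elim_inl, Sum.elim_inr, subst_inr, subst_inl, subst_map_inl, List.nil_append]
  rfl

/-- The insertion on `b` is commuted past the first one, so that the two legs on `a` can be removed
together by (CL2). -/
theorem ins₃_outer [NeZero n] {g : UGraph F} {a b : F} (ha : g.Internal a) (hab : b ≠ a)
    (hab' : b ≠ g.inv a) (lab : F → Fin n) {w : List F} (h : g.IsLay w) :
    g.ins₃ a b a lab w = (d (0 : Fin n) * d 0) • g.ins b lab w := by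
  have h3 := isLay_insert_cons (g := (g.insertLeg a).insertLeg (.inl b)) (.inl (.inl a))
    (isLay_insert_cons (.inl b) (isLay_insert_cons a h))
  rw [ins₃, val_iso' ((g.insertComm hab hab').insertLeg (.inl (.inl a))) h3]
  have h4 := ((g.insertComm hab hab').insertLeg (.inl (.inl a))).isLay h3
  refine (val_cl2_inl (ha.insert_inl b) h4).trans ?_
  rw [ins]
  have : ∀ x ∈ (.inr 3 :: w.map .inl : List (F ⊕ Fin 4)), (Sum.elim lab fun _ => (0 : Fin n)) x =
      ((Sum.elim (Sum.elim (Sum.elim lab fun _ => 0) fun _ => 0) fun _ => 0) ∘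
        ((g.insertComm hab hab').insertLeg (.inl (.inl a))).e.symm : _ → Fin n)
          (.inl (.inl x)) := by
    rintro (x | x) _ <;> simp [insertComm, Equiv.insertLeg, TDiag.sumRight]
  rw [val_congr_lab this]
  congr 1
  congr 1
  simp only [subst, List.flatMap_map, List.map_flatMap, List.flatMap_assoc, List.flatMap_cons,
    List.map_map]
  simp [insertComm, Equiv.insertLeg, TDiag.sumRight, List.flatMap_map]
  rw [List.flatMap_assoc, List.map_eq_flatMap]
  rfl

/-- Commuting two insertions also exchanges their feet at the front of the word; `val_insert_free`,
applied to the leg on the internal edge `b`, undoes this. -/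
theorem ins₃_comm [NeZero n] {g : UGraph F} {b c : F} (a : F) (hb : g.Internal b) (hbc : c ≠ b)
    (hbc' : c ≠ g.inv b) (lab : F → Fin n) {w : List F}
    (h : g.IsLay w) : g.ins₃ a b c lab w = g.ins₃ a c b lab w := by
  have h3 := isLay_insert_cons (g := (g.insertLeg a).insertLeg (.inl b)) (.inl (.inl c))
    (isLay_insert_cons (.inl b) (isLay_insert_cons a h))
  have h5 := isLay_insert_cons (g := (g.insertLeg a).insertLeg (.inl c)) (.inl (.inl b))
    (isLay_insert_cons (.inl c) (isLay_insert_cons a h))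
  have k1 : (Sum.inl c : F ⊕ Fin 4) ≠ .inl b := by simpa using hbc
  have k2 : (Sum.inl c : F ⊕ Fin 4) ≠ (g.insertLeg a).inv (.inl b) := by
    intro e
    by_cases c1 : b = a
    · subst c1; simp [insertLeg, insertInv] at e
    · by_cases c2 : b = g.inv a
      · subst c2; simp [insertLeg, insertInv, g.inv_ne] at e
      · simp [insertLeg, insertInv, c1, c2, hbc'] at e
  rw [ins₃, val_iso' ((g.insertLeg a).insertComm k1 k2) h3]
  have h4 := ((g.insertLeg a).insertComm k1 k2).isLay h3
  refine d_smul_cancel (0 : Fin n) ?_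
  refine val_insert_free (lab' := Sum.elim (Sum.elim (Sum.elim lab fun _ => 0) fun _ => 0)
    fun _ => 0) ((hb.insert_inl a).insert_inl (.inl c)) h4 h5 ?_ ?_
  · rintro ((x | x) | x) <;> simp [insertComm, TDiag.sumRight]
  · simp [insertComm, TDiag.sumRight, subst, List.flatMap_map]

/-- A diagram vanishes if it has a vertex that is joined to other vertices only. -/
theorem val_eq_zero_of_internal [NeZero n] {g : UGraph F} {v : F} (h0 : g.Internal v)
    (h1 : g.Internal (g.rot v)) (h2 : g.Internal (g.rot (g.rot v))) (lab : F → Fin n) {w : List F}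
    (h : g.IsLay w) : g.val lab w = 0 := by
  -- Write [i] and [ijk] for insertions on the edges 0, 1, 2 at the vertex. Sliding the third leg
  -- gives d²[2] + [201] + d²[0] = 0 and [210] + d²[1] + d²[2] = 0, where (CL2) has removed pairs on
  -- the same edge and d stands for the indeterminate of the label of the inserted legs. Since [201]
  -- = [210], it follows that [0] = [1].
  have key : ∀ {F : Type} (g : UGraph F) (v : F) (h0 : g.Internal v)
      (h1 : g.Internal (g.rot v)) (h2 : g.Internal (g.rot (g.rot v))) (lab : F → Fin n) (w : List F)
      (h : g.IsLay w), g.ins v lab w = g.ins (g.rot v) lab w := by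
    intro F g v h0 h1 h2 lab w h
    have r3 := g.rot_rot_rot v
    have hv := h0.rot_ne
    have hvv := g.rot_rot_ne h0.rot_ne
    have hvr := g.rot_rot_ne_rot h0.rot_ne
    have i01 : g.rot v ≠ g.inv v := fun e => h0.inv_ne_rot e.symm
    have i02 : g.rot (g.rot v) ≠ g.inv v := fun e => h0.inv_ne_rot_rot e.symm
    have i12 : g.rot (g.rot v) ≠ g.inv (g.rot v) := fun e => h1.inv_ne_rot e.symm
    have i10 : v ≠ g.inv (g.rot v) := fun e => h1.inv_ne_rot_rot (by rw [r3, ← e])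
    have i20 : v ≠ g.inv (g.rot (g.rot v)) := fun e => h2.inv_ne_rot (by rw [r3, ← e])
    have s1 := ins₃_slide hv (g.rot (g.rot v)) v lab h
    have s2 := ins₃_slide hv (g.rot (g.rot v)) (g.rot v) lab h
    have e1 := ins₃_comm (g.rot (g.rot v)) h0 hv i01 lab h
    rw [ins₃_same h0 _ _ h, ins₃_outer h2 hvv.symm i20 _ h] at s1
    rw [ins₃_same h1 _ _ h, ins₃_outer h2 hvr.symm (by
      intro e; exact h2.inv_ne_rot_rot (by rw [r3, ← e])) _ h] at s2
    rw [e1] at s1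
    have : (d 0 * d 0 : Lam n) • g.ins v lab w = (d 0 * d 0 : Lam n) • g.ins (g.rot v) lab w := by
      linear_combination (norm := module) s1 - s2
    rw [mul_smul, mul_smul] at this
    exact d_smul_cancel (0 : Fin n) (d_smul_cancel 0 this)
  -- By symmetry the three insertions agree, and their sum vanishes.
  have zero : ∀ {F : Type} (g : UGraph F) (v : F) (h0 : g.Internal v)
      (h1 : g.Internal (g.rot v)) (h2 : g.Internal (g.rot (g.rot v))) (lab : F → Fin n) (w : List F)
      (h : g.IsLay w), g.ins v lab w = 0 := by
    intro F g v h0 h1 h2 lab w h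
    have s := ins_slide h0.rot_ne lab h
    rw [← key g (g.rot v) h1 h2 (by rwa [g.rot_rot_rot]) lab w h, ← key g v h0 h1 h2 lab w h] at s
    have : (3 : ℚ) • g.ins v lab w = 0 := by rw [← s]; module
    exact (smul_eq_zero_iff_right (by norm_num : (3 : ℚ) ≠ 0)).1 this
  -- Applied to the graph that already has a leg on the edge of `v`: two legs on this edge give the
  -- original value times a unit.
  have z := zero (g.insertLeg v) (.inl v) (h0.insert_inl v) (h1.insert_inl v) (h2.insert_inl v)
    (Sum.elim lab fun _ => 0) _ (isLay_insert_cons v h)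
  rw [ins, val_cl2_inl h0 (isLay_insert_cons _ (isLay_insert_cons v h)), mul_smul] at z
  have z' := d_smul_cancel (0 : Fin n) (d_smul_cancel (0 : Fin n) (z.trans (by simp : (0 : C n) = _ • _ • 0)))
  simpa only [Sum.elim_inl, Sum.elim_inr, subst_inr, subst_inl, subst_map_inl, List.nil_append]
    using z'

end UGraph
end TriDiag

namespace TriDiag
variable {n : ℕ} {F F' G H : Type}
namespace UGraph

/-! ### Connected graphs -/

/-- All flags lie in one component. -/
def Conn (g : UGraph F) : Prop := ∀ a b, FlagConn g.inv g.rot a b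

theorem conn_flip {g : UGraph F} (h : g.Conn) (v : F) : (g.flip v).Conn := fun a b =>
  g.flip_conn v (h a b)

/-- A map to a connected graph is an isomorphism if it is bijective over one flag. -/
def equivOfUnique {g : UGraph G} {g' : UGraph F} (hg : g'.Conn) (φ : G → F)
    (hi : ∀ a, φ (g.inv a) = g'.inv (φ a)) (hr : ∀ a, φ (g.rot a) = g'.rot (φ a)) {b : F}
    (hb : ∃! a, φ a = b) : g.Equiv g' where
  e := _root_.Equiv.ofBijective φ (by
    have key : ∀ c, ∃! a, φ a = c := by
      intro c
      have h := hg b c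
      induction h with
      | refl => exact hb
      | @tail c c' _ h ih =>
        obtain ⟨a, ha, ha'⟩ := ih
        rcases h with rfl | rfl
        · refine ⟨g.inv a, (hi a).trans (by rw [ha]), fun a' h => ?_⟩
          replace h : φ a' = g'.inv c := h
          rw [← g.inv_inv a', ha' (g.inv a') ((hi a').trans (by rw [h, g'.inv_inv]))]
        · refine ⟨g.rot a, (hr a).trans (by rw [ha]), fun a' h => ?_⟩
          replace h : φ a' = g'.rot c := h
          rw [← g.rot_rot_rot a', ha' (g.rot (g.rot a'))
            ((hr _).trans (by rw [hr, h, g'.rot_rot_rot]))]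
    exact ⟨fun a a' h => (key (φ a')).unique h rfl, fun c => (key c).exists⟩)
  inv := hi
  rot := hr

theorem conn_of_map {g : UGraph F} {g₀ : UGraph G} (hg : g.Conn) (κ : F → G)
    (hκ : Function.Surjective κ) (h₁ : ∀ a, FlagConn g₀.inv g₀.rot (κ a) (κ (g.inv a)))
    (h₂ : ∀ a, FlagConn g₀.inv g₀.rot (κ a) (κ (g.rot a))) : g₀.Conn := by
  intro a b
  obtain ⟨a, rfl⟩ := hκ a
  obtain ⟨b, rfl⟩ := hκ b
  exact (hg a b).map κ h₁ h₂

/-- Undoes two insertions with legs on the same side of an edge. The edge {x, y} and the legs at `x`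
and `y` are deleted and the loose ends `a`, `b` are joined. These lie at different trivalent
vertices, so the new edge satisfies the hypothesis of (CL2); the surviving leg at the vertex of `a`
provides a univalent vertex. -/
theorem exists_remove {g : UGraph F} (hg : g.Conn) {x y p q r r' s s' a b : F} (hy : y = g.inv x)
    (hrx : r = g.rot x) (hp : p = g.rot r) (hq : q = g.rot y) (hr'' : r' = g.rot q)
    (hs : s = g.inv r) (hs' : s' = g.inv r') (hfs : g.rot s = s) (hfs' : g.rot s' = s')
    (ha : a = g.inv p) (hb : b = g.inv q) (hx3 : g.rot x ≠ x) (hy3 : g.rot y ≠ y)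
    (ha3 : g.rot a ≠ a) (hb3 : g.rot b ≠ b) (hyp : y ≠ p) (haq : a ≠ q)
    (hab : ¬ g.Orb a b) {l : F} (hl : g.Orb a l) (hl' : g.rot (g.inv l) = g.inv l) :
    ∃ (F₀ : Type) (g₀ : UGraph F₀) (a₀ : F₀), g₀.Conn ∧ g₀.Internal a₀ ∧
      Nonempty (((g₀.insertLeg a₀).insertLeg (.inr 1)).Equiv g) := by
  classical
  have r3 := g.rot_rot_rot
  have ii := g.inv_inv
  have ri := @rot_injective _ g
  have iii := @inv_injective _ g
  let S : F → Prop := fun c => c ≠ p ∧ c ≠ x ∧ c ≠ r ∧ c ≠ s ∧ c ≠ y ∧ c ≠ q ∧ c ≠ r' ∧ c ≠ s'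
  have px : g.rot p = x := by rw [hp, hrx, r3]
  have ry : g.rot r' = y := by rw [hr'', hq, r3]
  have rp : ∀ c, S c → S (g.rot c) := by
    intro c hc
    simp only [S] at hc ⊢
    refine ⟨?_, ?_, ?_, ?_, ?_, ?_, ?_, ?_⟩ <;> intro e
    · exact hc.2.2.1 (ri (e.trans hp))
    · exact hc.1 (ri (e.trans px.symm))
    · exact hc.2.1 (ri (e.trans hrx))
    · exact hc.2.2.2.1 (ri (e.trans hfs.symm))
    · exact hc.2.2.2.2.2.2.1 (ri (e.trans ry.symm))
    · exact hc.2.2.2.2.1 (ri (e.trans hq))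
    · exact hc.2.2.2.2.2.1 (ri (e.trans hr''))
    · exact hc.2.2.2.2.2.2.2 (ri (e.trans hfs'.symm))
  have ip : ∀ c, S c → c ≠ a → c ≠ b → S (g.inv c) := by
    intro c hc hca hcb
    simp only [S] at hc ⊢
    simp only [ne_eq, g.inv_eq_iff]
    refine ⟨?_, ?_, ?_, ?_, ?_, ?_, ?_, ?_⟩ <;> intro e <;> grind
  have p3 : g.rot p ≠ p := by grind
  have q3 : g.rot q ≠ q := by grind
  have r3' : g.rot r ≠ r := by grind
  have r3'' : g.rot r' ≠ r' := by grind
  have Sa : S a := by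
    simp only [S]
    refine ⟨?_, ?_, ?_, ?_, ?_, ?_, ?_, ?_⟩ <;> intro e <;> have := g.inv_ne p <;> grind
  have Sb : S b := by
    simp only [S]
    refine ⟨?_, ?_, ?_, ?_, ?_, ?_, ?_, ?_⟩ <;> intro e <;> have := g.inv_ne q <;> grind
  have hab' : b ≠ a := fun e => hab (Or.inl e)
  -- The loose ends `a` and `b` become the two halves of one edge.
  let inv₀ : F → F := fun c => if c = a then b else if c = b then a else g.inv c
  have i1 : inv₀ a = b := if_pos rfl
  have i2 : inv₀ b = a := by simp [inv₀, hab']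
  have i3 : ∀ c, c ≠ a → c ≠ b → inv₀ c = g.inv c := fun c h h' => by simp [inv₀, h, h']
  have i4 : ∀ c, S c → S (inv₀ c) := by
    intro c hc
    by_cases h1 : c = a
    · rw [h1, i1]; exact Sb
    · by_cases h2 : c = b
      · rw [h2, i2]; exact Sa
      · rw [i3 c h1 h2]; exact ip c hc h1 h2
  let I : {c // S c} → {c // S c} := fun c => ⟨inv₀ c.1, i4 _ c.2⟩
  let R : {c // S c} → {c // S c} := fun c => ⟨g.rot c.1, rp _ c.2⟩
  -- Collapsing all deleted half-edges to `a` turns paths of `g` into paths of the smaller graph,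
  -- which gives its connectedness and its foot.
  let κ : F → {c // S c} := fun c => if h : S c then ⟨c, h⟩ else ⟨a, Sa⟩
  have κS : ∀ c (h : S c), κ c = ⟨c, h⟩ := fun c h => dif_pos h
  have κN : ∀ c, ¬ S c → κ c = ⟨a, Sa⟩ := fun c h => dif_neg h
  have κs : Function.Surjective κ := fun c => ⟨c.1, κS _ c.2⟩
  have Nq : ¬ S q := by simp [S]
  have Np : ¬ S p := by simp [S]
  have ab : FlagConn I R ⟨a, Sa⟩ ⟨b, Sb⟩ := by
    have := FlagConn.inv_step (inv := I) (rot := R) ⟨a, Sa⟩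
    rwa [show I ⟨a, Sa⟩ = ⟨b, Sb⟩ from Subtype.ext i1] at this
  have ba : FlagConn I R ⟨b, Sb⟩ ⟨a, Sa⟩ := by
    have := FlagConn.inv_step (inv := I) (rot := R) ⟨b, Sb⟩
    rwa [show I ⟨b, Sb⟩ = ⟨a, Sa⟩ from Subtype.ext i2] at this
  have k1 : ∀ c, FlagConn I R (κ c) (κ (g.inv c)) := by
    intro c
    by_cases hc : S c
    · by_cases h1 : c = a
      · rw [h1, show g.inv a = p by rw [ha, ii], κS a Sa, κN p Np]; exact .refl
      · by_cases h2 : c = b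
        · rw [h2, show g.inv b = q by rw [hb, ii], κS b Sb, κN q Nq]; exact ba
        · rw [κS c hc, κS _ (ip c hc h1 h2)]
          have := FlagConn.inv_step (inv := I) (rot := R) ⟨c, hc⟩
          rwa [show I ⟨c, hc⟩ = ⟨g.inv c, ip c hc h1 h2⟩ from Subtype.ext (i3 c h1 h2)] at this
    · rw [κN c hc]
      by_cases h1 : c = p
      · rw [h1, ← ha, κS a Sa]; exact .refl
      · by_cases h2 : c = q
        · rw [h2, ← hb, κS b Sb]; exact ab
        · have : ¬ S (g.inv c) := by
            intro h
            refine hc ?_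
            have := ip (g.inv c) h (fun e => h1 (by rw [← ii c, e, ha, ii]))
              (fun e => h2 (by rw [← ii c, e, hb, ii]))
            rwa [ii] at this
          rw [κN _ this]; exact .refl
  have k2 : ∀ c, FlagConn I R (κ c) (κ (g.rot c)) := by
    intro c
    by_cases hc : S c
    · rw [κS c hc, κS _ (rp c hc)]
      exact FlagConn.rot_step (inv := I) (rot := R) ⟨c, hc⟩
    · have : ¬ S (g.rot c) := fun h => hc (by rw [← r3 c]; exact rp _ (rp _ h))
      rw [κN c hc, κN _ this]; exact .refl
  have Sl : S l := by
    rcases hl with rfl | rfl | rfl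
    exacts [Sa, rp _ Sa, rp _ (rp _ Sa)]
  have hla : g.rot l ≠ l := by
    rcases hl with rfl | rfl | rfl
    · exact ha3
    · exact fun e => ha3 (ri e)
    · exact fun e => ha3 (ri (ri e))
  have Sl' : S (g.inv l) := by
    refine ip l Sl ?_ ?_
    · rintro rfl
      rw [ha, ii] at hl'
      exact p3 hl'
    · rintro rfl
      exact hab hl
  let g₀ : UGraph {c // S c} :=
    { finite := by have := g.finite; infer_instance
      inv := I
      rot := R
      inv_inv := by
        rintro ⟨c, hc⟩
        refine Subtype.ext ?_
        change inv₀ (inv₀ c) = c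
        by_cases h1 : c = a
        · rw [h1, i1, i2]
        · by_cases h2 : c = b
          · rw [h2, i2, i1]
          · rw [i3 c h1 h2, i3, ii]
            · intro e; exact Np (by rw [← ii p, ← ha, ← e, ii]; exact hc)
            · intro e; exact Nq (by rw [← ii q, ← hb, ← e, ii]; exact hc)
      inv_ne := by
        rintro ⟨c, hc⟩ e
        replace e : inv₀ c = c := congrArg Subtype.val e
        by_cases h1 : c = a
        · rw [h1, i1] at e; exact hab' e
        · by_cases h2 : c = b
          · rw [h2, i2] at e; exact hab' e.symm
          · rw [i3 c h1 h2] at e; exact g.inv_ne _ e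
      rot_rot_rot := fun c => Subtype.ext (r3 c.1)
      exists_leg := by
        intro c
        refine ⟨⟨_, Sl'⟩, ?_, Subtype.ext hl'⟩
        have := (hg c.1 (g.inv l)).map κ k1 k2
        rwa [κS _ c.2, κS _ Sl'] at this }
  refine ⟨_, g₀, ⟨a, Sa⟩, conn_of_map hg κ κs k1 k2, ⟨?_, ?_, ?_, ?_⟩, ⟨equivOfUnique hg
    (Sum.elim (Sum.elim Subtype.val ![p, x, r, s]) ![y, q, r', s']) ?_ ?_ (b := x) ?_⟩⟩
  · exact fun e => ha3 (congrArg Subtype.val e)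
  · rw [show g₀.inv ⟨a, Sa⟩ = ⟨b, Sb⟩ from Subtype.ext i1]
    exact fun e => hb3 (congrArg Subtype.val e)
  · rw [show g₀.inv ⟨a, Sa⟩ = ⟨b, Sb⟩ from Subtype.ext i1]
    exact fun e => hab (Or.inr (Or.inl (congrArg Subtype.val e)))
  · rw [show g₀.inv ⟨a, Sa⟩ = ⟨b, Sb⟩ from Subtype.ext i1]
    exact fun e => hab (Or.inr (Or.inr (congrArg Subtype.val e)))
  · have e1 : g₀.inv ⟨a, Sa⟩ = ⟨b, Sb⟩ := Subtype.ext i1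
    have e2 : (⟨a, Sa⟩ : {c // S c}) ≠ ⟨b, Sb⟩ := fun e => hab' (congrArg Subtype.val e).symm
    have ia : g.inv a = p := by rw [ha, ii]
    have ib : g.inv b = q := by rw [hb, ii]
    have ix : g.inv y = x := by rw [hy, ii]
    have is : g.inv s = r := by rw [hs, ii]
    have is' : g.inv s' = r' := by rw [hs', ii]
    rintro ((⟨c, hc⟩ | c) | c)
    · by_cases h1 : c = a
      · subst h1
        simp [insertLeg, insertInv, e1, ia, e2]
      · by_cases h2 : c = b
        · subst h2
          simp [insertLeg, insertInv, e1, ib, hab']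
        · have e3 : (g₀.inv ⟨c, hc⟩).1 = g.inv c := i3 c h1 h2
          simp [insertLeg, insertInv, e1, h1, h2, e3]
    · fin_cases c <;> simp [insertLeg, insertInv, e1, ← ha, ← hy, ← hs, is]
    · fin_cases c <;> simp [insertLeg, insertInv, e1, ix, ← hs', ← hb, is']
  · rintro ((⟨c, hc⟩ | c) | c)
    · rfl
    · fin_cases c <;> simp [insertLeg, insertRot, px, hfs] <;> assumption
    · fin_cases c <;> simp [insertLeg, insertRot, ry, hfs'] <;> assumption
  · refine ⟨.inl (.inr 1), rfl, ?_⟩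
    rintro ((⟨c, hc⟩ | c) | c) h
    · exact absurd h hc.2.1
    · fin_cases c <;> simp at h ⊢ <;> grind
    · fin_cases c <;> simp at h <;> have := g.inv_ne x <;> grind

end UGraph
end TriDiag

namespace TriDiag
variable {n : ℕ} {F F' G H : Type}
namespace UGraph

/-! ### Small graphs -/

/-- A single edge. -/
def strutG : UGraph (Fin 2) := (strutDiag (n := 1) 0 0).toUGraph

/-- A vertex with three legs. -/
def tripodG : UGraph (Fin 6) := (tripodDiag (n := 1) 0 0 0).toUGraph

/-- The letter H. -/
def hG : UGraph (Fin 10) := (hDiag (n := 1) 0 0 0 0).toUGraph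

/-- A row of three vertices. -/
def combG : UGraph (Fin 10 ⊕ Fin 4) := hG.insertLeg 8

/-- A circle with two legs. -/
def wheelG : UGraph (Fin 8) := (wheelDiag (n := 1) 0 0).toUGraph

/-- A circle with three legs. -/
def triangleG : UGraph (Fin 8 ⊕ Fin 4) := wheelG.insertLeg 7

/-- Every value of `g` is a multiple of a value of `E`, which has `k` feet and `4 * k` flags less. -/
def Red (n : ℕ) (g : UGraph F) (E : UGraph G) (k : ℕ) : Prop :=
  Nat.card F = Nat.card G + 4 * k ∧ ∀ (lab : F → Fin n) (w : List F), g.IsLay w → ∃ (c : Lam n) (lab' : G → Fin n) (w' : List G),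
    E.IsLay w' ∧ w'.length + k = w.length ∧ g.val lab w = c • E.val lab' w'

/-- All values of `g` vanish. -/
def Null (n : ℕ) (g : UGraph F) : Prop := ∀ (lab : F → Fin n) (w : List F), g.val lab w = 0

theorem null_iff {g : UGraph F} :
    g.Null n ↔ ∀ (lab : F → Fin n) (w : List F), g.IsLay w → g.val lab w = 0 :=
  ⟨fun h lab w _ => h lab w, fun h lab w => by
    by_cases hw : g.IsLay w
    · exact h lab w hw
    · rw [val, dif_neg hw]⟩

theorem Red.of_flip {g : UGraph F} {v : F} (hv : g.rot v ≠ v) {E : UGraph G} {k : ℕ}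
    (h : (g.flip v).Red n E k) : g.Red n E k := by
  refine ⟨h.1, fun lab w hw => ?_⟩
  obtain ⟨c, lab', w', h1, h2, h3⟩ := h.2 lab w (isLay_flip.2 hw)
  rw [val_flip g hv lab hw, neg_eq_iff_eq_neg] at h3
  exact ⟨-c, lab', w', h1, h2, by rw [h3, neg_smul]⟩

theorem Null.of_flip {g : UGraph F} {v : F} (hv : g.rot v ≠ v) (h : (g.flip v).Null n) :
    g.Null n := by
  refine null_iff.2 fun lab w hw => ?_
  have := h lab w
  rwa [val_flip g hv lab hw, neg_eq_zero] at this

theorem Equiv.red {g : UGraph F} {E : UGraph G} (φ : g.Equiv E) : g.Red n E 0 := ⟨Nat.card_congr φ.e, fun lab w hw =>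
  ⟨1, lab ∘ φ.e.symm, w.map φ.e, φ.isLay hw, by simp, by rw [one_smul, val_iso' φ hw]⟩⟩

/-- Exchanging the two half-edges of a loop fixes all feet and reverses the vertex, so the value
equals its own negative. -/
theorem null_of_loop {g : UGraph F} {v : F} (hv : g.rot v ≠ v) (hl : g.inv v = g.rot v) :
    g.Null n := by
  classical
  refine null_iff.2 fun lab w hw => ?_
  have hvv := g.rot_rot_ne hv
  have hvr := g.rot_rot_ne_rot hv
  have r3 := g.rot_rot_rot
  have ii := g.inv_inv
  let φ : g.Equiv (g.flip v) :=
    { e := _root_.Equiv.swap v (g.rot v)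
      inv := by
        intro a
        rw [flip_inv]
        by_cases h1 : a = v
        · subst h1; rw [hl, Equiv.swap_apply_left, Equiv.swap_apply_right, ← hl, ii]
        · by_cases h2 : a = g.rot v
          · subst h2; rw [← hl, ii, Equiv.swap_apply_left, Equiv.swap_apply_right, hl]
          · rw [Equiv.swap_apply_of_ne_of_ne h1 h2, Equiv.swap_apply_of_ne_of_ne]
            · rw [Ne, g.inv_eq_iff, hl]; exact h2
            · rw [← hl]; exact fun e => h1 (g.inv_injective e)
      rot := by
        intro a
        by_cases ha : g.Orb v a
        · rcases ha with rfl | rfl | rfl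
          · rw [Equiv.swap_apply_left, Equiv.swap_apply_right,
              g.flip_rot_orb (g.orb_rot.2 (g.orb_self _)), r3]
          · rw [Equiv.swap_apply_right, Equiv.swap_apply_of_ne_of_ne hvv hvr,
              g.flip_rot_orb (g.orb_self _)]
          · rw [r3, Equiv.swap_apply_left, Equiv.swap_apply_of_ne_of_ne hvv hvr,
              g.flip_rot_orb (g.orb_rot.2 (g.orb_rot.2 (g.orb_self _))), r3]
        · have ha' : ¬ g.Orb v (g.rot a) := fun h => ha (g.orb_rot.1 h)
          rw [Equiv.swap_apply_of_ne_of_ne (fun e => ha' (Or.inl e))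
            (fun e => ha' (Or.inr (Or.inl e))), Equiv.swap_apply_of_ne_of_ne (fun e => ha (Or.inl e))
            (fun e => ha (Or.inr (Or.inl e))), g.flip_rot_not ha] }
  have hfix : ∀ a ∈ w, φ.e a = a := fun a ha => by
    have := hw.rot_eq ha
    refine Equiv.swap_apply_of_ne_of_ne ?_ ?_
    · rintro rfl; exact hv this
    · rintro rfl; exact hvr this
  have h1 := val_iso φ hw lab fun a ha => by rw [hfix a ha]
  rw [List.map_congr_left hfix, List.map_id', val_flip g hv lab hw] at h1
  have h2 : (2 : ℚ) • g.val lab w = 0 := by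
    rw [two_smul]; nth_rewrite 1 [h1]; exact neg_add_cancel _
  exact (smul_eq_zero_iff_right (by norm_num : (2 : ℚ) ≠ 0)).1 h2

/-- Here and below the model graph is mapped to `g` by the evident images of its half-edges. Since
`g` is connected, it suffices that one half-edge of `g` has exactly one preimage. -/
theorem red_strut {g : UGraph F} (hg : g.Conn) {a : F} (h : g.rot a = a)
    (h' : g.rot (g.inv a) = g.inv a) : g.Red n strutG 0 := by
  refine (equivOfUnique (g := strutG) hg ![a, g.inv a] ?_ ?_ (b := a) ⟨0, rfl, ?_⟩).symm.red
  · intro c; fin_cases c <;> simp [strutG, strutDiag, g.inv_inv]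
  · intro c; fin_cases c <;> simp [strutG, strutDiag, h, h']
  · intro c h; have := g.inv_ne a; fin_cases c <;> simp at h ⊢; exact this h

theorem red_tripod {g : UGraph F} (hg : g.Conn) {a b c : F} (hb : b = g.rot a) (hc : c = g.rot b)
    (ha3 : g.rot a ≠ a) (ha' : g.rot (g.inv a) = g.inv a) (hb' : g.rot (g.inv b) = g.inv b)
    (hc' : g.rot (g.inv c) = g.inv c) : g.Red n tripodG 0 := by
  have ca : g.rot c = a := by rw [hc, hb, g.rot_rot_rot]
  refine (equivOfUnique (g := tripodG) hg ![g.inv a, g.inv b, g.inv c, a, b, c] ?_ ?_ (b := a)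
    ⟨3, rfl, ?_⟩).symm.red
  · intro c; fin_cases c <;> simp [tripodG, tripodDiag, g.inv_inv]
  · intro c; fin_cases c <;> simp [tripodG, tripodDiag, ha', hb', hc', ca, ← hb, ← hc]
  · intro x h; have := g.inv_ne a; fin_cases x <;> simp at h ⊢ <;> grind [g.rot_injective]

theorem red_h {g : UGraph F} (hg : g.Conn) {p q r p' q' r' : F} (hp : p' = g.inv p)
    (hq : q = g.rot p) (hr : r = g.rot q) (hq' : q' = g.rot p') (hr' : r' = g.rot q')
    (hp3 : g.rot p ≠ p) (lq : g.rot (g.inv q) = g.inv q) (lr : g.rot (g.inv r) = g.inv r)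
    (lq' : g.rot (g.inv q') = g.inv q') (lr' : g.rot (g.inv r') = g.inv r') (hp' : g.rot p' ≠ p') :
    g.Red n hG 0 := by
  have rp : g.rot r = p := by rw [hr, hq, g.rot_rot_rot]
  have rp' : g.rot r' = p' := by rw [hr', hq', g.rot_rot_rot]
  have ip : g.inv p' = p := by rw [hp, g.inv_inv]
  refine (equivOfUnique (g := hG) hg
    ![g.inv q, g.inv r, g.inv r', g.inv q', q, r, r', q', p, p'] ?_ ?_ (b := p)
    ⟨8, rfl, ?_⟩).symm.red
  · intro c; fin_cases c <;> simp [hG, hDiag, g.inv_inv, ip, hp]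
  · intro c; fin_cases c <;> simp [hG, hDiag, lq, lq', lr, lr', rp, rp', ← hq, ← hr, ← hq', ← hr']
  · intro x h; have := g.inv_ne p; fin_cases x <;> simp at h ⊢ <;> grind [g.rot_injective]

theorem red_comb {g : UGraph F} (hg : g.Conn) {p q r p' q' r' p'' q'' r'' : F} (hp : p' = g.inv p)
    (hq : q = g.rot p) (hr : r = g.rot q) (hq' : q' = g.rot p') (hr' : r' = g.rot q')
    (hp'' : p'' = g.inv q') (hq'' : q'' = g.rot p'') (hr'' : r'' = g.rot q'')
    (hp3 : g.rot p ≠ p) (lq : g.rot (g.inv q) = g.inv q) (lr : g.rot (g.inv r) = g.inv r)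
    (lr' : g.rot (g.inv r') = g.inv r') (lq'' : g.rot (g.inv q'') = g.inv q'')
    (lr'' : g.rot (g.inv r'') = g.inv r'') (hp' : g.rot p' ≠ p') (hpq : p ≠ q')
    (hp3'' : g.rot p'' ≠ p'') :
    g.Red n combG 0 := by
  have rp : g.rot r = p := by rw [hr, hq, g.rot_rot_rot]
  have rp' : g.rot r' = p' := by rw [hr', hq', g.rot_rot_rot]
  have rp'' : g.rot r'' = p'' := by rw [hr'', hq'', g.rot_rot_rot]
  have ip : g.inv p' = p := by rw [hp, g.inv_inv]
  have iq : g.inv p'' = q' := by rw [hp'', g.inv_inv]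
  refine (equivOfUnique (g := combG) hg (Sum.elim
    ![g.inv q, g.inv r, g.inv r'', g.inv q'', q, r, r'', q'', p, p''] ![p', q', r', g.inv r'])
    ?_ ?_ (b := p) ⟨.inl 8, rfl, ?_⟩).symm.red
  · rintro (c | c) <;> fin_cases c <;>
      simp [combG, insertLeg, insertInv, hG, hDiag, g.inv_inv, ip, iq, ← hp, ← hp'']
  · rintro (c | c) <;> fin_cases c <;>
      simp [combG, insertLeg, insertRot, hG, hDiag, lq, lr', lr, lq'', lr'', rp, rp', rp'', ← hq,
        ← hr, ← hq', ← hr', ← hq'', ← hr'']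
  · rintro (x | x) h <;> have := g.inv_ne p <;> fin_cases x <;> simp at h ⊢ <;>
      grind [g.rot_injective, g.inv_inv]

theorem red_wheel {g : UGraph F} (hg : g.Conn) {x y p q r r' : F} (hy : y = g.inv x)
    (hrx : r = g.rot x) (hp : p = g.rot r) (hq : q = g.rot y) (hr' : r' = g.rot q)
    (hx3 : g.rot x ≠ x) (lr : g.rot (g.inv r) = g.inv r) (lr' : g.rot (g.inv r') = g.inv r')
    (hpq : p = g.inv q) (hy3 : g.rot y ≠ y) (hqx : q ≠ x) : g.Red n wheelG 0 := by
  have px : g.rot p = x := by rw [hp, hrx, g.rot_rot_rot]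
  have ry : g.rot r' = y := by rw [hr', hq, g.rot_rot_rot]
  have ix : g.inv y = x := by rw [hy, g.inv_inv]
  have ip : g.inv p = q := by rw [hpq, g.inv_inv]
  refine (equivOfUnique (g := wheelG) hg ![g.inv r, g.inv r', r, r', x, y, p, q]
    ?_ ?_ (b := x) ⟨4, rfl, ?_⟩).symm.red
  · intro c; fin_cases c <;> simp [wheelG, wheelDiag, g.inv_inv, ix, ip, ← hy, ← hpq]
  · intro c; fin_cases c <;> simp [wheelG, wheelDiag, px, ry, lr, lr', ← hrx, ← hp, ← hq, ← hr']
  · intro c h; have := g.inv_ne x; fin_cases c <;> simp at h ⊢ <;> grind [g.rot_injective]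

theorem red_triangle {g : UGraph F} (hg : g.Conn) {x y p q r r' a b l : F} (hy : y = g.inv x)
    (hrx : r = g.rot x) (hp : p = g.rot r) (hq : q = g.rot y) (hr' : r' = g.rot q)
    (hx3 : g.rot x ≠ x) (lr : g.rot (g.inv r) = g.inv r) (lr' : g.rot (g.inv r') = g.inv r')
    (ha : a = g.inv p) (hb : b = g.inv q) (hab : a = g.rot b) (hl : l = g.rot a)
    (ll : g.rot (g.inv l) = g.inv l)
    (hy3 : g.rot y ≠ y) (hqx : q ≠ x) : g.Red n triangleG 0 := by
  have px : g.rot p = x := by rw [hp, hrx, g.rot_rot_rot]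
  have ry : g.rot r' = y := by rw [hr', hq, g.rot_rot_rot]
  have lb : g.rot l = b := by rw [hl, hab, g.rot_rot_rot]
  have ix : g.inv y = x := by rw [hy, g.inv_inv]
  have ia : g.inv a = p := by rw [ha, g.inv_inv]
  have ib : g.inv b = q := by rw [hb, g.inv_inv]
  refine (equivOfUnique (g := triangleG) hg
    (Sum.elim ![g.inv r, g.inv r', r, r', x, y, p, q] ![b, a, l, g.inv l])
    ?_ ?_ (b := x) ⟨.inl 4, rfl, ?_⟩).symm.red
  · rintro (c | c) <;> fin_cases c <;>
      simp [triangleG, insertLeg, insertInv, wheelG, wheelDiag, g.inv_inv, ix, ia, ib, ← hy, ← ha,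
        ← hb]
  · rintro (c | c) <;> fin_cases c <;>
      simp [triangleG, insertLeg, insertRot, wheelG, wheelDiag, px, ry, lr, lr', lb, ll, ← hrx,
        ← hp, ← hq, ← hr', ← hab, ← hl]
  · rintro (c | c) h <;> have := g.inv_ne x <;> fin_cases c <;> simp at h ⊢ <;>
      grind [g.rot_injective, g.inv_inv]

end UGraph
end TriDiag

namespace TriDiag
variable {n : ℕ} {F F' G H : Type}
namespace UGraph

/-! ### Reduction of connected graphs -/

/-- The edge of `a` ends in a univalent vertex, on the side opposite to `a`. -/
def Leg (g : UGraph F) (a : F) : Prop := g.rot (g.inv a) = g.inv a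

/-- There are no loops. -/
def NoLoop (g : UGraph F) : Prop := ∀ v, g.rot v ≠ v → ¬ g.Orb v (g.inv v)

/-- Each trivalent vertex has a leg. -/
def HasLeg (g : UGraph F) : Prop := ∀ v, g.rot v ≠ v → ∃ l, g.Orb v l ∧ g.Leg l

/-- The graph is reduced to a smaller one, or to one of a few small graphs. -/
def Classified (n : ℕ) (g : UGraph F) : Prop :=
  g.Null n ∨ (∃ (F₀ : Type) (g₀ : UGraph F₀), g₀.Conn ∧ g.Red n g₀ 2) ∨ g.Red n strutG 0 ∨
    g.Red n tripodG 0 ∨ g.Red n hG 0 ∨ g.Red n combG 0 ∨ g.Red n wheelG 0 ∨ g.Red n triangleG 0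

theorem Classified.of_flip {g : UGraph F} {v : F} (hv : g.rot v ≠ v)
    (h : (g.flip v).Classified n) : g.Classified n := by
  rcases h with h | ⟨_, _, h, h'⟩ | h | h | h | h | h | h
  · exact .inl (h.of_flip hv)
  · exact .inr (.inl ⟨_, _, h, h'.of_flip hv⟩)
  · exact .inr (.inr (.inl (h.of_flip hv)))
  · exact .inr (.inr (.inr (.inl (h.of_flip hv))))
  · exact .inr (.inr (.inr (.inr (.inl (h.of_flip hv)))))
  · exact .inr (.inr (.inr (.inr (.inr (.inl (h.of_flip hv))))))
  · exact .inr (.inr (.inr (.inr (.inr (.inr (.inl (h.of_flip hv)))))))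
  · exact .inr (.inr (.inr (.inr (.inr (.inr (.inr (h.of_flip hv)))))))

theorem orb_symm (g : UGraph F) {v a : F} (h : g.Orb v a) : g.Orb a v := by
  have := g.rot_rot_rot v
  unfold Orb at *
  grind

theorem orb_trans (g : UGraph F) {v a b : F} (h : g.Orb v a) (h' : g.Orb a b) : g.Orb v b := by
  have := g.rot_rot_rot v
  unfold Orb at *
  grind

theorem flip_orb (g : UGraph F) {u v a : F} : (g.flip u).Orb v a ↔ g.Orb v a := by
  by_cases h : g.Orb u v
  · unfold Orb
    rw [g.flip_rot_orb h, g.flip_rot_orb (g.orb_rot.2 (g.orb_rot.2 h)), g.rot_rot_rot]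
    tauto
  · unfold Orb
    rw [g.flip_rot_not h, g.flip_rot_not fun h' => h (g.orb_rot.1 h')]

theorem flip_leg (g : UGraph F) {u a : F} : (g.flip u).Leg a ↔ g.Leg a := g.flip_rot_eq_iff

theorem NoLoop.flip {g : UGraph F} (h : g.NoLoop) (u : F) : (g.flip u).NoLoop := fun v hv => by
  rw [flip_orb]
  exact h v fun e => hv (g.flip_rot_eq_iff.2 e)

theorem HasLeg.flip {g : UGraph F} (h : g.HasLeg) (u : F) : (g.flip u).HasLeg := fun v hv => by
  obtain ⟨l, hl, hl'⟩ := h v fun e => hv (g.flip_rot_eq_iff.2 e)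
  exact ⟨l, g.flip_orb.2 hl, g.flip_leg.2 hl'⟩

theorem length_subst_insert {g : UGraph F} {a : F} {w : List (F ⊕ Fin 4)}
    (h : (g.insertLeg a).IsLay w) : (subst (fun _ => []) w).length + 1 = w.length := by
  obtain ⟨L, R, rfl, h'⟩ := h.exists_split_insert
  simp; omega

theorem red_of_insert {g₀ : UGraph G} {a : G} (ha : g₀.Internal a) {g : UGraph F}
    (φ : ((g₀.insertLeg a).insertLeg (.inr 1)).Equiv g) : g.Red n g₀ 2 := by
  constructor
  · have := g₀.finite
    rw [← Nat.card_congr φ.e, Nat.card_sum, Nat.card_sum]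
    simp
  · intro lab w hw
    have h1 := isLay_map_symm φ hw
    have h2 := isLay_subst_insert h1
    have e1 := length_subst_insert h1
    have e2 := length_subst_insert h2
    have e3 := (val_iso_symm φ (lab := lab) hw).trans (val_cl2 ha h1)
    refine ⟨_, _, _, isLay_subst_insert h2, ?_, e3⟩
    simp at e1 e2 ⊢
    omega

/-- The edge {x, y} carries one leg at each end, on the same side. If the two continuations are the
same edge, the graph is a circle with two legs; if they end at the same vertex, it is a triangle;
otherwise the two legs can be removed by (CL2). -/
theorem classified_of_edge {g : UGraph F} (hg : g.Conn) (nl : g.NoLoop) (hl : g.HasLeg) {x y : F}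
    (hy : y = g.inv x) (hx3 : g.rot x ≠ x) (hy3 : g.rot y ≠ y) (l1 : g.Leg (g.rot x))
    (l2 : ¬ g.Leg (g.rot (g.rot x))) (l3 : ¬ g.Leg (g.rot y)) (l4 : g.Leg (g.rot (g.rot y))) :
    g.Classified n := by
  have r3 := g.rot_rot_rot
  have ii := g.inv_inv
  have n1 := nl x hx3
  rw [← hy] at n1
  have n2 : ¬ g.Orb y x := fun h => n1 (g.orb_symm h)
  have yx : y ≠ g.rot x := fun h => n1 (Or.inr (Or.inl h))
  have yp : y ≠ g.rot (g.rot x) := fun h => n1 (Or.inr (Or.inr h))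
  have qx : g.rot y ≠ x := fun h => n2 (Or.inr (Or.inl h.symm))
  obtain ⟨a, ha⟩ : ∃ a, a = g.inv (g.rot (g.rot x)) := ⟨_, rfl⟩
  obtain ⟨b, hb⟩ : ∃ b, b = g.inv (g.rot y) := ⟨_, rfl⟩
  have p3 := fun e => hx3 (g.rot_injective (g.rot_injective e) : g.rot x = x)
  have q3 : g.rot (g.rot y) ≠ g.rot y := fun e => hy3 (g.rot_injective e)
  by_cases c1 : g.rot (g.rot x) = g.inv (g.rot y)
  · exact .inr (.inr (.inr (.inr (.inr (.inr (.inl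
      (red_wheel hg hy rfl rfl rfl rfl hx3 l1 l4 c1 hy3 qx)))))))
  have a3 : g.rot a ≠ a := by rw [ha]; exact l2
  have b3 : g.rot b ≠ b := by rw [hb]; exact l3
  obtain ⟨l, hl1, hl2⟩ := hl a a3
  by_cases c2 : g.Orb a b
  · have ab : b ≠ a := by
      intro e
      rw [ha, hb] at e
      exact yx (g.rot_injective (g.inv_injective e))
    have la : ¬ g.Leg a := by rw [Leg, ha, ii]; exact p3
    have lb : ¬ g.Leg b := by rw [Leg, hb, ii]; exact q3
    -- The model of the triangle has `a = rot b`. In the other cyclic order the vertex of `a` is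
    -- reversed first.
    rcases c2 with c2 | c2 | c2
    · exact absurd c2 ab
    · have ox : ¬ g.Orb a x := fun h => by
        refine nl _ p3 ?_
        rw [← ha]
        exact g.orb_symm (g.orb_rot.2 (g.orb_rot.2 h))
      have oy : ¬ g.Orb a y := fun h => by
        refine nl _ q3 ?_
        rw [← hb]
        exact g.orb_trans (g.orb_symm (g.orb_rot.2 h)) (Or.inr (Or.inl c2))
      have e1 := g.flip_rot_not ox
      have e2 := g.flip_rot_not fun h => ox (g.orb_rot.1 h)
      have e3 := g.flip_rot_not oy
      have e4 := g.flip_rot_not fun h => oy (g.orb_rot.1 h)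
      have e5 := g.flip_rot_orb (g.orb_self a)
      have e6 := g.flip_rot_orb (g.orb_rot.2 (g.orb_self a))
      refine Classified.of_flip a3 (.inr (.inr (.inr (.inr (.inr (.inr (.inr
        (red_triangle (conn_flip hg a) (x := x) (y := y) (a := a) (b := b) hy rfl rfl rfl rfl ?_ ?_
          ?_ ?_ ?_ ?_ rfl ?_ ?_ ?_))))))))
      · rwa [e1]
      · rw [e1]; exact g.flip_leg.2 l1
      · rw [e3, e4]; exact g.flip_leg.2 l4
      · rw [e1, e2]; exact ha
      · rw [e3]; exact hb
      · rw [c2, e6, r3]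
      · rw [e5]; refine g.flip_leg.2 ?_
        rcases hl1 with rfl | rfl | rfl
        exacts [absurd hl2 la, absurd (c2 ▸ hl2) lb, hl2]
      · rwa [e3]
      · rwa [e3]
    · refine .inr (.inr (.inr (.inr (.inr (.inr (.inr
        (red_triangle hg (x := x) (y := y) (a := a) (b := b) hy rfl rfl rfl rfl hx3 l1 l4 ha hb ?_
          rfl ?_ hy3 qx)))))))
      · rw [c2, r3]
      · rcases hl1 with rfl | rfl | rfl
        exacts [absurd hl2 la, hl2, absurd (c2 ▸ hl2) lb]
  · obtain ⟨F₀, g₀, a₀, h1, h2, ⟨φ⟩⟩ := exists_remove hg hy rfl rfl rfl rfl rfl rfl l1 l4 ha hb hx3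
      hy3 a3 b3 yp (fun e => c1 (by rw [← e, ha, ii])) c2 hl1 hl2
    exact .inr (.inl ⟨F₀, g₀, h1, red_of_insert h2 φ⟩)

/-- Loops and vertices without a leg make a graph null, and a vertex with three legs is a tripod. If
some edge has exactly one leg at each of its two ends, reversals put the legs on the same side and
`classified_of_edge` applies. Without such an edge, a connected graph has at most three vertices in
a row: it is an H or a comb. -/
theorem classified [NeZero n] {g : UGraph F} (hg : g.Conn) [Nonempty F] : g.Classified n := by
  have r3 := g.rot_rot_rot
  have ii := g.inv_inv
  have ri := @rot_injective _ g
  by_cases c0 : ∀ v, g.rot v = v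
  · obtain ⟨a⟩ := ‹Nonempty F›
    exact .inr (.inr (.inl (red_strut hg (c0 a) (c0 _))))
  push Not at c0
  obtain ⟨v₀, hv₀⟩ := c0
  by_cases c1 : ∃ v, g.rot v ≠ v ∧ g.inv v = g.rot v
  · obtain ⟨v, hv, hl⟩ := c1
    exact .inl (null_of_loop hv hl)
  push Not at c1
  have nl : g.NoLoop := by
    rintro v hv (h | h | h)
    · exact g.inv_ne v h
    · exact c1 v hv h
    · refine c1 (g.rot (g.rot v)) (fun e => hv (ri (ri e))) ?_
      rw [r3, ← h, ii]
  by_cases c2 : ∃ v, g.rot v ≠ v ∧ ¬ g.Leg v ∧ ¬ g.Leg (g.rot v) ∧ ¬ g.Leg (g.rot (g.rot v))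
  · obtain ⟨v, hv, l0, l1, l2⟩ := c2
    have key : ∀ v, g.rot v ≠ v → ¬ g.Leg v → g.Internal v := fun v hv hl =>
      ⟨hv, hl, fun e => nl v hv (Or.inr (Or.inl e)), fun e => nl v hv (Or.inr (Or.inr e))⟩
    exact .inl (null_iff.2 fun lab w hw => val_eq_zero_of_internal (key v hv l0)
      (key _ (fun e => hv (ri e)) l1) (key _ (fun e => hv (ri (ri e))) l2) lab hw)
  push Not at c2
  have hl : g.HasLeg := by
    intro v hv
    by_cases h0 : g.Leg v
    · exact ⟨_, Or.inl rfl, h0⟩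
    · by_cases h1 : g.Leg (g.rot v)
      · exact ⟨_, Or.inr (Or.inl rfl), h1⟩
      · exact ⟨_, Or.inr (Or.inr rfl), c2 v hv h0 h1⟩
  by_cases c3 : ∃ v, g.rot v ≠ v ∧ g.Leg v ∧ g.Leg (g.rot v) ∧ g.Leg (g.rot (g.rot v))
  · obtain ⟨v, hv, l0, l1, l2⟩ := c3
    exact .inr (.inr (.inr (.inl (red_tripod hg rfl rfl hv l0 l1 l2))))
  push Not at c3
  have tri : ∀ x, g.rot x ≠ x → g.rot (g.rot x) ≠ g.rot x ∧
      g.rot (g.rot (g.rot x)) ≠ g.rot (g.rot x) :=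
    fun x hx => ⟨fun e => hx (ri e), fun e => hx (ri (ri e))⟩
  have legr : ∀ x, g.rot x ≠ x → ¬ g.Leg (g.inv x) := fun x hx h => hx (by rwa [Leg, ii] at h)
  by_cases c4 : ∃ x, g.rot x ≠ x ∧ ¬ g.Leg x ∧ ¬ (g.Leg (g.rot x) ∧ g.Leg (g.rot (g.rot x))) ∧
      ¬ (g.Leg (g.rot (g.inv x)) ∧ g.Leg (g.rot (g.rot (g.inv x))))
  · obtain ⟨x, hx, lx, h1, h2⟩ := c4
    have ly := legr x hx
    have n1 := nl x hx
    have n2 : ¬ g.Orb (g.inv x) x := fun h => n1 (g.orb_symm h)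
    have ox : ∀ {u v}, ¬ g.Orb u v → ¬ g.Orb u (g.rot v) := fun h h' => h (g.orb_rot.1 h')
    -- The case in which the leg at `x` comes directly after `x` in the cyclic order; it is applied
    -- to `g` or to `g` with the vertex of `x` reversed. The vertex at the other end is reversed if
    -- necessary.
    have key : ∀ (g' : UGraph F), g'.Conn → g'.NoLoop → g'.HasLeg → g'.inv = g.inv →
        g'.rot x ≠ x → g'.rot (g'.inv x) ≠ g'.inv x → g'.Leg (g'.rot x) →
        ¬ g'.Leg (g'.rot (g'.rot x)) → ¬ g'.Orb x (g'.inv x) →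
        (¬ (g'.Leg (g'.rot (g'.inv x)) ∧ g'.Leg (g'.rot (g'.rot (g'.inv x))))) →
        g'.rot (g'.rot (g'.rot (g'.inv x))) = g'.inv x → ¬ g'.Leg (g'.inv x) →
        g'.Classified n := by
      intro g' hg nl hl hi hx hy l1 l2 hn h2 r3 ly
      have n2 : ¬ g'.Orb (g'.inv x) x := fun h => hn (g'.orb_symm h)
      have ox : ∀ {u v}, ¬ g'.Orb u v → ¬ g'.Orb u (g'.rot v) := fun h h' => h (g'.orb_rot.1 h')
      by_cases h3 : g'.Leg (g'.rot (g'.inv x))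
      · have h4 : ¬ g'.Leg (g'.rot (g'.rot (g'.inv x))) := fun h => h2 ⟨h3, h⟩
        have e1 := g'.flip_rot_not n2
        have e2 := g'.flip_rot_not (ox n2)
        have e5 := g'.flip_rot_orb (g'.orb_self (g'.inv x))
        have e6 := g'.flip_rot_orb (g'.orb_rot.2 (g'.orb_rot.2 (g'.orb_self (g'.inv x))))
        refine Classified.of_flip hy (classified_of_edge (conn_flip hg _) (nl.flip _) (hl.flip _)
          (x := x) (y := g'.inv x) rfl ?_ ?_ ?_ ?_ ?_ ?_)
        · rwa [e1]
        · exact fun e => hy (g'.flip_rot_eq_iff.1 e)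
        · rw [e1, flip_leg]; exact l1
        · rw [e1, e2, flip_leg]; exact l2
        · rw [e5, flip_leg]; exact h4
        · rw [e5, e6, flip_leg, r3]; exact h3
      · refine classified_of_edge hg nl hl rfl hx hy l1 l2 h3 ?_
        obtain ⟨l, hl1, hl2⟩ := hl _ hy
        rcases hl1 with rfl | rfl | rfl
        exacts [absurd hl2 ly, absurd hl2 h3, hl2]
    by_cases h3 : g.Leg (g.rot x)
    · exact key g hg nl hl rfl hx lx h3 (fun h => h1 ⟨h3, h⟩) n1 h2 (r3 _) ly
    · have e1 := g.flip_rot_not n1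
      have e2 := g.flip_rot_not (ox n1)
      have e3 := g.flip_rot_not (ox (ox n1))
      have e5 := g.flip_rot_orb (g.orb_self x)
      have e6 := g.flip_rot_orb (g.orb_rot.2 (g.orb_rot.2 (g.orb_self x)))
      have h4 : g.Leg (g.rot (g.rot x)) := by
        obtain ⟨l, hl1, hl2⟩ := hl x hx
        rcases hl1 with rfl | rfl | rfl
        exacts [absurd hl2 lx, absurd hl2 h3, hl2]
      refine Classified.of_flip hx (key (g.flip x) (conn_flip hg x) (nl.flip x) (hl.flip x) rfl
        ?_ ?_ ?_ ?_ ?_ ?_ ?_ ?_)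
      · exact fun e => hx (g.flip_rot_eq_iff.1 e)
      · exact fun e => lx (g.flip_rot_eq_iff.1 e)
      · rw [e5, flip_leg]; exact h4
      · rw [e5, e6, flip_leg, r3]; exact h3
      · rw [flip_orb]; exact n1
      · rw [flip_inv, e1, e2, flip_leg, flip_leg]; exact h2
      · rw [flip_inv, e1, e2, e3, r3]
      · rw [flip_leg]; exact ly
  push Not at c4
  have c4' : ∀ x, g.rot x ≠ x → ¬ g.Leg x → ¬ (g.Leg (g.rot x) ∧ g.Leg (g.rot (g.rot x))) →
      g.Leg (g.rot (g.inv x)) ∧ g.Leg (g.rot (g.rot (g.inv x))) := fun x h1 h2 h3 =>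
    c4 x h1 h2 (not_and.1 h3)
  -- Now every internal edge has an end with two legs. Start from such an end. Two legs at the
  -- opposite vertex give an H; one leg there forces the next edge to end in two legs, which gives a
  -- comb.
  obtain ⟨p, hp, lp, lp1, lp2⟩ : ∃ p, g.rot p ≠ p ∧ ¬ g.Leg p ∧ g.Leg (g.rot p) ∧
      g.Leg (g.rot (g.rot p)) := by
    obtain ⟨x, hx, lx⟩ : ∃ x, g.rot x ≠ x ∧ ¬ g.Leg x := by
      by_contra hcon
      push Not at hcon
      exact c3 v₀ hv₀ (hcon _ hv₀) (hcon _ (tri _ hv₀).1) (hcon _ (tri _ hv₀).2)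
    by_cases h : g.Leg (g.rot x) ∧ g.Leg (g.rot (g.rot x))
    · exact ⟨x, hx, lx, h⟩
    · exact ⟨g.inv x, lx, legr x hx, c4' x hx lx h⟩
  have lp' := legr p hp
  have n1 : ¬ g.Orb (g.inv p) p := fun h => nl p hp (g.orb_symm h)
  by_cases c5 : g.Leg (g.rot (g.inv p)) ∧ g.Leg (g.rot (g.rot (g.inv p)))
  · exact .inr (.inr (.inr (.inr (.inl (red_h hg rfl rfl rfl rfl rfl hp lp1 lp2 c5.1 c5.2 lp)))))
  have t1 := tri _ lp
  by_cases c6 : g.Leg (g.rot (g.inv p))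
  · have c7 : ¬ g.Leg (g.rot (g.rot (g.inv p))) := fun h => c5 ⟨c6, h⟩
    have h := c4' _ t1.2 c7 fun h => lp' (by simpa only [r3] using h.1)
    have n2 : ¬ g.Orb (g.inv p) (g.inv (g.rot (g.rot (g.inv p)))) := fun h => nl _ t1.2
      (g.orb_trans (g.orb_symm (g.orb_rot.2 (g.orb_rot.2 (g.orb_self _)))) h)
    have ox : ∀ {u v}, ¬ g.Orb u v → ¬ g.Orb u (g.rot v) := fun h h' => h (g.orb_rot.1 h')
    have e1 := g.flip_rot_not n1
    have e2 := g.flip_rot_not (ox n1)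
    have e3 := g.flip_rot_not n2
    have e4 := g.flip_rot_not (ox n2)
    have e5 := g.flip_rot_orb (g.orb_self (g.inv p))
    have e6 := g.flip_rot_orb (g.orb_rot.2 (g.orb_rot.2 (g.orb_self (g.inv p))))
    refine Classified.of_flip lp (.inr (.inr (.inr (.inr (.inr (.inl (red_comb (conn_flip hg _)
      (p := p) rfl rfl rfl rfl rfl rfl rfl rfl ?_ ?_ ?_ ?_ ?_ ?_ ?_ ?_ ?_)))))))
    · rwa [e1]
    · rw [e1]; exact g.flip_leg.2 lp1
    · rw [e1, e2]; exact g.flip_leg.2 lp2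
    · simp only [flip_inv, e5, e6, r3]; exact g.flip_leg.2 c6
    · simp only [flip_inv, e5, e3]; exact g.flip_leg.2 h.1
    · simp only [flip_inv, e5, e3, e4]; exact g.flip_leg.2 h.2
    · exact fun e => lp (g.flip_rot_eq_iff.1 e)
    · simp only [flip_inv, e5]; exact fun e => n1 (Or.inr (Or.inr e))
    · simp only [flip_inv, e5]; exact fun e => c7 (g.flip_rot_eq_iff.1 e)
  · have c7 : g.Leg (g.rot (g.rot (g.inv p))) := by
      obtain ⟨l, hl1, hl2⟩ := hl _ lp
      rcases hl1 with rfl | rfl | rfl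
      exacts [absurd hl2 lp', absurd hl2 c6, hl2]
    have h := c4' _ t1.1 c6 fun h => lp' (by simpa only [r3] using h.2)
    exact .inr (.inr (.inr (.inr (.inr (.inl (red_comb hg (p := p) rfl rfl rfl rfl rfl rfl rfl rfl
      hp lp1 lp2 c7 h.1 h.2 lp (fun e => n1 (Or.inr (Or.inl e))) c6))))))

end UGraph
end TriDiag

namespace TriDiag
variable {n : ℕ} {F F' G H : Type}

/-! ### The filtration by the number of feet -/

/-- The span of the diagrams with at most `u` feet. -/
def Fil (n u : ℕ) : Submodule (Lam n) (C n) :=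
  Submodule.span (Lam n) {x | ∃ (F : Type) (g : UGraph F) (lab : F → Fin n) (w : List F),
    g.IsLay w ∧ w.length ≤ u ∧ x = g.val lab w}

namespace UGraph

theorem val_mem_fil {g : UGraph F} (lab : F → Fin n) {w : List F} (h : g.IsLay w) {u : ℕ}
    (hu : w.length ≤ u) : g.val lab w ∈ Fil n u :=
  Submodule.subset_span ⟨F, g, lab, w, h, hu, rfl⟩

theorem IsLay.perm_of {g : UGraph F} {w w' : List F} (h : g.IsLay w) (h' : g.IsLay w') :
    w.Perm w' := (List.perm_ext_iff_of_nodup h.1 h'.1).2 fun a => (h.2 a).trans (h'.2 a).symm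

/-- If the diagrams that arise from joining two feet have their values in a submodule, then modulo
this submodule the order of the feet does not matter. -/
theorem val_sub_mem_of_perm {g : UGraph F} (P : Submodule (Lam n) (C n)) (lab : F → Fin n)
    {w w' : List F} (h : g.IsLay w) (p : w.Perm w')
    (hP : ∀ (y z : F) (hy : g.rot y = y) (hz : g.rot z = z) (hyz : y ≠ z)
      (lab' : F ⊕ Fin 2 → Fin n) (v : List (F ⊕ Fin 2)), (g.mergeLegs y z hy hz hyz).IsLay v →
      v.length + 1 = w.length → (g.mergeLegs y z hy hz hyz).val lab' v ∈ P) :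
    g.val lab w - g.val lab w' ∈ P := by
  have swap : ∀ L R y z, (L ++ y :: z :: R).Perm w →
      g.val lab (L ++ y :: z :: R) - g.val lab (L ++ z :: y :: R) ∈ P := by
    intro L R y z hp
    have hl := h.perm hp.symm
    have hn := (List.perm_middle.trans (List.Perm.cons _ List.perm_middle)).nodup_iff.1 hl.1
    have hyz : y ≠ z := by rintro rfl; simp at hn
    by_cases hlab : lab y = lab z
    · have hy := hl.rot_eq (a := y) (by simp)
      have hz := hl.rot_eq (a := z) (by simp)
      have := hP y z hy hz hyz (Sum.elim lab fun _ => lab y) (L.map .inl ++ .inr 1 :: R.map .inl)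
        (isLay_merge hl hy hz hyz) (by rw [← hp.length_eq]; simp; omega)
      rwa [val_merge_append hl hy hz hyz (lab := lab) (by simp) (by simpa using hlab.symm)
        (by simp)] at this
    · rw [val_exchange_of_ne hl hlab, sub_self]
      exact P.zero_mem
  have key : ∀ l l' : List F, l.Perm l' → ∀ L : List F, (L ++ l).Perm w →
      g.val lab (L ++ l) - g.val lab (L ++ l') ∈ P := by
    intro l l' hp
    induction hp with
    | nil => intro L _; simp
    | cons x _ ih => intro L hL; simpa using ih (L ++ [x]) (by simpa using hL)
    | swap x y l => intro L hL; exact swap _ _ _ _ hL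
    | trans h₁ _ ih₁ ih₂ =>
      intro L hL
      have := add_mem (ih₁ L hL) (ih₂ L ((h₁.symm.append_left L).trans hL))
      rwa [sub_add_sub_cancel] at this
  exact key w w' p [] (by simp)

theorem val_sub_mem_fil {g : UGraph F} (lab : F → Fin n) {w w' : List F} (h : g.IsLay w)
    (p : w.Perm w') {u : ℕ} (hu : w.length ≤ u + 1) : g.val lab w - g.val lab w' ∈ Fil n u :=
  val_sub_mem_of_perm _ lab h p fun y z hy hz hyz lab' v hv hl => val_mem_fil lab' hv (by omega)

theorem conn_mergeLegs {g : UGraph F} (hg : g.Conn) {y z : F} (hy : g.rot y = y) (hz : g.rot z = z)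
    (hyz : y ≠ z) : (g.mergeLegs y z hy hz hyz).Conn := by
  set m := g.mergeLegs y z hy hz hyz with hm
  have s0 : FlagConn m.inv m.rot (.inr 0) (.inr 1) := .inv_step (inv := m.inv) (rot := m.rot) _
  have s1 : FlagConn m.inv m.rot (.inr 1) (.inr 0) := .inv_step (inv := m.inv) (rot := m.rot) _
  have s2 : FlagConn m.inv m.rot (.inr 0) (.inl z) := .rot_step (inv := m.inv) (rot := m.rot) _
  have sy : FlagConn m.inv m.rot (.inl y) (.inr 0) := by
    have := FlagConn.rot_step (inv := m.inv) (rot := m.rot) (.inl y)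
    simpa [hm, mergeLegs, mergeRot] using this
  have sz : FlagConn m.inv m.rot (.inl z) (.inl y) := by
    have := FlagConn.rot_step (inv := m.inv) (rot := m.rot) (.inl z)
    simpa [hm, mergeLegs, mergeRot, hyz.symm] using this
  have key : ∀ a b, FlagConn m.inv m.rot (.inl a) (.inl b) := by
    intro a b
    refine (hg a b).map Sum.inl (fun c => .inv_step (Sum.inl c)) fun c => ?_
    by_cases h : c = y
    · subst h; rw [hy]; exact .refl
    · by_cases h' : c = z
      · subst h'; rw [hz]; exact .refl
      · have := FlagConn.rot_step (inv := m.inv) (rot := m.rot) (.inl c)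
        simpa [hm, mergeLegs, mergeRot, h, h'] using this
  have to' : ∀ a, FlagConn m.inv m.rot a (.inl z) := by
    rintro (a | a)
    · exact key a z
    · fin_cases a
      exacts [s2, s1.trans s2]
  have of' : ∀ a, FlagConn m.inv m.rot (.inl z) a := by
    rintro (a | a)
    · exact key z a
    · fin_cases a
      exacts [sz.trans sy, (sz.trans sy).trans s0]
  exact fun a b => (to' a).trans (of' b)

theorem isLay_strut : strutG.IsLay [0, 1] := by
  refine ⟨by decide, fun a => ?_⟩; fin_cases a <;> simp [strutG, strutDiag]

theorem isLay_tripod : tripodG.IsLay [0, 1, 2] := by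
  refine ⟨by decide, fun a => ?_⟩; fin_cases a <;> simp [tripodG, tripodDiag]

theorem isLay_h : hG.IsLay [0, 1, 2, 3] := by
  refine ⟨by decide, fun a => ?_⟩; fin_cases a <;> simp [hG, hDiag]

theorem isLay_wheel : wheelG.IsLay [0, 1] := by
  refine ⟨by decide, fun a => ?_⟩; fin_cases a <;> simp [wheelG, wheelDiag]

theorem isLay_comb : combG.IsLay [.inl 0, .inl 1, .inl 2, .inl 3, .inr 3] :=
  (isLay_insert 8 (L := [0, 1, 2, 3]) (R := []) isLay_h)

theorem isLay_triangle : triangleG.IsLay [.inl 0, .inl 1, .inr 3] :=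
  (isLay_insert 7 (L := [0, 1]) (R := []) isLay_wheel)

theorem internal_wheel : ∀ k, 4 ≤ k → wheelG.Internal k := by
  intro k hk
  constructor <;> fin_cases k <;> simp_all [wheelG, wheelDiag]

/-- The reflection of the triangle that exchanges `inl 0` and `inr 3`. -/
def triangleRefl : Fin 8 ⊕ Fin 4 → Fin 8 ⊕ Fin 4 :=
  Sum.elim ![.inr 3, .inl 1, .inr 2, .inl 3, .inr 0, .inl 7, .inr 1, .inl 5]
    ![.inl 4, .inl 6, .inl 2, .inl 0]

theorem triangleRefl_involutive : Function.Involutive triangleRefl := by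
  unfold Function.Involutive; decide

/-- A reflection of the plane reverses the orientation of all three vertices, whence the three
reversals. -/
def triangleEquiv : triangleG.Equiv (((triangleG.flip (.inl 2)).flip (.inl 3)).flip (.inr 2)) where
  e := triangleRefl_involutive.toPerm
  inv := by
    rintro (a | a) <;> fin_cases a <;>
      simp [triangleG, wheelG, wheelDiag, insertLeg, insertInv, triangleRefl]
  rot := by
    rintro (a | a) <;> fin_cases a <;>
      simp [triangleG, wheelG, wheelDiag, insertLeg, insertRot, triangleRefl, flip, flipRot, Orb]

/-- The reflection contributes a sign for each of the three vertices. The leg of `inr 3` is inserted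
on an internal edge of the circle with two legs, so its label and foot may be adapted to those of
`inl 0`, with which the reflection exchanges it. Then the reflected diagram has the same value,
which therefore equals its negative. -/
theorem null_triangle : triangleG.Null n := by
  have anti : ∀ (lab : Fin 8 ⊕ Fin 4 → Fin n) (w : List (Fin 8 ⊕ Fin 4)), triangleG.IsLay w →
      triangleG.val (lab ∘ triangleRefl) (w.map triangleRefl) = - triangleG.val lab w := by
    intro lab w hw
    have h1 := triangleEquiv.isLay hw
    have h2 := isLay_flip.1 h1
    have h3 := isLay_flip.1 h2
    have v0 : triangleG.rot (.inl 2) ≠ .inl 2 := by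
      simp [triangleG, wheelG, wheelDiag, insertLeg, insertRot]
    have v1 : (triangleG.flip (.inl 2)).rot (.inl 3) ≠ .inl 3 := by
      rw [Ne, flip_rot_eq_iff]
      simp [triangleG, wheelG, wheelDiag, insertLeg, insertRot]
    have v2 : ((triangleG.flip (.inl 2)).flip (.inl 3)).rot (.inr 2) ≠ .inr 2 := by
      rw [Ne, flip_rot_eq_iff, flip_rot_eq_iff]
      simp [triangleG, wheelG, wheelDiag, insertLeg, insertRot]
    rw [val_iso' triangleEquiv hw, val_flip _ v2 _ h2, val_flip _ v1 _ h3,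
      val_flip _ v0 _ (isLay_flip.1 h3), neg_neg, neg_neg]
    rfl
  refine null_iff.2 fun lab w hw => ?_
  have hi := internal_wheel 7 (by decide)
  have key : ∀ w₀, triangleG.IsLay w₀ → subst (fun _ => []) w₀ = subst (fun _ => []) w →
      subst (fun _ => []) (w₀.map triangleRefl) = subst (fun _ => []) w₀ →
      triangleG.val lab w = 0 := by
    intro w₀ h₀ e e'
    have h₁ : triangleG.IsLay (w₀.map triangleRefl) :=
      isLay_flip.1 (isLay_flip.1 (isLay_flip.1 (triangleEquiv.isLay h₀)))
    -- The free leg receives the label of the foot with which it is exchanged.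
    set lab₀ : Fin 8 ⊕ Fin 4 → Fin n := Sum.elim (fun c => lab (.inl c)) fun _ => lab (.inl 0)
      with hlab₀
    have e1 := anti lab₀ w₀ h₀
    have e2 := val_insert_free (lab := lab₀) (lab' := lab₀) hi h₁ h₀ (fun _ => rfl) e'
    have e3 : triangleG.val (lab₀ ∘ triangleRefl) (w₀.map triangleRefl) =
        triangleG.val lab₀ (w₀.map triangleRefl) := by
      refine val_congr_lab ?_
      intro a ha
      have := h₁.rot_eq ha
      revert this
      rcases a with a | a <;> fin_cases a <;>
        simp [triangleG, insertLeg, insertRot, wheelG, wheelDiag, triangleRefl, hlab₀]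
    have e4 : (2 : ℚ) • triangleG.val lab₀ w₀ = 0 := by
      rw [e3] at e1
      have e5 : triangleG.val lab₀ (w₀.map triangleRefl) = triangleG.val lab₀ w₀ :=
        d_smul_cancel _ e2
      rw [two_smul]
      nth_rewrite 1 [← e5]
      rw [e1, neg_add_cancel]
    have e5 := (smul_eq_zero_iff_right (by norm_num : (2 : ℚ) ≠ 0)).1 e4
    have e6 := val_insert_free (lab := lab) (lab' := lab₀) hi hw h₀ (fun _ => rfl) e.symm
    refine d_smul_cancel (lab₀ (.inr 3)) (e6.trans ?_)
    have e7 : (wheelG.insertLeg 7).val lab₀ w₀ = 0 := e5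
    rw [e7, smul_zero, smul_zero]
  have hp := (isLay_subst_insert hw).perm_of isLay_wheel
  have h2 : subst (fun _ => []) w = [0, 1] ∨ subst (fun _ => []) w = [1, 0] := by
    have key : ∀ x y : Fin 8, [x, y].Perm [0, 1] → [x, y] = [0, 1] ∨ [x, y] = [1, 0] := by decide
    obtain ⟨x, y, e⟩ := List.length_eq_two.1 hp.length_eq
    rw [e] at hp ⊢
    exact key x y hp
  -- The free foot is placed next to `inl 0`, so that the reflected word differs only in the
  -- position of the free foot.
  rcases h2 with h2 | h2
  · refine key [.inl 0, .inr 3, .inl 1] (isLay_triangle.perm (by decide)) ?_ ?_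
    · rw [h2]; rfl
    · rfl
  · refine key [.inl 1, .inr 3, .inl 0] (isLay_triangle.perm (by decide)) ?_ ?_
    · rw [h2]; rfl
    · rfl

/-- A connected graph with u feet and t trivalent vertices has u + 3t half-edges and first Betti
number 1 + (t − u)/2, so the inequality says that it contains a circle. Removing two legs costs
eight half-edges and two feet and preserves the inequality. Among the small graphs only the circle
with two legs and the vanishing triangle satisfy it. -/
theorem val_mem_fil_two_of_card [NeZero n] {g : UGraph F} (hg : g.Conn) (lab : F → Fin n)
    {w : List F} (h : g.IsLay w) (hc : 4 * w.length ≤ Nat.card F) : g.val lab w ∈ Fil n 2 := by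
  induction hk : Nat.card F using Nat.strong_induction_on generalizing F with
  | _ k ih =>
  have hn : ∀ {F : Type} {g : UGraph F} {w : List F}, g.IsLay w → w.length = 0 → ∀ lab : F → Fin n,
      g.val lab w ∈ Fil n 2 := fun h hw lab => val_mem_fil lab h (by omega)
  by_cases hF : Nonempty F
  swap
  · cases w with
    | nil => exact hn h rfl lab
    | cons a w => exact absurd ⟨a⟩ hF
  have len : ∀ {G : Type} {E : UGraph G} {w' w'' : List G}, E.IsLay w' → E.IsLay w'' →
      w'.length = w''.length := fun h h' => (h.perm_of h').length_eq
  rcases classified (n := n) hg with h1 | ⟨F₀, g₀, h0, h1, h2⟩ | ⟨h1, h2⟩ | ⟨h1, h2⟩ | ⟨h1, h2⟩ |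
    ⟨h1, h2⟩ | ⟨h1, h2⟩ | ⟨h1, h2⟩
  · rw [h1]; exact zero_mem _
  · obtain ⟨c, lab', w', e1, e2, e3⟩ := h2 lab w h
    rw [e3]
    exact Submodule.smul_mem _ _ (ih (Nat.card F₀) (by omega) h0 lab' e1 (by omega) rfl)
  · obtain ⟨c, lab', w', e1, e2, e3⟩ := h2 lab w h
    have e4 := len e1 isLay_strut
    simp at e4 h1; omega
  · obtain ⟨c, lab', w', e1, e2, e3⟩ := h2 lab w h
    have e4 := len e1 isLay_tripod
    simp at e4 h1; omega
  · obtain ⟨c, lab', w', e1, e2, e3⟩ := h2 lab w h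
    have e4 := len e1 isLay_h
    simp at e4 h1; omega
  · obtain ⟨c, lab', w', e1, e2, e3⟩ := h2 lab w h
    have e4 := len e1 isLay_comb
    simp at e4 h1; omega
  · obtain ⟨c, lab', w', e1, e2, e3⟩ := h2 lab w h
    rw [e3]
    exact Submodule.smul_mem _ _ (val_mem_fil lab' e1 (len e1 isLay_wheel).le)
  · obtain ⟨c, lab', w', e1, e2, e3⟩ := h2 lab w h
    rw [e3, null_triangle, smul_zero]
    exact zero_mem _

/-- Modulo diagrams with two feet, the order of the feet of a tree does not matter. -/
theorem val_sub_mem_fil_two [NeZero n] {g : UGraph F} (hg : g.Conn) (lab : F → Fin n)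
    {w w' : List F} (h : g.IsLay w) (p : w.Perm w') (hc : 4 * w.length ≤ Nat.card F + 6) :
    g.val lab w - g.val lab w' ∈ Fil n 2 :=
  -- A tree with u feet has 4u − 6 half-edges. Joining two feet removes one foot and adds two
  -- half-edges, and the resulting graph meets the bound of `val_mem_fil_two_of_card`.
  val_sub_mem_of_perm _ lab h p fun y z hy hz hyz lab' v hv hl =>
    val_mem_fil_two_of_card (conn_mergeLegs hg hy hz hyz) lab' hv (by
      have := g.finite
      rw [Nat.card_sum]
      simp
      omega)

end UGraph
end TriDiag

namespace TriDiag
variable {n : ℕ} {F F' G H : Type}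
namespace UGraph

/-! ### Spanning sets of values -/

/-- All values of `g` with the labelling `lab` lie in `P`. -/
def Mem (P : Submodule (Lam n) (C n)) (g : UGraph F) (lab : F → Fin n) : Prop :=
  ∀ w, g.IsLay w → g.val lab w ∈ P

/-- Modulo `P`, the values of `g` do not depend on the order of the feet. -/
def OrderFree (P : Submodule (Lam n) (C n)) (g : UGraph F) : Prop :=
  ∀ (lab : F → Fin n) (w w' : List F), g.IsLay w → w.Perm w' → g.val lab w - g.val lab w' ∈ P

variable {P : Submodule (Lam n) (C n)}

theorem OrderFree.mem {g : UGraph F} (hf : g.OrderFree P) {lab : F → Fin n} {w : List F} (hw : g.IsLay w)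
    (h : g.val lab w ∈ P) : g.Mem P lab := fun w' hw' => by
  have := sub_mem h (hf lab w w' hw (hw.perm_of hw'))
  rwa [sub_sub_cancel] at this

theorem Mem.iso {g : UGraph F} {g' : UGraph G} (φ : g.Equiv g') {lab : F → Fin n}
    {lab' : G → Fin n} (h : g'.Mem P lab') (hl : ∀ a, g.rot a = a → lab' (φ.e a) = lab a) :
    g.Mem P lab := fun w hw => by
  rw [val_iso φ hw lab' fun a ha => hl a (hw.rot_eq ha)]
  exact h _ (φ.isLay hw)

theorem Mem.flip {g : UGraph F} {v : F} (hv : g.rot v ≠ v) {lab : F → Fin n}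
    (h : g.Mem P lab) : (g.flip v).Mem P lab := fun w hw => by
  rw [val_flip g hv lab (isLay_flip.1 hw), neg_mem_iff]
  exact h w (isLay_flip.1 hw)

theorem Mem.slide {g : UGraph F} {v : F} (hv : g.rot v ≠ v) {lab : F ⊕ Fin 4 → Fin n}
    (h₁ : (g.insertLeg (g.rot v)).Mem P lab) (h₂ : (g.insertLeg (g.rot (g.rot v))).Mem P lab) :
    (g.insertLeg v).Mem P lab := fun w hw => by
  have := g.val_slide hv lab hw
  rw [add_assoc] at this
  rw [eq_neg_of_add_eq_zero_left this, neg_mem_iff]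
  exact add_mem (h₁ w hw) (h₂ w hw)

theorem smul_d_mem_iff (i : Fin n) {x : C n} : d i • x ∈ P ↔ x ∈ P := by
  obtain ⟨u, hu⟩ := isUnit_d i
  rw [← hu]
  exact Submodule.smul_mem_iff_of_isUnit P u.isUnit

theorem Mem.insert_insert {g : UGraph F} {a : F} (ha : g.Internal a)
    {lab : (F ⊕ Fin 4) ⊕ Fin 4 → Fin n} (h : g.Mem P fun c => lab (.inl (.inl c))) :
    ((g.insertLeg a).insertLeg (.inr 1)).Mem P lab := fun w hw => by
  rw [val_cl2 ha hw]
  exact P.smul_mem _ (h _ (isLay_subst_insert (isLay_subst_insert hw)))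

/-- The factor in (CL2) is a unit, so the relation can also be read backwards: neighbouring legs may
be attached in order to prove membership. -/
theorem Mem.of_insert_insert {g : UGraph F} {a : F} (ha : g.Internal a)
    {lab : (F ⊕ Fin 4) ⊕ Fin 4 → Fin n} (h : ((g.insertLeg a).insertLeg (.inr 1)).Mem P lab) :
    g.Mem P fun c => lab (.inl (.inl c)) := fun w hw => by
  have hW := isLay_insert_cons (g := g.insertLeg a) (.inr 1) (isLay_insert_cons a hw)
  have := h _ hW
  rw [val_cl2 ha hW, mul_smul, smul_d_mem_iff, smul_d_mem_iff] at this
  simpa only [subst_inr, subst_inl, subst_map_inl, List.nil_append] using this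

theorem Mem.insert_congr {g : UGraph F} {a : F} (ha : g.Internal a) {lab lab' : F ⊕ Fin 4 → Fin n}
    (h : (g.insertLeg a).Mem P lab) (hl : ∀ c, lab' (.inl c) = lab (.inl c)) :
    (g.insertLeg a).Mem P lab' := fun w hw => by
  have := val_insert_free ha hw hw hl rfl
  rw [← smul_d_mem_iff (lab (.inr 3)), this, smul_d_mem_iff]
  exact h w hw

/-- A labelled graph that is isomorphic to its opposite. -/
theorem Mem.of_anti {g : UGraph F} (hf : g.OrderFree P) {v : F} (hv : g.rot v ≠ v)
    (φ : g.Equiv (g.flip v)) {lab : F → Fin n} (hl : ∀ a, g.rot a = a → lab (φ.e a) = lab a) :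
    g.Mem P lab := fun w hw => by
  have h1 := val_iso φ hw lab fun a ha => hl a (hw.rot_eq ha)
  have h3 := isLay_flip.1 (φ.isLay hw)
  rw [val_flip g hv lab h3] at h1
  have h2 := hf lab w _ hw (hw.perm_of h3)
  rw [eq_neg_of_add_eq_zero_right (a := g.val lab w) (b := g.val lab (w.map φ.e))
    (by rw [h1, neg_add_cancel]), sub_neg_eq_add, ← two_smul ℚ] at h2
  have := P.smul_mem (algebraMap ℚ (Lam n) 2⁻¹) h2
  rwa [algebraMap_smul, smul_smul, inv_mul_cancel₀ two_ne_zero, one_smul] at this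

theorem free_of_length {g : UGraph F} {w₀ : List F} (h₀ : g.IsLay w₀) {u : ℕ}
    (hu : w₀.length ≤ u + 1) (hP : Fil n u ≤ P) : g.OrderFree P := fun lab w w' hw p =>
  hP (val_sub_mem_fil lab hw p (by rwa [(hw.perm_of h₀).length_eq]))

/-- For trees this is stronger than `free_of_length`: only the diagrams with two feet need to lie in
`P`. The comb with five feet has to be compared with the tripod at a stage where diagrams with four
feet are not yet available. -/
theorem free_of_card [NeZero n] {g : UGraph F} (hg : g.Conn) {w₀ : List F} (h₀ : g.IsLay w₀)
    (hc : 4 * w₀.length ≤ Nat.card F + 6) (hP : Fil n 2 ≤ P) : g.OrderFree P := fun lab w w' hw p =>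
  hP (val_sub_mem_fil_two hg lab hw p (by rwa [(hw.perm_of h₀).length_eq]))

/-! ### Connectedness of the small graphs -/

/-- Follow a path given by a list of steps. -/
def walk (g : UGraph F) (l : List Bool) (a : F) : F :=
  l.foldl (fun a s => if s then g.rot a else g.inv a) a

theorem flagConn_walk (g : UGraph F) (l : List Bool) (a : F) :
    FlagConn g.inv g.rot a (g.walk l a) := by
  induction l generalizing a with
  | nil => exact .refl
  | cons s l ih =>
    refine Relation.ReflTransGen.trans (b := if s then g.rot a else g.inv a) ?_ (ih _)
    split_ifs
    exacts [FlagConn.rot_step a, FlagConn.inv_step a]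

theorem flagConn_symm (g : UGraph F) {a b : F} (h : FlagConn g.inv g.rot a b) :
    FlagConn g.inv g.rot b a := by
  induction h with
  | refl => exact .refl
  | @tail b c _ h ih =>
    refine Relation.ReflTransGen.trans ?_ ih
    rcases h with rfl | rfl
    · have := FlagConn.inv_step (inv := g.inv) (rot := g.rot) (g.inv b)
      rwa [g.inv_inv] at this
    · have := (FlagConn.rot_step (inv := g.inv) (rot := g.rot) (g.rot b)).trans (FlagConn.rot_step _)
      rwa [g.rot_rot_rot] at this

/-- Explicit walks to a base point make connectedness of a concrete graph decidable. -/
theorem conn_of_walk {g : UGraph F} {b : F} (l : F → List Bool) (h : ∀ a, g.walk (l a) a = b) :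
    g.Conn := fun a c => by
  have h1 := g.flagConn_walk (l a) a
  have h2 := g.flagConn_walk (l c) c
  rw [h] at h1 h2
  exact h1.trans (g.flagConn_symm h2)

theorem conn_strut : strutG.Conn :=
  conn_of_walk (b := 0) ![[], [false]] (by decide)

theorem conn_tripod : tripodG.Conn :=
  conn_of_walk (b := 3) ![[false], [false, true, true], [false, true], [], [true, true], [true]]
    (by decide)

theorem conn_h : hG.Conn :=
  conn_of_walk (b := 8) ![[false, true, true], [false, true], [false, true, false],
    [false, true, true, false], [true, true], [true], [true, false], [true, true, false], [],
    [false]] (by decide)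

theorem conn_wheel : wheelG.Conn :=
  conn_of_walk (b := 2) ![[false], [false, true, false, true], [], [true, false, true], [true],
    [false, true], [true, true], [false, true, true]] (by decide)

theorem conn_insertLeg {g : UGraph F} (hg : g.Conn) (a : F) : (g.insertLeg a).Conn := by
  have h := g.insert_conn a
  have h1 : ∀ c d, FlagConn (g.insertLeg a).inv (g.insertLeg a).rot (.inl c) (.inl d) :=
    fun c d => (hg c d).map Sum.inl h.1 fun c => .rot_step (Sum.inl c)
  have h2 : ∀ c, FlagConn (g.insertLeg a).inv (g.insertLeg a).rot c (.inl a) := by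
    rintro (c | c)
    · exact h1 c a
    · have h3 : FlagConn (g.insertLeg a).inv (g.insertLeg a).rot (.inr c) (.inr 3) := h.2 c
      have h4 : FlagConn (g.insertLeg a).inv (g.insertLeg a).rot (.inr 0) (.inr 3) := h.2 0
      exact (h3.trans ((g.insertLeg a).flagConn_symm h4)).trans (FlagConn.inv_step _)
  exact fun c d => (h2 c).trans ((g.insertLeg a).flagConn_symm (h2 d))

end UGraph
end TriDiag

/-! ### Relations between the labels of combs and tripods -/

namespace TriDiag
variable {n : ℕ} {F F' G H : Type}
namespace UGraph
variable {P : Submodule (Lam n) (C n)}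

/-- An isomorphism given by an injective map between finite sets of the same size. -/
def equivOfInjective {g : UGraph F} {g' : UGraph G} (φ : F → G) (hφ : Function.Injective φ)
    (hc : Nat.card F = Nat.card G) (hi : ∀ a, φ (g.inv a) = g'.inv (φ a))
    (hr : ∀ a, φ (g.rot a) = g'.rot (φ a)) : g.Equiv g' where
  e := _root_.Equiv.ofBijective φ (by
    have := g.finite
    have := g'.finite
    exact (Nat.bijective_iff_injective_and_card φ).2 ⟨hφ, hc⟩)
  inv := hi
  rot := hr

/-- Labels for the feet of the letter H. -/
def hLab (a b c e : Fin n) : Fin 10 → Fin n := ![a, b, c, e, a, b, c, e, a, a]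

/-- Labels for the feet of a row of three vertices. -/
def combLab (a b c d e : Fin n) : Fin 10 ⊕ Fin 4 → Fin n := Sum.elim (hLab a b d e) fun _ => c

/-- Labels for the feet of a tripod. -/
def tripodLab (a b c : Fin n) : Fin 6 → Fin n := ![a, b, c, a, b, c]

theorem internal_h : hG.Internal 8 := by constructor <;> simp [hG, hDiag]

theorem rot_h_ne : hG.rot 8 ≠ 8 := by simp [hG, hDiag]

/-- The middle leg is inserted on the bar of the letter H, so its label only matters up to units. -/
theorem comb_congr (a b c c' d e : Fin n) (h : combG.Mem P (combLab a b c d e)) :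
    combG.Mem P (combLab a b c' d e) :=
  Mem.insert_congr internal_h h fun _ => rfl

theorem rot_comb_inl : combG.rot (.inl 8) ≠ .inl 8 := by
  simp [combG, insertLeg, insertRot, hG, hDiag]

theorem rot_comb_inr : combG.rot (.inr 0) ≠ .inr 0 := by
  simp [combG, insertLeg, insertRot, hG, hDiag]

def combSwap : combG.Equiv (combG.flip (.inl 8)) :=
  equivOfInjective (Sum.map ![1, 0, 2, 3, 5, 4, 6, 7, 8, 9] id) (by decide) rfl
    (by rintro (a | a) <;> fin_cases a <;> simp [combG, insertLeg, insertInv, hG, hDiag])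
    (by rintro (a | a) <;> fin_cases a <;>
          simp [combG, insertLeg, insertRot, hG, hDiag, flip, flipRot, Orb])

theorem comb_swap {a b c d e : Fin n} (h : combG.Mem P (combLab a b c d e)) :
    combG.Mem P (combLab b a c d e) := by
  refine (h.flip rot_comb_inl).iso combSwap ?_
  rintro (x | x) hx <;> fin_cases x <;> revert hx <;>
    simp [combSwap, equivOfInjective, combG, insertLeg, insertRot, hG, hDiag, combLab, hLab]

def combRev : combG.Equiv (combG.flip (.inr 0)) :=
  equivOfInjective (Sum.map ![3, 2, 1, 0, 7, 6, 5, 4, 9, 8] ![1, 0, 2, 3]) (by decide) rfl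
    (by rintro (a | a) <;> fin_cases a <;> simp [combG, insertLeg, insertInv, hG, hDiag])
    (by rintro (a | a) <;> fin_cases a <;>
          simp [combG, insertLeg, insertRot, hG, hDiag, flip, flipRot, Orb])

theorem comb_rev {a b c d e : Fin n} (h : combG.Mem P (combLab a b c d e)) :
    combG.Mem P (combLab e d c b a) := by
  refine (h.flip rot_comb_inr).iso combRev ?_
  rintro (x | x) hx <;> fin_cases x <;> revert hx <;>
    simp [combRev, equivOfInjective, combG, insertLeg, insertRot, hG, hDiag, combLab, hLab]

def combFive : (hG.insertLeg 5).Equiv combG :=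
  equivOfInjective (Sum.elim ![.inr 3, .inl 0, .inl 2, .inl 3, .inr 2, .inr 0, .inl 6, .inl 7,
      .inr 1, .inl 9] ![.inl 8, .inl 4, .inl 5, .inl 1]) (by decide) rfl
    (by rintro (a | a) <;> fin_cases a <;> simp [combG, insertLeg, insertInv, hG, hDiag])
    (by rintro (a | a) <;> fin_cases a <;> simp [combG, insertLeg, insertRot, hG, hDiag])

def combFour : (hG.insertLeg 4).Equiv (combG.flip (.inr 0)) :=
  equivOfInjective (Sum.elim ![.inl 0, .inr 3, .inl 2, .inl 3, .inr 0, .inr 2, .inl 6, .inl 7,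
      .inr 1, .inl 9] ![.inl 8, .inl 4, .inl 5, .inl 1]) (by decide) rfl
    (by rintro (a | a) <;> fin_cases a <;> simp [combG, insertLeg, insertInv, hG, hDiag])
    (by rintro (a | a) <;> fin_cases a <;>
          simp [combG, insertLeg, insertRot, hG, hDiag, flip, flipRot, Orb])

/-- The slide relation at the left vertex of the letter H: the middle leg moves to either of the two
outer legs, and both results are again combs. -/
theorem comb_jacobi {a b c d e : Fin n} (h₁ : combG.Mem P (combLab b c a d e))
    (h₂ : combG.Mem P (combLab a c b d e)) : combG.Mem P (combLab a b c d e) := by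
  have e4 : hG.rot 8 = 4 := rfl
  have e5 : hG.rot 4 = 5 := rfl
  refine Mem.slide rot_h_ne ?_ ?_
  · rw [e4]
    refine (h₂.flip rot_comb_inr).iso combFour ?_
    rintro (x | x) hx <;> fin_cases x <;> revert hx <;>
      simp [combFour, equivOfInjective, insertLeg, insertRot, hG, hDiag, combLab, hLab]
  · rw [e4, e5]
    refine h₁.iso combFive ?_
    rintro (x | x) hx <;> fin_cases x <;> revert hx <;>
      simp [combFive, equivOfInjective, insertLeg, insertRot, hG, hDiag, combLab, hLab]

/-! Relations between tripods -/

def tripodRot : tripodG.Equiv tripodG :=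
  equivOfInjective ![1, 2, 0, 4, 5, 3] (by decide) rfl (by decide) (by decide)

theorem tripod_rot {a b c : Fin n} (h : tripodG.Mem P (tripodLab a b c)) :
    tripodG.Mem P (tripodLab b c a) := by
  refine h.iso tripodRot ?_
  intro x hx; fin_cases x <;> revert hx <;>
    simp [tripodRot, equivOfInjective, tripodG, tripodDiag, tripodLab]

theorem rot_tripod_ne : tripodG.rot 3 ≠ 3 := by simp [tripodG, tripodDiag]

def tripodSwap : tripodG.Equiv (tripodG.flip 3) :=
  equivOfInjective ![0, 2, 1, 3, 5, 4] (by decide) rfl (by decide)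
    (by intro a; fin_cases a <;> simp [tripodG, tripodDiag, flip, flipRot, Orb])

theorem tripod_swap {a b c : Fin n} (h : tripodG.Mem P (tripodLab a b c)) :
    tripodG.Mem P (tripodLab a c b) := by
  refine (h.flip rot_tripod_ne).iso tripodSwap ?_
  intro x hx; fin_cases x <;> revert hx <;>
    simp [tripodSwap, equivOfInjective, tripodG, tripodDiag, tripodLab]

theorem tripod_anti (hP : tripodG.OrderFree P) (a b : Fin n) : tripodG.Mem P (tripodLab a b b) := by
  refine Mem.of_anti hP rot_tripod_ne tripodSwap ?_
  intro x hx; fin_cases x <;> revert hx <;>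
    simp [tripodSwap, equivOfInjective, tripodG, tripodDiag, tripodLab]

/-- The row of three vertices that (CL1) produces from a tripod, identified with the comb. -/
def tripodComb : ((tripodG.insertLeg 2).insertLeg (.inl 3)).Equiv combG :=
  equivOfInjective (Sum.elim (Sum.elim ![.inl 3, .inr 3, .inl 1, .inr 1, .inr 2, .inr 0]
      ![.inl 5, .inl 8, .inl 4, .inl 0]) ![.inl 9, .inl 7, .inl 6, .inl 2]) (by decide) (by simp)
    (by rintro ((a | a) | a) <;> fin_cases a <;>
          simp [combG, insertLeg, insertInv, hG, hDiag, tripodG, tripodDiag])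
    (by rintro ((a | a) | a) <;> fin_cases a <;>
          simp [combG, insertLeg, insertRot, hG, hDiag, tripodG, tripodDiag])

theorem two_mul_sq_smul_mem {i : Fin n} {x : C n} : (2 * d i ^ 2) • x ∈ P ↔ x ∈ P := by
  have h2 : IsUnit (2 : Lam n) := by
    have := (isUnit_iff_ne_zero.2 (two_ne_zero : (2 : ℚ) ≠ 0)).map (algebraMap ℚ (Lam n))
    rwa [map_ofNat] at this
  obtain ⟨u, hu⟩ := h2.mul ((isUnit_d i).pow 2)
  rw [← hu]
  exact Submodule.smul_mem_iff_of_isUnit P u.isUnit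

/-- (CL1) at the leg with label `i`: two combs that differ only in the order of three feet on the
interval `i` add up to 2dᵢ² times the tripod. Modulo `P` this order is irrelevant, so twice the comb
is a unit multiple of the tripod. -/
theorem comb_iff_tripod (hP : combG.OrderFree P) (hP' : tripodG.OrderFree P) (a i e : Fin n) :
    combG.Mem P (combLab i e i i a) ↔ tripodG.Mem P (tripodLab a i e) := by
  have hl : tripodG.IsLay [0, 1, 2] := isLay_tripod
  set lab : (Fin 6 ⊕ Fin 4) ⊕ Fin 4 → Fin n :=
    Sum.elim (Sum.elim (tripodLab a i e) fun _ => i) fun _ => i with hlab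
  have key := val_cl1 (g := tripodG) (lab := lab) (L := [0]) (R := [2]) (f := 1) hl
    (by simp [tripodG, tripodDiag]) rfl rfl
  have e1 : tripodG.inv (tripodG.rot (tripodG.inv 1)) = 2 := rfl
  have e2 : tripodG.rot (tripodG.rot (tripodG.inv 1)) = 3 := rfl
  rw [e1, e2] at key
  set X := (tripodG.insertLeg 2).insertLeg (.inl 3) with hX
  have l1 : X.IsLay ([.inl (.inl 0), .inl (.inr 3), .inl (.inl 1), .inr 3, .inl (.inl 2)]) := by
    refine ⟨by decide, ?_⟩
    rintro ((x | x) | x) <;> fin_cases x <;>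
      simp [hX, insertLeg, insertRot, tripodG, tripodDiag]
  have l2 : X.IsLay ([.inl (.inl 0), .inr 3, .inl (.inl 1), .inl (.inr 3), .inl (.inl 2)]) :=
    l1.perm (by decide)
  have hlab' : ∀ w, X.IsLay w → X.val lab w = combG.val (combLab i e i i a) (w.map tripodComb.e) := by
    intro w hw
    refine val_iso tripodComb hw _ ?_
    rintro x hx
    have := hw.rot_eq hx
    revert this
    rcases x with (x | x) | x <;> fin_cases x <;>
      simp [hX, tripodComb, equivOfInjective, combLab, hLab, hlab, tripodLab, insertLeg, insertRot,
        tripodG, tripodDiag]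
  have k1 := hlab' _ l1
  have k2 := hlab' _ l2
  have m1 := tripodComb.isLay l1
  have m2 := tripodComb.isLay l2
  constructor
  · intro h
    refine hP'.mem hl ?_
    have := add_mem (h _ m1) (h _ m2)
    rw [← k1, ← k2] at this
    rw [← two_mul_sq_smul_mem (i := i)]
    exact key ▸ this
  · intro h
    refine hP.mem m1 ?_
    rw [← k1]
    have h1 : X.val lab _ + X.val lab _ ∈ P := key ▸ P.smul_mem _ (h _ hl)
    -- The sum and the difference of the two combs lie in `P`; half the sum of both is the first
    -- comb.
    have h2 := hP (combLab i e i i a) _ _ m1 (m1.perm_of m2)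
    rw [← k1, ← k2] at h2
    have h3 := P.smul_mem (algebraMap ℚ (Lam n) 2⁻¹) (add_mem h1 h2)
    rw [algebraMap_smul] at h3
    convert h3 using 1
    simp only [List.map_nil, List.map_cons, List.nil_append, List.cons_append]
    module

/-- The bookkeeping of labels, separated from the diagrams: `K` and `T` stand for membership of
combs and tripods. Tripods with a label 0 give combs with three labels 0; the free middle label
together with the three-term relation spreads this to all combs, and (CL1) returns to all tripods.
-/
theorem comb_and_tripod_rules [NeZero n] {K : Fin n → Fin n → Fin n → Fin n → Fin n → Prop}
    {T : Fin n → Fin n → Fin n → Prop} (congr : ∀ a b c c' d e, K a b c d e → K a b c' d e)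
    (swap : ∀ a b c d e, K a b c d e → K b a c d e) (rev : ∀ a b c d e, K a b c d e → K e d c b a)
    (jacobi : ∀ a b c d e, K b c a d e → K a c b d e → K a b c d e)
    (trot : ∀ a b c, T a b c → T b c a) (tswap : ∀ a b c, T a b c → T a c b)
    (anti : ∀ a b, T a b b) (iff : ∀ a i e, K i e i i a ↔ T a i e)
    (ht : ∀ c d : Fin n, 0 < c → c < d → T 0 c d) :
    (∀ a b c d e, K a b c d e) ∧ ∀ a b c, T a b c := by
  have t0 : ∀ c d, T 0 c d := by
    intro c d
    rcases lt_trichotomy c d with h | rfl | h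
    · rcases (Fin.zero_le c).eq_or_lt with rfl | hc
      · exact trot _ _ _ (anti d 0)
      · exact ht c d hc h
    · exact anti _ _
    · rcases (Fin.zero_le d).eq_or_lt with rfl | hc
      · exact trot _ _ _ (trot _ _ _ (anti c 0))
      · exact tswap _ _ _ (ht d c hc h)
  have z : ∀ b e, K 0 b 0 0 e := fun b e => (iff e 0 b).2 (trot _ _ _ (trot _ _ _ (t0 b e)))
  have s4 : ∀ a b c d e, K a b c d e → K a b c e d := fun a b c d e h =>
    rev _ _ _ _ _ (swap _ _ _ _ _ (rev _ _ _ _ _ h))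
  -- In the terms of the three-term relation the labels `d` and `e` stand in the middle, where they
  -- may be replaced by 0; this leads back to `z`. The next step removes the remaining 0 at the left
  -- in the same way.
  have x0 : ∀ b d e, K 0 b 0 d e := fun b d e => rev _ _ _ _ _ (jacobi e d 0 b 0
    (congr d 0 0 e b 0 (swap _ _ _ _ _ (s4 _ _ _ _ _ (z d b))))
    (congr e 0 0 d b 0 (swap _ _ _ _ _ (s4 _ _ _ _ _ (z e b)))))
  have x : ∀ a b d e, K a b 0 d e := fun a b d e => jacobi a b 0 d e
    (congr b 0 0 a d e (swap _ _ _ _ _ (x0 b d e))) (congr a 0 0 b d e (swap _ _ _ _ _ (x0 a d e)))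
  have hk : ∀ a b c d e, K a b c d e := fun a b c d e => congr _ _ _ _ _ _ (x a b d e)
  exact ⟨hk, fun a b c => (iff a b c).1 (hk _ _ _ _ _)⟩

theorem comb_and_tripod_mem [NeZero n] (hP : combG.OrderFree P) (hP' : tripodG.OrderFree P)
    (ht : ∀ c d : Fin n, 0 < c → c < d → tripodG.Mem P (tripodLab 0 c d)) :
    (∀ a b c d e : Fin n, combG.Mem P (combLab a b c d e)) ∧
      ∀ a b c : Fin n, tripodG.Mem P (tripodLab a b c) :=
  comb_and_tripod_rules (K := fun a b c d e => combG.Mem P (combLab a b c d e))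
    (T := fun a b c => tripodG.Mem P (tripodLab a b c))
    (fun _ _ _ _ _ _ => comb_congr _ _ _ _ _ _) (fun _ _ _ _ _ => comb_swap)
    (fun _ _ _ _ _ => comb_rev) (fun _ _ _ _ _ => comb_jacobi) (fun _ _ _ => tripod_rot)
    (fun _ _ _ => tripod_swap) (tripod_anti hP') (comb_iff_tripod hP hP') ht

end UGraph
end TriDiag

namespace TriDiag
variable {n : ℕ} {F F' G H : Type}
namespace UGraph
variable {P : Submodule (Lam n) (C n)}

/-! Relations between letters H -/

def hSwap : hG.Equiv (hG.flip 8) :=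
  equivOfInjective ![1, 0, 2, 3, 5, 4, 6, 7, 8, 9] (by decide) rfl (by decide)
    (by intro a; fin_cases a <;> simp [hG, hDiag, flip, flipRot, Orb])

theorem h_swap {a b c e : Fin n} (h : hG.Mem P (hLab a b c e)) : hG.Mem P (hLab b a c e) := by
  refine (h.flip rot_h_ne).iso hSwap ?_
  intro x hx; fin_cases x <;> revert hx <;> simp [hSwap, equivOfInjective, hG, hDiag, hLab]

theorem h_anti (hP : hG.OrderFree P) (a c e : Fin n) : hG.Mem P (hLab a a c e) := by
  refine Mem.of_anti hP rot_h_ne hSwap ?_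
  intro x hx; fin_cases x <;> revert hx <;> simp [hSwap, equivOfInjective, hG, hDiag, hLab]

def hRev : hG.Equiv hG :=
  equivOfInjective ![3, 2, 1, 0, 7, 6, 5, 4, 9, 8] (by decide) rfl (by decide) (by decide)

theorem h_rev {a b c e : Fin n} (h : hG.Mem P (hLab a b c e)) : hG.Mem P (hLab e c b a) := by
  refine h.iso hRev ?_
  intro x hx; fin_cases x <;> revert hx <;> simp [hRev, equivOfInjective, hG, hDiag, hLab]

def hFive : (combG.insertLeg (.inl 5)).Equiv ((hG.insertLeg 8).insertLeg (.inr 1)) :=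
  equivOfInjective (Sum.elim (Sum.elim ![.inl (.inr 3), .inl (.inl 0), .inl (.inl 2),
      .inl (.inl 3), .inl (.inr 2), .inl (.inr 0), .inl (.inl 6), .inl (.inl 7), .inl (.inr 1),
      .inl (.inl 9)] Sum.inr) ![.inl (.inl 8), .inl (.inl 4), .inl (.inl 5), .inl (.inl 1)])
    (by decide) rfl
    (by rintro ((a | a) | a) <;> fin_cases a <;>
          simp [combG, insertLeg, insertInv, hG, hDiag])
    (by rintro ((a | a) | a) <;> fin_cases a <;>
          simp [combG, insertLeg, insertRot, hG, hDiag])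

def hFour : (combG.insertLeg (.inl 4)).Equiv
    (((hG.insertLeg 8).insertLeg (.inr 1)).flip (.inl (.inr 0))) :=
  equivOfInjective (Sum.elim (Sum.elim ![.inl (.inl 0), .inl (.inr 3), .inl (.inl 2),
      .inl (.inl 3), .inl (.inr 0), .inl (.inr 2), .inl (.inl 6), .inl (.inl 7), .inl (.inr 1),
      .inl (.inl 9)] Sum.inr) ![.inl (.inl 8), .inl (.inl 4), .inl (.inl 5), .inl (.inl 1)])
    (by decide) rfl
    (by rintro ((a | a) | a) <;> fin_cases a <;>
          simp [combG, insertLeg, insertInv, hG, hDiag])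
    (by rintro ((a | a) | a) <;> fin_cases a <;>
          simp [combG, insertLeg, insertRot, hG, hDiag, flip, flipRot, Orb])

/-- A three-term relation for one pair of labels, with an arbitrary auxiliary label `m`. Attach legs
with labels 0 and `m` to the bar and slide the leg of `m` to the legs of `a` and `b`; in both terms
two neighbouring legs on the bar can be removed, with `m` left as an outer label. -/
theorem h_jacobi [NeZero n] {a b c e m : Fin n} (h₁ : hG.Mem P (hLab a m c e))
    (h₂ : hG.Mem P (hLab b m c e)) : hG.Mem P (hLab a b c e) := by
  have e4 : combG.rot (.inl 8) = .inl 4 := rfl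
  have e5 : combG.rot (.inl 4) = .inl 5 := rfl
  -- The leg with label `m` is slid across the left vertex. On the leg of `a` it leaves `b` and 0 as
  -- neighbours on the bar, on the leg of `b` it leaves `a` and 0.
  have h3 : (combG.insertLeg (.inl 8)).Mem P (Sum.elim (combLab a b 0 c e) fun _ => m) := by
    refine Mem.slide rot_comb_inl ?_ ?_
    · rw [e4]
      refine ((Mem.insert_insert (lab := Sum.elim (Sum.elim (hLab a m c e) fun _ => b) fun _ => 0)
        internal_h h₁).flip ?_).iso hFour ?_
      · simp [insertLeg, insertRot]
      · rintro ((x | x) | x) hx <;> fin_cases x <;> revert hx <;>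
          simp [hFour, equivOfInjective, combG, insertLeg, insertRot, hG, hDiag, combLab, hLab]
    · rw [e4, e5]
      refine (Mem.insert_insert (lab := Sum.elim (Sum.elim (hLab b m c e) fun _ => a) fun _ => 0)
        internal_h h₂).iso hFive ?_
      rintro ((x | x) | x) hx <;> fin_cases x <;> revert hx <;>
        simp [hFive, equivOfInjective, combG, insertLeg, insertRot, hG, hDiag, combLab, hLab]
  have h4 := h3.iso (hG.insertTwice 8).symm
    (lab := Sum.elim (Sum.elim (hLab a b c e) fun _ => m) fun _ => 0) (by
      rintro ((x | x) | x) hx <;> rfl)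
  exact h4.of_insert_insert internal_h

/-- The three-term relation with `m = 0`, applied on both sides of the bar, reduces to one label 0
on each side; antisymmetry and symmetry of the letter H arrange the rest. -/
theorem h_mem [NeZero n] (hP : hG.OrderFree P)
    (hh : ∀ e f : Fin n, 0 < e → e ≤ f → hG.Mem P (hLab 0 e 0 f)) (a b c e : Fin n) :
    hG.Mem P (hLab a b c e) := by
  have s4 : ∀ {a b c e}, hG.Mem P (hLab a b c e) → hG.Mem P (hLab a b e c) := fun h =>
    h_rev (h_swap (h_rev h))
  have h0 : ∀ e f, hG.Mem P (hLab 0 e 0 f) := by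
    intro e f
    rcases (Fin.zero_le e).eq_or_lt with rfl | he
    · exact h_anti hP _ _ _
    rcases (Fin.zero_le f).eq_or_lt with rfl | hf
    · exact h_rev (h_anti hP _ _ _)
    rcases le_total e f with h | h
    · exact hh e f he h
    · exact s4 (h_swap (h_rev (hh f e hf h)))
  have h1 : ∀ b c e, hG.Mem P (hLab 0 b c e) := fun b c e =>
    h_rev (h_jacobi (m := 0) (h_rev (h0 b e)) (h_rev (h0 b c)))
  exact h_jacobi (m := 0) (h_swap (h1 a c e)) (h_swap (h1 b c e))

/-! Relations between circles with two legs -/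

/-- Labels for the feet of a circle. -/
def wheelLab (a b : Fin n) : Fin 8 → Fin n := ![a, b, a, b, a, a, a, a]

def wheelRot : ((wheelG.insertLeg 4).insertLeg (.inr 1)).Equiv
    ((wheelG.insertLeg 7).insertLeg (.inr 1)) :=
  equivOfInjective (Sum.elim (Sum.elim ![.inr 3, .inl (.inr 3), .inr 2, .inl (.inr 2), .inr 1,
      .inl (.inr 0), .inr 0, .inl (.inr 1)]
      ![.inl (.inl 6), .inl (.inl 4), .inl (.inl 2), .inl (.inl 0)])
      ![.inl (.inl 5), .inl (.inl 7), .inl (.inl 3), .inl (.inl 1)])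
    (by decide) rfl
    (by rintro ((a | a) | a) <;> fin_cases a <;>
          simp [insertLeg, insertInv, wheelG, wheelDiag])
    (by rintro ((a | a) | a) <;> fin_cases a <;>
          simp [insertLeg, insertRot, wheelG, wheelDiag])

/-- On a circle with four legs labelled by the neighbouring pairs 0, 0 and `a`, `b`, (CL2) may
remove either pair. -/
theorem wheel_mem [NeZero n] (h : wheelG.Mem P (wheelLab 0 0)) (a b : Fin n) :
    wheelG.Mem P (wheelLab a b) := by
  refine Mem.of_insert_insert (a := 4) (lab := Sum.elim (Sum.elim (wheelLab a b) fun _ => 0)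
    fun _ => 0) (internal_wheel 4 (by decide)) ?_
  refine (Mem.insert_insert (lab := Sum.elim (Sum.elim (wheelLab 0 0) fun _ => b) fun _ => a)
    (internal_wheel 7 (by decide)) h).iso wheelRot ?_
  rintro ((x | x) | x) hx <;> fin_cases x <;> revert hx <;>
    simp [wheelRot, equivOfInjective, insertLeg, insertRot, wheelG, wheelDiag, wheelLab]

def strutSwap : strutG.Equiv strutG :=
  equivOfInjective ![1, 0] (by decide) rfl (by decide) (by decide)

theorem strut_swap {a b : Fin n} (h : strutG.Mem P ![a, b]) : strutG.Mem P ![b, a] := by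
  refine h.iso strutSwap ?_
  intro x _; fin_cases x <;> simp [strutSwap, equivOfInjective]

theorem Mem.congr {g : UGraph F} {lab lab' : F → Fin n} (h : g.Mem P lab)
    (hl : ∀ a, g.rot a = a → lab a = lab' a) : g.Mem P lab' := h.iso (Equiv.refl g) hl

end UGraph
end TriDiag

namespace TriDiag
variable {n : ℕ} {F F' G H : Type}

/-! ### The filtration and the product -/

theorem fil_mono {u v : ℕ} (h : u ≤ v) : Fil n u ≤ Fil n v := by
  refine Submodule.span_mono ?_
  rintro _ ⟨F, g, lab, w, hw, hl, rfl⟩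
  exact ⟨F, g, lab, w, hw, hl.trans h, rfl⟩

theorem mul_mem_fil {u v : ℕ} {x y : C n} (hx : x ∈ Fil n u) (hy : y ∈ Fil n v) :
    x * y ∈ Fil n (u + v) := by
  induction hx, hy using Submodule.span_induction₂ with
  | mem_mem x y hx hy =>
    obtain ⟨F, g, lab, w, hw, hl, rfl⟩ := hx
    obtain ⟨G, g', lab', w', hw', hl', rfl⟩ := hy
    rw [UGraph.val_mul hw hw']
    exact UGraph.val_mem_fil _ (UGraph.isLay_sum hw hw') (by simp; omega)
  | zero_left => rw [zero_mul]; exact zero_mem _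
  | zero_right => rw [mul_zero]; exact zero_mem _
  | add_left x y z _ _ _ h1 h2 => rw [add_mul]; exact add_mem h1 h2
  | add_right x y z _ _ _ h1 h2 => rw [mul_add]; exact add_mem h1 h2
  | smul_left r x y _ _ h => rw [smul_mul_assoc]; exact Submodule.smul_mem _ _ h
  | smul_right r x y _ _ h => rw [mul_smul_comm]; exact Submodule.smul_mem _ _ h

def UGraph.sumComm (g : UGraph F) (g' : UGraph G) : (g.sum g').Equiv (g'.sum g) where
  e := _root_.Equiv.sumComm F G
  inv := by rintro (a | a) <;> rfl
  rot := by rintro (a | a) <;> rfl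

/-- The products in the two orders are gluings of the same disjoint union and differ only in the
order of the feet. -/
theorem commutator_mem_fil {u v t : ℕ} {x y : C n} (hx : x ∈ Fil n u) (hy : y ∈ Fil n v)
    (ht : u + v ≤ t + 1) : x * y - y * x ∈ Fil n t := by
  induction hx, hy using Submodule.span_induction₂ with
  | mem_mem x y hx hy =>
    obtain ⟨F, g, lab, w, hw, hl, rfl⟩ := hx
    obtain ⟨G, g', lab', w', hw', hl', rfl⟩ := hy
    rw [UGraph.val_mul hw hw', UGraph.val_mul hw' hw]
    have h1 := UGraph.isLay_sum hw hw'
    have h2 := UGraph.isLay_sum hw' hw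
    rw [UGraph.val_iso (g.sumComm g') h1 (Sum.elim lab' lab)
      (by rintro (a | a) _ <;> rfl)]
    have h3 := (g.sumComm g').isLay h1
    exact UGraph.val_sub_mem_fil _ h3 (h3.perm_of h2) (by simp; omega)
  | zero_left => rw [zero_mul, mul_zero, sub_zero]; exact zero_mem _
  | zero_right => rw [zero_mul, mul_zero, sub_zero]; exact zero_mem _
  | add_left x y z _ _ _ h1 h2 =>
    rw [add_mul, mul_add, add_sub_add_comm]; exact add_mem h1 h2
  | add_right x y z _ _ _ h1 h2 =>
    rw [add_mul, mul_add, add_sub_add_comm]; exact add_mem h1 h2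
  | smul_left r x y _ _ h =>
    rw [smul_mul_assoc, mul_smul_comm, ← smul_sub]; exact Submodule.smul_mem _ _ h
  | smul_right r x y _ _ h =>
    rw [smul_mul_assoc, mul_smul_comm, ← smul_sub]; exact Submodule.smul_mem _ _ h

/-- To leading order, `χ` is given by any arrangement of the feet. -/
theorem UDiag.chi_sub_val_mem_fil (D : UDiag n F) (hD : D.toUGraph.Conn) {lab : F → Fin n}
    (hl : ∀ a (h : D.rot a = a), D.lab ⟨a, h⟩ = lab a) {w : List F} (hw : D.toUGraph.IsLay w)
    {u : ℕ} (hu : w.length ≤ u + 1) : D.chi - D.toUGraph.val lab w ∈ Fil n u := by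
  have hne : Nonempty {w // D.IsOrdering w} := by
    refine ⟨fun i => w.filter fun a => lab a = i, fun i => hw.1.filter _, fun i a => ?_,
      fun i a b c _ _ => hD a b⟩
    simp only [List.mem_filter, decide_eq_true_eq, hw.2]
    constructor
    · rintro ⟨h, rfl⟩; exact ⟨h, hl a h⟩
    · rintro ⟨h, rfl⟩; exact ⟨h, (hl a h).symm⟩
  have hc : (Fintype.card {w // D.IsOrdering w} : ℚ) ≠ 0 := Nat.cast_ne_zero.2 Fintype.card_ne_zero
  have key : ∀ v : {w // D.IsOrdering w}, (D.glue v.1 v.2).toC - D.toUGraph.val lab w ∈ Fil n u := by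
    intro v
    have hv : ∀ i, ∀ a ∈ (D.glue v.1 v.2).feet i, lab a = i := by
      intro i a ha
      obtain ⟨h, h'⟩ := (v.2.mem_iff i a).1 ha
      rw [← hl a h, h']
    rw [TDiag.toC_eq_val _ lab hv]
    have h1 := (D.glue v.1 v.2).isLay_flatMap
    have hp := UGraph.IsLay.perm_of h1 hw
    exact UGraph.val_sub_mem_fil lab h1 hp (by rwa [hp.length_eq])
  have e : D.chi - D.toUGraph.val lab w = algebraMap ℚ (Lam n)
      (Fintype.card {w // D.IsOrdering w} : ℚ)⁻¹ • ∑ v : {w // D.IsOrdering w},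
        ((D.glue v.1 v.2).toC - D.toUGraph.val lab w) := by
    rw [Finset.sum_sub_distrib, algebraMap_smul, smul_sub, Finset.sum_const, Finset.card_univ,
      ← Nat.cast_smul_eq_nsmul ℚ, smul_smul, inv_mul_cancel₀ hc, one_smul, UDiag.chi]
  rw [e]
  exact Submodule.smul_mem _ _ (Submodule.sum_mem _ fun v _ => key v)

theorem strut_chi_sub (a b : Fin n) :
    (strutDiag a b).chi - UGraph.strutG.val ![a, b] [0, 1] ∈ Fil n 1 :=
  (strutDiag a b).chi_sub_val_mem_fil UGraph.conn_strut (fun _ _ => rfl) UGraph.isLay_strut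
    le_rfl

theorem tripod_chi_sub (a b c : Fin n) :
    (tripodDiag a b c).chi - UGraph.tripodG.val (UGraph.tripodLab a b c) [0, 1, 2] ∈ Fil n 2 :=
  (tripodDiag a b c).chi_sub_val_mem_fil UGraph.conn_tripod (fun _ _ => rfl) UGraph.isLay_tripod
    le_rfl

theorem h_chi_sub (a b c e : Fin n) :
    (hDiag a b c e).chi - UGraph.hG.val (UGraph.hLab a b c e) [0, 1, 2, 3] ∈ Fil n 3 :=
  (hDiag a b c e).chi_sub_val_mem_fil UGraph.conn_h (fun _ _ => rfl) UGraph.isLay_h le_rfl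

theorem wheel_chi_sub (a b : Fin n) :
    (wheelDiag a b).chi - UGraph.wheelG.val (UGraph.wheelLab a b) [0, 1] ∈ Fil n 1 :=
  (wheelDiag a b).chi_sub_val_mem_fil UGraph.conn_wheel (fun _ _ => rfl) UGraph.isLay_wheel
    le_rfl

/-! ### The generators -/

section Gen
variable [NeZero n]

/-- The number of feet of a generator. -/
def Gen.wt : Gen n → ℕ
  | strut _ _ _ => 2
  | tripod _ _ _ _ => 3
  | h _ _ _ _ => 4
  | wheel => 2

theorem Gen.two_le_wt (g : Gen n) : 2 ≤ g.wt := by cases g <;> simp [Gen.wt]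

theorem mem_of_sub_mem' {R M : Type*} [Ring R] [AddCommGroup M] [Module R M] {P : Submodule R M}
    {x y : M} (h : x - y ∈ P) (hy : y ∈ P) : x ∈ P := by
  have := add_mem h hy
  rwa [sub_add_cancel] at this

theorem Gen.chi_mem_fil (g : Gen n) : g.chi ∈ Fil n g.wt := by
  cases g with
  | strut a b _ =>
    exact mem_of_sub_mem' (fil_mono (u := 1) (by simp [Gen.wt]) (strut_chi_sub a b))
      (UGraph.val_mem_fil _ UGraph.isLay_strut le_rfl)
  | tripod c d _ _ =>
    exact mem_of_sub_mem' (fil_mono (u := 2) (by simp [Gen.wt]) (tripod_chi_sub 0 c d))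
      (UGraph.val_mem_fil _ UGraph.isLay_tripod le_rfl)
  | h e f _ _ =>
    exact mem_of_sub_mem' (fil_mono (u := 3) (by simp [Gen.wt]) (h_chi_sub 0 e 0 f))
      (UGraph.val_mem_fil _ UGraph.isLay_h le_rfl)
  | wheel =>
    exact mem_of_sub_mem' (fil_mono (u := 1) (by simp [Gen.wt]) (wheel_chi_sub 0 0))
      (UGraph.val_mem_fil _ UGraph.isLay_wheel le_rfl)

/-- The span of the products of generators with at most `u` feet. -/
def ProdSpan (n : ℕ) [NeZero n] (u : ℕ) : Submodule (Lam n) (C n) :=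
  Submodule.span (Lam n) {x | ∃ l : List (Gen n), (l.map Gen.wt).sum ≤ u ∧ x = (l.map Gen.chi).prod}

theorem prodSpan_mono {u v : ℕ} (h : u ≤ v) : ProdSpan n u ≤ ProdSpan n v := by
  refine Submodule.span_mono ?_
  rintro _ ⟨l, hl, rfl⟩
  exact ⟨l, hl.trans h, rfl⟩

theorem mul_mem_prodSpan {u v : ℕ} {x y : C n} (hx : x ∈ ProdSpan n u) (hy : y ∈ ProdSpan n v) :
    x * y ∈ ProdSpan n (u + v) := by
  induction hx, hy using Submodule.span_induction₂ with
  | mem_mem x y hx hy =>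
    obtain ⟨l, hl, rfl⟩ := hx
    obtain ⟨l', hl', rfl⟩ := hy
    exact Submodule.subset_span ⟨l ++ l', by simp; omega, by simp⟩
  | zero_left => rw [zero_mul]; exact zero_mem _
  | zero_right => rw [mul_zero]; exact zero_mem _
  | add_left x y z _ _ _ h1 h2 => rw [add_mul]; exact add_mem h1 h2
  | add_right x y z _ _ _ h1 h2 => rw [mul_add]; exact add_mem h1 h2
  | smul_left r x y _ _ h => rw [smul_mul_assoc]; exact Submodule.smul_mem _ _ h
  | smul_right r x y _ _ h => rw [mul_smul_comm]; exact Submodule.smul_mem _ _ h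

theorem chi_mem_prodSpan (g : Gen n) {u : ℕ} (hu : g.wt ≤ u) : g.chi ∈ ProdSpan n u :=
  Submodule.subset_span ⟨[g], by simpa using hu, by simp⟩

theorem prod_mem_fil (l : List (Gen n)) : (l.map Gen.chi).prod ∈ Fil n (l.map Gen.wt).sum := by
  induction l with
  | nil =>
    have h : TDiag.one.toC = (1 : C n) := map_one _
    rw [TDiag.toC_eq_val TDiag.one (fun _ => 0) (fun _ a _ => a.elim)] at h
    simp only [List.map_nil, List.prod_nil, List.sum_nil]
    rw [← h]
    refine UGraph.val_mem_fil _ TDiag.one.isLay_flatMap ?_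
    have : ∀ l : List Empty, l.length = 0 := fun l =>
      List.length_eq_zero_iff.2 (List.eq_nil_iff_forall_not_mem.2 fun a => a.elim)
    rw [this]
  | cons g l ih =>
    simp only [List.map_cons, List.prod_cons, List.sum_cons]
    exact mul_mem_fil g.chi_mem_fil ih

/-- To leading order, products of generators do not depend on the order of the factors. -/
theorem prod_sub_mem_fil {l l' : List (Gen n)} (p : l.Perm l') {u : ℕ}
    (hu : (l.map Gen.wt).sum ≤ u + 1) :
    (l.map Gen.chi).prod - (l'.map Gen.chi).prod ∈ Fil n u := by
  induction p generalizing u with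
  | nil => rw [sub_self]; exact zero_mem _
  | @cons g l l' p ih =>
    simp only [List.map_cons, List.prod_cons, List.sum_cons, ← mul_sub] at hu ⊢
    -- The induction hypothesis gains one foot on the tail, which needs a tail of positive weight;
    -- the empty tail is trivial.
    cases l with
    | nil => rw [List.nil_perm.1 p, sub_self, mul_zero]; exact zero_mem _
    | cons g' l =>
      have h1 := g'.two_le_wt
      obtain ⟨v, hv⟩ : ∃ v, ((g' :: l).map Gen.wt).sum = v + 1 :=
        ⟨(g'.wt - 1) + (l.map Gen.wt).sum, by simp; omega⟩
      exact fil_mono (by omega) (mul_mem_fil g.chi_mem_fil (ih hv.le))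
  | swap g g' l =>
    simp only [List.map_cons, List.prod_cons, List.sum_cons, ← mul_assoc, ← sub_mul] at hu ⊢
    have h1 := g'.two_le_wt
    exact fil_mono (u := (g'.wt + g.wt - 1) + (l.map Gen.wt).sum) (by omega)
      (mul_mem_fil (commutator_mem_fil g'.chi_mem_fil g.chi_mem_fil (by omega)) (prod_mem_fil l))
  | trans p₁ p₂ ih₁ ih₂ =>
    have := add_mem (ih₁ hu) (ih₂ (by rwa [← (p₁.map Gen.wt).sum_eq]))
    rwa [sub_add_sub_cancel] at this

end Gen

/-! ### Components -/

namespace UGraph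

theorem exists_isLay (g : UGraph F) : ∃ w, g.IsLay w := by
  classical
  have := g.finite
  have := Fintype.ofFinite F
  exact ⟨(Finset.univ.filter fun a => g.rot a = a).toList, Finset.nodup_toList _, by simp⟩

/-- The restriction to a union of components. -/
def restrict (g : UGraph F) (S : F → Prop) (hi : ∀ a, S a → S (g.inv a))
    (hr : ∀ a, S a → S (g.rot a)) : UGraph {a // S a} where
  finite := by have := g.finite; infer_instance
  inv a := ⟨g.inv a.1, hi _ a.2⟩
  rot a := ⟨g.rot a.1, hr _ a.2⟩
  inv_inv a := Subtype.ext (g.inv_inv _)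
  inv_ne a := fun e => g.inv_ne a.1 (congrArg Subtype.val e)
  rot_rot_rot a := Subtype.ext (g.rot_rot_rot _)
  exists_leg := by
    rintro ⟨a, ha⟩
    obtain ⟨b, h, hb⟩ := g.exists_leg a
    have key : ∀ c, FlagConn g.inv g.rot a c → ∃ hc : S c,
        FlagConn (fun a : {a // S a} => (⟨g.inv a.1, hi _ a.2⟩ : {a // S a}))
          (fun a => ⟨g.rot a.1, hr _ a.2⟩) ⟨a, ha⟩ ⟨c, hc⟩ := by
      intro c h
      induction h with
      | refl => exact ⟨ha, .refl⟩
      | @tail c c' _ h ih =>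
        obtain ⟨hc, h'⟩ := ih
        rcases h with rfl | rfl
        · exact ⟨hi _ hc, h'.tail (Or.inl rfl)⟩
        · exact ⟨hr _ hc, h'.tail (Or.inr rfl)⟩
    obtain ⟨hS, h'⟩ := key b h
    exact ⟨⟨b, hS⟩, h', Subtype.ext hb⟩

open scoped Classical in
def restrictSum (g : UGraph F) (S : F → Prop) (hi : ∀ a, S a → S (g.inv a))
    (hr : ∀ a, S a → S (g.rot a)) (hi' : ∀ a, ¬ S a → ¬ S (g.inv a))
    (hr' : ∀ a, ¬ S a → ¬ S (g.rot a)) :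
    ((g.restrict S hi hr).sum (g.restrict (fun a => ¬ S a) hi' hr')).Equiv g where
  e := _root_.Equiv.sumCompl S
  inv := by rintro (a | a) <;> rfl
  rot := by rintro (a | a) <;> rfl

end UGraph

/-- Induction on the number of feet. A connected graph is reduced by `classified`, and label
relations modulo fewer feet lead to generators. A disconnected graph is, up to fewer feet, the
product of the values of two smaller graphs. -/
theorem fil_le_prodSpan [NeZero n] (u : ℕ) : Fil n u ≤ ProdSpan n u := by
  induction u using Nat.strong_induction_on with
  | _ u ih =>
  refine Submodule.span_le.2 ?_
  rintro _ ⟨F, g, lab, w, hw, hl, rfl⟩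
  rcases hl.lt_or_eq with hl | hl
  · exact prodSpan_mono hl.le (ih _ hl (UGraph.val_mem_fil lab hw le_rfl))
  have low : ∀ v, v < u → Fil n v ≤ ProdSpan n u := fun v hv =>
    (ih v hv).trans (prodSpan_mono hv.le)
  have len : ∀ {G : Type} {E : UGraph G} {w' w'' : List G}, E.IsLay w' → E.IsLay w'' →
      w'.length = w''.length := fun h h' => (h.perm_of h').length_eq
  by_cases hF : Nonempty F
  swap
  · have hF' : IsEmpty F := not_nonempty_iff.1 hF
    have h1 : g.val lab w = 1 := by
      rw [UGraph.val_eq hw]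
      have φ : TDiag.Iso (g.lay lab w hw) (TDiag.one : TDiag n Empty) :=
        ⟨Equiv.equivEmpty F, fun a => isEmptyElim a, fun a => isEmptyElim a, fun i =>
          List.eq_nil_iff_forall_not_mem.2 fun a => a.elim⟩
      rw [φ.toC_eq]
      exact map_one _
    rw [h1]
    exact Submodule.subset_span ⟨[], by simp, by simp⟩
  by_cases hg : g.Conn
  · rcases UGraph.classified (n := n) hg with h | ⟨F₀, g₀, _, _, h⟩ | ⟨_, h⟩ | ⟨_, h⟩ | ⟨_, h⟩ |
      ⟨_, h⟩ | ⟨_, h⟩ | ⟨_, h⟩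
    · rw [h]; exact zero_mem _
    all_goals
      obtain ⟨c, lab', w', e1, e2, e3⟩ := h lab w hw
      rw [e3]
      refine Submodule.smul_mem _ _ ?_
    · exact low w'.length (by omega) (UGraph.val_mem_fil lab' e1 le_rfl)
    · have e4 := len e1 UGraph.isLay_strut
      simp at e4
      obtain rfl : u = 2 := by omega
      have hf : UGraph.strutG.OrderFree (ProdSpan n 2) :=
        UGraph.free_of_length UGraph.isLay_strut (u := 1) le_rfl (low 1 (by omega))
      have h1 : ∀ a b : Fin n, a ≤ b → UGraph.strutG.Mem (ProdSpan n 2) ![a, b] := fun a b hab =>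
        hf.mem UGraph.isLay_strut (mem_of_sub_mem' (by
          rw [← neg_sub, neg_mem_iff]; exact low 1 (by omega) (strut_chi_sub a b))
          (chi_mem_prodSpan (.strut a b hab) le_rfl))
      refine UGraph.Mem.congr (lab := ![lab' 0, lab' 1]) ?_ (fun a _ => by fin_cases a <;> rfl) _ e1
      rcases le_total (lab' 0) (lab' 1) with h | h
      exacts [h1 _ _ h, UGraph.strut_swap (h1 _ _ h)]
    · have e4 := len e1 UGraph.isLay_tripod
      simp at e4
      obtain rfl : u = 3 := by omega
      have hf : UGraph.tripodG.OrderFree (ProdSpan n 3) :=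
        UGraph.free_of_length UGraph.isLay_tripod (u := 2) le_rfl (low 2 (by omega))
      -- Combs have five feet, but at this stage only diagrams with at most two feet are known to be
      -- spanned; being a tree, the comb needs no more.
      have hf' : UGraph.combG.OrderFree (ProdSpan n 3) :=
        UGraph.free_of_card (UGraph.conn_insertLeg UGraph.conn_h _) UGraph.isLay_comb
          (by simp) (low 2 (by omega))
      refine UGraph.Mem.congr ((UGraph.comb_and_tripod_mem hf' hf fun c d hc hcd => ?_).2
        (lab' 0) (lab' 1) (lab' 2)) (fun a ha => ?_) _ e1
      · exact hf.mem UGraph.isLay_tripod (mem_of_sub_mem' (by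
          rw [← neg_sub, neg_mem_iff]; exact low 2 (by omega) (tripod_chi_sub 0 c d))
          (chi_mem_prodSpan (.tripod c d hc hcd) le_rfl))
      · revert ha
        fin_cases a <;> simp [UGraph.tripodG, tripodDiag, UGraph.tripodLab]
    · have e4 := len e1 UGraph.isLay_h
      simp at e4
      obtain rfl : u = 4 := by omega
      have hf : UGraph.hG.OrderFree (ProdSpan n 4) :=
        UGraph.free_of_length UGraph.isLay_h (u := 3) le_rfl (low 3 (by omega))
      refine UGraph.Mem.congr (UGraph.h_mem hf (fun e f he hef => ?_)
        (lab' 0) (lab' 1) (lab' 2) (lab' 3)) (fun a ha => ?_) _ e1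
      · exact hf.mem UGraph.isLay_h (mem_of_sub_mem' (by
          rw [← neg_sub, neg_mem_iff]; exact low 3 (by omega) (h_chi_sub 0 e 0 f))
          (chi_mem_prodSpan (.h e f he hef) le_rfl))
      · revert ha
        fin_cases a <;> simp [UGraph.hG, hDiag, UGraph.hLab]
    · have e4 := len e1 UGraph.isLay_comb
      simp at e4
      obtain rfl : u = 5 := by omega
      have hf : UGraph.tripodG.OrderFree (ProdSpan n 5) :=
        UGraph.free_of_length UGraph.isLay_tripod (u := 2) le_rfl (low 2 (by omega))
      have hf' : UGraph.combG.OrderFree (ProdSpan n 5) :=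
        UGraph.free_of_card (UGraph.conn_insertLeg UGraph.conn_h _) UGraph.isLay_comb
          (by simp) (low 2 (by omega))
      -- No generator has five feet: combs are combinations of tripods and diagrams with two feet,
      -- which the induction hypothesis covers.
      refine UGraph.Mem.congr ((UGraph.comb_and_tripod_mem hf' hf fun c d hc hcd =>
        fun w'' hw'' => low 3 (by omega) (UGraph.val_mem_fil _ hw''
          (len hw'' UGraph.isLay_tripod).le)).1 (lab' (.inl 0)) (lab' (.inl 1)) (lab' (.inr 3))
        (lab' (.inl 2)) (lab' (.inl 3))) (fun a ha => ?_) _ e1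
      revert ha
      rcases a with a | a <;> fin_cases a <;>
        simp [UGraph.combG, UGraph.insertLeg, UGraph.insertRot, UGraph.hG, hDiag, UGraph.combLab,
          UGraph.hLab]
    · have e4 := len e1 UGraph.isLay_wheel
      simp at e4
      obtain rfl : u = 2 := by omega
      have hf : UGraph.wheelG.OrderFree (ProdSpan n 2) :=
        UGraph.free_of_length UGraph.isLay_wheel (u := 1) le_rfl (low 1 (by omega))
      refine UGraph.Mem.congr (UGraph.wheel_mem (hf.mem UGraph.isLay_wheel (mem_of_sub_mem' (by
          rw [← neg_sub, neg_mem_iff]; exact low 1 (by omega) (wheel_chi_sub 0 0))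
          (chi_mem_prodSpan .wheel le_rfl))) (lab' 0) (lab' 1)) (fun a ha => ?_) _ e1
      revert ha
      fin_cases a <;> simp [UGraph.wheelG, wheelDiag, UGraph.wheelLab]
    · rw [UGraph.null_triangle]; exact zero_mem _
  · unfold UGraph.Conn at hg
    push Not at hg
    obtain ⟨a, b, hab⟩ := hg
    -- The component of `a`; its complement contains `b`. Both parts have feet, hence both have
    -- fewer than `u`.
    set S : F → Prop := fun c => FlagConn g.inv g.rot a c with hS
    have hi : ∀ c, S c → S (g.inv c) := fun c h => h.tail (Or.inl rfl)
    have hr : ∀ c, S c → S (g.rot c) := fun c h => h.tail (Or.inr rfl)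
    have hi' : ∀ c, ¬ S c → ¬ S (g.inv c) := fun c h h' => h (by
      have := hi _ h'; rwa [g.inv_inv] at this)
    have hr' : ∀ c, ¬ S c → ¬ S (g.rot c) := fun c h h' => h (by
      have := hr _ (hr _ h'); rwa [g.rot_rot_rot] at this)
    have φ := (g.restrictSum S hi hr hi' hr').symm
    obtain ⟨w₁, h₁⟩ := (g.restrict S hi hr).exists_isLay
    obtain ⟨w₂, h₂⟩ := (g.restrict (fun a => ¬ S a) hi' hr').exists_isLay
    have pos : ∀ {G : Type} {g : UGraph G} {w : List G}, g.IsLay w → G → 0 < w.length := by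
      intro G g w h c
      obtain ⟨b, _, hb⟩ := g.exists_leg c
      exact List.length_pos_of_mem ((h.2 b).2 hb)
    have p₁ := pos h₁ ⟨a, .refl⟩
    have p₂ := pos h₂ ⟨b, hab⟩
    have h3 := φ.isLay hw
    have h4 := UGraph.isLay_sum h₁ h₂
    have hp := h3.perm_of h4
    have hlen : w₁.length + w₂.length = u := by
      have := hp.length_eq
      simp at this
      omega
    rw [UGraph.val_iso' φ hw]
    set lab' := lab ∘ φ.e.symm with hlab'
    -- Move the feet of the component of `a` in front of all others, at the cost of diagrams with
    -- fewer feet.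
    refine mem_of_sub_mem' (low (u - 1) (by omega) (UGraph.val_sub_mem_fil lab' h3 hp
      (by simp; omega))) ?_
    have e : lab' = Sum.elim (lab' ∘ .inl) (lab' ∘ .inr) := by simp
    rw [e, ← UGraph.val_mul h₁ h₂, ← hlen]
    exact mul_mem_prodSpan (ih _ (by omega) (UGraph.val_mem_fil _ h₁ le_rfl))
      (ih _ (by omega) (UGraph.val_mem_fil _ h₂ le_rfl))

/-! ### The ordered monomials span -/

section Order
variable [NeZero n] [LinearOrder (Gen n)]

/-- The list of the factors of an ordered monomial. -/
def factors (m : Gen n →₀ ℕ) : List (Gen n) :=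
  (m.support.sort (· ≤ ·)).flatMap fun g => List.replicate (m g) g

theorem orderedMonomial_eq (m : Gen n →₀ ℕ) :
    orderedMonomial m = ((factors m).map Gen.chi).prod := by
  rw [orderedMonomial, factors]
  generalize m.support.sort (· ≤ ·) = l
  induction l with
  | nil => rfl
  | cons g l ih => simp [ih]

theorem exists_factors_perm (l : List (Gen n)) : ∃ m, (factors m).Perm l := by
  refine ⟨Multiset.toFinsupp (l : Multiset (Gen n)), ?_⟩
  rw [List.perm_iff_count]
  intro g
  rw [factors, List.count_flatMap]
  simp only [Function.comp_def, List.count_replicate]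
  have : ∀ l' : List (Gen n), l'.Nodup → (List.map (fun x => if (x == g) = true then
      (Multiset.toFinsupp (l : Multiset (Gen n))) x else 0) l').sum =
        if g ∈ l' then l.count g else 0 := by
    intro l' hl'
    induction l' with
    | nil => simp
    | cons x l' ih =>
      rw [List.nodup_cons] at hl'
      rw [List.map_cons, List.sum_cons, ih hl'.2]
      by_cases hx : x = g
      · subst hx; simp [hl'.1]
      · simp [hx, Ne.symm hx]
  rw [this _ (Finset.sort_nodup _ _)]
  simp only [Finset.mem_sort, Finsupp.mem_support_iff]
  by_cases hg : l.count g = 0 <;> simp [hg]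

/-- Sorting the factors of a product changes it by an element with fewer feet, which is again a
combination of products with fewer feet. -/
theorem span_orderedMonomial :
    Submodule.span (Lam n) (Set.range (orderedMonomial : (Gen n →₀ ℕ) → C n)) = ⊤ := by
  set S := Submodule.span (Lam n) (Set.range (orderedMonomial : (Gen n →₀ ℕ) → C n)) with hS
  have key : ∀ u, ProdSpan n u ≤ S := by
    intro u
    induction u using Nat.strong_induction_on with
    | _ u ih =>
    refine Submodule.span_le.2 ?_
    rintro _ ⟨l, hl, rfl⟩
    obtain ⟨m, hm⟩ := exists_factors_perm l
    have h1 : orderedMonomial m ∈ S := Submodule.subset_span ⟨m, rfl⟩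
    rw [orderedMonomial_eq] at h1
    cases u with
    | zero =>
      cases l with
      | nil => rwa [hm.eq_nil] at h1
      | cons g l => have := g.two_le_wt; simp at hl; omega
    | succ u =>
      exact mem_of_sub_mem' (ih u (by omega) (fil_le_prodSpan u (prod_sub_mem_fil hm.symm hl))) h1
  refine (Submodule.eq_top_iff'.2 fun x => ?_)
  obtain ⟨x, rfl⟩ := Ideal.Quotient.mk_surjective x
  induction x using MonoidAlgebra.induction_on with
  | of D =>
    obtain ⟨⟨F, D⟩, rfl⟩ := Quotient.exists_rep D
    change D.toC ∈ S
    obtain ⟨lab, h⟩ := D.exists_lab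
    rw [D.toC_eq_val lab h]
    exact key _ (fil_le_prodSpan _ (UGraph.val_mem_fil lab D.isLay_flatMap le_rfl))
  | add x y hx hy => rw [map_add]; exact add_mem hx hy
  | smul c x hx => rw [UGraph.mk_smul]; exact S.smul_mem _ hx

end Order
end TriDiag

namespace TriDiag
variable {n : ℕ} {F F' G H : Type}

/-! ### Weight systems -/

/-- The data of a weight system on trivalent diagrams: the colours `K` form a basis of a metrized
Lie algebra with structure constants `V`, which acts through `ρ i` on the `i`-th interval. -/
structure WeightSystem (n : ℕ) (K A : Type) [Fintype K] [DecidableEq K] [Ring A]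
    [Algebra (Lam n) A] where
  dual : K → K
  dual_dual : ∀ x, dual (dual x) = x
  V : K → K → K → ℤ
  V_rot : ∀ x y z, V y z x = V x y z
  -- Thus `V` only takes the values 0, 1 and −1. The product over the three half-edges of a vertex
  -- then equals the weight of the vertex, and no half-edge per vertex has to be selected.
  V_cube : ∀ x y z, V x y z * V x y z * V x y z = V x y z
  ρ : Fin n → K → A
  commute : ∀ i j x y, i ≠ j → Commute (ρ i x) (ρ j y)
  -- The identity behind (STU); `p` is the colour of the new half-edge at the vertex, and its dual
  -- that of the foot.
  bracket : ∀ i y z, ρ i y * ρ i z - ρ i z * ρ i y = ∑ p, V p z y • ρ i (dual p)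
  unit : K
  ρ_unit : ∀ i, ρ i unit = algebraMap (Lam n) A (d i)
  -- The identity behind (CL2), with `v` the colour between the two legs. The hypotheses express
  -- that the vertices at both ends of the edge have nonzero weight; without them the identity fails
  -- for the oscillator algebra.
  parallel : ∀ u p b b' x y x' y', V u x y ≠ 0 → V (dual p) x' y' ≠ 0 →
    ∑ v, V (dual u) v (dual b) * V (dual v) p (dual b') =
      if u = p ∧ b = unit ∧ b' = unit then 1 else 0
  -- The identity behind (CL1): `t` colours the given foot, `b` and `b'` the two new feet, `u` and
  -- `u'` the row between the three vertices.
  ladder : ∀ i p q, ∑ t, ∑ u, ∑ b, ∑ u', ∑ b',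
      (V (dual t) u u' * V p (dual u) (dual b) * V (dual u') q (dual b')) •
        (ρ i b * ρ i t * ρ i b' + ρ i b' * ρ i t * ρ i b) =
      (2 * d i ^ 2) • ∑ t, V (dual t) p q • ρ i t

namespace WeightSystem

variable {K A : Type} [Fintype K] [DecidableEq K] [Ring A] [Algebra (Lam n) A]
  (W : WeightSystem n K A)

/-- The colourings of the half-edges such that the two halves of each edge have dual colours. -/
def State (g : UGraph F) : Type := {c : F → K // ∀ a, c (g.inv a) = W.dual (c a)}

instance (g : UGraph F) : Fintype (W.State g) := by
  classical
  have := g.finite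
  have := Fintype.ofFinite F
  exact Fintype.ofFinite {c : F → K // ∀ a, c (g.inv a) = W.dual (c a)}

open scoped Classical in
/-- The product of the cubes of the weights of the trivalent vertices. -/
def verts (g : UGraph F) (c : F → K) : ℤ :=
  ∏ᶠ a, if g.rot a = a then 1 else W.V (c a) (c (g.rot a)) (c (g.rot (g.rot a)))

/-- The product of the operators assigned to the feet. -/
def op (D : TDiag n F) (c : F → K) : A :=
  ((List.finRange n).map fun i => ((D.feet i).map fun a => W.ρ i (c a)).prod).prod

/-- The weight of a diagram. -/
def weight (D : TDiag n F) : A := ∑ c : W.State D.toUGraph, W.verts D.toUGraph c.1 • W.op D c.1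

theorem verts_eq (g : UGraph F) [Fintype F] [DecidableEq F] (c : F → K) : W.verts g c =
    ∏ a, if g.rot a = a then 1 else W.V (c a) (c (g.rot a)) (c (g.rot (g.rot a))) := by
  rw [verts, finprod_eq_prod_of_fintype]
  exact Finset.prod_congr rfl fun a _ => by congr

/-- The states of isomorphic graphs. -/
def stateCongr {g : UGraph F} {g' : UGraph G} (φ : g.Equiv g') : W.State g ≃ W.State g' where
  toFun c := ⟨c.1 ∘ φ.e.symm, fun b => by
    obtain ⟨a, rfl⟩ := φ.e.surjective b
    simp [← φ.inv, c.2]⟩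
  invFun c := ⟨c.1 ∘ φ.e, fun a => by simp [φ.inv, c.2]⟩
  left_inv c := Subtype.ext (by funext a; simp)
  right_inv c := Subtype.ext (by funext a; simp)

theorem weight_iso {D : TDiag n F} {E : TDiag n G} (φ : TDiag.Iso D E) :
    W.weight D = W.weight E := by
  classical
  refine Fintype.sum_equiv (W.stateCongr ⟨φ.e, φ.inv, φ.rot⟩) _ _ fun c => ?_
  change _ = W.verts E.toUGraph (c.1 ∘ φ.e.symm) • W.op E (c.1 ∘ φ.e.symm)
  congr 1
  · simp only [verts]
    refine finprod_eq_of_bijective φ.e φ.e.bijective fun a => ?_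
    have e : E.rot (φ.e a) = φ.e a ↔ D.rot a = a := by rw [← φ.rot, φ.e.apply_eq_iff_eq]
    have e1 : ∀ a, φ.e.symm (E.rot (φ.e a)) = D.rot a := fun a => by rw [← φ.rot]; simp
    have e2 : ∀ a, φ.e.symm (E.rot (E.rot (φ.e a))) = D.rot (D.rot a) := fun a => by
      rw [← φ.rot, ← φ.rot]; simp
    simp [e, e1, e2]
  · simp only [op]
    congr 1
    refine List.map_congr_left fun i _ => ?_
    rw [← φ.feet, List.map_map]
    congr 1
    refine List.map_congr_left fun a _ => ?_
    simp

theorem prod_map_mul_of_commute {ι : Type} (l : List ι) (hl : l.Nodup) (f g : ι → A)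
    (h : ∀ i j, i ≠ j → Commute (f i) (g j)) :
    (l.map fun i => f i * g i).prod = (l.map f).prod * (l.map g).prod := by
  induction l with
  | nil => simp
  | cons i l ih =>
    rw [List.nodup_cons] at hl
    have hc : Commute (l.map f).prod (g i) := by
      have : ∀ l' : List ι, i ∉ l' → Commute (l'.map f).prod (g i) := by
        intro l' hi
        induction l' with
        | nil => simp
        | cons j l' ih =>
          simp only [List.mem_cons, not_or] at hi
          rw [List.map_cons, List.prod_cons]
          exact (h j i (Ne.symm hi.1)).mul_left (ih hi.2)
      exact this l hl.1
    simp only [List.map_cons, List.prod_cons, ih hl.2]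
    rw [mul_assoc, ← mul_assoc (g i), ← hc.eq, mul_assoc, mul_assoc]

/-- The operators of different intervals commute, so the factors of the lower diagram can be
gathered interval by interval. -/
theorem op_mul (D : TDiag n F) (E : TDiag n G) (c : F → K) (c' : G → K) :
    W.op (D.mul E) (Sum.elim c c') = W.op D c * W.op E c' := by
  simp only [op]
  rw [← prod_map_mul_of_commute _ (List.nodup_finRange n)]
  · congr 1
    refine List.map_congr_left fun i _ => ?_
    simp [TDiag.mul, Function.comp_def]
  · intro i j hij
    have h1 : ∀ (l : List F) (x : K), Commute (l.map fun a => W.ρ i (c a)).prod (W.ρ j x) := by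
      intro l x
      induction l with
      | nil => simp
      | cons a l ih => simpa using (W.commute i j _ _ hij).mul_left ih
    generalize E.feet j = l
    induction l with
    | nil => simp
    | cons a l ih => simpa using (h1 _ _).mul_right ih

/-- The states of a disjoint union. -/
def stateSum (g : UGraph F) (g' : UGraph G) : W.State (g.sum g') ≃ W.State g × W.State g' where
  toFun c := (⟨c.1 ∘ .inl, fun a => c.2 (.inl a)⟩, ⟨c.1 ∘ .inr, fun a => c.2 (.inr a)⟩)
  invFun c := ⟨Sum.elim c.1.1 c.2.1, by rintro (a | a); exacts [c.1.2 a, c.2.2 a]⟩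
  left_inv c := Subtype.ext (by funext a; rcases a with a | a <;> rfl)
  right_inv c := rfl

theorem verts_sum (g : UGraph F) (g' : UGraph G) (c : F → K) (c' : G → K) :
    W.verts (g.sum g') (Sum.elim c c') = W.verts g c * W.verts g' c' := by
  classical
  have := g.finite
  have := g'.finite
  have := Fintype.ofFinite F
  have := Fintype.ofFinite G
  simp [verts_eq, Fintype.prod_sum_type, UGraph.sum]

theorem weight_mul (D : TDiag n F) (E : TDiag n G) :
    W.weight (D.mul E) = W.weight D * W.weight E := by
  rw [weight, weight, weight, Finset.sum_mul_sum, ← Finset.sum_product',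
    Finset.univ_product_univ]
  refine Fintype.sum_equiv (W.stateSum D.toUGraph E.toUGraph) _ _ fun c => ?_
  obtain ⟨⟨c, c'⟩, rfl⟩ := (W.stateSum D.toUGraph E.toUGraph).symm.surjective c
  rw [Equiv.apply_symm_apply, smul_mul_smul_comm, ← op_mul, ← verts_sum]
  rfl

theorem weight_one : W.weight TDiag.one = 1 := by
  have : Unique (W.State (TDiag.one : TDiag n Empty).toUGraph) :=
    ⟨⟨⟨fun a => a.elim, fun a => a.elim⟩⟩, fun c => Subtype.ext (funext fun a => a.elim)⟩
  rw [weight, Fintype.sum_unique]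
  simp only [verts, op]
  rw [finprod_of_isEmpty, one_smul]
  simp [TDiag.one]

/-! ### Compatibility with the relations -/

/-- Isolates the factor of the interval `i`; the relations that change only this interval become
identities between fixed factors `X` and `Y`. -/
theorem exists_prod_update (i : Fin n) (f : Fin n → A) :
    ∃ X Y : A, ∀ f' : Fin n → A, (∀ j, j ≠ i → f' j = f j) →
      ((List.finRange n).map f').prod = X * f' i * Y := by
  obtain ⟨l, l', h⟩ := List.append_of_mem (List.mem_finRange i)
  have hn := List.nodup_finRange n
  rw [h] at hn
  refine ⟨(l.map f).prod, (l'.map f).prod, fun f' hf => ?_⟩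
  have h1 : l.map f' = l.map f := List.map_congr_left fun j hj => hf j (by
    rintro rfl; simp [List.nodup_append] at hn; exact (hn.2.2 _ hj).1 rfl)
  have h2 : l'.map f' = l'.map f := List.map_congr_left fun j hj => hf j (by
    rintro rfl; simp [List.nodup_append, hj] at hn)
  rw [h, List.map_append, List.map_cons, h1, h2, List.prod_append, List.prod_cons, mul_assoc]

/-- The states after joining two legs. -/
def stateMerge (g : UGraph F) {y z : F} (hy : g.rot y = y) (hz : g.rot z = z) (hyz : y ≠ z) :
    W.State (g.mergeLegs y z hy hz hyz) ≃ W.State g × K where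
  toFun c := (⟨c.1 ∘ .inl, fun a => c.2 (.inl a)⟩, c.1 (.inr 0))
  invFun c := ⟨Sum.elim c.1.1 ![c.2, W.dual c.2], by
    rintro (a | a)
    · exact c.1.2 a
    · fin_cases a
      · rfl
      · exact (W.dual_dual _).symm⟩
  left_inv c := Subtype.ext (by
    funext a
    rcases a with a | a
    · rfl
    · fin_cases a
      · rfl
      · exact (c.2 (.inr 0)).symm)
  right_inv c := rfl

/-- The half-edges `y`, `z` and `inr 0` of the new vertex each contribute the same value by cyclic
symmetry, and its cube is the value itself. -/
theorem verts_merge (g : UGraph F) {y z : F} (hy : g.rot y = y) (hz : g.rot z = z) (hyz : y ≠ z)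
    (c : F ⊕ Fin 2 → K) : W.verts (g.mergeLegs y z hy hz hyz) c =
      W.verts g (c ∘ .inl) * W.V (c (.inr 0)) (c (.inl z)) (c (.inl y)) := by
  classical
  have := g.finite
  have := Fintype.ofFinite F
  rw [verts_eq, verts_eq, Fintype.prod_sum_type]
  have inj : Function.Injective g.rot := fun u v e => by
    rw [← g.rot_rot_rot u, e, g.rot_rot_rot]
  have h0 : ∀ a : F, (if (g.mergeLegs y z hy hz hyz).rot (.inl a) = .inl a then 1 else
        W.V (c (.inl a)) (c ((g.mergeLegs y z hy hz hyz).rot (.inl a)))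
          (c ((g.mergeLegs y z hy hz hyz).rot ((g.mergeLegs y z hy hz hyz).rot (.inl a))))) =
      (if a = y then W.V (c (.inr 0)) (c (.inl z)) (c (.inl y)) else 1) *
      (if a = z then W.V (c (.inr 0)) (c (.inl z)) (c (.inl y)) else 1) *
      if g.rot a = a then 1 else W.V ((c ∘ .inl) a) ((c ∘ .inl) (g.rot a))
        ((c ∘ .inl) (g.rot (g.rot a))) := by
    intro a
    by_cases h : a = y
    · subst h
      simp only [hy, hyz, if_true, if_false, mul_one]
      simp [UGraph.mergeLegs, UGraph.mergeRot, hyz]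
      rw [← W.V_rot]
    · by_cases h' : a = z
      · subst h'
        simp only [hz, hyz.symm, if_true, if_false, mul_one, one_mul]
        simp [UGraph.mergeLegs, UGraph.mergeRot, hyz, hyz.symm]
        rw [W.V_rot]
      · have h1 : g.rot a ≠ y := fun e => h (inj (e.trans hy.symm))
        have h2 : g.rot a ≠ z := fun e => h' (inj (e.trans hz.symm))
        simp [UGraph.mergeLegs, UGraph.mergeRot, h, h', h1, h2]
  rw [Finset.prod_congr rfl fun a _ => h0 a, Finset.prod_mul_distrib, Finset.prod_mul_distrib]
  simp only [Finset.prod_ite_eq', Finset.mem_univ, if_true, Fin.prod_univ_two]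
  have r0 : (g.mergeLegs y z hy hz hyz).rot (.inr 0) = .inl z := rfl
  have r1 : (g.mergeLegs y z hy hz hyz).rot (.inr 1) = .inr 1 := rfl
  have r2 : (g.mergeLegs y z hy hz hyz).rot (.inl z) = .inl y := by
    simp [UGraph.mergeLegs, UGraph.mergeRot, hyz.symm]
  rw [r0, r1, r2, if_neg (by simp), if_pos rfl]
  conv_rhs => rw [← W.V_cube]
  ring

/-- For a fixed state of the old graph, summing over the colour of the new edge yields the bracket
of the two neighbouring operators. -/
theorem weight_stu (D : TDiag n F) (i : Fin n) (L R : List F) (y z : F)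
    (h : D.feet i = L ++ y :: z :: R) :
    W.weight (D.merge i L R y z h) = W.weight D - W.weight (D.exchange i L R y z h) := by
  have hn := D.nodup_feet i
  rw [h] at hn
  have hyz : y ≠ z := by rintro rfl; simp [List.nodup_append] at hn
  have hw : W.weight (D.merge i L R y z h) = ∑ c : W.State D.toUGraph, ∑ p,
      (W.verts D.toUGraph c.1 * W.V p (c.1 z) (c.1 y)) • W.op (D.merge i L R y z h)
        (Sum.elim c.1 ![p, W.dual p]) := by
    rw [← Fintype.sum_prod_type' (f := fun (c : W.State D.toUGraph) p =>
      (W.verts D.toUGraph c.1 * W.V p (c.1 z) (c.1 y)) • W.op (D.merge i L R y z h)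
        (Sum.elim c.1 ![p, W.dual p]))]
    refine (Fintype.sum_equiv (W.stateMerge D.toUGraph (D.rot_eq_of_feet h (by simp))
      (D.rot_eq_of_feet h (by simp)) hyz).symm _ _ ?_).symm
    rintro ⟨c, p⟩
    exact congrArg (· • _) (W.verts_merge D.toUGraph (D.rot_eq_of_feet h (by simp))
      (D.rot_eq_of_feet h (by simp)) hyz (Sum.elim c.1 ![p, W.dual p])).symm
  have hw' : W.weight (D.exchange i L R y z h) = ∑ c : W.State D.toUGraph,
    W.verts D.toUGraph c.1 • W.op (D.exchange i L R y z h) c.1 := rfl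
  rw [hw, hw', weight, ← Finset.sum_sub_distrib]
  · refine Finset.sum_congr rfl fun c _ => ?_
    obtain ⟨X, Y, hXY⟩ := exists_prod_update i fun j => ((D.feet j).map fun a => W.ρ j (c.1 a)).prod
    have e1 : W.op D c.1 = X * ((L.map fun a => W.ρ i (c.1 a)).prod *
        (W.ρ i (c.1 y) * W.ρ i (c.1 z)) * (R.map fun a => W.ρ i (c.1 a)).prod) * Y := by
      rw [op, hXY _ fun j _ => rfl, h]
      simp [mul_assoc]
    have e2 : W.op (D.exchange i L R y z h) c.1 = X * ((L.map fun a => W.ρ i (c.1 a)).prod *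
        (W.ρ i (c.1 z) * W.ρ i (c.1 y)) * (R.map fun a => W.ρ i (c.1 a)).prod) * Y := by
      rw [op, hXY _ fun j hj => by simp [TDiag.exchange, hj]]
      simp [TDiag.exchange, mul_assoc]
    have e3 : ∀ p, W.op (D.merge i L R y z h) (Sum.elim c.1 ![p, W.dual p]) =
        X * ((L.map fun a => W.ρ i (c.1 a)).prod *
        (W.ρ i (W.dual p)) * (R.map fun a => W.ρ i (c.1 a)).prod) * Y := by
      intro p
      rw [op, hXY _ fun j hj => by simp [TDiag.merge, hj, Function.comp_def]]
      simp [TDiag.merge, mul_assoc, Function.comp_def]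
    rw [e1, e2, ← smul_sub, ← sub_mul, ← mul_sub, ← sub_mul, ← mul_sub, W.bracket]
    simp only [e3, mul_smul, ← Finset.smul_sum]
    congr 1
    simp only [Finset.mul_sum, Finset.sum_mul, mul_smul_comm, smul_mul_assoc]

end WeightSystem
end TriDiag

/-! ### State sums of diagrams with inserted legs: (CL2) and (CL1) -/

namespace TriDiag
variable {n : ℕ} {F F' G H : Type}
namespace WeightSystem

variable {K A : Type} [Fintype K] [DecidableEq K] [Ring A] [Algebra (Lam n) A]
  (W : WeightSystem n K A)

theorem verts_insert (g : UGraph F) (a : F) (c : F ⊕ Fin 4 → K) : W.verts (g.insertLeg a) c =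
    W.verts g (c ∘ .inl) * W.V (c (.inr 0)) (c (.inr 1)) (c (.inr 2)) := by
  classical
  have := g.finite
  have := Fintype.ofFinite F
  rw [verts_eq, verts_eq, Fintype.prod_sum_type]
  congr 1
  · refine Finset.prod_congr rfl fun x _ => ?_
    simp [UGraph.insertLeg, UGraph.insertRot]
  · simp [Fin.prod_univ_four, UGraph.insertLeg, UGraph.insertRot]
    rw [W.V_rot (c (.inr 0)) (c (.inr 1)) (c (.inr 2)),
      ← W.V_rot (c (.inr 2)) (c (.inr 0)) (c (.inr 1)), W.V_cube]

/-- Supplies the hypotheses of `parallel`: a state that contributes has nonzero weight at every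
vertex. -/
theorem V_ne_zero_of_verts {g : UGraph F} {c : F → K} (h : W.verts g c ≠ 0) {a : F}
    (ha : g.rot a ≠ a) : W.V (c a) (c (g.rot a)) (c (g.rot (g.rot a))) ≠ 0 := by
  classical
  have := g.finite
  have := Fintype.ofFinite F
  rw [verts_eq, Finset.prod_ne_zero_iff] at h
  simpa [ha] using h a (Finset.mem_univ _)

open scoped Classical in
/-- The extension of a colouring to an inserted leg, where the colour `u` is given to `a`. -/
def extend (c : F → K) (a : F) (u b : K) : F ⊕ Fin 4 → K :=
  Sum.elim (Function.update c a u) ![W.dual u, c a, W.dual b, b]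

open scoped Classical in
/-- The extension of a colouring to a leg inserted behind `z`, where the colour `u` is given
to `z`. -/
def extendInv (c : F → K) (z : F) (u b : K) : F ⊕ Fin 4 → K :=
  Sum.elim (Function.update c z u) ![c z, W.dual u, W.dual b, b]

open scoped Classical in
@[simp] theorem extend_self (c : F → K) (a : F) (u b : K) : W.extend c a u b (.inl a) = u := by
  rw [extend, Sum.elim_inl, Function.update_self]

open scoped Classical in
theorem extend_of_ne (c : F → K) {a x : F} (h : x ≠ a) (u b : K) :
    W.extend c a u b (.inl x) = c x := by
  rw [extend, Sum.elim_inl, Function.update_of_ne h]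

@[simp] theorem extend_zero (c : F → K) (a : F) (u b : K) :
    W.extend c a u b (.inr 0) = W.dual u := rfl

@[simp] theorem extend_one (c : F → K) (a : F) (u b : K) :
    W.extend c a u b (.inr 1) = c a := rfl

@[simp] theorem extend_two (c : F → K) (a : F) (u b : K) :
    W.extend c a u b (.inr 2) = W.dual b := rfl

@[simp] theorem extend_three (c : F → K) (a : F) (u b : K) : W.extend c a u b (.inr 3) = b := rfl

open scoped Classical in
@[simp] theorem extendInv_self (c : F → K) (z : F) (u b : K) : W.extendInv c z u b (.inl z) = u := by
  rw [extendInv, Sum.elim_inl, Function.update_self]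

open scoped Classical in
theorem extendInv_of_ne (c : F → K) {z x : F} (h : x ≠ z) (u b : K) :
    W.extendInv c z u b (.inl x) = c x := by
  rw [extendInv, Sum.elim_inl, Function.update_of_ne h]

@[simp] theorem extendInv_zero (c : F → K) (z : F) (u b : K) :
    W.extendInv c z u b (.inr 0) = c z := rfl

@[simp] theorem extendInv_one (c : F → K) (z : F) (u b : K) :
    W.extendInv c z u b (.inr 1) = W.dual u := rfl

@[simp] theorem extendInv_two (c : F → K) (z : F) (u b : K) :
    W.extendInv c z u b (.inr 2) = W.dual b := rfl

@[simp] theorem extendInv_three (c : F → K) (z : F) (u b : K) : W.extendInv c z u b (.inr 3) = b := rfl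

open scoped Classical in
/-- The states after the insertion of a leg. -/
def stateInsert (g : UGraph F) (a : F) : W.State (g.insertLeg a) ≃ W.State g × K × K where
  toFun c := (⟨Function.update (c.1 ∘ .inl) a (c.1 (.inr 1)), fun x => by
    by_cases h : x = a
    · subst h
      have : c.1 (.inl (g.inv x)) = W.dual (c.1 (.inr 1)) := c.2 (.inr 1)
      simpa [g.inv_ne] using this
    · by_cases h' : x = g.inv a
      · subst h'
        have := c.2 (.inl (g.inv a))
        rw [show (g.insertLeg a).inv (.inl (g.inv a)) = .inr 1 from g.insertInv_inv a] at this
        simpa [g.inv_ne, g.inv_inv] using this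
      · have := c.2 (.inl x)
        rw [show (g.insertLeg a).inv (.inl x) = .inl (g.inv x) from g.insertInv_of_ne h h'] at this
        have h1 : g.inv x ≠ a := fun e => h' (by rw [← e, g.inv_inv])
        simpa [h, h1] using this⟩, c.1 (.inl a), c.1 (.inr 3))
  invFun x := ⟨W.extend x.1.1 a x.2.1 x.2.2, by
    rintro (b | b)
    · by_cases h : b = a
      · subst h
        rw [show (g.insertLeg b).inv (.inl b) = .inr 0 from g.insertInv_self b]
        simp
      · by_cases h' : b = g.inv a
        · subst h'
          rw [show (g.insertLeg a).inv (.inl (g.inv a)) = .inr 1 from g.insertInv_inv a]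
          simp [extend_of_ne, h, x.1.2, W.dual_dual]
        · rw [show (g.insertLeg a).inv (.inl b) = .inl (g.inv b) from g.insertInv_of_ne h h']
          have h1 : g.inv b ≠ a := fun e => h' (by rw [← e, g.inv_inv])
          simp [extend_of_ne, h, h1, x.1.2]
    · fin_cases b <;>
        simp [extend_of_ne, UGraph.insertLeg, UGraph.insertInv, g.inv_ne, x.1.2, W.dual_dual]⟩
  left_inv c := Subtype.ext (by
    funext b
    rcases b with b | b
    · by_cases h : b = a
      · subst h; simp
      · simp [extend_of_ne, h]
    · fin_cases b
      · have := c.2 (.inl a)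
        rw [show (g.insertLeg a).inv (.inl a) = .inr 0 from g.insertInv_self a] at this
        simp [extend_of_ne, this]
      · simp
      · exact (c.2 (.inr 3)).symm
      · rfl)
  right_inv x := by
    obtain ⟨c, u, b⟩ := x
    refine Prod.ext (Subtype.ext ?_) (Prod.ext ?_ rfl)
    · funext x
      by_cases h : x = a
      · subst h; simp
      · simp [extend_of_ne, h]
    · simp

open scoped Classical in
/-- The states after the insertion of a leg behind `z`. -/
def stateInsertInv (g : UGraph F) (z : F) :
    W.State (g.insertLeg (g.inv z)) ≃ W.State g × K × K where
  toFun c := (⟨Function.update (c.1 ∘ .inl) z (c.1 (.inr 0)), fun x => by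
    by_cases h : x = z
    · subst h
      have : c.1 (.inl (g.inv x)) = W.dual (c.1 (.inr 0)) := c.2 (.inr 0)
      simpa [g.inv_ne] using this
    · by_cases h' : x = g.inv z
      · subst h'
        have := c.2 (.inl (g.inv z))
        rw [show (g.insertLeg (g.inv z)).inv (.inl (g.inv z)) = .inr 0 from
          g.insertInv_self _] at this
        simpa [g.inv_ne, g.inv_inv] using this
      · have := c.2 (.inl x)
        rw [show (g.insertLeg (g.inv z)).inv (.inl x) = .inl (g.inv x) from
          g.insertInv_of_ne h' (by rwa [g.inv_inv])] at this
        have h1 : g.inv x ≠ z := fun e => h' (by rw [← e, g.inv_inv])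
        simpa [h, h1] using this⟩, c.1 (.inl z), c.1 (.inr 3))
  invFun x := ⟨W.extendInv x.1.1 z x.2.1 x.2.2, by
    rintro (b | b)
    · by_cases h : b = z
      · subst h
        have := g.insertInv_inv (g.inv b)
        rw [g.inv_inv] at this
        rw [show (g.insertLeg (g.inv b)).inv (.inl b) = .inr 1 from this]
        simp
      · by_cases h' : b = g.inv z
        · subst h'
          rw [show (g.insertLeg (g.inv z)).inv (.inl (g.inv z)) = .inr 0 from g.insertInv_self _]
          simp [extendInv_of_ne, h, x.1.2, W.dual_dual]
        · rw [show (g.insertLeg (g.inv z)).inv (.inl b) = .inl (g.inv b) from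
            g.insertInv_of_ne h' (by rwa [g.inv_inv])]
          have h1 : g.inv b ≠ z := fun e => h' (by rw [← e, g.inv_inv])
          simp [extendInv_of_ne, h, h1, x.1.2]
    · fin_cases b <;>
        simp [extendInv_of_ne, UGraph.insertLeg, UGraph.insertInv, g.inv_ne, g.inv_inv, x.1.2,
          W.dual_dual]⟩
  left_inv c := Subtype.ext (by
    funext b
    rcases b with b | b
    · by_cases h : b = z
      · subst h; simp
      · simp [extendInv_of_ne, h]
    · fin_cases b
      · simp
      · have := c.2 (.inl z)
        have h := g.insertInv_inv (g.inv z)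
        rw [g.inv_inv] at h
        rw [show (g.insertLeg (g.inv z)).inv (.inl z) = .inr 1 from h] at this
        simp [extendInv_of_ne, this]
      · exact (c.2 (.inr 3)).symm
      · rfl)
  right_inv x := by
    obtain ⟨c, u, b⟩ := x
    refine Prod.ext (Subtype.ext ?_) (Prod.ext ?_ rfl)
    · funext x
      by_cases h : x = z
      · subst h; simp
      · simp [extendInv_of_ne, h]
    · simp

theorem sum_stateInsert {M : Type*} [AddCommMonoid M] (g : UGraph F) (a : F)
    (Ψ : (F ⊕ Fin 4 → K) → M) :
    ∑ c : W.State (g.insertLeg a), Ψ c.1 = ∑ c : W.State g, ∑ u, ∑ b, Ψ (W.extend c.1 a u b) := by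
  simp_rw [← Fintype.sum_prod_type' fun u b => Ψ (W.extend (_ : F → K) a u b)]
  rw [← Fintype.sum_prod_type' fun (c : W.State g) (x : K × K) => Ψ (W.extend c.1 a x.1 x.2)]
  exact (Fintype.sum_equiv (W.stateInsert g a).symm _ _ fun x => rfl).symm

theorem sum_stateInsertInv {M : Type*} [AddCommMonoid M] (g : UGraph F) (z : F)
    (Ψ : (F ⊕ Fin 4 → K) → M) : ∑ c : W.State (g.insertLeg (g.inv z)), Ψ c.1 =
      ∑ c : W.State g, ∑ u, ∑ b, Ψ (W.extendInv c.1 z u b) := by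
  simp_rw [← Fintype.sum_prod_type' fun u b => Ψ (W.extendInv (_ : F → K) z u b)]
  rw [← Fintype.sum_prod_type' fun (c : W.State g) (x : K × K) => Ψ (W.extendInv c.1 z x.1 x.2)]
  exact (Fintype.sum_equiv (W.stateInsertInv g z).symm _ _ fun x => rfl).symm

theorem op_congr (D : TDiag n F) {c c' : F → K} (h : ∀ a, D.rot a = a → c a = c' a) :
    W.op D c = W.op D c' := by
  simp only [op]
  congr 1
  refine List.map_congr_left fun i _ => ?_
  congr 1
  refine List.map_congr_left fun a ha => ?_
  rw [h a ((D.mem_feet a).1 ⟨i, ha⟩)]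

theorem op_insertLeg (D : TDiag n F) (a : F) (i : Fin n) (k : ℕ) {c : F ⊕ Fin 4 → K}
    (h : c (.inr 3) = W.unit) : W.op (D.insertLeg a i k) c = d i • W.op D (c ∘ .inl) := by
  obtain ⟨X, Y, hXY⟩ := exists_prod_update i
    fun j => ((D.feet j).map fun a => W.ρ j (c (.inl a))).prod
  rw [op, op, hXY _ fun j hj => by simp [TDiag.insertLeg, hj, Function.comp_def]]
  simp only [Function.comp_apply]
  rw [hXY _ fun j hj => rfl]
  simp only [TDiag.insertLeg, if_true, insertAt, ← List.map_take, ← List.map_drop, List.map_append,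
    List.map_cons, List.map_map, List.prod_append, List.prod_cons, h, W.ρ_unit,
    ← Algebra.smul_def, mul_smul_comm, smul_mul_assoc]
  rw [← List.prod_append, ← List.map_append, List.take_append_drop]
  rfl

/-- Summing over the colour between the two new legs, `parallel` forces both legs to carry the
central colour, which acts by `dᵢ` and `dⱼ`, and leaves the colour of the edge unchanged. -/
theorem weight_cl2 (D : TDiag n F) (a : F) (ha : D.rot a ≠ a) (hb : D.rot (D.inv a) ≠ D.inv a)
    (i j : Fin n) (k l : ℕ) :
    W.weight ((D.insertLeg a i k).insertLeg (.inr 1) j l) = (d i * d j) • W.weight D := by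
  classical
  set D' := (D.insertLeg a i k).insertLeg (.inr 1) j l with hD'
  rw [weight, weight, Finset.smul_sum]
  refine (W.sum_stateInsert _ _ fun c => W.verts D'.toUGraph c • W.op D' c).trans ?_
  refine (W.sum_stateInsert D.toUGraph a fun c => ∑ u, ∑ b, W.verts D'.toUGraph
    (W.extend c (.inr 1) u b) • W.op D' (W.extend c (.inr 1) u b)).trans ?_
  refine Finset.sum_congr rfl fun c _ => ?_
  set Φ : K → K → A := fun b b' => W.op D' (Sum.elim (Sum.elim c.1 fun _ => b) fun _ => b') with hΦ
  have e1 : ∀ u b u' b', W.op D' (W.extend (W.extend c.1 a u b) (.inr 1) u' b') = Φ b b' := by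
    intro u b u' b'
    refine W.op_congr _ ?_
    rintro ((x | x) | x) hx
    · have : x ≠ a := by
        rintro rfl
        simp [hD', TDiag.insertLeg, UGraph.insertLeg, UGraph.insertRot, ha] at hx
      simp [extend_of_ne, this]
    · fin_cases x <;>
        simp [hD', TDiag.insertLeg, UGraph.insertLeg, UGraph.insertRot] at hx
      simp [extend_of_ne]
    · fin_cases x <;>
        simp [hD', TDiag.insertLeg, UGraph.insertLeg, UGraph.insertRot] at hx
      simp
  have e2 : ∀ u b u' b', W.verts D'.toUGraph (W.extend (W.extend c.1 a u b) (.inr 1) u' b') =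
      W.verts D.toUGraph (Function.update c.1 a u) *
        (W.V (W.dual u) u' (W.dual b) * W.V (W.dual u') (c.1 a) (W.dual b')) := by
    intro u b u' b'
    refine (W.verts_insert (D.insertLeg a i k).toUGraph _ _).trans ?_
    rw [show (D.insertLeg a i k).toUGraph = D.toUGraph.insertLeg a from rfl, W.verts_insert,
      mul_assoc]
    congr 1
    · congr 1
      funext x
      by_cases h : x = a
      · subst h; simp [extend_of_ne]
      · simp [extend_of_ne, h]
    · simp [extend_of_ne]
  have e3 : ∀ u b b', W.verts D.toUGraph (Function.update c.1 a u) *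
      ∑ u', W.V (W.dual u) u' (W.dual b) * W.V (W.dual u') (c.1 a) (W.dual b') =
      if u = c.1 a then (if b = W.unit then (if b' = W.unit then W.verts D.toUGraph c.1 else 0)
        else 0) else 0 := by
    intro u b b'
    -- If this product vanishes, so does the right side; otherwise both end vertices of the edge
    -- have nonzero weight, as `parallel` requires.
    by_cases h0 : W.verts D.toUGraph (Function.update c.1 a u) = 0
    · rw [h0, zero_mul]
      split_ifs with h h1 h2
      · subst h
        rwa [Function.update_eq_self, eq_comm] at h0
      all_goals rfl
    · have h1 := W.V_ne_zero_of_verts h0 ha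
      have h2 := W.V_ne_zero_of_verts h0 hb
      rw [Function.update_self] at h1
      rw [Function.update_of_ne (D.inv_ne a), c.2] at h2
      rw [W.parallel _ _ _ _ _ _ _ _ h1 h2]
      by_cases h : u = c.1 a
      · subst h
        by_cases h3 : b = W.unit <;> by_cases h4 : b' = W.unit <;> simp [h3, h4]
      · simp [h]
  have e4 : Φ W.unit W.unit = (d i * d j) • W.op D c.1 := by
    rw [hΦ]
    beta_reduce
    rw [hD', W.op_insertLeg _ _ _ _ rfl, W.op_insertLeg _ _ _ _ rfl, smul_smul, mul_comm]
    rfl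
  calc _ = ∑ u, ∑ b, ∑ b', (W.verts D.toUGraph (Function.update c.1 a u) *
      ∑ u', W.V (W.dual u) u' (W.dual b) * W.V (W.dual u') (c.1 a) (W.dual b')) • Φ b b' := by
        refine Finset.sum_congr rfl fun u _ => Finset.sum_congr rfl fun b _ => ?_
        rw [Finset.sum_comm]
        refine Finset.sum_congr rfl fun b' _ => ?_
        simp only [e1, e2, Finset.mul_sum, Finset.sum_smul]
    _ = _ := by
        simp only [e3, ite_smul, zero_smul, Finset.sum_ite_eq', Finset.sum_ite_irrel,
          Finset.sum_const_zero, Finset.mem_univ, if_true, e4]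
        rw [smul_comm]

/-- Isolates the weight of one vertex; the factor `R` only sees the colours at the other trivalent
vertices. -/
theorem exists_verts_eq (g : UGraph F) {x : F} (hx : g.rot x ≠ x) (c₀ : F → K) :
    ∃ R : ℤ, ∀ c : F → K, (∀ a, g.rot a ≠ a → ¬ g.Orb x a → c a = c₀ a) →
      W.verts g c = R * W.V (c x) (c (g.rot x)) (c (g.rot (g.rot x))) := by
  classical
  have := g.finite
  have := Fintype.ofFinite F
  refine ⟨∏ a, if g.rot a = a ∨ g.Orb x a then 1 else
    W.V (c₀ a) (c₀ (g.rot a)) (c₀ (g.rot (g.rot a))), fun c hc => ?_⟩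
  have h1 := g.rot_rot_ne hx
  have h2 := g.rot_rot_ne_rot hx
  set v := W.V (c x) (c (g.rot x)) (c (g.rot (g.rot x))) with hv
  have key : ∀ a, (if g.rot a = a then 1 else W.V (c a) (c (g.rot a)) (c (g.rot (g.rot a)))) =
      (if g.rot a = a ∨ g.Orb x a then 1 else
        W.V (c₀ a) (c₀ (g.rot a)) (c₀ (g.rot (g.rot a)))) * (if a = x then v else 1) *
        (if a = g.rot x then v else 1) * (if a = g.rot (g.rot x) then v else 1) := by
    intro a
    by_cases h : g.Orb x a
    · rcases h with rfl | rfl | rfl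
      · simp [hx, hx.symm, h1.symm, hv, UGraph.Orb]
      · simp [hx, h2, h2.symm, hv, UGraph.Orb, g.rot_rot_rot]
        rw [W.V_rot]
      · simp [h1, h1.symm, h2, hv, UGraph.Orb, g.rot_rot_rot]
        rw [← W.V_rot]
    · have h3 : a ≠ x ∧ a ≠ g.rot x ∧ a ≠ g.rot (g.rot x) := by
        simpa [UGraph.Orb, not_or] using h
      by_cases h4 : g.rot a = a
      · simp [h3, h4]
      · have h5 : g.rot (g.rot a) ≠ g.rot a := fun e => h4 (g.rot_injective e)
        have h6 : g.rot (g.rot (g.rot a)) ≠ g.rot (g.rot a) := fun e => h5 (g.rot_injective e)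
        simp only [h, h3, h4, or_self, if_false, mul_one]
        rw [hc a h4 h, hc _ h5 (by rwa [g.orb_rot]), hc _ h6 (by rwa [g.orb_rot, g.orb_rot])]
  rw [verts_eq, Finset.prod_congr rfl fun a _ => key a]
  simp only [Finset.prod_mul_distrib, Finset.prod_ite_eq', Finset.mem_univ, if_true]
  conv_rhs => rw [hv, ← W.V_cube]
  ring

open scoped Classical in
/-- Change the colour of an edge. -/
def relabel (g : UGraph F) (f : F) (c : F → K) (t : K) : F → K :=
  Function.update (Function.update c f t) (g.inv f) (W.dual t)

/-- A state is a state normalised to the colour `unit` on the edge of `f`, together with the colour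
of this edge. The colour of the foot can then be summed alone while everything else stays fixed. -/
theorem sum_relabel {M : Type*} [AddCommMonoid M] (g : UGraph F) (f : F) (Ψ : (F → K) → M) :
    ∑ c : W.State g, Ψ c.1 =
      ∑ c : {c : W.State g // c.1 f = W.unit}, ∑ t, Ψ (W.relabel g f c.1.1 t) := by
  classical
  have hr : ∀ (c : W.State g) t a, W.relabel g f c.1 t (g.inv a) = W.dual (W.relabel g f c.1 t a) := by
    intro c t a
    by_cases h : a = f
    · subst h
      simp [relabel, (g.inv_ne a).symm]
    · by_cases h' : a = g.inv f
      · subst h'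
        simp [relabel, g.inv_inv, (g.inv_ne f).symm, W.dual_dual]
      · have h1 : g.inv a ≠ f := fun e => h' (by rw [← e, g.inv_inv])
        have h2 : g.inv a ≠ g.inv f := fun e => h (g.inv_injective e)
        simp [relabel, h, h', h1, h2, c.2]
  have hne := g.inv_ne f
  rw [← Fintype.sum_prod_type'
    fun (c : {c : W.State g // c.1 f = W.unit}) t => Ψ (W.relabel g f c.1.1 t)]
  let E : {c : W.State g // c.1 f = W.unit} × K ≃ W.State g :=
    { toFun := fun x => ⟨W.relabel g f x.1.1.1 x.2, hr _ _⟩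
      invFun := fun c => (⟨⟨W.relabel g f c.1 W.unit, hr _ _⟩, by simp [relabel, hne.symm]⟩, c.1 f)
      left_inv := by
        rintro ⟨⟨c, hc⟩, t⟩
        refine Prod.ext (Subtype.ext (Subtype.ext (funext fun a => ?_)))
          (by simp [relabel, hne.symm])
        by_cases h : a = f
        · subst h; simp [relabel, hne.symm, hc]
        · by_cases h' : a = g.inv f
          · subst h'; simp [relabel, hc, c.2]
          · simp [relabel, h, h']
      right_inv := by
        intro c
        refine Subtype.ext (funext fun a => ?_)
        by_cases h : a = f
        · subst h; simp [relabel, hne.symm]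
        · by_cases h' : a = g.inv f
          · subst h'; simp [relabel, c.2]
          · simp [relabel, h, h'] }
  exact (Fintype.sum_equiv E _ _ fun x => rfl).symm

/-- All feet other than the three consecutive ones contribute the same factors `X` and `Y` in the
three diagrams of (CL1). -/
theorem exists_op_comb (D : TDiag n F) (i : Fin n) (L R : List F) (f : F)
    (h : D.feet i = L ++ f :: R) (c₀ : F → K) : ∃ X Y : A, ∀ c : F → K,
      (∀ a, D.rot a = a → a ≠ f → c a = c₀ a) → W.op D c = X * W.ρ i (c f) * Y ∧
      ∀ c' : (F ⊕ Fin 4) ⊕ Fin 4 → K, (∀ a, D.rot a = a → c' (.inl (.inl a)) = c a) →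
        W.op (D.comb i L f) c' =
          X * (W.ρ i (c' (.inl (.inr 3))) * W.ρ i (c f) * W.ρ i (c' (.inr 3))) * Y ∧
        W.op (D.combRev i L f) c' =
          X * (W.ρ i (c' (.inr 3)) * W.ρ i (c f) * W.ρ i (c' (.inl (.inr 3)))) * Y := by
  obtain ⟨X, Y, hXY⟩ := exists_prod_update i fun j => ((D.feet j).map fun a => W.ρ j (c₀ a)).prod
  refine ⟨X * (L.map fun a => W.ρ i (c₀ a)).prod, (R.map fun a => W.ρ i (c₀ a)).prod * Y,
    fun c hc => ?_⟩
  have hn := D.nodup_feet i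
  have foot : ∀ j a, a ∈ D.feet j → D.rot a = a := fun j a ha => (D.mem_feet a).1 ⟨j, ha⟩
  have hf : f ∈ D.feet i := by simp [h]
  have hj : ∀ j, j ≠ i → ∀ a ∈ D.feet j, c a = c₀ a := fun j hj a ha =>
    hc a (foot j a ha) (by rintro rfl; exact hj (D.eq_of_mem_feet _ _ _ ha hf))
  rw [h] at hn
  have hL : ∀ a ∈ L, c a = c₀ a := fun a ha => hc a (foot i a (by simp [h, ha])) (by
    rintro rfl; simp [List.nodup_append, ha] at hn; exact (hn.2.2 _ ha).1 rfl)
  have hR : ∀ a ∈ R, c a = c₀ a := fun a ha => hc a (foot i a (by simp [h, ha])) (by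
    rintro rfl; simp [List.nodup_append, ha] at hn)
  have eL : L.map (fun a => W.ρ i (c a)) = L.map fun a => W.ρ i (c₀ a) :=
    List.map_congr_left fun a ha => by rw [hL a ha]
  have eR : R.map (fun a => W.ρ i (c a)) = R.map fun a => W.ρ i (c₀ a) :=
    List.map_congr_left fun a ha => by rw [hR a ha]
  have ej : ∀ j, j ≠ i → (D.feet j).map (fun a => W.ρ j (c a)) =
      (D.feet j).map fun a => W.ρ j (c₀ a) := fun j h =>
    List.map_congr_left fun a ha => by rw [hj j h a ha]
  refine ⟨?_, fun c' hc' => ?_⟩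
  · rw [op, hXY _ fun j h => by rw [ej j h], h]
    simp only [List.map_append, List.map_cons, List.prod_append, List.prod_cons, eL, eR, mul_assoc]
  have eL' : L.map (fun a => W.ρ i (c' (.inl (.inl a)))) = L.map fun a => W.ρ i (c₀ a) :=
    List.map_congr_left fun a ha => by rw [hc' a (foot i a (by simp [h, ha])), hL a ha]
  have eR' : R.map (fun a => W.ρ i (c' (.inl (.inl a)))) = R.map fun a => W.ρ i (c₀ a) :=
    List.map_congr_left fun a ha => by rw [hc' a (foot i a (by simp [h, ha])), hR a ha]
  have ej' : ∀ j, j ≠ i → (D.feet j).map (fun a => W.ρ j (c' (.inl (.inl a)))) =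
      (D.feet j).map fun a => W.ρ j (c₀ a) := fun j h =>
    List.map_congr_left fun a ha => by rw [hc' a (foot j a ha), hj j h a ha]
  have h1 : (D.comb i L f).feet i = (L.map .inl).map .inl ++
      .inl (.inr 3) :: .inl (.inl f) :: .inr 3 :: (R.map .inl).map .inl := by
    simp only [TDiag.comb, TDiag.insertLeg, if_true, h]
    exact UGraph.insertAt_comb L R f
  have h2 : (D.combRev i L f).feet i = (L.map .inl).map .inl ++
      .inr 3 :: .inl (.inl f) :: .inl (.inr 3) :: (R.map .inl).map .inl := by
    simp only [TDiag.combRev, TDiag.insertLeg, if_true, h]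
    exact UGraph.insertAt_combRev L R f
  constructor
  · rw [op, hXY _ fun j h => by
      simp only [TDiag.comb, TDiag.insertLeg, if_neg h, List.map_map, Function.comp_def, ej' j h],
      h1]
    simp only [List.map_append, List.map_cons, List.prod_append, List.prod_cons, List.map_map,
      Function.comp_def, eL', eR', mul_assoc, hc' f (foot i f hf)]
  · rw [op, hXY _ fun j h => by
      simp only [TDiag.combRev, TDiag.insertLeg, if_neg h, List.map_map, Function.comp_def,
        ej' j h], h2]
    simp only [List.map_append, List.map_cons, List.prod_append, List.prod_cons, List.map_map,
      Function.comp_def, eL', eR', mul_assoc, hc' f (foot i f hf)]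

theorem sum_stateInsert₂ {M : Type*} [AddCommMonoid M] (g : UGraph F) (z y : F)
    (Ψ : ((F ⊕ Fin 4) ⊕ Fin 4 → K) → M) :
    ∑ c : W.State ((g.insertLeg (g.inv z)).insertLeg (.inl y)), Ψ c.1 =
      ∑ c : W.State g, ∑ u, ∑ b, ∑ u', ∑ b',
        Ψ (W.extend (W.extendInv c.1 z u b) (.inl y) u' b') := by
  rw [W.sum_stateInsert, W.sum_stateInsertInv _ _ fun c => ∑ u, ∑ b, Ψ (W.extend c (.inl y) u b)]

/-- With the colours away from the vertex fixed, the sums over the foot, the two new feet and the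
row are those of `ladder`; the rest contributes the common factors `X`, `Y` and `r`. -/
theorem weight_cl1 (D : TDiag n F) (i : Fin n) (L R : List F) (f : F)
    (h : D.feet i = L ++ f :: R) (hf : D.rot (D.inv f) ≠ D.inv f) :
    W.weight (D.comb i L f) + W.weight (D.combRev i L f) = (2 * d i ^ 2) • W.weight D := by
  classical
  set x := D.inv f with hx
  set z := D.rot x with hz
  set y := D.rot z with hy
  have hff : D.rot f = f := D.rot_eq_of_feet h (by simp)
  have hyx : y ≠ x := D.rot_rot_ne hf
  have hyz : y ≠ z := D.rot_rot_ne_rot hf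
  have hzz : D.rot z ≠ z := hyz
  have hyy : D.rot y ≠ y := by rw [hy, hz, D.rot_rot_rot]; exact hyx.symm
  have fx : f ≠ x := (D.inv_ne f).symm
  have fz : f ≠ z := by rintro e; rw [← e] at hzz; exact hzz hff
  have fy : f ≠ y := by rintro e; rw [← e] at hyy; exact hyy hff
  set g'' := (D.toUGraph.insertLeg (D.inv z)).insertLeg (.inl y) with hg''
  have hV : ∀ c u b u' b', W.verts g'' (W.extend (W.extendInv c z u b) (.inl y) u' b') =
      W.verts D.toUGraph (Function.update (Function.update c z u) y u') *
        (W.V (c z) (W.dual u) (W.dual b) * W.V (W.dual u') (c y) (W.dual b')) := by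
    intro c u b u' b'
    rw [hg'', W.verts_insert, W.verts_insert, mul_assoc]
    congr 1
    · congr 1
      funext a
      by_cases h1 : a = y
      · subst h1; simp
      · by_cases h2 : a = z
        · subst h2
          simp [extend_of_ne, h1]
        · simp [extend_of_ne, extendInv_of_ne, h1, h2]
    · simp [extend_of_ne, extendInv_of_ne, hyz]
  have h1 : W.weight (D.comb i L f) = _ := W.sum_stateInsert₂ D.toUGraph z y fun c =>
    W.verts g'' c • W.op (D.comb i L f) c
  have h2 : W.weight (D.combRev i L f) = _ := W.sum_stateInsert₂ D.toUGraph z y fun c =>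
    W.verts g'' c • W.op (D.combRev i L f) c
  rw [h1, h2, ← Finset.sum_add_distrib]
  simp only [← Finset.sum_add_distrib, ← smul_add]
  rw [W.sum_relabel D.toUGraph f fun c => ∑ u, ∑ b, ∑ u', ∑ b',
    W.verts g'' (W.extend (W.extendInv c z u b) (.inl y) u' b') •
      (W.op (D.comb i L f) (W.extend (W.extendInv c z u b) (.inl y) u' b') +
        W.op (D.combRev i L f) (W.extend (W.extendInv c z u b) (.inl y) u' b'))]
  rw [weight, W.sum_relabel D.toUGraph f fun c => W.verts D.toUGraph c • W.op D c,
    Finset.smul_sum]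
  refine Finset.sum_congr rfl fun c _ => ?_
  obtain ⟨X, Y, hXY⟩ := W.exists_op_comb D i L R f h c.1.1
  obtain ⟨r, hr⟩ := W.exists_verts_eq D.toUGraph hf c.1.1
  have ex : ∀ t, W.relabel D.toUGraph f c.1.1 t x = W.dual t := fun t => by simp [relabel, hx]
  have ef : ∀ t, W.relabel D.toUGraph f c.1.1 t f = t := fun t => by
    simp [relabel, (D.inv_ne f).symm]
  have eo : ∀ t a, a ≠ f → a ≠ x → W.relabel D.toUGraph f c.1.1 t a = c.1.1 a := fun t a h h' => by
    simp [relabel, h, ← hx, h']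
  have ez := fun t => eo t z fz.symm hf
  have ey := fun t => eo t y fy.symm hyx
  have e1 : ∀ t, W.verts D.toUGraph (W.relabel D.toUGraph f c.1.1 t) =
      r * W.V (W.dual t) (c.1.1 z) (c.1.1 y) := fun t => by
    rw [hr _ fun a ha ha' => eo t a (by rintro rfl; exact ha hff) fun e => ha' (Or.inl e), ← hz,
      ← hy, ex, ez, ey]
  have e2 : ∀ t u u', W.verts D.toUGraph (Function.update (Function.update
      (W.relabel D.toUGraph f c.1.1 t) z u) y u') = r * W.V (W.dual t) u u' := fun t u u' => by
    rw [hr _ fun a ha ha' => ?_, ← hz, ← hy]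
    · simp [hyx.symm, hyz.symm, Ne.symm hf, ex]
    · have : a ≠ x ∧ a ≠ z ∧ a ≠ y := by simpa [UGraph.Orb, not_or] using ha'
      simp [this, eo t a (by rintro rfl; exact ha hff)]
  have e3 : ∀ t a, D.rot a = a → a ≠ f → W.relabel D.toUGraph f c.1.1 t a = c.1.1 a :=
    fun t a ha h => eo t a h (by rintro rfl; exact hf ha)
  have e4 : ∀ t u b u' b', ∀ a, D.rot a = a → W.extend (W.extendInv
      (W.relabel D.toUGraph f c.1.1 t) z u b) (.inl y) u' b' (.inl (.inl a)) =
        W.relabel D.toUGraph f c.1.1 t a := by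
    intro t u b u' b' a ha
    have h1 : a ≠ y := by rintro rfl; exact hyy ha
    have h2 : a ≠ z := by rintro rfl; exact hzz ha
    rw [extend_of_ne _ _ (by simpa using h1), extendInv_of_ne _ _ h2]
  have e5 : ∀ t u b u' b', W.verts g'' (W.extend (W.extendInv
        (W.relabel D.toUGraph f c.1.1 t) z u b) (.inl y) u' b') •
      (W.op (D.comb i L f) (W.extend (W.extendInv
        (W.relabel D.toUGraph f c.1.1 t) z u b) (.inl y) u' b') +
        W.op (D.combRev i L f) (W.extend (W.extendInv
          (W.relabel D.toUGraph f c.1.1 t) z u b) (.inl y) u' b')) =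
      X * (r • ((W.V (W.dual t) u u' * W.V (c.1.1 z) (W.dual u) (W.dual b) *
        W.V (W.dual u') (c.1.1 y) (W.dual b')) • (W.ρ i b * W.ρ i t * W.ρ i b' +
          W.ρ i b' * W.ρ i t * W.ρ i b))) * Y := by
    intro t u b u' b'
    have := (hXY _ (e3 t)).2 _ (e4 t u b u' b')
    rw [this.1, this.2, hV, e2, ef, ez, ey, ← add_mul, ← mul_add, smul_smul, mul_smul_comm,
      smul_mul_assoc, extend_three, extend_of_ne _ _ (by simp), extendInv_three]
    congr 1
    ring
  have e6 : ∀ t, W.verts D.toUGraph (W.relabel D.toUGraph f c.1.1 t) •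
      W.op D (W.relabel D.toUGraph f c.1.1 t) =
      X * (r • (W.V (W.dual t) (c.1.1 z) (c.1.1 y) • W.ρ i t)) * Y := by
    intro t
    rw [(hXY _ (e3 t)).1, e1, ef, smul_smul, mul_smul_comm, smul_mul_assoc]
  simp only [e5, e6, ← Finset.sum_mul, ← Finset.mul_sum, ← Finset.smul_sum]
  rw [W.ladder, smul_comm, mul_smul_comm, smul_mul_assoc]

/-- The algebra homomorphism given by a weight system. -/
theorem exists_hom : ∃ ψ : C n →ₐ[Lam n] A, ∀ {F : Type} (D : TDiag n F), ψ D.toC = W.weight D := by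
  let μ : Diag n →* A :=
    { toFun := Quotient.lift (fun D => W.weight D.2) fun _ _ ⟨φ⟩ => W.weight_iso φ
      map_one' := W.weight_one
      map_mul' := by rintro ⟨_, D⟩ ⟨_, E⟩; exact W.weight_mul D E }
  let Ψ : Free n →ₐ[Lam n] A := MonoidAlgebra.lift (Lam n) A (Diag n) μ
  have hΨ : ∀ {F : Type} (D : TDiag n F), Ψ D.elt = W.weight D := by
    intro F D
    rw [TDiag.elt]
    simp only [Ψ]
    rw [MonoidAlgebra.lift_of]
    rfl
  have hR : ∀ x, x ∈ relIdeal n → Ψ x = 0 := by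
    intro x hx
    change x ∈ relSpan n at hx
    induction hx using Submodule.span_induction with
    | mem x hx =>
      cases hx with
      | stu D i L R y z h => simp only [map_sub, hΨ, W.weight_stu, sub_self]
      | cl1 D i L R f h hf =>
        simp only [map_sub, map_add, map_smul, hΨ]
        rw [W.weight_cl1 D i L R f h hf, sub_self]
      | cl2 D a ha hb h₁ h₂ i j k l hk hl =>
        simp only [map_sub, map_smul, hΨ]
        rw [W.weight_cl2 D a ha hb, sub_self]
    | zero => exact map_zero _
    | add x y _ _ hx hy => rw [map_add, hx, hy, add_zero]
    | smul c x _ hx => rw [map_smul, hx, smul_zero]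
  exact ⟨Ideal.Quotient.liftₐ (relIdeal n) Ψ hR, fun D => hΨ D⟩

end WeightSystem
end TriDiag

namespace TriDiag
variable {n : ℕ} {F F' G H : Type}

/-! ### The oscillator algebra -/

/-- The basis of the oscillator Lie algebra with bosons indexed by `I`, enlarged by an abelian
summand: the number operator `inl true` and the central element `inl false`, which are dual to each
other, the creation and annihilation operators, and dual pairs of further central elements. -/
abbrev Col (n : ℕ) (I : Type) : Type := Bool ⊕ (Bool × I) ⊕ (Bool × Fin n × Fin n)

namespace Col

variable {I : Type}

/-- The dual basis vector. -/
def dual : Col n I → Col n I :=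
  Sum.map not (Sum.map (Prod.map not id) (Prod.map not id))

/-- The sign that goes with annihilation and creation. -/
def sgn (s : Bool) : ℤ := if s then -1 else 1

variable [DecidableEq I]

/-- The invariant trilinear form. -/
def V : Col n I → Col n I → Col n I → ℤ
  | .inl true, .inr (.inl (s, a)), .inr (.inl (t, b)) => if t = !s ∧ b = a then sgn s else 0
  | .inr (.inl (s, a)), .inr (.inl (t, b)), .inl true => if t = !s ∧ b = a then sgn s else 0
  | .inr (.inl (t, b)), .inl true, .inr (.inl (s, a)) => if t = !s ∧ b = a then sgn s else 0
  | _, _, _ => 0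

theorem dual_dual (x : Col n I) : dual (dual x) = x := by
  rcases x with x | ⟨x, a⟩ | ⟨x, a⟩ <;> simp [dual]

theorem V_rot (x y z : Col n I) : V y z x = V x y z := by
  rcases x with (_ | _) | ⟨s, a⟩ | x <;> rcases y with (_ | _) | ⟨t, b⟩ | y <;>
    rcases z with (_ | _) | ⟨r, c⟩ | z <;> simp [V]

theorem V_cube (x y z : Col n I) : V x y z * V x y z * V x y z = V x y z := by
  rcases x with (_ | _) | ⟨s, a⟩ | x <;> rcases y with (_ | _) | ⟨t, b⟩ | y <;>
    rcases z with (_ | _) | ⟨r, c⟩ | z <;> simp [V, sgn] <;> split_ifs <;> simp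

variable [Fintype I] {M : Type*} [AddCommGroup M]

/-- The bracket in terms of the form. -/
def br (u v : Col n I) (Φ : Col n I → M) : M :=
  match u, v with
    | .inr (.inl (s, a)), .inr (.inl (t, b)) =>
      if t = !s ∧ b = a then sgn s • Φ (.inl false) else 0
    | .inl true, .inr (.inl (s, a)) => sgn s • Φ (.inr (.inl (s, a)))
    | .inr (.inl (s, a)), .inl true => -(sgn s • Φ (.inr (.inl (s, a))))
    | _, _ => 0

/-- `br u v Φ` is the linear extension of `Φ` evaluated at a bracket: contraction of the form with
the dual basis. In this form the sums over colours have few terms. -/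
theorem sum_V (u v : Col n I) (Φ : Col n I → M) : ∑ t, V (dual t) u v • Φ t = br u v Φ := by
  rcases u with (_ | _) | ⟨_ | _, a⟩ | u <;> rcases v with (_ | _) | ⟨_ | _, b⟩ | v <;>
    simp [Fintype.sum_prod_type, V, dual, sgn, ite_smul, br]

theorem sum_V' (u : Col n I) (Φ : Col n I → Col n I → M) :
    ∑ v, ∑ b, V u (dual v) (dual b) • Φ v b = ∑ v, br u (dual v) (Φ v) :=
  Finset.sum_congr rfl fun v _ => by simp only [V_rot (dual _) u (dual v), sum_V]

theorem sum_V_number (Φ : Col n I → Col n I → M) :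
    ∑ u, ∑ b, V (.inl true) (dual u) (dual b) • Φ u b =
      ∑ a, Φ (.inr (.inl (true, a))) (.inr (.inl (false, a))) -
        ∑ a, Φ (.inr (.inl (false, a))) (.inr (.inl (true, a))) := by
  rw [sum_V']
  simp [Fintype.sum_prod_type, br, dual, sgn, sub_eq_add_neg]

theorem sum_V_boson (s : Bool) (a : I) (Φ : Col n I → Col n I → M) :
    ∑ u, ∑ b, V (.inr (.inl (s, a))) (dual u) (dual b) • Φ u b =
      sgn s • (Φ (.inr (.inl (s, a))) (.inl false) - Φ (.inl false) (.inr (.inl (s, a)))) := by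
  rw [sum_V']
  cases s <;> simp [Fintype.sum_prod_type, br, dual, sgn] <;> abel

theorem sum_V_eq_zero {u : Col n I} (hu : ∀ v w, V u v w = 0) (Φ : Col n I → Col n I → M) :
    ∑ v, ∑ b, V u (dual v) (dual b) • Φ v b = 0 := by
  simp [hu]

theorem sum_V_mul_boson (s : Bool) (a : I) (b : Col n I) (f : Col n I → ℤ) :
    ∑ v, V (.inr (.inl (s, a))) v (dual b) * f v =
      if b = .inl false then sgn s * f (.inr (.inl (!s, a))) else
        if b = .inr (.inl (s, a)) then - (sgn s * f (.inl true)) else 0 := by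
  rcases b with (_ | _) | ⟨_ | _, b⟩ | b <;> cases s <;>
    simp [Fintype.sum_prod_type, V, dual, sgn, eq_comm (a := a)]

/-- Between two bosons, the middle colour is forced: a boson can only pass a leg of central colour
if it is to meet a boson again with nonzero weight. -/
theorem parallel_boson (s : Bool) (a : I) (t : Bool) (c : I) (b b' : Col n I) :
    ∑ v, V (dual (.inr (.inl (s, a)))) v (dual b) * V (dual v) (.inr (.inl (t, c))) (dual b') =
      if (.inr (.inl (s, a)) : Col n I) = .inr (.inl (t, c)) ∧ b = .inl false ∧ b' = .inl false
        then 1 else 0 := by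
  refine (sum_V_mul_boson (!s) a b _).trans ?_
  rcases b with (_ | _) | ⟨_, _⟩ | b
  · rcases b' with (_ | _) | ⟨_, _⟩ | b' <;> cases s <;> cases t <;>
      simp [V, dual, sgn, eq_comm (a := a)]
  · simp [V, dual]
  · simp [V, dual]
  · simp [V, dual]

end Col

variable {I A : Type} [Fintype I] [DecidableEq I] [Ring A] [Algebra (Lam n) A]

/-- The action of the oscillator algebra on the `i`-th interval. -/
def oscRho (x y : Fin n → I → A) (z : Bool → Fin n → Fin n → A) (i : Fin n) : Col n I → A
  | .inl true => ∑ a, x i a * y i a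
  | .inl false => algebraMap (Lam n) A (d i)
  | .inr (.inl (true, a)) => x i a
  -- The factor `d i` makes the commutator of annihilation and creation, up to sign, the central
  -- element, which acts by `d i`.
  | .inr (.inl (false, a)) => -(d i • y i a)
  -- A dual pair of additional central elements for each pair of intervals `k`, `l`: one acts on
  -- `k`, the other on `l`. They contribute only to edges and make the symbols of the edges
  -- independent of the rest.
  | .inr (.inr (s, k, l)) => if i = (bif s then k else l) then z s k l else 0

theorem sum_comm₅ {ι M : Type*} [Fintype ι] [AddCommMonoid M] (f : ι → ι → ι → ι → ι → M) :
    ∑ t, ∑ u, ∑ b, ∑ u', ∑ b', f t u b u' b' = ∑ u, ∑ b, ∑ b', ∑ u', ∑ t, f t u b u' b' := by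
  rw [Finset.sum_comm]
  refine Finset.sum_congr rfl fun u _ => ?_
  rw [Finset.sum_comm]
  refine Finset.sum_congr rfl fun b _ => ?_
  rw [Finset.sum_comm, Finset.sum_congr rfl fun u' _ => Finset.sum_comm, Finset.sum_comm]

/-- The weight system of the oscillator algebra for operators that satisfy the canonical
commutation relations. -/
def oscillator (x y : Fin n → I → A) (z : Bool → Fin n → Fin n → A)
    (hxx : ∀ i j a b, Commute (x i a) (x j b)) (hyy : ∀ i j a b, Commute (y i a) (y j b))
    (hyx : ∀ i j a b, y i a * x j b - x j b * y i a = if i = j ∧ a = b then 1 else 0)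
    (hxz : ∀ i a s k l, Commute (x i a) (z s k l)) (hyz : ∀ i a s k l, Commute (y i a) (z s k l))
    (hzz : ∀ s k l s' k' l', Commute (z s k l) (z s' k' l')) : WeightSystem n (Col n I) A where
  dual := Col.dual
  dual_dual := Col.dual_dual
  V := Col.V
  V_rot := Col.V_rot
  V_cube := Col.V_cube
  ρ := oscRho x y z
  unit := .inl false
  ρ_unit _ := rfl
  commute := by
    have hyx' : ∀ i j a b, i ≠ j → Commute (y i a) (x j b) := fun i j a b h => by
      rw [Commute, SemiconjBy, ← sub_eq_zero, hyx, if_neg fun e => h e.1]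
    have c1 : ∀ i j a c, i ≠ j → Commute (x i a) (oscRho x y z j c) := by
      intro i j a c h
      rcases c with (_ | _) | ⟨_ | _, b⟩ | ⟨s, k, l⟩ <;> simp only [oscRho]
      · exact (Algebra.commutes _ _).symm
      · exact Commute.sum_right _ _ _ fun b _ => (hxx _ _ _ _).mul_right (hyx' _ _ _ _ h.symm).symm
      · exact ((hyx' _ _ _ _ h.symm).symm.smul_right _).neg_right
      · exact hxx _ _ _ _
      · split_ifs
        exacts [hxz _ _ _ _ _, Commute.zero_right _]
    have c2 : ∀ i j a c, i ≠ j → Commute (y i a) (oscRho x y z j c) := by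
      intro i j a c h
      rcases c with (_ | _) | ⟨_ | _, b⟩ | ⟨s, k, l⟩ <;> simp only [oscRho]
      · exact (Algebra.commutes _ _).symm
      · exact Commute.sum_right _ _ _ fun b _ => (hyx' _ _ _ _ h).mul_right (hyy _ _ _ _)
      · exact ((hyy _ _ _ _).smul_right _).neg_right
      · exact hyx' _ _ _ _ h
      · split_ifs
        exacts [hyz _ _ _ _ _, Commute.zero_right _]
    have c3 : ∀ s k l j c, Commute (z s k l) (oscRho x y z j c) := by
      intro s k l j c
      rcases c with (_ | _) | ⟨_ | _, b⟩ | ⟨s, k, l⟩ <;> simp only [oscRho]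
      · exact (Algebra.commutes _ _).symm
      · exact Commute.sum_right _ _ _ fun b _ =>
          (hxz _ _ _ _ _).symm.mul_right (hyz _ _ _ _ _).symm
      · exact ((hyz _ _ _ _ _).symm.smul_right _).neg_right
      · exact (hxz _ _ _ _ _).symm
      · split_ifs
        exacts [hzz _ _ _ _ _ _, Commute.zero_right _]
    intro i j c c' h
    rcases c with (_ | _) | ⟨_ | _, b⟩ | ⟨s, k, l⟩ <;> simp only [oscRho]
    · exact Algebra.commutes _ _
    · exact Commute.sum_left _ _ _ fun b _ => (c1 _ _ _ _ h).mul_left (c2 _ _ _ _ h)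
    · exact ((c2 _ _ _ _ h).smul_left _).neg_left
    · exact c1 _ _ _ _ h
    · split_ifs
      exacts [c3 _ _ _ _ _, Commute.zero_left _]
  bracket := by
    intro i u v
    have hd : ∑ p, Col.V p v u • oscRho x y z i (Col.dual p) =
        ∑ t, Col.V (Col.dual t) v u • oscRho x y z i t :=
      Fintype.sum_equiv ⟨Col.dual, Col.dual, Col.dual_dual, Col.dual_dual⟩ _ _ fun p => by
        simp [Col.dual_dual]
    have e1 : ∀ a b, y i a * x i b = x i b * y i a + if a = b then 1 else 0 := fun a b => by
      have := hyx i i a b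
      rw [sub_eq_iff_eq_add] at this
      simpa [add_comm] using this
    have e2 : ∀ b, (∑ a, x i a * y i a) * x i b = x i b * (∑ a, x i a * y i a) + x i b := by
      intro b
      simp only [Finset.sum_mul, Finset.mul_sum, mul_assoc, e1, mul_add, Finset.sum_add_distrib]
      congr 1
      · refine Finset.sum_congr rfl fun a _ => ?_
        rw [← mul_assoc, (hxx i i a b).eq, mul_assoc]
      · simp
    have e3 : ∀ b, y i b * (∑ a, x i a * y i a) = (∑ a, x i a * y i a) * y i b + y i b := by
      intro b
      simp only [Finset.sum_mul, Finset.mul_sum, ← mul_assoc, e1, add_mul, Finset.sum_add_distrib]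
      congr 1
      · refine Finset.sum_congr rfl fun a _ => ?_
        rw [mul_assoc, (hyy i i b a).eq, mul_assoc]
      · simp
    have e4 : ∀ s k l, Commute (∑ a, x i a * y i a) (z s k l) := fun s k l =>
      Commute.sum_left _ _ _ fun b _ => (hxz _ _ _ _ _).mul_left (hyz _ _ _ _ _)
    have c : ∀ (r : Lam n) (a : A), algebraMap (Lam n) A r * a = a * algebraMap (Lam n) A r :=
      fun r a => Algebra.commutes r a
    have cz : ∀ X : A, (∀ s k l, Commute X (z s k l)) → ∀ s k l (P : Prop) [Decidable P],
        X * (if P then z s k l else 0) = (if P then z s k l else 0) * X := fun X h s k l P _ => by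
      split_ifs
      exacts [(h _ _ _).eq, by simp]
    rw [hd, Col.sum_V, sub_eq_iff_eq_add]
    rcases u with (_ | _) | ⟨_ | _, a⟩ | ⟨s, k, l⟩ <;>
      rcases v with (_ | _) | ⟨_ | _, b⟩ | ⟨s', k', l'⟩ <;>
      simp only [oscRho, Col.sgn, Col.br, c, zero_add, if_true, if_false, Bool.not_true, Bool.not_false,
        Bool.false_eq_true, reduceCtorEq, false_and, true_and, one_smul, neg_smul, neg_neg]
    · rw [mul_neg, neg_mul, mul_smul_comm, smul_mul_assoc, e3, smul_add]; abel
    · rw [e2, add_comm]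
    · exact cz _ e4 s' k' l' _
    · rw [mul_neg, neg_mul, mul_smul_comm, smul_mul_assoc, e3, smul_add]; abel
    · rw [neg_mul_neg, neg_mul_neg, smul_mul_smul_comm, smul_mul_smul_comm, (hyy i i a b).eq]
    · rw [mul_neg, neg_mul, mul_smul_comm, smul_mul_assoc, e1, smul_add, smul_ite,
        Algebra.algebraMap_eq_smul_one, smul_zero]
      split_ifs <;> abel
    · exact cz _ (fun s k l => ((hyz i a s k l).smul_left _).neg_left) s' k' l' _
    · rw [e2]; abel
    · rw [mul_neg, neg_mul, mul_smul_comm, smul_mul_assoc, e1, smul_add, smul_ite,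
        Algebra.algebraMap_eq_smul_one, smul_zero]
      simp only [eq_comm (a := b)]
      split_ifs <;> abel
    · exact (hxx i i a b).eq
    · exact cz _ (hxz i a) s' k' l' _
    · exact (cz _ e4 s k l _).symm
    · exact (cz _ (fun s k l => ((hyz i b s k l).smul_left _).neg_left) s k l _).symm
    · exact (cz _ (hxz i b) s k l _).symm
    · exact cz _ (fun s' k' l' => by
        split_ifs
        exacts [hzz _ _ _ _ _ _, Commute.zero_left _]) s' k' l' _
  parallel := by
    intro u p b b' r t r' t' h h'
    -- The nonvanishing hypotheses leave the number operator and bosons for `u`, the central element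
    -- and bosons for `p`; only two bosons give a nonzero sum.
    rcases u with (_ | _) | ⟨s, a⟩ | u
    · simp [Col.V] at h
    · rcases p with (_ | _) | ⟨s', a'⟩ | p
      · simp [Col.V, Col.dual]
      · simp [Col.V, Col.dual] at h'
      · simp [Col.V, Col.dual]
      · simp [Col.V, Col.dual] at h'
    · rcases p with (_ | _) | ⟨s', a'⟩ | p
      · rcases b' with (_ | _) | ⟨_, _⟩ | b' <;> rcases b with (_ | _) | ⟨_, _⟩ | b <;>
          simp [Col.V, Col.dual]
      · simp [Col.V, Col.dual] at h'
      · exact Col.parallel_boson _ _ _ _ _ _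
      · simp [Col.V, Col.dual] at h'
    · simp [Col.V] at h
  ladder := by
    intro i p q
    set Ψ : Col n I → Col n I → Col n I → A := fun b b' t => oscRho x y z i b * oscRho x y z i t *
      oscRho x y z i b' + oscRho x y z i b' * oscRho x y z i t * oscRho x y z i b with hΨ
    -- The sums are reordered so that the sum over `t` is a bracket. The sums over `b'`, `u'` and
    -- then `u`, `b` are contractions with `q` and `p`, which are explicit for each type of colour.
    calc _ = ∑ u, ∑ b, Col.V p (Col.dual u) (Col.dual b) • ∑ b', ∑ u',
        Col.V q (Col.dual b') (Col.dual u') • Col.br u u' (Ψ b b') := by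
          rw [sum_comm₅]
          refine Finset.sum_congr rfl fun u _ => Finset.sum_congr rfl fun b _ => ?_
          simp only [← Col.sum_V, Finset.smul_sum, smul_smul]
          refine Finset.sum_congr rfl fun b' _ => Finset.sum_congr rfl fun u' _ =>
            Finset.sum_congr rfl fun t _ => ?_
          rw [Col.V_rot (Col.dual u') q (Col.dual b')]
          congr 1
          ring
      _ = _ := by
        rw [Col.sum_V]
        rcases p with (_ | _) | ⟨s, a⟩ | p
        · rw [Col.sum_V_eq_zero (by simp [Col.V])]
          simp [Col.br]
        · rw [Col.sum_V_number]
          rcases q with (_ | _) | ⟨s', a'⟩ | q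
          · simp only [Col.sum_V_eq_zero (u := .inl false) (by simp [Col.V])]
            simp [Col.br]
          · simp only [Col.sum_V_number]
            simp [Col.br, hΨ, oscRho, Col.sgn]
          · simp only [Col.sum_V_boson]
            cases s' <;> simp [Col.br, hΨ, oscRho, Col.sgn]
            all_goals simp only [Algebra.algebraMap_eq_smul_one, smul_mul_assoc, mul_smul_comm,
              one_mul, mul_one, smul_smul]
            all_goals module
          · simp only [Col.sum_V_eq_zero (u := .inr (.inr q)) (by simp [Col.V])]
            simp [Col.br]
        · rw [Col.sum_V_boson]
          rcases q with (_ | _) | ⟨s', a'⟩ | q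
          · simp only [Col.sum_V_eq_zero (u := .inl false) (by simp [Col.V])]
            simp [Col.br]
          · simp only [Col.sum_V_number]
            cases s <;> simp [Col.br, hΨ, oscRho, Col.sgn]
            all_goals simp only [Algebra.algebraMap_eq_smul_one, smul_mul_assoc, mul_smul_comm,
              one_mul, mul_one, smul_smul]
            all_goals module
          · simp only [Col.sum_V_boson]
            cases s <;> cases s' <;> simp [Col.br, hΨ, oscRho, Col.sgn]
            all_goals simp only [Algebra.algebraMap_eq_smul_one, smul_mul_assoc, mul_smul_comm,
              one_mul, mul_one, smul_smul]
            all_goals first | module | (split_ifs <;> module)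
          · simp only [Col.sum_V_eq_zero (u := .inr (.inr q)) (by simp [Col.V])]
            simp [Col.br]
        · rw [Col.sum_V_eq_zero (by simp [Col.V])]
          simp [Col.br]

end TriDiag

namespace TriDiag
variable {n : ℕ} {F F' G H : Type}

open MvPolynomial

/-! ### Leading symbols of operators on polynomials -/

section Symbol
variable {σ R : Type} [CommRing R]

/-- The polynomials of total degree less than `j`. -/
def Low (σ R : Type) [CommRing R] (j : ℕ) : Submodule R (MvPolynomial σ R) where
  carrier := {m | ∀ e : σ →₀ ℕ, j ≤ e.degree → coeff e m = 0}
  add_mem' h h' e he := by rw [coeff_add, h e he, h' e he, add_zero]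
  zero_mem' _ _ := coeff_zero _
  smul_mem' c m h e he := by rw [coeff_smul, h e he, smul_zero]

theorem low_mono {i j : ℕ} (h : i ≤ j) : Low σ R i ≤ Low σ R j := fun _ hm e he =>
  hm e (h.trans he)

theorem IsHomogeneous.mul_mem_low {p : MvPolynomial σ R} {k : ℕ} (hp : p.IsHomogeneous k)
    {m : MvPolynomial σ R} {j : ℕ} (hm : m ∈ Low σ R j) : p * m ∈ Low σ R (j + k) := by
  classical
  intro e he
  rw [coeff_mul]
  refine Finset.sum_eq_zero fun x hx => ?_
  by_cases h : x.1.degree = k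
  · have := congrArg Finsupp.degree (Finset.HasAntidiagonal.mem_antidiagonal.1 hx)
    rw [map_add] at this
    rw [hm x.2 (by omega), mul_zero]
  · rw [hp.coeff_eq_zero h, zero_mul]

/-- The operator `P` raises the total degree by at most `k`, and its part of degree `k` is the
multiplication with the homogeneous polynomial `p`. -/
structure HasSymbol (P : Module.End R (MvPolynomial σ R)) (k : ℕ) (p : MvPolynomial σ R) :
    Prop where
  hom : p.IsHomogeneous k
  sub_mem : ∀ j, ∀ m ∈ Low σ R (j + 1), P m - p * m ∈ Low σ R (j + k)

namespace HasSymbol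

variable {P Q : Module.End R (MvPolynomial σ R)} {k l : ℕ} {p q : MvPolynomial σ R}

/-- The error P(Qm) − pqm is the error of P at Qm plus p times the error of Q at m. -/
theorem mul (hP : HasSymbol P k p) (hQ : HasSymbol Q l q) : HasSymbol (P * Q) (k + l) (p * q) := by
  refine ⟨hP.hom.mul hQ.hom, fun j m hm => ?_⟩
  have h1 := hQ.sub_mem j m hm
  have h2 : Q m ∈ Low σ R (j + l + 1) := by
    have h3 := IsHomogeneous.mul_mem_low hQ.hom hm
    have := add_mem (low_mono (show j + l ≤ j + l + 1 by omega) h1)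
      (low_mono (show j + 1 + l ≤ j + l + 1 by omega) h3)
    rwa [sub_add_cancel] at this
  have h4 := add_mem (hP.sub_mem _ _ h2) (IsHomogeneous.mul_mem_low hP.hom h1)
  have e : (P * Q) m - p * q * m = P (Q m) - p * Q m + p * (Q m - q * m) := by
    rw [Module.End.mul_apply]; ring
  rw [e]
  exact low_mono (by omega) h4

theorem one : HasSymbol (1 : Module.End R (MvPolynomial σ R)) 0 1 :=
  ⟨isHomogeneous_one σ R, fun j m _ => by simp⟩

theorem zero : HasSymbol (0 : Module.End R (MvPolynomial σ R)) k 0 :=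
  ⟨isHomogeneous_zero σ R k, fun j m _ => by simp⟩

theorem add (hP : HasSymbol P k p) (hQ : HasSymbol Q k q) : HasSymbol (P + Q) k (p + q) := by
  refine ⟨hP.hom.add hQ.hom, fun j m hm => ?_⟩
  have := add_mem (hP.sub_mem j m hm) (hQ.sub_mem j m hm)
  rwa [show P m - p * m + (Q m - q * m) = (P + Q) m - (p + q) * m by
    rw [LinearMap.add_apply]; ring] at this

theorem smul (hP : HasSymbol P k p) (r : R) : HasSymbol (r • P) k (r • p) := by
  refine ⟨(homogeneousSubmodule σ R k).smul_mem r hP.hom, fun j m hm => ?_⟩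
  have := (Low σ R _).smul_mem r (hP.sub_mem j m hm)
  rwa [smul_sub, ← smul_mul_assoc] at this

theorem zsmul (hP : HasSymbol P k p) (r : ℤ) : HasSymbol (r • P) k (r • p) := by
  rw [← Int.cast_smul_eq_zsmul R, ← Int.cast_smul_eq_zsmul R]
  exact hP.smul _

theorem neg (hP : HasSymbol P k p) : HasSymbol (-P) k (-p) := by
  simpa using hP.zsmul (-1)

theorem sum {ι : Type*} (s : Finset ι) {P : ι → Module.End R (MvPolynomial σ R)}
    {p : ι → MvPolynomial σ R} (h : ∀ i ∈ s, HasSymbol (P i) k (p i)) :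
    HasSymbol (∑ i ∈ s, P i) k (∑ i ∈ s, p i) := by
  classical
  induction s using Finset.induction_on with
  | empty => simpa using zero
  | insert i s hi ih =>
    rw [Finset.sum_insert hi, Finset.sum_insert hi]
    exact (h i (by simp)).add (ih fun j hj => h j (by simp [hj]))

theorem list_prod {ι : Type*} (l : List ι) {P : ι → Module.End R (MvPolynomial σ R)} {k : ι → ℕ}
    {p : ι → MvPolynomial σ R} (h : ∀ i, HasSymbol (P i) (k i) (p i)) :
    HasSymbol (l.map P).prod (l.map k).sum (l.map p).prod := by
  induction l with
  | nil => exact one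
  | cons i l ih => simpa using (h i).mul ih

theorem lmul (hp : p.IsHomogeneous k) : HasSymbol (Algebra.lmul R _ p) k p :=
  ⟨hp, fun j m _ => by simp⟩

/-- The derivative lowers the degree, so only the multiplication is seen by the symbol. -/
theorem pderiv_add_lmul {P : Module.End R (MvPolynomial σ R)} {v w : σ}
    (hP : ∀ m, P m = pderiv v m + X w * m) : HasSymbol P 1 (X w) := by
  refine ⟨isHomogeneous_X R w, fun j m hm e he => ?_⟩
  rw [hP, add_sub_cancel_right, coeff_pderiv,
    hm _ (by rw [map_add, Finsupp.degree_single]; omega), zero_mul]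

end HasSymbol

end Symbol

/-! ### The polynomial representation of the oscillator algebra -/

section Representation
variable (n : ℕ) (I : Type) [Fintype I] [DecidableEq I]

/-- The variables: positions (`inl (true, i, a)`), momenta (`inl (false, i, a)`), and two central
variables for each pair of intervals. -/
abbrev Var : Type := (Bool × Fin n × I) ⊕ (Bool × Fin n × Fin n)

/-- The polynomials on which the oscillator algebra acts. -/
abbrev Pol : Type := MvPolynomial (Var n I) (Lam n)

variable {n I}

theorem pderiv_comm' (v w : Var n I) (f : Pol n I) :
    pderiv v (pderiv w f) = pderiv w (pderiv v f) := by
  ext e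
  by_cases h : v = w
  · rw [h]
  · simp only [coeff_pderiv, Finsupp.add_apply, Finsupp.single_eq_of_ne h,
      Finsupp.single_eq_of_ne (Ne.symm h), add_zero, add_right_comm e]
    ring_nf

/-- Multiplication by a position. -/
def posOp (i : Fin n) (a : I) : Module.End (Lam n) (Pol n I) :=
  Algebra.lmul (Lam n) _ (X (.inl (true, i, a)))

/-- The derivative, shifted by a momentum. -/
def momOp (i : Fin n) (a : I) : Module.End (Lam n) (Pol n I) :=
  -- The momentum variable commutes with all operators and so does not affect the canonical
  -- commutation relations, but it gives the operator a nonzero symbol.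
  (pderiv (.inl (true, i, a)) : Derivation (Lam n) _ _).toLinearMap +
    Algebra.lmul (Lam n) _ (X (.inl (false, i, a)))

/-- Multiplication by a central variable. -/
def cenOp (s : Bool) (k l : Fin n) : Module.End (Lam n) (Pol n I) :=
  Algebra.lmul (Lam n) _ (X (.inr (s, k, l)))

theorem commute_lmul (p q : Pol n I) :
    Commute (Algebra.lmul (Lam n) _ p) (Algebra.lmul (Lam n) _ q) := by
  rw [Commute, SemiconjBy, ← map_mul, mul_comm, map_mul]

theorem momOp_apply (i : Fin n) (a : I) (f : Pol n I) :
    momOp i a f = pderiv (.inl (true, i, a)) f + X (.inl (false, i, a)) * f := rfl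

theorem posOp_apply (i : Fin n) (a : I) (f : Pol n I) :
    posOp i a f = X (.inl (true, i, a)) * f := rfl

theorem cenOp_apply (s : Bool) (k l : Fin n) (f : Pol n I) :
    cenOp s k l f = X (.inr (s, k, l)) * f := rfl

/-- The weight system given by the polynomial representation. -/
def oscWeight (n : ℕ) (I : Type) [Fintype I] [DecidableEq I] :
    WeightSystem n (Col n I) (Module.End (Lam n) (Pol n I)) :=
  oscillator posOp momOp cenOp (fun _ _ _ _ => commute_lmul _ _)
    (fun i j a b => LinearMap.ext fun f => by
      rw [Module.End.mul_apply, Module.End.mul_apply]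
      simp only [momOp_apply, map_add, Derivation.leibniz, smul_eq_mul, pderiv_X]
      rw [pderiv_comm']
      simp [Pi.single_apply]
      ring)
    (fun i j a b => LinearMap.ext fun f => by
      rw [LinearMap.sub_apply, Module.End.mul_apply, Module.End.mul_apply]
      simp only [momOp_apply, posOp_apply, Derivation.leibniz, smul_eq_mul, pderiv_X,
        Pi.single_apply]
      by_cases h : i = j ∧ a = b
      · obtain ⟨rfl, rfl⟩ := h
        simp
        ring
      · have h' : (.inl (true, j, b) : Var n I) ≠ .inl (true, i, a) := fun e => h (by
          simp only [Sum.inl.injEq, Prod.mk.injEq, true_and] at e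
          exact ⟨e.1.symm, e.2.symm⟩)
        rw [if_neg h, if_neg h']
        simp
        ring)
    (fun _ _ _ _ _ => commute_lmul _ _)
    (fun i a s k l => LinearMap.ext fun f => by
      rw [Module.End.mul_apply, Module.End.mul_apply]
      simp only [momOp_apply, cenOp_apply, Derivation.leibniz, smul_eq_mul, pderiv_X]
      simp [Pi.single_apply]
      ring)
    (fun _ _ _ _ _ _ => commute_lmul _ _)

/-- The leading symbols of the basis of the oscillator algebra. -/
def oscSym (i : Fin n) : Col n I → Pol n I
  | .inl true => ∑ a, X (.inl (true, i, a)) * X (.inl (false, i, a))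
  | .inl false => MvPolynomial.C (d i)
  | .inr (.inl (true, a)) => X (.inl (true, i, a))
  | .inr (.inl (false, a)) => -(d i • X (.inl (false, i, a)))
  | .inr (.inr (s, k, l)) => if i = (bif s then k else l) then X (.inr (s, k, l)) else 0

/-- The degrees of the leading symbols. -/
def Col.deg : Col n I → ℕ
  | .inl true => 2
  | .inl false => 0
  | .inr _ => 1

theorem hasSymbol_oscRho (i : Fin n) (c : Col n I) :
    HasSymbol ((oscWeight n I).ρ i c) c.deg (oscSym i c) := by
  change HasSymbol (oscRho posOp momOp cenOp i c) _ _
  rcases c with (_ | _) | ⟨_ | _, a⟩ | ⟨s, k, l⟩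
  · have : (algebraMap (Lam n) (Module.End (Lam n) (Pol n I)) (d i)) =
      Algebra.lmul (Lam n) _ (MvPolynomial.C (d i)) :=
      LinearMap.ext fun f => MvPolynomial.smul_eq_C_mul f (d i)
    simp only [oscRho]
    rw [this]
    exact HasSymbol.lmul (isHomogeneous_C _ _)
  · exact HasSymbol.sum _ fun a _ =>
      (HasSymbol.lmul (isHomogeneous_X _ _)).mul (HasSymbol.pderiv_add_lmul (momOp_apply _ _))
  · exact ((HasSymbol.pderiv_add_lmul (momOp_apply _ _)).smul _).neg
  · exact HasSymbol.lmul (isHomogeneous_X _ _)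
  · simp only [oscRho, oscSym]
    split_ifs
    · exact HasSymbol.lmul (isHomogeneous_X _ _)
    · exact HasSymbol.zero

/-- Two for each edge, and by `Col.deg_of_V` four for each vertex of nonzero weight. Hence the
degrees at the feet add up to the number of feet minus the number of trivalent vertices, for every
contributing state: 2 for the trees and 0 for the circle. -/
theorem Col.deg_dual (c : Col n I) : c.deg + (Col.dual c).deg = 2 := by
  rcases c with (_ | _) | c | c <;> rfl

theorem Col.deg_of_V {u v w : Col n I} (h : Col.V u v w ≠ 0) : u.deg + v.deg + w.deg = 4 := by
  rcases u with (_ | _) | ⟨_ | _, a⟩ | u <;> rcases v with (_ | _) | ⟨_ | _, b⟩ | v <;>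
    rcases w with (_ | _) | ⟨_ | _, c⟩ | w <;> simp [Col.V, Col.deg] at h ⊢

end Representation

end TriDiag

namespace TriDiag
variable {n : ℕ} {F F' G H : Type}

/-! ### State sums of the generators -/

namespace WeightSystem

variable {K A : Type} [Fintype K] [DecidableEq K] [Ring A] [Algebra (Lam n) A]
  (W : WeightSystem n K A)

/-- The states of an edge. -/
def stateStrut : W.State UGraph.strutG ≃ K where
  toFun c := c.1 0
  invFun t := ⟨![t, W.dual t], fun a => by
    fin_cases a
    · rfl
    · exact (W.dual_dual _).symm⟩
  left_inv c := Subtype.ext (by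
    funext a
    fin_cases a
    · rfl
    · exact (c.2 0).symm)
  right_inv t := rfl

/-- The states of a tripod. -/
def stateTripod : W.State UGraph.tripodG ≃ K × K × K where
  toFun c := (c.1 3, c.1 1, c.1 2)
  invFun t := ⟨![W.dual t.1, t.2.1, t.2.2, t.1, W.dual t.2.1, W.dual t.2.2], fun a => by
    fin_cases a
    exacts [(W.dual_dual _).symm, rfl, rfl, rfl, (W.dual_dual _).symm, (W.dual_dual _).symm]⟩
  left_inv c := Subtype.ext (by
    funext a
    fin_cases a
    exacts [(c.2 3).symm, rfl, rfl, rfl, (c.2 1).symm, (c.2 2).symm])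
  right_inv t := rfl

/-- The states of the letter H. -/
def stateH : W.State UGraph.hG ≃ (K × K) × K × K × K where
  toFun c := ((c.1 4, c.1 6), c.1 1, c.1 9, c.1 3)
  invFun t := ⟨![W.dual t.1.1, t.2.1, W.dual t.1.2, t.2.2.2, t.1.1, W.dual t.2.1, t.1.2,
      W.dual t.2.2.2, W.dual t.2.2.1, t.2.2.1], fun a => by
    fin_cases a
    exacts [(W.dual_dual _).symm, rfl, (W.dual_dual _).symm, rfl, rfl, (W.dual_dual _).symm,
      rfl, (W.dual_dual _).symm, (W.dual_dual _).symm, rfl]⟩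
  left_inv c := Subtype.ext (by
    funext a
    fin_cases a
    exacts [(c.2 4).symm, rfl, (c.2 6).symm, rfl, rfl, (c.2 1).symm, rfl, (c.2 3).symm,
      (c.2 9).symm, rfl])
  right_inv t := rfl

/-- The states of the wheel with two spokes. -/
def stateWheel : W.State UGraph.wheelG ≃ (K × K) × K × K where
  toFun c := ((c.1 2, c.1 3), c.1 7, c.1 5)
  invFun t := ⟨![W.dual t.1.1, W.dual t.1.2, t.1.1, t.1.2, W.dual t.2.2, t.2.2, W.dual t.2.1, t.2.1],
    fun a => by
    fin_cases a
    exacts [(W.dual_dual _).symm, (W.dual_dual _).symm, rfl, rfl, (W.dual_dual _).symm, rfl,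
      (W.dual_dual _).symm, rfl]⟩
  left_inv c := Subtype.ext (by
    funext a
    fin_cases a
    exacts [(c.2 2).symm, (c.2 3).symm, rfl, rfl, (c.2 5).symm, rfl, (c.2 7).symm, rfl])
  right_inv t := rfl

theorem verts_cube_eq (x y z : K) : W.V x y z * (W.V y z x * W.V z x y) = W.V x y z := by
  rw [W.V_rot y z x, W.V_rot x y z, ← mul_assoc, W.V_cube]

theorem verts_strut (c : Fin 2 → K) : W.verts UGraph.strutG c = 1 := by
  rw [verts_eq, Fin.prod_univ_two]
  rfl

theorem verts_tripod (c : Fin 6 → K) :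
    W.verts UGraph.tripodG c = W.V (c 3) (c 4) (c 5) := by
  rw [verts_eq, Fin.prod_univ_six]
  change (1 : ℤ) * 1 * 1 * W.V (c 3) (c 4) (c 5) * W.V (c 4) (c 5) (c 3) * W.V (c 5) (c 3) (c 4) = _
  linear_combination W.verts_cube_eq (c 3) (c 4) (c 5)

theorem verts_h (c : Fin 10 → K) :
    W.verts UGraph.hG c = W.V (c 4) (c 5) (c 8) * W.V (c 6) (c 9) (c 7) := by
  rw [verts_eq, Fin.prod_univ_succ, Fin.prod_univ_succ, Fin.prod_univ_eight]
  change (1 : ℤ) * (1 * (1 * 1 * W.V (c 4) (c 5) (c 8) * W.V (c 5) (c 8) (c 4) *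
    W.V (c 6) (c 9) (c 7) * W.V (c 7) (c 6) (c 9) * W.V (c 8) (c 4) (c 5) *
    W.V (c 9) (c 7) (c 6))) = _
  conv_rhs => rw [← W.verts_cube_eq (c 4) (c 5) (c 8), ← W.verts_cube_eq (c 6) (c 9) (c 7)]
  ring

theorem verts_wheel (c : Fin 8 → K) :
    W.verts UGraph.wheelG c = W.V (c 2) (c 6) (c 4) * W.V (c 3) (c 5) (c 7) := by
  rw [verts_eq, Fin.prod_univ_eight]
  change (1 : ℤ) * 1 * W.V (c 2) (c 6) (c 4) * W.V (c 3) (c 5) (c 7) * W.V (c 4) (c 2) (c 6) *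
    W.V (c 5) (c 7) (c 3) * W.V (c 6) (c 4) (c 2) * W.V (c 7) (c 3) (c 5) = _
  conv_rhs => rw [← W.verts_cube_eq (c 2) (c 6) (c 4), ← W.verts_cube_eq (c 3) (c 5) (c 7)]
  ring

variable {M : Type*} [AddCommGroup M]

theorem sum_strut (f : K → K → M) :
    ∑ c : W.State UGraph.strutG, W.verts UGraph.strutG c.1 • f (c.1 0) (c.1 1) =
      ∑ t, f t (W.dual t) := by
  refine (Fintype.sum_equiv W.stateStrut.symm _ _ fun t => ?_).symm
  rw [verts_strut, one_smul]
  rfl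

theorem sum_tripod (f : K → K → K → M) :
    ∑ c : W.State UGraph.tripodG, W.verts UGraph.tripodG c.1 • f (c.1 0) (c.1 1) (c.1 2) =
      ∑ p, ∑ u, ∑ b, W.V p (W.dual u) (W.dual b) • f (W.dual p) u b := by
  simp only [← Fintype.sum_prod_type']
  refine (Fintype.sum_equiv W.stateTripod.symm _ _ fun t => ?_).symm
  rw [verts_tripod]
  rfl

theorem sum_h (f : K → K → K → K → M) :
    ∑ c : W.State UGraph.hG, W.verts UGraph.hG c.1 • f (c.1 0) (c.1 1) (c.1 2) (c.1 3) =
      ∑ p : K × K, ∑ u, ∑ b, ∑ v, (W.V p.1 (W.dual u) (W.dual b) * W.V p.2 b (W.dual v)) •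
        f (W.dual p.1) u (W.dual p.2) v := by
  simp only [← Fintype.sum_prod_type']
  refine (Fintype.sum_equiv W.stateH.symm _ _ fun t => ?_).symm
  rw [verts_h]
  rfl

theorem sum_wheel (f : K → K → M) :
    ∑ c : W.State UGraph.wheelG, W.verts UGraph.wheelG c.1 • f (c.1 0) (c.1 1) =
      ∑ p : K × K, ∑ u, ∑ b, (W.V p.1 (W.dual u) (W.dual b) * W.V p.2 b u) •
        f (W.dual p.1) (W.dual p.2) := by
  simp only [← Fintype.sum_prod_type']
  refine (Fintype.sum_equiv W.stateWheel.symm _ _ fun t => ?_).symm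
  rw [verts_wheel]
  rfl

end WeightSystem

/-! ### The symbols of the generators -/

section
variable {I : Type} [Fintype I] [DecidableEq I]

open WeightSystem

theorem prod_map_flatMap {α β M : Type*} [CommMonoid M] (l : List α) (f : α → List β)
    (g : β → M) : ((l.flatMap f).map g).prod = (l.map fun a => ((f a).map g).prod).prod := by
  induction l with
  | nil => rfl
  | cons a l ih => simp [ih]

theorem sum_map_flatMap {α β M : Type*} [AddCommMonoid M] (l : List α) (f : α → List β)
    (g : β → M) : ((l.flatMap f).map g).sum = (l.map fun a => ((f a).map g).sum).sum := by
  induction l with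
  | nil => rfl
  | cons a l ih => simp [ih]

/-- Symbols multiply in a commutative ring, so the order of the operators is lost and any word of
the feet can be used. -/
theorem hasSymbol_op (D : TDiag n F) {lab : F → Fin n} (hl : ∀ i, ∀ a ∈ D.feet i, lab a = i)
    {w : List F} (hw : D.toUGraph.IsLay w) (c : F → Col n I) :
    HasSymbol ((oscWeight n I).op D c) (w.map fun a => (c a).deg).sum
      (w.map fun a => oscSym (lab a) (c a)).prod := by
  have hp := UGraph.IsLay.perm_of D.isLay_flatMap hw
  rw [← (hp.map _).sum_eq, ← (hp.map _).prod_eq, prod_map_flatMap, sum_map_flatMap]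
  have h : ∀ i, (D.feet i).map (fun a => oscSym (lab a) (c a)) =
      (D.feet i).map fun a => oscSym i (c a) := fun i =>
    List.map_congr_left fun a ha => by rw [hl i a ha]
  simp only [h]
  exact HasSymbol.list_prod _ fun i => HasSymbol.list_prod _ fun a => hasSymbol_oscRho i (c a)

/-- The homomorphism given by the polynomial representation of the oscillator algebra. -/
def oscHom (n : ℕ) (I : Type) [Fintype I] [DecidableEq I] :
    C n →ₐ[Lam n] Module.End (Lam n) (Pol n I) :=
  (oscWeight n I).exists_hom.choose

theorem oscHom_toC (D : TDiag n F) : oscHom n I D.toC = (oscWeight n I).weight D :=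
  (oscWeight n I).exists_hom.choose_spec D

/-- All gluings in the average have the same symbol, namely the state sum in which each foot
contributes its symbol. The hypothesis `hk` makes this sum homogeneous. -/
theorem hasSymbol_chi (D : UDiag n F) (hD : D.toUGraph.Conn) {lab : F → Fin n}
    (hl : ∀ a (h : D.rot a = a), D.lab ⟨a, h⟩ = lab a) {w : List F} (hw : D.toUGraph.IsLay w)
    {k : ℕ} (hk : ∀ c : (oscWeight n I).State D.toUGraph, (oscWeight n I).verts D.toUGraph c.1 ≠ 0 →
      (w.map fun a => (c.1 a).deg).sum = k) :
    HasSymbol (oscHom n I D.chi) k (∑ c : (oscWeight n I).State D.toUGraph,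
      (oscWeight n I).verts D.toUGraph c.1 • (w.map fun a => oscSym (lab a) (c.1 a)).prod) := by
  have hne : Nonempty {w // D.IsOrdering w} := by
    refine ⟨fun i => w.filter fun a => lab a = i, fun i => hw.1.filter _, fun i a => ?_,
      fun i a b c _ _ => hD a b⟩
    simp only [List.mem_filter, decide_eq_true_eq, hw.2]
    constructor
    · rintro ⟨h, rfl⟩; exact ⟨h, hl a h⟩
    · rintro ⟨h, rfl⟩; exact ⟨h, (hl a h).symm⟩
  have hc : (Fintype.card {w // D.IsOrdering w} : ℚ) ≠ 0 := Nat.cast_ne_zero.2 Fintype.card_ne_zero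
  set s := ∑ c : (oscWeight n I).State D.toUGraph,
      (oscWeight n I).verts D.toUGraph c.1 • (w.map fun a => oscSym (lab a) (c.1 a)).prod with hs
  have key : ∀ v : {w // D.IsOrdering w}, HasSymbol (oscHom n I (D.glue v.1 v.2).toC) k s := by
    intro v
    rw [oscHom_toC]
    refine HasSymbol.sum _ fun c _ => ?_
    by_cases h : (oscWeight n I).verts D.toUGraph c.1 = 0
    · change HasSymbol ((oscWeight n I).verts D.toUGraph c.1 • _) _ _
      rw [h, zero_smul, zero_smul]
      exact HasSymbol.zero
    · rw [← hk c h]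
      refine (hasSymbol_op (D.glue v.1 v.2) (fun i a ha => ?_) hw c.1).zsmul _
      obtain ⟨h, h'⟩ := (v.2.mem_iff i a).1 ha
      rw [← hl a h, h']
  have e1 : oscHom n I D.chi = algebraMap ℚ (Lam n) (Fintype.card {w // D.IsOrdering w} : ℚ)⁻¹ •
      ∑ v : {w // D.IsOrdering w}, oscHom n I (D.glue v.1 v.2).toC := by
    rw [UDiag.chi, ← algebraMap_smul (Lam n), map_smul, map_sum]
  have e2 : s = algebraMap ℚ (Lam n) (Fintype.card {w // D.IsOrdering w} : ℚ)⁻¹ •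
      ∑ v : {w // D.IsOrdering w}, s := by
    rw [Finset.sum_const, Finset.card_univ, algebraMap_smul, ← Nat.cast_smul_eq_nsmul ℚ, smul_smul,
      inv_mul_cancel₀ hc, one_smul]
  rw [e1, e2]
  exact (HasSymbol.sum _ fun v _ => key v).smul _

theorem deg_of_state {g : UGraph F} (c : (oscWeight n I).State g) (a : F) :
    (c.1 (g.inv a)).deg + (c.1 a).deg = 2 := by
  rw [c.2, add_comm]
  exact Col.deg_dual _

theorem deg_of_verts {g : UGraph F} {c : F → Col n I} (h : (oscWeight n I).verts g c ≠ 0) (a : F)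
    (ha : g.rot a ≠ a) : (c a).deg + (c (g.rot a)).deg + (c (g.rot (g.rot a))).deg = 4 :=
  Col.deg_of_V ((oscWeight n I).V_ne_zero_of_verts h ha)

theorem hasSymbol_strut (a b : Fin n) :
    HasSymbol (oscHom n I (strutDiag a b).chi) 2
      (∑ t, oscSym a t * oscSym b (Col.dual t)) := by
  have := hasSymbol_chi (I := I) (strutDiag a b) UGraph.conn_strut (lab := ![a, b])
    (fun _ _ => rfl) UGraph.isLay_strut (k := 2) fun c hc => by
      have h := deg_of_state c 0
      simp only [List.map_cons, List.map_nil, List.sum_cons, List.sum_nil]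
      change (c.1 1).deg + (c.1 0).deg = 2 at h
      omega
  convert this using 1
  refine ((oscWeight n I).sum_strut fun s t => oscSym a s * oscSym b t).symm.trans ?_
  refine Finset.sum_congr rfl fun c _ => congrArg (HSMul.hSMul _) ?_
  simp only [List.map_cons, List.map_nil, List.prod_cons, List.prod_nil, mul_one]
  rfl

theorem hasSymbol_tripod (a b c : Fin n) :
    HasSymbol (oscHom n I (tripodDiag a b c).chi) 2
      (∑ p, ∑ u, ∑ v, Col.V p (Col.dual u) (Col.dual v) •
        (oscSym a (Col.dual p) * (oscSym b u * oscSym c v))) := by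
  have := hasSymbol_chi (I := I) (tripodDiag a b c) UGraph.conn_tripod
    (lab := UGraph.tripodLab a b c) (fun _ _ => rfl) UGraph.isLay_tripod (k := 2) fun c hc => by
      have h0 := deg_of_state c 0
      have h1 := deg_of_state c 1
      have h2 := deg_of_state c 2
      have h3 := deg_of_verts (g := UGraph.tripodG) hc 3 (by decide)
      simp only [List.map_cons, List.map_nil, List.sum_cons, List.sum_nil]
      change (c.1 3).deg + (c.1 0).deg = 2 at h0
      change (c.1 4).deg + (c.1 1).deg = 2 at h1
      change (c.1 5).deg + (c.1 2).deg = 2 at h2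
      change (c.1 3).deg + (c.1 4).deg + (c.1 5).deg = 4 at h3
      omega
  convert this using 1
  refine ((oscWeight n I).sum_tripod fun s t u =>
    oscSym a s * (oscSym b t * oscSym c u)).symm.trans ?_
  refine Finset.sum_congr rfl fun c _ => congrArg (HSMul.hSMul _) ?_
  simp only [List.map_cons, List.map_nil, List.prod_cons, List.prod_nil, mul_one]
  rfl

theorem hasSymbol_h (a b c e : Fin n) :
    HasSymbol (oscHom n I (hDiag a b c e).chi) 2
      (∑ p : Col n I × Col n I, ∑ u, ∑ t, ∑ v,
        (Col.V p.1 (Col.dual u) (Col.dual t) * Col.V p.2 t (Col.dual v)) •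
        (oscSym a (Col.dual p.1) * (oscSym b u * (oscSym c (Col.dual p.2) * oscSym e v)))) := by
  have := hasSymbol_chi (I := I) (hDiag a b c e) UGraph.conn_h
    (lab := UGraph.hLab a b c e) (fun _ _ => rfl) UGraph.isLay_h (k := 2) fun c hc => by
      have h0 := deg_of_state c 0
      have h1 := deg_of_state c 1
      have h2 := deg_of_state c 2
      have h3 := deg_of_state c 3
      have h4 := deg_of_state c 8
      have h5 := deg_of_verts (g := UGraph.hG) hc 4 (by decide)
      have h6 := deg_of_verts (g := UGraph.hG) hc 6 (by decide)
      simp only [List.map_cons, List.map_nil, List.sum_cons, List.sum_nil]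
      change (c.1 4).deg + (c.1 0).deg = 2 at h0
      change (c.1 5).deg + (c.1 1).deg = 2 at h1
      change (c.1 6).deg + (c.1 2).deg = 2 at h2
      change (c.1 7).deg + (c.1 3).deg = 2 at h3
      change (c.1 9).deg + (c.1 8).deg = 2 at h4
      change (c.1 4).deg + (c.1 5).deg + (c.1 8).deg = 4 at h5
      change (c.1 6).deg + (c.1 9).deg + (c.1 7).deg = 4 at h6
      omega
  convert this using 1
  refine ((oscWeight n I).sum_h fun s t u v =>
    oscSym a s * (oscSym b t * (oscSym c u * oscSym e v))).symm.trans ?_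
  refine Finset.sum_congr rfl fun c _ => congrArg (HSMul.hSMul _) ?_
  simp only [List.map_cons, List.map_nil, List.prod_cons, List.prod_nil, mul_one]
  rfl

theorem hasSymbol_wheel (a b : Fin n) :
    HasSymbol (oscHom n I (wheelDiag a b).chi) 0
      (∑ p : Col n I × Col n I, ∑ u, ∑ t,
        (Col.V p.1 (Col.dual u) (Col.dual t) * Col.V p.2 t u) •
        (oscSym a (Col.dual p.1) * oscSym b (Col.dual p.2))) := by
  have := hasSymbol_chi (I := I) (wheelDiag a b) UGraph.conn_wheel
    (lab := UGraph.wheelLab a b) (fun _ _ => rfl) UGraph.isLay_wheel (k := 0) fun c hc => by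
      have h0 := deg_of_state c 0
      have h1 := deg_of_state c 1
      have h2 := deg_of_state c 4
      have h3 := deg_of_state c 6
      have h5 := deg_of_verts (g := UGraph.wheelG) hc 2 (by decide)
      have h6 := deg_of_verts (g := UGraph.wheelG) hc 3 (by decide)
      simp only [List.map_cons, List.map_nil, List.sum_cons, List.sum_nil]
      change (c.1 2).deg + (c.1 0).deg = 2 at h0
      change (c.1 3).deg + (c.1 1).deg = 2 at h1
      change (c.1 5).deg + (c.1 4).deg = 2 at h2
      change (c.1 7).deg + (c.1 6).deg = 2 at h3
      change (c.1 2).deg + (c.1 6).deg + (c.1 4).deg = 4 at h5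
      change (c.1 3).deg + (c.1 5).deg + (c.1 7).deg = 4 at h6
      omega
  convert this using 1
  refine ((oscWeight n I).sum_wheel fun s t => oscSym a s * oscSym b t).symm.trans ?_
  refine Finset.sum_congr rfl fun c _ => congrArg (HSMul.hSMul _) ?_
  simp only [List.map_cons, List.map_nil, List.prod_cons, List.prod_nil, mul_one]
  rfl

end

end TriDiag

namespace TriDiag
variable {n : ℕ} {F F' G H : Type}

open MvPolynomial

/-! ### Specialisation of the symbols -/

section Specialisation
variable [NeZero n]

/-- The polynomials in the generators. -/
abbrev GenPol (n : ℕ) [NeZero n] : Type := MvPolynomial (Gen n) (Lam n)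

/-- The inverse of `dᵢ`. -/
def dInv (i : Fin n) : Lam n := AddMonoidAlgebra.single (Pi.single i (-1)) 1

theorem d_mul_dInv (i : Fin n) : d i * dInv i = 1 := by
  rw [d, dInv, AddMonoidAlgebra.single_mul_single, ← Pi.single_add]
  simp [AddMonoidAlgebra.one_def]

theorem C_d_mul_dInv (i : Fin n) :
    (MvPolynomial.C (d i) : GenPol n) * MvPolynomial.C (dInv i) = 1 := by
  rw [← map_mul, d_mul_dInv, map_one]

/-- One half. -/
def half (n : ℕ) [NeZero n] : GenPol n := algebraMap ℚ _ (1 / 2)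

theorem two_mul_half : 2 * half n = 1 := by
  rw [half, ← map_ofNat (algebraMap ℚ (GenPol n)) 2, ← map_mul,
    show (2 : ℚ) * (1 / 2) = 1 by norm_num, map_one]

/-- The variable of the edge with ends `a`, `b`. -/
def strutVar (a b : Fin n) : GenPol n :=
  if h : a ≤ b then X (.strut a b h) else X (.strut b a (le_of_not_ge h))

theorem strutVar_comm (a b : Fin n) : strutVar a b = strutVar b a := by
  unfold strutVar
  rcases lt_trichotomy a b with h | rfl | h
  · rw [dif_pos h.le, dif_neg h.not_ge]
  · rfl
  · rw [dif_neg h.not_ge, dif_pos h.le]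

/-- The variable of the tripod with the ends `1`, `c`, `e`, as an alternating function. -/
def tripodVar (c e : Fin n) : GenPol n :=
  if h : 0 < c ∧ c < e then X (.tripod c e h.1 h.2) else
    if h : 0 < e ∧ e < c then -X (.tripod e c h.1 h.2) else 0

theorem tripodVar_comm (c e : Fin n) : tripodVar c e = -tripodVar e c := by
  unfold tripodVar
  by_cases h : 0 < c ∧ c < e
  · rw [dif_pos h, dif_neg fun h' => h.2.not_gt h'.2, dif_pos h, neg_neg]
  · rw [dif_neg h]
    by_cases h' : 0 < e ∧ e < c
    · rw [dif_pos h', dif_pos h']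
    · rw [dif_neg h', dif_neg h', dif_neg h, neg_zero]

theorem tripodVar_zero_left (e : Fin n) : tripodVar 0 e = 0 := by
  simp [tripodVar, Fin.not_lt_zero]

/-- The variable of the letter H with the top labels `1` and the bottom labels `e`, `f`. -/
def hVar (e f : Fin n) : GenPol n :=
  if h : 0 < e ∧ e ≤ f then X (.h e f h.1 h.2) else
    if h : 0 < f ∧ f ≤ e then X (.h f e h.1 h.2) else 0

theorem hVar_comm (e f : Fin n) : hVar e f = hVar f e := by
  rcases eq_or_ne e f with rfl | hne
  · rfl
  unfold hVar
  by_cases h : 0 < e ∧ e ≤ f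
  · rw [dif_pos h, dif_neg fun h' => hne (h.2.antisymm h'.2), dif_pos h]
  · rw [dif_neg h]
    by_cases h' : 0 < f ∧ f ≤ e
    · rw [dif_pos h', dif_pos h']
    · rw [dif_neg h', dif_neg h', dif_neg h]

theorem hVar_zero_left (e : Fin n) : hVar 0 e = 0 := by
  have h : ¬ ((0 : Fin n) < e ∧ e ≤ 0) := fun h => h.1.not_ge h.2
  rw [hVar, dif_neg fun h => lt_irrefl _ h.1, dif_neg h]

/-- The value of the momentum of the `c`-th interval with index `e`. -/
def momVal (c e : Fin n) : GenPol n :=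
  -- The solution p of d₀(d_c p(c,e) − d_e p(e,c)) = `tripodVar c e` and −d₀²(d_c p(c,e) + d_e
  -- p(e,c)) = `hVar c e`. The left sides are the symbols of the tripod and of the letter H under
  -- this specialisation.
  half n * MvPolynomial.C (dInv c) *
    (MvPolynomial.C (dInv 0) * tripodVar c e - MvPolynomial.C (dInv 0) ^ 2 * hVar c e)

theorem momVal_zero_left (e : Fin n) : momVal 0 e = 0 := by
  rw [momVal, tripodVar_zero_left, hVar_zero_left]; ring

theorem momVal_zero_right (e : Fin n) : momVal e 0 = 0 := by
  rw [momVal, tripodVar_comm, hVar_comm, tripodVar_zero_left, hVar_zero_left]; ring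

/-- The value of the first central variable. -/
def cenVal (a b : Fin n) : GenPol n :=
  -- The symbol of an edge is the bracketed expression plus the values for (a, b) and (b, a), which
  -- explains the half. It is solved for `strutVar a b`.
  half n * (strutVar a b - (MvPolynomial.C (d b) * momVal a a + MvPolynomial.C (d a) * momVal b b
    - MvPolynomial.C (d b) * momVal b a - MvPolynomial.C (d a) * momVal a b))

variable (K : ℕ)

/-- The values of the variables. -/
def varVal : Var n (Fin n ⊕ Fin K) → GenPol n
  -- The positions on the interval i are the i-th basis vector, except that they vanish on the
  -- interval 0. Products of positions and momenta then pick out single values `momVal`.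
  | .inl (true, i, .inl j) => if j = i ∧ i ≠ 0 then 1 else 0
  | .inl (false, i, .inl j) => momVal i j
  -- The additional `K` bosons are invisible except in the circle, which counts all bosons.
  | .inl (_, _, .inr _) => 0
  | .inr (true, k, l) => cenVal k l
  | .inr (false, _, _) => 1

/-- The specialisation. -/
def special : Pol n (Fin n ⊕ Fin K) →ₐ[Lam n] GenPol n := aeval (varVal K)

/-- The specialised symbols of the basis of the oscillator algebra. -/
def symVal (i : Fin n) (c : Col n (Fin n ⊕ Fin K)) : GenPol n := special K (oscSym i c)

theorem symVal_number (i : Fin n) : symVal K i (.inl true) = momVal i i := by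
  by_cases h : i = 0
  · simp [symVal, oscSym, special, varVal, Fintype.sum_sum_type, h, momVal_zero_left]
  · simp [symVal, oscSym, special, varVal, Fintype.sum_sum_type, h]

theorem symVal_central (i : Fin n) : symVal K i (.inl false) = MvPolynomial.C (d i) := by
  simp [symVal, oscSym, special]

theorem symVal_pos (i j : Fin n) :
    symVal K i (.inr (.inl (true, .inl j))) = if j = i ∧ i ≠ 0 then 1 else 0 := by
  simp only [symVal, oscSym, special, aeval_X, varVal]

theorem symVal_mom (i j : Fin n) :
    symVal K i (.inr (.inl (false, .inl j))) = -(MvPolynomial.C (d i) * momVal i j) := by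
  simp [symVal, oscSym, special, varVal, MvPolynomial.smul_eq_C_mul]

theorem symVal_inr (i : Fin n) (s : Bool) (j : Fin K) :
    symVal K i (.inr (.inl (s, .inr j))) = 0 := by
  cases s <;> simp [symVal, oscSym, special, varVal]

theorem symVal_cen (i : Fin n) (s : Bool) (k l : Fin n) : symVal K i (.inr (.inr (s, k, l))) =
    if i = (bif s then k else l) then (if s then cenVal k l else 1) else 0 := by
  cases s <;> simp only [symVal, oscSym, special] <;> split_ifs <;> simp_all [varVal]

/-- On the interval 0 positions and momenta both vanish. A foot there must carry a nonbosonic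
colour, which simplifies the state sums of all generators with a foot of label 0 next to a vertex.
-/
theorem symVal_zero_boson (s : Bool) (a : Fin n ⊕ Fin K) :
    symVal (n := n) K 0 (.inr (.inl (s, a))) = 0 := by
  rcases a with a | a
  · cases s
    · rw [symVal_mom, momVal_zero_left, mul_zero, neg_zero]
    · rw [symVal_pos, if_neg (by simp)]
  · exact symVal_inr _ _ _ _

theorem special_strut (a b : Fin n) :
    special K (∑ t, oscSym a t * oscSym b (Col.dual t)) = strutVar a b := by
  have e : ∀ i j : Fin n, (∑ k, (if k = i ∧ i ≠ 0 then (1 : GenPol n) else 0) *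
      -(MvPolynomial.C (d j) * momVal j k)) = -(MvPolynomial.C (d j) * momVal j i) := by
    intro i j
    by_cases h : i = 0
    · simp [h, momVal_zero_right]
    · simp [h]
  have e' : ∀ i j : Fin n, (∑ k, -(MvPolynomial.C (d j) * momVal j k) *
      (if k = i ∧ i ≠ 0 then (1 : GenPol n) else 0)) = -(MvPolynomial.C (d j) * momVal j i) := by
    intro i j
    rw [← e i j]
    exact Finset.sum_congr rfl fun k _ => mul_comm _ _
  have h1 : special K (∑ t, oscSym a t * oscSym b (Col.dual t)) =
      ∑ t, symVal K a t * symVal K b (Col.dual t) := by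
    rw [map_sum]
    exact Finset.sum_congr rfl fun t _ => map_mul _ _ _
  rw [h1]
  simp only [Fintype.sum_sum_type, Fintype.sum_prod_type, Fintype.sum_bool, Col.dual, Sum.map_inl,
    Sum.map_inr, Prod.map_apply, Bool.not_true, Bool.not_false, id_eq, symVal_number,
    symVal_central, symVal_pos, symVal_mom, symVal_inr, symVal_cen, mul_zero,
    Finset.sum_const_zero, add_zero, cond_true, cond_false, if_true, Bool.false_eq_true, if_false,
    e, e']
  have e2 : (∑ k, ∑ l, (if a = k then cenVal k l else 0) * (if b = l then (1 : GenPol n) else 0)) =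
      cenVal a b := by simp
  have e3 : (∑ k, ∑ l, (if a = l then (1 : GenPol n) else 0) * (if b = k then cenVal k l else 0)) =
      cenVal b a := by simp
  rw [e2, e3, cenVal, cenVal, strutVar_comm b a]
  linear_combination (strutVar a b - (MvPolynomial.C (d b) * momVal a a +
    MvPolynomial.C (d a) * momVal b b - MvPolynomial.C (d b) * momVal b a -
    MvPolynomial.C (d a) * momVal a b)) * two_mul_half (n := n)

/-- If the foot on the interval 0 is not a boson, nonzero weight forces the number operator at its
vertex, so the foot carries the central element, of value d₀. -/
theorem sum_special_number {M : Type*} [AddCommGroup M]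
    (Φ : GenPol n → Col n (Fin n ⊕ Fin K) → Col n (Fin n ⊕ Fin K) → M)
    (hΦ : ∀ u v, Φ 0 u v = 0) :
    ∑ p, ∑ u, ∑ v, Col.V p (Col.dual u) (Col.dual v) • Φ (symVal K 0 (Col.dual p)) u v =
      ∑ a, Φ (MvPolynomial.C (d 0)) (.inr (.inl (true, a))) (.inr (.inl (false, a))) -
        ∑ a, Φ (MvPolynomial.C (d 0)) (.inr (.inl (false, a))) (.inr (.inl (true, a))) := by
  rw [Finset.sum_eq_single (.inl true), ← symVal_central K]
  · exact Col.sum_V_number _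
  · rintro ((_ | _) | ⟨s, a⟩ | p) _ hp
    · exact Col.sum_V_eq_zero (by simp [Col.V]) _
    · exact absurd rfl hp
    · simp only [Col.dual, Sum.map_inr, Sum.map_inl, Prod.map_apply, id_eq, symVal_zero_boson, hΦ,
        smul_zero, Finset.sum_const_zero]
    · exact Col.sum_V_eq_zero (by simp [Col.V]) _
  · simp

theorem pos_mul_mom (c e : Fin n) :
    ∑ a, symVal K c (.inr (.inl (true, a))) * symVal K e (.inr (.inl (false, a))) =
      -(MvPolynomial.C (d e) * momVal e c) := by
  simp only [Fintype.sum_sum_type, symVal_pos, symVal_mom, symVal_inr]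
  by_cases h : c = 0
  · simp [h, momVal_zero_right]
  · simp [h]

theorem mom_mul_pos (c e : Fin n) :
    ∑ a, symVal K c (.inr (.inl (false, a))) * symVal K e (.inr (.inl (true, a))) =
      -(MvPolynomial.C (d c) * momVal c e) := by
  rw [← pos_mul_mom K]
  exact Finset.sum_congr rfl fun a _ => mul_comm _ _

/-- The foot of label 0 gives d₀; the other two feet are a position and a momentum, in both orders
and with opposite signs. This is the first equation defining `momVal`. -/
theorem special_tripod (c e : Fin n) :
    special K (∑ p, ∑ u, ∑ v, Col.V p (Col.dual u) (Col.dual v) •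
      (oscSym 0 (Col.dual p) * (oscSym c u * oscSym e v))) = tripodVar c e := by
  simp only [map_sum, map_zsmul, map_mul]
  refine (sum_special_number K (fun z u v => z * (symVal K c u * symVal K e v)) (by simp)).trans ?_
  rw [← Finset.mul_sum, ← Finset.mul_sum, pos_mul_mom, mom_mul_pos, momVal, momVal,
    tripodVar_comm e c, hVar_comm e c]
  have h0 := C_d_mul_dInv (0 : Fin n)
  have hc := C_d_mul_dInv c
  have he := C_d_mul_dInv e
  have h2 := two_mul_half (n := n)
  generalize (MvPolynomial.C (d c) : GenPol n) = dc at *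
  generalize (MvPolynomial.C (dInv c) : GenPol n) = ic at *
  generalize (MvPolynomial.C (d e) : GenPol n) = de at *
  generalize (MvPolynomial.C (dInv e) : GenPol n) = ie at *
  generalize (MvPolynomial.C (d 0) : GenPol n) = d0 at *
  generalize (MvPolynomial.C (dInv 0) : GenPol n) = i0 at *
  generalize half n = hf at *
  generalize tripodVar c e = t at *
  generalize hVar c e = η at *
  calc _ = (dc * ic) * (hf * (d0 * i0) * t - hf * (d0 * i0) * i0 * η) +
        (de * ie) * (hf * (d0 * i0) * t + hf * (d0 * i0) * i0 * η) := by ring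
    _ = (2 * hf) * t := by rw [h0, hc, he]; ring
    _ = t := by rw [h2, one_mul]

/-- Both feet of label 0 give d₀. The bar transports the boson from one vertex to the other, and its
sign turns the alternating sum of `special_tripod` into a symmetric one. -/
theorem special_h (e f : Fin n) :
    special K (∑ p : Col n (Fin n ⊕ Fin K) × Col n (Fin n ⊕ Fin K), ∑ u, ∑ t, ∑ v,
      (Col.V p.1 (Col.dual u) (Col.dual t) * Col.V p.2 t (Col.dual v)) •
        (oscSym 0 (Col.dual p.1) * (oscSym e u * (oscSym 0 (Col.dual p.2) * oscSym f v)))) =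
      hVar e f := by
  simp only [map_sum, map_zsmul, map_mul]
  have h1 : ∀ t z, ∑ q, ∑ v, Col.V q t (Col.dual v) • (z * (symVal K 0 (Col.dual q) * symVal K f v)) =
      ∑ v, Col.V (.inl true) t (Col.dual v) • (z * (MvPolynomial.C (d 0) * symVal K f v)) := by
    intro t z
    rw [Finset.sum_eq_single (.inl true), ← symVal_central K]
    · rfl
    · rintro ((_ | _) | ⟨s, a⟩ | q) _ hp
      · simp [Col.V]
      · exact absurd rfl hp
      · simp only [Col.dual, Sum.map_inr, Sum.map_inl, Prod.map_apply, id_eq, symVal_zero_boson,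
          smul_zero, zero_mul, mul_zero, Finset.sum_const_zero]
      · simp [Col.V]
    · simp
  have h2 : ∀ s a z, ∑ v, Col.V (.inl true) (.inr (.inl (s, a))) (Col.dual v) •
      (z * (MvPolynomial.C (d 0) * symVal K f v)) =
      Col.sgn s • (z * (MvPolynomial.C (d 0) * symVal K f (.inr (.inl (s, a))))) := by
    intro s a z
    rw [Finset.sum_eq_single (.inr (.inl (s, a)))]
    · simp [Col.V, Col.dual]
    · rintro ((_ | _) | ⟨s', a'⟩ | q) _ hp
      · simp [Col.V, Col.dual]
      · simp [Col.V, Col.dual]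
      · have : ¬ ((!s') = !s ∧ a' = a) := fun h => hp (by
          rw [h.2, Bool.not_inj h.1])
        simp only [Col.V, Col.dual, Sum.map_inr, Sum.map_inl, Prod.map_apply, id_eq, if_neg this,
          zero_smul]
      · simp [Col.V, Col.dual]
    · simp
  have h3 : ∀ p u t, ∑ q, ∑ v, (Col.V p (Col.dual u) (Col.dual t) * Col.V q t (Col.dual v)) •
      (symVal K 0 (Col.dual p) * (symVal K e u * (symVal K 0 (Col.dual q) * symVal K f v))) =
      Col.V p (Col.dual u) (Col.dual t) • ∑ v, Col.V (.inl true) t (Col.dual v) •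
        (symVal K 0 (Col.dual p) * symVal K e u * (MvPolynomial.C (d 0) * symVal K f v)) := by
    intro p u t
    rw [← h1, Finset.smul_sum]
    refine Finset.sum_congr rfl fun q _ => ?_
    rw [Finset.smul_sum]
    exact Finset.sum_congr rfl fun v _ => by rw [mul_smul, mul_assoc]
  calc _ = ∑ p, ∑ u, ∑ t, Col.V p (Col.dual u) (Col.dual t) • ∑ v,
        Col.V (.inl true) t (Col.dual v) •
          (symVal K 0 (Col.dual p) * symVal K e u * (MvPolynomial.C (d 0) * symVal K f v)) := by
        rw [Fintype.sum_prod_type]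
        refine Finset.sum_congr rfl fun p _ => ?_
        rw [Finset.sum_comm]
        refine Finset.sum_congr rfl fun u _ => ?_
        rw [Finset.sum_comm]
        exact Finset.sum_congr rfl fun t _ => h3 p u t
    _ = _ := by
      refine (sum_special_number K (fun z u t => ∑ v, Col.V (.inl true) t (Col.dual v) •
          (z * symVal K e u * (MvPolynomial.C (d 0) * symVal K f v))) (by simp)).trans ?_
      simp only [h2, Col.sgn, if_true, Bool.false_eq_true, if_false, one_smul, neg_smul,
        Finset.sum_neg_distrib]
      have e1 : ∀ x y : Col n (Fin n ⊕ Fin K), (MvPolynomial.C (d 0) * symVal K e x *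
          (MvPolynomial.C (d 0) * symVal K f y)) =
          MvPolynomial.C (d 0) ^ 2 * (symVal K e x * symVal K f y) := fun x y => by ring
      simp only [e1, ← Finset.mul_sum, pos_mul_mom, mom_mul_pos]
      rw [momVal, momVal, tripodVar_comm f e, hVar_comm f e]
      have h0 := C_d_mul_dInv (0 : Fin n)
      have hc := C_d_mul_dInv f
      have he := C_d_mul_dInv e
      have h2 := two_mul_half (n := n)
      generalize (MvPolynomial.C (d f) : GenPol n) = dc at *
      generalize (MvPolynomial.C (dInv f) : GenPol n) = ic at *
      generalize (MvPolynomial.C (d e) : GenPol n) = de at *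
      generalize (MvPolynomial.C (dInv e) : GenPol n) = ie at *
      generalize (MvPolynomial.C (d 0) : GenPol n) = d0 at *
      generalize (MvPolynomial.C (dInv 0) : GenPol n) = i0 at *
      generalize half n = hf at *
      generalize tripodVar e f = t at *
      generalize hVar e f = η at *
      calc _ = (dc * ic) * (hf * (d0 * i0) * d0 * t + hf * (d0 * i0) ^ 2 * η) +
            (de * ie) * (- (hf * (d0 * i0) * d0 * t) + hf * (d0 * i0) ^ 2 * η) := by ring
        _ = (2 * hf) * η := by rw [h0, hc, he]; ring
        _ = η := by rw [h2, one_mul]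

/-- Both feet are central, and what remains is the trace of the square of the number operator in the
adjoint representation: each of the `n + K` bosons contributes its creation and its annihilation
operator. -/
theorem special_wheel :
    special K (∑ p : Col n (Fin n ⊕ Fin K) × Col n (Fin n ⊕ Fin K), ∑ u, ∑ t,
      (Col.V p.1 (Col.dual u) (Col.dual t) * Col.V p.2 t u) •
        (oscSym 0 (Col.dual p.1) * oscSym 0 (Col.dual p.2))) =
      MvPolynomial.C (2 * ((n + K : ℕ) : Lam n) * d 0 ^ 2) := by
  simp only [map_sum, map_zsmul, map_mul]
  have h1 : ∀ t u z, ∑ q, Col.V q t u • (z * symVal K 0 (Col.dual q)) =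
      Col.V (.inl true) t u • (z * MvPolynomial.C (d (0 : Fin n))) := by
    intro t u z
    rw [Finset.sum_eq_single (.inl true), ← symVal_central K]
    · rfl
    · rintro ((_ | _) | ⟨s, a⟩ | q) _ hp
      · simp [Col.V]
      · exact absurd rfl hp
      · simp only [Col.dual, Sum.map_inr, Sum.map_inl, Prod.map_apply, id_eq, symVal_zero_boson,
          smul_zero, zero_mul, mul_zero, Finset.sum_const_zero]
      · simp [Col.V]
    · simp
  calc _ = ∑ p, ∑ u, ∑ t, Col.V p (Col.dual u) (Col.dual t) •
        (Col.V (.inl true) t u • (symVal K 0 (Col.dual p) * MvPolynomial.C (d (0 : Fin n)))) := by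
        rw [Fintype.sum_prod_type]
        refine Finset.sum_congr rfl fun p _ => ?_
        rw [Finset.sum_comm]
        refine Finset.sum_congr rfl fun u _ => ?_
        rw [Finset.sum_comm]
        refine Finset.sum_congr rfl fun t _ => ?_
        rw [← h1, Finset.smul_sum]
        exact Finset.sum_congr rfl fun v _ => by rw [mul_smul]; rfl
    _ = _ := by
      refine (sum_special_number K (fun z u t => Col.V (.inl true) t u •
        (z * MvPolynomial.C (d (0 : Fin n)))) (by simp)).trans ?_
      have h2 : (MvPolynomial.C (2 : Lam n) : GenPol n) = 2 := map_ofNat _ 2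
      simp [Col.V, Col.sgn, h2]
      ring

end Specialisation

end TriDiag

namespace TriDiag
variable {n : ℕ} {F F' G H : Type}

open MvPolynomial

/-! ### Linear independence of the ordered monomials -/

theorem HasSymbol.pow {σ R : Type} [CommRing R] {P : Module.End R (MvPolynomial σ R)} {k : ℕ}
    {p : MvPolynomial σ R} (h : HasSymbol P k p) (m : ℕ) : HasSymbol (P ^ m) (m * k) (p ^ m) := by
  induction m with
  | zero => simpa using HasSymbol.one
  | succ m ih =>
    rw [pow_succ, pow_succ, add_mul, one_mul]
    exact ih.mul h

/-- Applying the operator to the polynomial 1 reveals its symbol: the error has degree less than k.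
-/
theorem HasSymbol.coeff_apply_one {σ R : Type} [CommRing R] {P : Module.End R (MvPolynomial σ R)}
    {k : ℕ} {p : MvPolynomial σ R} (h : HasSymbol P k p) {e : σ →₀ ℕ} (he : k ≤ e.degree) :
    coeff e (P 1) = coeff e p := by
  classical
  have h1 : (1 : MvPolynomial σ R) ∈ Low σ R (0 + 1) := fun e he => by
    rw [coeff_one, if_neg]
    rintro rfl
    simp at he
  have := h.sub_mem 0 1 h1 e (by omega)
  rwa [mul_one, coeff_sub, sub_eq_zero] at this

section
variable [NeZero n]

/-- The degree of the symbol of a generator. -/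
def Gen.deg : Gen n → ℕ
  | wheel => 0
  | _ => 2

/-- The specialised symbol of a generator. -/
def Gen.symbol (K : ℕ) : Gen n → GenPol n
  | wheel => MvPolynomial.C (2 * ((n + K : ℕ) : Lam n) * d 0 ^ 2)
  | g => X g

theorem Gen.exists_symbol (K : ℕ) (g : Gen n) :
    ∃ p, HasSymbol (oscHom n (Fin n ⊕ Fin K) g.chi) g.deg p ∧ special K p = g.symbol K := by
  rcases g with ⟨a, b, hab⟩ | ⟨c, e, hc, hce⟩ | ⟨e, f, he, hef⟩ | _
  · refine ⟨_, hasSymbol_strut a b, (special_strut K a b).trans ?_⟩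
    rw [strutVar, dif_pos hab]
    rfl
  · refine ⟨_, hasSymbol_tripod 0 c e, (special_tripod K c e).trans ?_⟩
    rw [tripodVar, dif_pos ⟨hc, hce⟩]
    rfl
  · refine ⟨_, hasSymbol_h 0 e 0 f, (special_h K e f).trans ?_⟩
    rw [hVar, dif_pos ⟨he, hef⟩]
    rfl
  · exact ⟨_, hasSymbol_wheel 0 0, special_wheel K⟩

/-- All generators except the circle become distinct variables; the circle only contributes a power
of a scalar. -/
theorem prod_symbol (K : ℕ) (m : Gen n →₀ ℕ) : (m.prod fun g k => g.symbol K ^ k) =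
    monomial (m.erase .wheel) ((2 * ((n + K : ℕ) : Lam n) * d 0 ^ 2) ^ m .wheel) := by
  classical
  rw [← Finsupp.mul_prod_erase' m .wheel _ fun _ => pow_zero _, monomial_eq, map_pow]
  congr 1
  refine Finset.prod_congr rfl fun g hg => ?_
  have : g ≠ .wheel := fun h => by simp [h] at hg
  cases g <;> first | rfl | exact absurd rfl this

variable [LinearOrder (Gen n)]

theorem exists_symbol_orderedMonomial (K : ℕ) (m : Gen n →₀ ℕ) :
    ∃ p, HasSymbol (oscHom n (Fin n ⊕ Fin K) (orderedMonomial m)) (m.sum fun g k => k * g.deg) p ∧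
      special K p =
        monomial (m.erase .wheel) ((2 * ((n + K : ℕ) : Lam n) * d 0 ^ 2) ^ m .wheel) := by
  choose p hp hs using Gen.exists_symbol (n := n) K
  have hl : ∀ {M : Type} [CommMonoid M] (f : Gen n → M),
      ((m.support.sort (· ≤ ·)).map f).prod = ∏ g ∈ m.support, f g := fun f => by
    rw [← List.prod_toFinset f (Finset.sort_nodup _ _), Finset.sort_toFinset]
  have hl' : ∀ f : Gen n → ℕ,
      ((m.support.sort (· ≤ ·)).map f).sum = ∑ g ∈ m.support, f g := fun f => by
    rw [← List.sum_toFinset f (Finset.sort_nodup _ _), Finset.sort_toFinset]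
  refine ⟨∏ g ∈ m.support, p g ^ m g, ?_, ?_⟩
  · rw [orderedMonomial, map_list_prod, List.map_map, ← hl, Finsupp.sum, ← hl']
    refine HasSymbol.list_prod _ fun g => ?_
    rw [Function.comp_apply, map_pow]
    exact (hp g).pow _
  · rw [← prod_symbol, map_prod]
    exact Finset.prod_congr rfl fun g _ => by rw [map_pow, hs]

theorem kappa_injective :
    Function.Injective fun K : ℕ => 2 * ((n + K : ℕ) : Lam n) * d (0 : Fin n) ^ 2 := by
  have : CharZero (Lam n) := algebraRat.charZero _
  intro K K' h
  have h1 := ((isUnit_d (0 : Fin n)).pow 2).mul_right_cancel h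
  have h2 : (((2 * (n + K) : ℕ)) : Lam n) = ((2 * (n + K') : ℕ) : Lam n) := by
    push_cast at h1 ⊢
    exact h1
  have := Nat.cast_injective h2
  omega

/-- In the top degree of a relation, the symbols give a relation between the images of the ordered
monomials. These images separate monomials up to the exponent of the circle, and this exponent is
detected by varying the number `K` of additional bosons. -/
theorem linearIndependent_orderedMonomial :
    LinearIndependent (Lam n) (orderedMonomial : (Gen n →₀ ℕ) → C n) := by
  classical
  rw [linearIndependent_iff]
  intro l hl
  by_contra hne
  set deg : (Gen n →₀ ℕ) → ℕ := fun m => m.sum fun g k => k * g.deg with hdeg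
  obtain ⟨m₀, hm₀, hmax⟩ := Finset.exists_max_image l.support deg (Finsupp.support_nonempty_iff.2 hne)
  set s := l.support.filter fun m => deg m = deg m₀ with hs
  -- The relation is applied to the polynomial 1 and compared in the maximal degree; monomials of
  -- smaller degree cannot contribute there. Then the variables are specialised.
  have top : ∀ K : ℕ, ∑ m ∈ s, l m • (monomial (m.erase .wheel)
      ((2 * ((n + K : ℕ) : Lam n) * d 0 ^ 2) ^ m .wheel) : GenPol n) = 0 := by
    intro K
    choose p hp hsp using exists_symbol_orderedMonomial (n := n) K
    have h0 : ∑ m ∈ l.support, l m • oscHom n (Fin n ⊕ Fin K) (orderedMonomial m) 1 = 0 := by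
      have := congrArg (fun x => oscHom n (Fin n ⊕ Fin K) x 1) hl
      simpa [Finsupp.linearCombination_apply, Finsupp.sum] using this
    have h1 : ∑ m ∈ s, l m • p m = 0 := by
      refine MvPolynomial.ext _ _ fun e => ?_
      by_cases he : e.degree = deg m₀
      · have h2 := congrArg (coeff e) h0
        rw [coeff_sum] at h2
        rw [coeff_sum, hs, Finset.sum_filter]
        refine Eq.trans (Finset.sum_congr rfl fun m hm => ?_) h2
        rw [coeff_smul, coeff_smul, (hp m).coeff_apply_one ((hmax m hm).trans he.ge)]
        split_ifs with h
        · rfl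
        · rw [(hp m).hom.coeff_eq_zero (fun h' => h (h'.symm.trans he)), smul_zero]
      · rw [coeff_sum]
        refine Finset.sum_eq_zero fun m hm => ?_
        rw [coeff_smul, (hp m).hom.coeff_eq_zero, smul_zero]
        exact fun h => he (h.trans (Finset.mem_filter.1 hm).2)
    have h2 := congrArg (special K) h1
    simpa only [map_sum, map_smul, map_zero, hsp] using h2
  -- The terms that agree with `m₀` except for the exponent of the circle, with the circle as a
  -- variable. Its values at the scalars of the circle are coefficients of `top K`.
  set P : Polynomial (Lam n) := ∑ m ∈ s.filter fun m => m.erase .wheel = m₀.erase .wheel,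
    Polynomial.monomial (m .wheel) (l m) with hP
  have roots : ∀ K : ℕ, P.IsRoot (2 * ((n + K : ℕ) : Lam n) * d (0 : Fin n) ^ 2) := by
    intro K
    have h := congrArg (coeff (m₀.erase .wheel)) (top K)
    rw [coeff_sum, coeff_zero] at h
    rw [Polynomial.IsRoot, hP, Polynomial.eval_finsetSum, Finset.sum_filter]
    refine Eq.trans (Finset.sum_congr rfl fun m _ => ?_) h
    rw [coeff_smul, coeff_monomial, Polynomial.eval_monomial, smul_eq_mul, mul_ite, mul_zero]
  -- Different `K` give different roots, and Λ(n) is a domain.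
  have hP0 : P = 0 := Polynomial.eq_zero_of_infinite_isRoot P
    ((Set.infinite_range_of_injective (kappa_injective (n := n))).mono (by
      rintro _ ⟨K, rfl⟩
      exact roots K))
  have h := congrArg (fun q => Polynomial.coeff q (m₀ .wheel)) hP0
  simp only [hP, Polynomial.finsetSum_coeff, Polynomial.coeff_monomial, Polynomial.coeff_zero] at h
  rw [Finset.sum_eq_single m₀] at h
  · rw [if_pos rfl] at h
    exact Finsupp.mem_support_iff.1 hm₀ h
  · intro m hm hmm
    refine if_neg fun hw => hmm ?_
    have he := (Finset.mem_filter.1 hm).2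
    ext g
    by_cases hg : g = .wheel
    · rw [hg, hw]
    · rw [← Finsupp.erase_ne hg, he, Finsupp.erase_ne hg]
  · intro h'
    refine absurd ?_ h'
    rw [hs, Finset.mem_filter, Finset.mem_filter]
    exact ⟨⟨hm₀, rfl⟩, rfl⟩

/-- The ordered monomials form a basis of `C(n)`. -/
def orderedBasis : Module.Basis (Gen n →₀ ℕ) (Lam n) (C n) :=
  Module.Basis.mk linearIndependent_orderedMonomial span_orderedMonomial.ge

theorem orderedBasis_apply (m : Gen n →₀ ℕ) : orderedBasis m = orderedMonomial m :=
  Module.Basis.mk_apply _ _ _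

end

end TriDiag

end

theorem corollary9 (n : ℕ) [NeZero n] :
    Module.Free (TriDiag.Lam n) (TriDiag.C n) ∧
      ∀ [LinearOrder (TriDiag.Gen n)],
        ∃ b : Module.Basis (TriDiag.Gen n →₀ ℕ) (TriDiag.Lam n) (TriDiag.C n),
          ∀ m : TriDiag.Gen n →₀ ℕ, b m = TriDiag.orderedMonomial m := by
  constructor
  · classical
    -- Freeness requires some total order on the generators; any choice serves.
    let _ : LinearOrder (TriDiag.Gen n) := linearOrderOfSTO WellOrderingRel
    exact Module.Free.of_basis TriDiag.orderedBasis
  · intro _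
    exact ⟨TriDiag.orderedBasis, TriDiag.orderedBasis_apply⟩
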